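/- **Conventions.** Let $\mathbf k$ be a field. A collection $E=\{E(n)\}_{n\ge1}$ consists of $\mathbb Z$-graded $\mathbf k$-vector spaces of finite type with right $\Sigma_n$-actions; $\downarrow$ is the desuspension, $(\downarrow V)_p=V_{p+1}$; $(\mathbf sE)(n)=\mathrm{sgn}\otimes\uparrow^{n-1}E(n)$; and $E^*$ is the graded dual, $(E^*(n))_p=\mathrm{Hom}(E(n)_p,\mathbf k)$, with the transposed action. Let $\mathit{Ass}(n)=\mathbf k[\Sigma_n]$ be the operad for associative algebras, and let $\mathit{Cycl}(n)=\mathbf k[\mathbf Z_n\backslash\Sigma_n]\cong\mathbf k[\Sigma_{n-1}]$ be the right $\mathit{Ass}$-module induced by the projection $\Sigma_n\to\mathbf Z_n\backslash\Sigma_n$. Then $\mathbf s\mathit{Ass}$ is an operad, $\mathbf s\mathit{Cycl}$ is a right module over it, $(\mathbf s\mathit{Ass})^*$ is a cooperad and $(\mathbf s\mathit{Cycl})^*$ is a right comodule over it. For a cooperad $\mathcal Q$ and a right $\mathcal Q$-comodule $N$, let $\Omega(\mathcal Q)=(\mathcal F(\downarrow\mathcal Q),\partial_\Omega)$ be the free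 operad on the part of $\downarrow\mathcal Q$ in arities $\ge2$, and let $\Omega(N;\mathcal Q)=(N\circ\mathcal F(\downarrow\mathcal Q),\partial_\Omega)$ be the free right $\mathcal F(\downarrow\mathcal Q)$-module on $N$, where $\partial_\Omega$ is the equivariant derivation of degree $-1$ whose value on a generator is the sum of its decompositions along all trees with two vertices: a term $x'\otimes x''$ contributes the composite of $x'$ and $\downarrow x''$ (respectively of $\downarrow x'$ and $\downarrow x''$) with the sign $(-1)^{|x'|}$ (respectively $(-1)^{|\downarrow x'|}$). Let $K_n$ be the associahedron: the convex polytope of dimension $n-2$ in $\mathbf R^{n-1}$ (a point for $n=1$) defined by $\sum_{x=1}^{n-1} t_x=3^{n-1}$ and $\sum_{x\in I}t_x\ge3^{\#I}$ for all intervals $I$ of $\{1,\dots,n-1\}$. Let $W_n$ be the cyclohedron: the convex polytope of dimension $n-1$ in $\mathbf R^n$ defined by $\sum_{x=1}^n t_x=3^n$ and $\sum_{x\in I}t_x\ge3^{\#I}$ for all cyclic intervals $I$ of $\{1,\dots,n\}$. The faces of $K_n$ are indexed by the bracketings of a word of $n$ letters, and those of $W_n$ by the bracketings of a cyclic word of $n$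 letters. Put $\overline K_n=\Sigma_n\times K_n$ and $\overline W_n=\Sigma_n\times_{\mathbf Z_n}W_n\cong\Sigma_{n-1}\times W_n$, where $\mathbf Z_n$ rotates the coordinates. Inserting bracketings, enclosed in a pair of brackets, in place of letters identifies the products $K_m\times K_n$ and $W_m\times K_n$ with codimension-one faces of $K_{m+n-1}$ and $W_{m+n-1}$. Thereby the cellular chains $\overline{\mathcal A}=CC_*(\overline K)$ with coefficients in $\mathbf k$ form a differential graded operad, and $\mathcal M=CC_*(\overline W)$ is a differential graded right $\overline{\mathcal A}$-module. **Theorem.** The derivation $\partial_\Omega$ exists for $(\mathbf s\mathit{Ass})^*$ and $(\mathbf s\mathit{Cycl})^*$, it is unique, and $\partial_\Omega^2=0$. The differential graded operads $\Omega((\mathbf s\mathit{Ass})^*)$ and $\overline{\mathcal A}$ are isomorphic, and along a suitable isomorphism of these there is an isomorphism of differential graded right modules (in particular a $\Sigma_n$-equivariant isomorphism of chain complexes for every $n\ge1$) $$\Omega\big((\mathbf s\mathit{Cycl})^*;(\mathbf s\mathit{Ass})^*\big)\;\cong\;\mathcal M=CC_*(\overline W).$$ It can be chosen such that for every $n\ge1$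 the generator of arity $n$ dual to $\uparrow^{n-1}\xi_n$, where $\xi_n\in\mathit{Cycl}(n)$ is the class of the identical permutation, is sent to the top-dimensional cell of $W_n$ with one of its orientations; hence the cobar differential of this generator corresponds to the cellular boundary of the top cell. -/

import Mathlib

open Equiv TensorProduct

noncomputable section

namespace Cyclo

universe u

/-! Part 1. Graded collections, compositions, suspensions and duals. -/

/-- A collection of graded vector spaces of finite type: for every arity `n` and every degree `p`
a finite dimensional vector space with a right action of the symmetric group on `n` letters;
`act σ x` is `x · σ`. -/
structure Coll (k : Type u) [Field k] where
  obj : ℕ → ℤ → Type u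
  [grp : ∀ n p, AddCommGroup (obj n p)]
  [mod : ∀ n p, Module k (obj n p)]
  [fin : ∀ n p, Module.Finite k (obj n p)]
  act : ∀ {n : ℕ} {p : ℤ}, Perm (Fin n) → obj n p →ₗ[k] obj n p
  act_one : ∀ {n : ℕ} {p : ℤ} (x : obj n p), act 1 x = x
  act_mul : ∀ {n : ℕ} {p : ℤ} (σ τ : Perm (Fin n)) (x : obj n p),
    act (σ * τ) x = act τ (act σ x)

attribute [instance] Coll.grp Coll.mod Coll.fin

variable {k : Type u} [Field k]

/-- The structure maps `x ∘_i y` (`i` counted from `0`) of a right module `M` over an operad `P`;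
for `M = P` these are the structure maps of an operad. The arity of `x ∘_i y` is `m + n - 1`. -/
structure Composition (M P : Coll k) where
  comp : ∀ {m n r : ℕ} (_ : r + 1 = m + n) (_ : Fin m) {p q s : ℤ} (_ : p + q = s),
    M.obj m p →ₗ[k] P.obj n q →ₗ[k] M.obj r s

/-- The structure maps of a right comodule `N` over a cooperad `Q`; for `N = Q` these are the
structure maps of a cooperad. `decomp h i hs` is the component of bidegree `(p, q)` of the map
`N(m + n - 1) → N(m) ⊗ Q(n)` that is dual to `∘_i`. -/
structure Decomposition (N Q : Coll k) where
  decomp : ∀ {m n r : ℕ} (_ : r + 1 = m + n) (_ : Fin m) {p q s : ℤ} (_ : p + q = s),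
    N.obj r s →ₗ[k] N.obj m p ⊗[k] Q.obj n q

/-- The sign `(-1) ^ p` in the ground field. -/
def sgnPow (k : Type u) [Field k] (p : ℤ) : k := ((p.negOnePow : ℤ) : k)

/-- The sign of a permutation in the ground field. -/
def sgnPerm (k : Type u) [Field k] {n : ℕ} (σ : Perm (Fin n)) : k := ((Perm.sign σ : ℤ) : k)

/-- The suspension `(𝐬 E)(n) = sgn ⊗ ↑^(n-1) E(n)` of a collection. -/
def Coll.susp (E : Coll k) : Coll k where
  obj n p := E.obj n (p - (n - 1))
  act σ := sgnPerm k σ • E.act σ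
  act_one x := by simp [sgnPerm, E.act_one]
  act_mul σ τ x := by
    simp only [sgnPerm, LinearMap.smul_apply, E.act_mul, map_smul, smul_smul]
    congr 1
    simp

/-- The structure maps induced on suspensions. The sign is the Koszul sign of moving `↑^(n-1)`
across `x`, times the sign of the composition in the suspension of the operad for commutative
algebras (the endomorphism operad of a line of degree `-1`). -/
def Composition.susp {M P : Coll k} (c : Composition M P) : Composition M.susp P.susp where
  comp {m n r} h i {p q s} hs :=
    sgnPow k (((n : ℤ) - 1) * (p - (m - 1)) + (i : ℕ) * ((n : ℤ) - 1)) •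
      c.comp h i (p := p - (m - 1)) (q := q - (n - 1)) (s := s - (r - 1)) (by omega)

/-- The desuspension `↓ E`: `(↓ E)(n)_p = E(n)_(p+1)`. -/
def Coll.desusp (E : Coll k) : Coll k where
  obj n p := E.obj n (p + 1)
  act σ := E.act σ
  act_one := E.act_one
  act_mul := E.act_mul

/-- The dual collection: `(E^*)(n)_p` is the dual of `E(n)_p`, with the transposed right action. -/
def Coll.dual (E : Coll k) : Coll k where
  obj n p := Module.Dual k (E.obj n p)
  act σ := (E.act σ⁻¹).dualMap
  act_one f := by ext x; simp [E.act_one]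
  act_mul σ τ f := by ext x; simp [E.act_mul]

/-- The dual of a composition: the comodule `M^*` over the cooperad `P^*`. The map is the transpose
of `∘_i` followed by the inverse of the isomorphism `M(m)^* ⊗ P(n)^* ≅ (M(m) ⊗ P(n))^*`. -/
def Composition.dual {M P : Coll k} (c : Composition M P) : Decomposition M.dual P.dual where
  decomp {m n _} h i {p q _} hs :=
    (TensorProduct.dualDistribEquiv k (M.obj m p) (P.obj n q)).symm.toLinearMap ∘ₗ
      (TensorProduct.lift (c.comp h i hs)).dualMap

/-! Part 2. The operad `Ass` and the `Ass`-module `Cycl`. -/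

/-- The inputs of a composite `x ∘_i y` are the inputs of `x` other than `i` together with
the inputs of `y`, the latter inserted in place of `i`. -/
def inputs {m n r : ℕ} (h : r + 1 = m + n) (i : Fin m) : {y : Fin m // y ≠ i} ⊕ Fin n ≃ Fin r where
  toFun := Sum.elim
    (fun y => if hy : y.1.1 < i.1 then ⟨y.1.1, by omega⟩ else ⟨y.1.1 + n - 1, by omega⟩)
    (fun z => ⟨i.1 + z.1, by omega⟩)
  invFun x :=
    if h1 : x.1 < i.1 then Sum.inl ⟨⟨x.1, by omega⟩, by
      intro he; have := congrArg Fin.val he; simp at this; omega⟩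
    else if h2 : x.1 < i.1 + n then Sum.inr ⟨x.1 - i.1, by omega⟩
    else Sum.inl ⟨⟨x.1 + 1 - n, by omega⟩, by
      intro he; have := congrArg Fin.val he; simp at this; omega⟩
  left_inv := by
    rintro (⟨y, hy⟩ | z)
    · have hy2 : y.1 ≠ i.1 := fun he => hy (Fin.ext he)
      by_cases h1 : y.1 < i.1
      · simp only [Sum.elim_inl, h1, dite_true]
      · have h3 : ¬ y.1 + n - 1 < i.1 := by omega
        have h4 : ¬ y.1 + n - 1 < i.1 + n := by omega
        simp only [Sum.elim_inl, h1, dite_false, h3, h4]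
        congr 2
        ext
        simp
        omega
    · simp
  right_inv := by
    intro x
    by_cases h1 : x.1 < i.1
    · simp only [h1, dite_true, Sum.elim_inl]
    · by_cases h2 : x.1 < i.1 + n
      · simp only [h1, h2, dite_true, dite_false, Sum.elim_inr]
        ext
        simp
        omega
      · have h3 : ¬ x.1 + 1 - n < i.1 := by omega
        simp only [h1, h2, dite_false, Sum.elim_inl, h3]
        ext
        simp
        omega

/-- The bijection that a permutation `σ` induces between the letters other than `i` and the letters
other than `σ i`. -/
def others {m : ℕ} (σ : Perm (Fin m)) (i : Fin m) : {y : Fin m // y ≠ i} ≃ {y : Fin m // y ≠ σ i} :=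
  σ.subtypeEquiv (fun _ => (σ.injective.ne_iff).symm)

/-- The permutation `σ ∘_i τ`: the block of the inputs of `τ` sits in the place of the `i`-th input
of `σ`, and is permuted by `τ`. It is `σ(1, …, 1, τ, 1, …, 1)`. -/
def permComp {m n r : ℕ} (h : r + 1 = m + n) (i : Fin m) (σ : Perm (Fin m)) (τ : Perm (Fin n)) :
    Perm (Fin r) :=
  (inputs h i).symm.trans
    ((Equiv.sumCongr (others σ i) τ).trans (inputs h (σ i)))

/-- The group of cyclic permutations of `n` letters. -/
def cyclicGroup (n : ℕ) : Subgroup (Perm (Fin n)) := Subgroup.zpowers (finRotate n)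

theorem permComp_mul {m n r : ℕ} (h : r + 1 = m + n) (i : Fin m) (ζ σ : Perm (Fin m))
    (ρ τ : Perm (Fin n)) :
    permComp h i (ζ * σ) (ρ * τ) = permComp h (σ i) ζ ρ * permComp h i σ τ := by
  ext x
  simp only [permComp, Equiv.trans_apply, Perm.mul_apply, Equiv.symm_apply_apply]
  rcases (inputs h i).symm x with y | z <;> rfl

theorem permComp_one_one {m n r : ℕ} (h : r + 1 = m + n) (i : Fin m) :
    permComp h i 1 1 = 1 := by
  ext x
  simp only [permComp, Equiv.trans_apply]
  have key : ∀ y, (Equiv.sumCongr (others (1 : Perm (Fin m)) i) (1 : Perm (Fin n))) y = y := by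
    rintro (y | z) <;> rfl
  rw [key]
  exact congrArg Fin.val ((inputs h i).apply_symm_apply x)

theorem rotate_val {n : ℕ} (x : Fin n) : (finRotate n x).1 = if x.1 + 1 = n then 0 else x.1 + 1 := by
  obtain _ | n := n
  · exact x.elim0
  · rw [coe_finRotate]
    have : x = Fin.last n ↔ x.1 + 1 = n + 1 := by
      rw [Fin.ext_iff]; simp
    simp only [this]

theorem rotate_pow_val {n : ℕ} (s : ℕ) (x : Fin n) :
    ((finRotate n ^ s) x).1 = (x.1 + s) % n := by
  induction s with
  | zero => simp [Nat.mod_eq_of_lt x.2]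
  | succ s ih =>
    rw [pow_succ', Perm.mul_apply, rotate_val, ih]
    have hn : 0 < n := by have := x.2; omega
    have := Nat.mod_lt (x.1 + s) hn
    rw [← Nat.add_assoc, Nat.add_mod (x.1 + s) 1 n]
    split_ifs with hh
    · obtain rfl | hn1 : n = 1 ∨ 1 < n := by omega
      · omega
      · rw [Nat.mod_eq_of_lt hn1, hh, Nat.mod_self]
    · have hn1 : 1 < n := by omega
      rw [Nat.mod_eq_of_lt hn1]
      exact (Nat.mod_eq_of_lt (by omega)).symm

theorem permComp_rotate {m n r : ℕ} (h : r + 1 = m + n) (hn : 1 ≤ n) (i : Fin m) :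
    permComp h i (finRotate m) 1 ∈ cyclicGroup r := by
  have key : permComp h i (finRotate m) 1 = finRotate r ^ (if i.1 + 1 = m then n else 1) := by
    ext x
    rw [rotate_pow_val]
    obtain ⟨y, rfl⟩ := (inputs h i).surjective x
    simp only [permComp, Equiv.trans_apply, Equiv.symm_apply_apply]
    have hi := rotate_val i
    have him := i.2
    rcases y with ⟨y, hy⟩ | z
    · have hy2 : y.1 ≠ i.1 := fun he => hy (Fin.ext he)
      have hyv := rotate_val y
      have hym := y.2
      simp only [inputs, Equiv.coe_fn_mk, Equiv.sumCongr_apply, Sum.map_inl, Sum.elim_inl,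
        others, Equiv.subtypeEquiv_apply]
      split_ifs at * <;> simp only at * <;> first
        | omega
        | (rw [Nat.mod_eq_of_lt (by omega)]; omega)
        | (rw [Nat.mod_eq_sub_mod (by omega), Nat.mod_eq_of_lt (by omega)]; omega)
    · have hz := z.2
      simp only [inputs, Equiv.coe_fn_mk, Equiv.sumCongr_apply, Sum.map_inr, Sum.elim_inr,
        Perm.one_apply]
      split_ifs at * <;> first
        | (rw [Nat.mod_eq_of_lt (by omega)]; omega)
        | (rw [Nat.mod_eq_sub_mod (by omega), Nat.mod_eq_of_lt (by omega)]; omega)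
  rw [key]
  exact Subgroup.npow_mem_zpowers _ _

theorem permComp_cyclic {m n r : ℕ} (h : r + 1 = m + n) (hn : 1 ≤ n) (ζ : Perm (Fin m))
    (hζ : ζ ∈ cyclicGroup m) : ∀ i : Fin m, permComp h i ζ 1 ∈ cyclicGroup r := by
  obtain ⟨z, rfl⟩ := Subgroup.mem_zpowers_iff.mp hζ
  induction z with
  | zero =>
    intro i
    rw [zpow_zero, permComp_one_one]
    exact one_mem _
  | succ z ih =>
    intro i
    have h1 := permComp_mul h i (finRotate m) (finRotate m ^ (z : ℤ)) 1 1
    rw [one_mul, ← zpow_one_add, add_comm] at h1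
    rw [h1]
    exact mul_mem (permComp_rotate h hn _) (ih ⟨_, rfl⟩ i)
  | pred z ih =>
    intro i
    have h1 := permComp_mul h i (finRotate m) (finRotate m ^ (-(z : ℤ) - 1)) 1 1
    rw [one_mul, ← zpow_one_add, add_sub_cancel] at h1
    have h2 := ih ⟨_, rfl⟩ i
    rw [h1] at h2
    exact (Subgroup.mul_mem_cancel_left _ (permComp_rotate h hn _)).mp h2


/-- The operad `Ass` as a collection: `Ass(n) = k[Σ_n]` for `n ≥ 1`, in degree `0`, with the right
regular representation. -/
def ass (k : Type u) [Field k] : Coll k where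
  obj n p := {_σ : Perm (Fin n) // 1 ≤ n ∧ p = 0} →₀ k
  act ρ := Finsupp.lmapDomain k k (fun a => ⟨a.1 * ρ, a.2⟩)
  act_one x := by
    simp only [mul_one, Subtype.coe_eta, Finsupp.lmapDomain_apply]
    exact Finsupp.mapDomain_id
  act_mul σ τ x := by
    simp only [Finsupp.lmapDomain_apply, ← Finsupp.mapDomain_comp]
    simp only [Function.comp_def, mul_assoc]

/-- The operad structure of `Ass`: on permutations, `(σ, τ) ↦ σ ∘_i τ`. -/
def assComp (k : Type u) [Field k] : Composition (ass k) (ass k) where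
  comp h i _ _ _ hs :=
    Finsupp.linearCombination k fun a => Finsupp.linearCombination k fun b =>
      Finsupp.single ⟨permComp h i a.1 b.1, by have := a.2; have := b.2; omega⟩ 1

/-- The set `ℤ_n \ Σ_n` of permutations modulo the left multiplication by cyclic ones. -/
abbrev CyclicOrder (n : ℕ) : Type := Quotient (QuotientGroup.rightRel (cyclicGroup n))

/-- The projection `Σ_n → ℤ_n \ Σ_n`. -/
def CyclicOrder.mk {n : ℕ} (σ : Perm (Fin n)) : CyclicOrder n := Quotient.mk _ σ

/-- The right action of the symmetric group on cyclic orders. -/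
def CyclicOrder.act {n : ℕ} (ρ : Perm (Fin n)) : CyclicOrder n → CyclicOrder n :=
  Quotient.map (· * ρ) (by
    intro σ τ hστ
    have h1 := QuotientGroup.rightRel_apply.mp hστ
    refine QuotientGroup.rightRel_apply.mpr ?_
    simpa [mul_assoc] using h1)

/-- The composition `[σ] ∘_i τ = [σ ∘_i τ]`. -/
def CyclicOrder.comp {m n r : ℕ} (h : r + 1 = m + n) (hn : 1 ≤ n) (i : Fin m)
    (c : CyclicOrder m) (τ : Perm (Fin n)) : CyclicOrder r :=
  Quotient.map (fun σ => permComp h i σ τ) (by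
    intro σ σ' hσ
    have h1 := QuotientGroup.rightRel_apply.mp hσ
    refine QuotientGroup.rightRel_apply.mpr ?_
    have h2 := permComp_mul h i (σ' * σ⁻¹) σ 1 τ
    rw [inv_mul_cancel_right, one_mul] at h2
    simp only [h2, mul_inv_cancel_right]
    exact permComp_cyclic h hn _ h1 _) c

/-- The collection `Cycl`: `Cycl(n) = k[ℤ_n \ Σ_n]` for `n ≥ 1`, in degree `0`. The permutations
that fix the first letter represent `ℤ_n \ Σ_n`, whence `Cycl(n) ≅ k[Σ_(n-1)]`. -/
def cycl (k : Type u) [Field k] : Coll k where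
  obj n p := {_c : CyclicOrder n // 1 ≤ n ∧ p = 0} →₀ k
  act ρ := Finsupp.lmapDomain k k (fun a => ⟨a.1.act ρ, a.2⟩)
  act_one x := by
    rename_i n p
    have key : ∀ a : CyclicOrder n, a.act 1 = a := by
      rintro ⟨a⟩
      exact congrArg CyclicOrder.mk (mul_one a)
    simp only [key, Finsupp.lmapDomain_apply]
    exact Finsupp.mapDomain_id
  act_mul σ τ x := by
    simp only [Finsupp.lmapDomain_apply, ← Finsupp.mapDomain_comp]
    congr 1
    funext a
    obtain ⟨⟨a⟩, ha⟩ := a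
    exact Subtype.ext (congrArg CyclicOrder.mk (mul_assoc a σ τ).symm)

/-- The `Ass`-module structure of `Cycl`, induced from `Ass` by the projection. -/
def cyclComp (k : Type u) [Field k] : Composition (cycl k) (ass k) where
  comp h i _ _ _ hs :=
    Finsupp.linearCombination k fun a => Finsupp.linearCombination k fun b =>
      Finsupp.single ⟨a.1.comp h b.2.1 i b.1, by have := a.2; have := b.2; omega⟩ 1

/-! Part 3. Free operads, free right modules over them, and the cobar construction. -/

/-- The two sorts of elements in a pair (operad, right module over it). -/
inductive Kind
  | operad
  | module

/-- The smallest arity of a generator: generators of operads have arity at least two,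
generators of modules have arity at least one. -/
def Kind.minArity : Kind → ℕ
  | operad => 2
  | module => 1

/-- Formal expressions, of given arity and degree, in the operations of a pair (operad `F`,
right `F`-module): `FreeExpr G .operad` are the elements of `F`, and `FreeExpr G .module` those of the
module; `G .operad` generates `F`, and `G .module` generates the module. -/
inductive FreeExpr (G : Kind → Coll k) : Kind → ℕ → ℤ → Type u
  | gen {b : Kind} {n : ℕ} {p : ℤ} (hn : b.minArity ≤ n) (x : (G b).obj n p) : FreeExpr G b n p
  | unit : FreeExpr G .operad 1 0
  | comp {b : Kind} {m n r : ℕ} (h : r + 1 = m + n) (i : Fin m) {p q s : ℤ} (hs : p + q = s)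
      (x : FreeExpr G b m p) (y : FreeExpr G .operad n q) : FreeExpr G b r s
  | act {b : Kind} {n : ℕ} {p : ℤ} (σ : Perm (Fin n)) (x : FreeExpr G b n p) : FreeExpr G b n p
  | zero {b : Kind} {n : ℕ} {p : ℤ} : FreeExpr G b n p
  | add {b : Kind} {n : ℕ} {p : ℤ} (x y : FreeExpr G b n p) : FreeExpr G b n p
  | smul {b : Kind} {n : ℕ} {p : ℤ} (a : k) (x : FreeExpr G b n p) : FreeExpr G b n p

open FreeExpr in
/-- The congruence on formal expressions generated by the axioms of vector spaces, the linearity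
of all operations and of the generators, the equivariance of the generators, and the axioms
of a graded operad and a graded right module over it. -/
inductive Rel (G : Kind → Coll k) :
    ∀ {b : Kind} {n : ℕ} {p : ℤ}, FreeExpr G b n p → FreeExpr G b n p → Prop
  | refl {b n p} (x : FreeExpr G b n p) : Rel G x x
  | symm {b n p} {x y : FreeExpr G b n p} : Rel G x y → Rel G y x
  | trans {b n p} {x y z : FreeExpr G b n p} : Rel G x y → Rel G y z → Rel G x z
  | comp_congr {b m n r} (h : r + 1 = m + n) (i : Fin m) {p q s : ℤ} (hs : p + q = s)
      {x x' : FreeExpr G b m p} {y y' : FreeExpr G .operad n q} :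
      Rel G x x' → Rel G y y' → Rel G (comp h i hs x y) (comp h i hs x' y')
  | act_congr {b n p} (σ : Perm (Fin n)) {x x' : FreeExpr G b n p} :
      Rel G x x' → Rel G (act σ x) (act σ x')
  | add_congr {b n p} {x x' y y' : FreeExpr G b n p} :
      Rel G x x' → Rel G y y' → Rel G (add x y) (add x' y')
  | smul_congr {b n p} (a : k) {x x' : FreeExpr G b n p} :
      Rel G x x' → Rel G (smul a x) (smul a x')
  | add_comm {b n p} (x y : FreeExpr G b n p) : Rel G (add x y) (add y x)
  | add_assoc {b n p} (x y z : FreeExpr G b n p) : Rel G (add (add x y) z) (add x (add y z))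
  | zero_add {b n p} (x : FreeExpr G b n p) : Rel G (add zero x) x
  | zero_smul {b n p} (x : FreeExpr G b n p) : Rel G (smul 0 x) zero
  | one_smul {b n p} (x : FreeExpr G b n p) : Rel G (smul 1 x) x
  | mul_smul {b n p} (a c : k) (x : FreeExpr G b n p) : Rel G (smul (a * c) x) (smul a (smul c x))
  | smul_add {b n p} (a : k) (x y : FreeExpr G b n p) :
      Rel G (smul a (add x y)) (add (smul a x) (smul a y))
  | add_smul {b n p} (a c : k) (x : FreeExpr G b n p) :
      Rel G (smul (a + c) x) (add (smul a x) (smul c x))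
  | gen_add {b n p} (hn : Kind.minArity b ≤ n) (x y : (G b).obj n p) :
      Rel G (gen hn (x + y)) (add (gen hn x) (gen hn y))
  | gen_smul {b n p} (hn : Kind.minArity b ≤ n) (a : k) (x : (G b).obj n p) :
      Rel G (gen hn (a • x)) (smul a (gen hn x))
  | gen_act {b n p} (hn : Kind.minArity b ≤ n) (σ : Perm (Fin n)) (x : (G b).obj n p) :
      Rel G (gen hn ((G b).act σ x)) (act σ (gen hn x))
  | act_add {b n p} (σ : Perm (Fin n)) (x y : FreeExpr G b n p) :
      Rel G (act σ (add x y)) (add (act σ x) (act σ y))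
  | act_smul {b n p} (σ : Perm (Fin n)) (a : k) (x : FreeExpr G b n p) :
      Rel G (act σ (smul a x)) (smul a (act σ x))
  | act_one {b n p} (x : FreeExpr G b n p) : Rel G (act 1 x) x
  | act_mul {b n p} (σ τ : Perm (Fin n)) (x : FreeExpr G b n p) :
      Rel G (act (σ * τ) x) (act τ (act σ x))
  | comp_add_left {b m n r} (h : r + 1 = m + n) (i : Fin m) {p q s : ℤ} (hs : p + q = s)
      (x x' : FreeExpr G b m p) (y : FreeExpr G .operad n q) :
      Rel G (comp h i hs (add x x') y) (add (comp h i hs x y) (comp h i hs x' y))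
  | comp_smul_left {b m n r} (h : r + 1 = m + n) (i : Fin m) {p q s : ℤ} (hs : p + q = s)
      (a : k) (x : FreeExpr G b m p) (y : FreeExpr G .operad n q) :
      Rel G (comp h i hs (smul a x) y) (smul a (comp h i hs x y))
  | comp_add_right {b m n r} (h : r + 1 = m + n) (i : Fin m) {p q s : ℤ} (hs : p + q = s)
      (x : FreeExpr G b m p) (y y' : FreeExpr G .operad n q) :
      Rel G (comp h i hs x (add y y')) (add (comp h i hs x y) (comp h i hs x y'))
  | comp_smul_right {b m n r} (h : r + 1 = m + n) (i : Fin m) {p q s : ℤ} (hs : p + q = s)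
      (a : k) (x : FreeExpr G b m p) (y : FreeExpr G .operad n q) :
      Rel G (comp h i hs x (smul a y)) (smul a (comp h i hs x y))
  | unit_comp {n} {p : ℤ} (h : n + 1 = 1 + n) (i : Fin 1) (hs : 0 + p = p)
      (x : FreeExpr G .operad n p) : Rel G (comp h i hs unit x) x
  | comp_unit {b n} {p : ℤ} (h : n + 1 = n + 1) (i : Fin n) (hs : p + 0 = p)
      (x : FreeExpr G b n p) : Rel G (comp h i hs x unit) x
  /-- `(x · σ) ∘_i (y · τ) = (x ∘_(σ i) y) · (σ ∘_i τ)` -/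
  | comp_act {b m n r} (h : r + 1 = m + n) (i : Fin m) {p q s : ℤ} (hs : p + q = s)
      (σ : Perm (Fin m)) (τ : Perm (Fin n)) (x : FreeExpr G b m p) (y : FreeExpr G .operad n q) :
      Rel G (comp h i hs (act σ x) (act τ y)) (act (permComp h i σ τ) (comp h (σ i) hs x y))
  /-- `(x ∘_i y) ∘_(i + j) z = x ∘_i (y ∘_j z)` -/
  | assoc {b l m n r₁ r₂ r} (h₁ : r₁ + 1 = l + m) (h₂ : r₂ + 1 = m + n) (h₃ : r + 1 = r₁ + n)
      (h₄ : r + 1 = l + r₂) (i : Fin l) (j : Fin m) (i' : Fin r₁) (hi : i'.1 = i.1 + j.1)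
      {p q t s₁ s₂ s : ℤ} (hs₁ : p + q = s₁) (hs₂ : q + t = s₂) (hs₃ : s₁ + t = s)
      (hs₄ : p + s₂ = s)
      (x : FreeExpr G b l p) (y : FreeExpr G .operad m q) (z : FreeExpr G .operad n t) :
      Rel G (comp h₃ i' hs₃ (comp h₁ i hs₁ x y) z) (comp h₄ i hs₄ x (comp h₂ j hs₂ y z))
  /-- `(x ∘_i y) ∘_(j + m - 1) z = ± (x ∘_j z) ∘_i y` for `i < j`, where `m` is the arity of `y` -/
  | parallel {b l m n r₁ r₂ r} (h₁ : r₁ + 1 = l + m) (h₂ : r₂ + 1 = l + n) (h₃ : r + 1 = r₁ + n)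
      (h₄ : r + 1 = r₂ + m) (i j : Fin l) (hij : i < j) (j' : Fin r₁) (hj : j'.1 + 1 = j.1 + m)
      (i' : Fin r₂) (hi : i'.1 = i.1)
      {p q t s₁ s₂ s : ℤ} (hs₁ : p + q = s₁) (hs₂ : p + t = s₂) (hs₃ : s₁ + t = s)
      (hs₄ : s₂ + q = s)
      (x : FreeExpr G b l p) (y : FreeExpr G .operad m q) (z : FreeExpr G .operad n t) :
      Rel G (comp h₃ j' hs₃ (comp h₁ i hs₁ x y) z)
        (smul (sgnPow k (q * t)) (comp h₄ i' hs₄ (comp h₂ j hs₂ x z) y))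

/-- The free pair: `Free G .operad` is the free graded operad generated by (the part in arities
at least two of) `G .operad`, and `Free G .module` is the free right module over it generated
by `G .module`. -/
def Free (G : Kind → Coll k) (b : Kind) (n : ℕ) (p : ℤ) : Type u :=
  Quot (Rel G (b := b) (n := n) (p := p))

namespace Free

variable {G : Kind → Coll k} {b : Kind}

/-- The class of a formal expression. -/
def mk {n : ℕ} {p : ℤ} (x : FreeExpr G b n p) : Free G b n p := Quot.mk _ x

theorem sound {n : ℕ} {p : ℤ} {x y : FreeExpr G b n p} (h : Rel G x y) : mk x = mk y := Quot.sound h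

instance (n : ℕ) (p : ℤ) : Zero (Free G b n p) := ⟨mk .zero⟩

instance (n : ℕ) (p : ℤ) : Add (Free G b n p) :=
  ⟨Quot.map₂ FreeExpr.add (fun _ _ _ h => .add_congr (.refl _) h)
    (fun _ _ _ h => .add_congr h (.refl _))⟩

instance (n : ℕ) (p : ℤ) : Neg (Free G b n p) :=
  ⟨Quot.map (FreeExpr.smul (-1)) (fun _ _ h => .smul_congr _ h)⟩

instance (n : ℕ) (p : ℤ) : AddCommGroup (Free G b n p) where
  add_assoc := by rintro ⟨x⟩ ⟨y⟩ ⟨z⟩; exact sound (.add_assoc x y z)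
  zero_add := by rintro ⟨x⟩; exact sound (.zero_add x)
  add_zero := by rintro ⟨x⟩; exact sound ((Rel.add_comm _ _).trans (.zero_add x))
  add_comm := by rintro ⟨x⟩ ⟨y⟩; exact sound (.add_comm x y)
  neg_add_cancel := by
    rintro ⟨x⟩
    refine sound (((Rel.add_congr (.refl _) (Rel.one_smul x).symm).trans
      (Rel.add_smul (-1) 1 x).symm).trans ?_)
    rw [neg_add_cancel]
    exact .zero_smul x
  nsmul := nsmulRec
  zsmul := zsmulRec

instance (n : ℕ) (p : ℤ) : Module k (Free G b n p) where
  smul a := Quot.map (FreeExpr.smul a) (fun _ _ h => .smul_congr _ h)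
  one_smul := by rintro ⟨x⟩; exact sound (.one_smul x)
  mul_smul := by rintro a c ⟨x⟩; exact sound (.mul_smul a c x)
  smul_add := by rintro a ⟨x⟩ ⟨y⟩; exact sound (.smul_add a x y)
  add_smul := by rintro a c ⟨x⟩; exact sound (.add_smul a c x)
  zero_smul := by rintro ⟨x⟩; exact sound (.zero_smul x)
  smul_zero := by
    intro a
    refine sound (((Rel.smul_congr a (Rel.zero_smul .zero).symm).trans
      (Rel.mul_smul a 0 .zero).symm).trans ?_)
    rw [mul_zero]
    exact .zero_smul _

/-- The inclusion of the generators. -/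
def gen {n : ℕ} {p : ℤ} (hn : b.minArity ≤ n) : (G b).obj n p →ₗ[k] Free G b n p where
  toFun x := mk (.gen hn x)
  map_add' x y := sound (.gen_add hn x y)
  map_smul' a x := sound (.gen_smul hn a x)

/-- The right action of the symmetric group. -/
def act {n : ℕ} {p : ℤ} (σ : Perm (Fin n)) : Free G b n p →ₗ[k] Free G b n p where
  toFun := Quot.map (FreeExpr.act σ) (fun _ _ h => .act_congr σ h)
  map_add' := by rintro ⟨x⟩ ⟨y⟩; exact sound (.act_add σ x y)
  map_smul' := by rintro a ⟨x⟩; exact sound (.act_smul σ a x)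

/-- The structure maps `∘_i`. -/
def comp {m n r : ℕ} (h : r + 1 = m + n) (i : Fin m) {p q s : ℤ} (hs : p + q = s) :
    Free G b m p →ₗ[k] Free G .operad n q →ₗ[k] Free G b r s :=
  LinearMap.mk₂ k
    (Quot.map₂ (FreeExpr.comp h i hs) (fun _ _ _ hh => .comp_congr h i hs (.refl _) hh)
      (fun _ _ _ hh => .comp_congr h i hs hh (.refl _)))
    (by rintro ⟨x⟩ ⟨x'⟩ ⟨y⟩; exact sound (.comp_add_left h i hs x x' y))
    (by rintro a ⟨x⟩ ⟨y⟩; exact sound (.comp_smul_left h i hs a x y))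
    (by rintro ⟨x⟩ ⟨y⟩ ⟨y'⟩; exact sound (.comp_add_right h i hs x y y'))
    (by rintro a ⟨x⟩ ⟨y⟩; exact sound (.comp_smul_right h i hs a x y))

/-- The unit of the operad. -/
def unit : Free G .operad 1 0 := mk .unit

end Free

/-- The generators of the cobar construction on a comodule `N` over a cooperad `Q`: the operad is
generated by the desuspension of `Q`, and the module is generated by `N`. -/
def cobarGens (N Q : Coll k) : Kind → Coll k
  | .operad => Q.desusp
  | .module => N

/-- The underlying graded objects of the cobar construction: the operad `Ω(Q) = F(↓Q)`, and the
right `Ω(Q)`-module `Ω(N; Q) = N ∘ F(↓Q)`. -/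
abbrev Cobar (N Q : Coll k) : Kind → ℕ → ℤ → Type u := Free (cobarGens N Q)

/-- The structure maps of the comodule `N` and of the cooperad `Q`, in terms of the generators
of the cobar construction. -/
def cobarDecomp {N Q : Coll k} (δN : Decomposition N Q) (δQ : Decomposition Q Q) :
    ∀ (b : Kind) {m n r : ℕ} (_ : r + 1 = m + n) (_ : Fin m) {p q s : ℤ} (_ : p + q + 1 = s),
      (cobarGens N Q b).obj r s →ₗ[k]
        (cobarGens N Q b).obj m p ⊗[k] (cobarGens N Q .operad).obj n q
  | .operad, _, _, _, h, i, p, q, s, hs =>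
      δQ.decomp h i (p := p + 1) (q := q + 1) (s := s + 1) (by omega)
  | .module, _, _, _, h, i, p, q, s, hs => δN.decomp h i (p := p) (q := q + 1) (s := s) (by omega)

/-- The unshuffles: permutations `ρ` of `r` letters such that `ρ⁻¹` is increasing on the first `n`
letters and on the others. They correspond to the subsets `B = ρ⁻¹{1, …, n}` with `n` elements,
hence to the trees with `r` labelled inputs and two vertices of which the upper one has
`n` inputs. -/
def unshuffles (r n : ℕ) : Finset (Perm (Fin r)) :=
  open Classical in
  Finset.univ.filter fun ρ =>
    (∀ x y : Fin r, x < y → y.1 < n → ρ⁻¹ x < ρ⁻¹ y) ∧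
    (∀ x y : Fin r, x < y → n ≤ x.1 → ρ⁻¹ x < ρ⁻¹ y)

theorem Kind.minArity_pos (b : Kind) : 0 < b.minArity := by cases b <;> decide

/-- The contribution to the cobar differential of a generator `x` of the tree given by an
unshuffle `ρ` whose lower vertex has `m` and whose upper vertex has `n` inputs, in the bidegree
`(p, q)`. It is `∑ (-1) ^ p (x' ∘_0 ↓x'') · ρ`, where `∑ x' ⊗ x''` is the `0`-th decomposition
of `x · ρ⁻¹`, and `p` is the degree of the generator `x'` (so it is `|↓x'|` for the operad). -/
def cobarTree {N Q : Coll k} (δN : Decomposition N Q) (δQ : Decomposition Q Q) (b : Kind)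
    {m n r : ℕ} (h : r + 1 = m + n) (hm : b.minArity ≤ m) (hn : 2 ≤ n) (ρ : Perm (Fin r))
    {p q s s' : ℤ} (hs : p + q = s') (hs' : s' + 1 = s)
    (x : (cobarGens N Q b).obj r s) : Cobar N Q b r s' :=
  have hpos : 0 < m := lt_of_lt_of_le b.minArity_pos hm
  sgnPow k p • Free.act ρ
    (TensorProduct.lift
      ((Free.comp h ⟨0, hpos⟩ hs).compl₁₂ (Free.gen hm) (Free.gen (b := .operad) hn))
      (cobarDecomp δN δQ b h ⟨0, hpos⟩ (by rw [hs, hs']) ((cobarGens N Q b).act ρ⁻¹ x)))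

/-- The value of the cobar differential on a generator: the sum over all trees with two vertices
and over all bidegrees of the decompositions of the generator (only finitely many bidegrees
contribute). -/
def cobarOnGen {N Q : Coll k} (δN : Decomposition N Q) (δQ : Decomposition Q Q) (b : Kind)
    {r : ℕ} {s s' : ℤ} (hs : s' + 1 = s) (x : (cobarGens N Q b).obj r s) : Cobar N Q b r s' :=
  ∑ n ∈ Finset.Icc 2 r, ∑ ρ ∈ unshuffles r n, ∑ᶠ p : ℤ,
    if hn : 2 ≤ n ∧ b.minArity + n ≤ r + 1 then
      cobarTree δN δQ b (m := r + 1 - n) (by omega) (by omega) hn.1 ρ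
        (add_sub_cancel p s') hs x
    else 0

/-- A family of linear maps of degree `-1` on the cobar construction is the cobar differential if it
is equivariant, a derivation with respect to all `∘_i`, and is given on the generators by the
structure maps of the cooperad and of the comodule. -/
structure IsCobarDifferential {N Q : Coll k} (δN : Decomposition N Q) (δQ : Decomposition Q Q)
    (D : ∀ (b : Kind) (n : ℕ) {p p' : ℤ} (_ : p' + 1 = p), Cobar N Q b n p →ₗ[k] Cobar N Q b n p') :
    Prop where
  act : ∀ (b : Kind) (n : ℕ) {p p' : ℤ} (hp : p' + 1 = p) (σ : Perm (Fin n)) (x : Cobar N Q b n p),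
    D b n hp (Free.act σ x) = Free.act σ (D b n hp x)
  comp : ∀ (b : Kind) {m n r : ℕ} (h : r + 1 = m + n) (i : Fin m) {p p' q q' s s' : ℤ}
    (hp : p' + 1 = p) (hq : q' + 1 = q) (hs : s' + 1 = s) (hpq : p + q = s)
    (x : Cobar N Q b m p) (y : Cobar N Q .operad n q),
    D b r hs (Free.comp h i hpq x y) =
      Free.comp h i (by omega) (D b m hp x) y +
        sgnPow k p • Free.comp h i (by omega) x (D .operad n hq y)
  gen : ∀ (b : Kind) {n : ℕ} (hn : b.minArity ≤ n) {p p' : ℤ} (hp : p' + 1 = p)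
    (x : (cobarGens N Q b).obj n p), D b n hp (Free.gen hn x) = cobarOnGen δN δQ b hp x

/-- There is at most one cobar differential. -/
theorem IsCobarDifferential.unique {N Q : Coll k} {δN : Decomposition N Q} {δQ : Decomposition Q Q}
    {D D' : ∀ (b : Kind) (n : ℕ) {p p' : ℤ} (_ : p' + 1 = p),
      Cobar N Q b n p →ₗ[k] Cobar N Q b n p'}
    (hD : IsCobarDifferential δN δQ D) (hD' : IsCobarDifferential δN δQ D')
    (b : Kind) (n : ℕ) {p p' : ℤ} (hp : p' + 1 = p) (x : Cobar N Q b n p) :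
    D b n hp x = D' b n hp x := by
  have unit_zero : ∀ {E : ∀ (b : Kind) (n : ℕ) {p p' : ℤ} (_ : p' + 1 = p),
      Cobar N Q b n p →ₗ[k] Cobar N Q b n p'} (_ : IsCobarDifferential δN δQ E)
      {p' : ℤ} (hp : p' + 1 = 0), E .operad 1 hp Free.unit = 0 := by
    intro E hE p' hp
    have h1 := hE.comp .operad (m := 1) (n := 1) (r := 1) rfl 0 hp hp hp (add_zero 0)
      Free.unit Free.unit
    have h2 : Free.comp (G := cobarGens N Q) (b := .operad) (m := 1) (n := 1) (r := 1) rfl 0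
        (add_zero 0) Free.unit Free.unit = Free.unit := Free.sound (.comp_unit _ _ _ _)
    have h3 : ∀ z : Cobar N Q .operad 1 p', Free.comp (G := cobarGens N Q) (m := 1) (n := 1) (r := 1)
        rfl 0 (by omega : p' + 0 = p') z Free.unit = z := by
      rintro ⟨z⟩; exact Free.sound (.comp_unit _ _ _ _)
    have h4 : ∀ z : Cobar N Q .operad 1 p', Free.comp (G := cobarGens N Q) (m := 1) (n := 1) (r := 1)
        rfl 0 (by omega : 0 + p' = p') Free.unit z = z := by
      rintro ⟨z⟩; exact Free.sound (.unit_comp _ _ _ _)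
    rw [h2, h3, h4] at h1
    simpa [sgnPow] using h1
  suffices key : ∀ {b : Kind} {n : ℕ} {p : ℤ} (e : FreeExpr (cobarGens N Q) b n p) {p' : ℤ}
      (hp : p' + 1 = p), D b n hp (Free.mk e) = D' b n hp (Free.mk e) by
    obtain ⟨e⟩ := x
    exact key e hp
  clear x hp
  intro b n p x
  induction x with
  | gen hn x =>
    intro p' hp
    exact (hD.gen _ hn hp x).trans (hD'.gen _ hn hp x).symm
  | unit =>
    intro p' hp
    exact (unit_zero hD hp).trans (unit_zero hD' hp).symm
  | @comp b m n r h i p q s hs x y ihx ihy =>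
    intro p' hp
    have e1 := hD.comp b h i (sub_add_cancel p 1) (sub_add_cancel q 1) hp hs
      (Free.mk x) (Free.mk y)
    have e2 := hD'.comp b h i (sub_add_cancel p 1) (sub_add_cancel q 1) hp hs
      (Free.mk x) (Free.mk y)
    have e3 : D b m (sub_add_cancel p 1) (Free.mk x) = D' b m (sub_add_cancel p 1) (Free.mk x) :=
      ihx _
    have e4 : D .operad n (sub_add_cancel q 1) (Free.mk y) =
      D' .operad n (sub_add_cancel q 1) (Free.mk y) := ihy _
    rw [e3, e4, ← e2] at e1
    exact e1
  | @act b n p σ x ih =>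
    intro p' hp
    have e1 := hD.act b n hp σ (Free.mk x)
    have e2 := hD'.act b n hp σ (Free.mk x)
    have e3 : D b n hp (Free.mk x) = D' b n hp (Free.mk x) := ih hp
    rw [e3, ← e2] at e1
    exact e1
  | @zero b n p =>
    intro p' hp
    exact (map_zero (D b n hp)).trans (map_zero (D' b n hp)).symm
  | @add b n p x y ihx ihy =>
    intro p' hp
    have e3 : D b n hp (Free.mk x) = D' b n hp (Free.mk x) := ihx hp
    have e4 : D b n hp (Free.mk y) = D' b n hp (Free.mk y) := ihy hp
    have e1 := map_add (D b n hp) (Free.mk x) (Free.mk y)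
    have e2 := map_add (D' b n hp) (Free.mk x) (Free.mk y)
    rw [e3, e4, ← e2] at e1
    exact e1
  | @smul b n p a x ih =>
    intro p' hp
    have e3 : D b n hp (Free.mk x) = D' b n hp (Free.mk x) := ih hp
    have e1 := map_smul (D b n hp) a (Free.mk x)
    have e2 := map_smul (D' b n hp) a (Free.mk x)
    rw [e3, ← e2] at e1
    exact e1

/-- The comodule `(𝐬 Cycl)^*` over the cooperad `(𝐬 Ass)^*`. -/
def cyclDual (k : Type u) [Field k] : Decomposition (cycl k).susp.dual (ass k).susp.dual :=
  (cyclComp k).susp.dual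

/-- The cooperad `(𝐬 Ass)^*`. -/
def assDual (k : Type u) [Field k] : Decomposition (ass k).susp.dual (ass k).susp.dual :=
  (assComp k).susp.dual

/-- The cobar construction on `(𝐬 Cycl)^*` and `(𝐬 Ass)^*`: `Ω k .operad` is `Ω((𝐬 Ass)^*)`,
and `Ω k .module` is `Ω((𝐬 Cycl)^*; (𝐬 Ass)^*)`. -/
abbrev Ω (k : Type u) [Field k] : Kind → ℕ → ℤ → Type u :=
  Cobar (cycl k).susp.dual (ass k).susp.dual

/-- The generator `(↑^(n-1) ξ_n)^*` of `Ω((𝐬 Cycl)^*; (𝐬 Ass)^*)` in arity `n` and degree `n - 1`: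
the functional dual to the class `ξ_n` of the identical permutation. -/
def topGenerator (k : Type u) [Field k] (n : ℕ) (hn : 1 ≤ n) : Ω k .module n ((n - 1 : ℕ) : ℤ) :=
  Free.gen (G := cobarGens (cycl k).susp.dual (ass k).susp.dual) (b := .module) hn
    (Finsupp.lapply (R := k) (M := k) ⟨CyclicOrder.mk 1, hn, by omega⟩ :
      ({_c : CyclicOrder n // 1 ≤ n ∧ ((n - 1 : ℕ) : ℤ) - ((n : ℤ) - 1) = 0} →₀ k) →ₗ[k] k)

/-! Part 4. Cellular chains of convex polytopes. -/

section Polytope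

variable {E : Type*} [AddCommGroup E] [Module ℝ E] [TopologicalSpace E]

/-- A nonempty face of dimension `p` of a convex polytope, with a basis of its direction. The cells of
the polytope are its nonempty faces, and the basis orients the cell. -/
structure OrientedFace (P : Set E) (p : ℕ) where
  face : Set E
  nonempty : face.Nonempty
  exposed : IsExposed ℝ P face
  frame : Fin p → E
  independent : LinearIndependent ℝ frame
  span_frame : Submodule.span ℝ (Set.range frame) = vectorSpan ℝ face

/-- The sign of the determinant of the transition matrix from a frame `f` to a frame `g`, and zero
if there is no such matrix. It compares the orientations given by two bases of one subspace. -/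
def orientationSign {p : ℕ} (f g : Fin p → E) : ℤ :=
  open Classical in
  if h : ∃ A : Matrix (Fin p) (Fin p) ℝ, ∀ i, g i = ∑ j, A i j • f j then
    (SignType.sign h.choose.det : ℤ)
  else 0

/-- Cellular chains of degree `p` of a polytope with coefficients in `k`: functions on the oriented
`p`-cells that change the sign when the orientation is reversed. The value at an oriented cell is
the coefficient of the chain at this cell. -/
def IsChain (k : Type*) [Field k] {P : Set E} {p : ℕ} (c : OrientedFace P p → k) : Prop :=
  ∀ a b : OrientedFace P p, a.face = b.face →
    c b = ((orientationSign a.frame b.frame : ℤ) : k) * c a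

/-- The oriented cell `a` of dimension `p` is in the boundary of the oriented cell `b` of
dimension `p + 1`, with the orientation that is induced by the convention `outward normal first`. -/
def IsInduced {P : Set E} {p : ℕ} (b : OrientedFace P (p + 1)) (a : OrientedFace P p) : Prop :=
  a.face ⊆ b.face ∧
    ∃ x ∈ b.face \ a.face, ∃ y ∈ a.face, b.frame = Fin.cons (y - x) a.frame

/-- The cellular boundary: the coefficient of `∂ c` at an oriented cell `a` is the sum, over
all cells `F` of the next dimension that have `a` in the boundary, of the coefficients of `c` at `F`
oriented in such a way that the induced orientation is that of `a`. -/
def boundary {k : Type*} [Field k] {P : Set E} {p : ℕ} (c : OrientedFace P (p + 1) → k)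
    (a : OrientedFace P p) : k :=
  open Classical in
  ∑ᶠ F : Set E,
    if h : ∃ b : OrientedFace P (p + 1), b.face = F ∧ IsInduced b a then c h.choose else 0

end Polytope

/-! Part 5. Associahedra, cyclohedra, and the cellular chains of their symmetrizations. -/

/-- The value of the function that truncates the simplex: `3 ^ #A`. For the empty set of
coordinates it is `0`; so the associahedron `K_1` is a point. -/
def bound (A : Finset ℕ) : ℝ := if A = ∅ then 0 else 3 ^ A.card

/-- The `x`-th coordinate of a vector (coordinates are numbered from `0`), and `0` if there is no such
coordinate. -/
def coord {g : ℕ} (t : Fin g → ℝ) (x : ℕ) : ℝ := if h : x < g then t ⟨x, h⟩ else 0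

/-- The vector `t` lies on the hyperplane `P_A` where the sum of the coordinates in `A` is the
prescribed bound. -/
def Tight {g : ℕ} (t : Fin g → ℝ) (A : Finset ℕ) : Prop := ∑ x ∈ A, coord t x = bound A

/-- A cyclic word of `n` letters has `n` gaps between neighbours, the `x`-th gap being between
the letters `x` and `x + 1` modulo `n`; a linear word has the first `n - 1` of these. -/
def Kind.gaps : Kind → ℕ → ℕ
  | operad, n => n - 1
  | module, n => n

/-- The sets of gaps inside a pair of brackets in a (linear or cyclic) word of `n` letters: intervals
`[i, j]`, and for cyclic words also the cyclic intervals `i][j`. -/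
def Kind.IsBracket (b : Kind) (n : ℕ) (A : Finset ℕ) : Prop :=
  (∃ i j, i ≤ j ∧ j < b.gaps n ∧ A = Finset.Icc i j) ∨
    (b = module ∧ ∃ i j, i < j ∧ j < n ∧ A = Finset.range (i + 1) ∪ Finset.Ico j n)

/-- The associahedron `K_n` (for `.operad`) and the cyclohedron `W_n` (for `.module`), realized
as truncations of a simplex. -/
def Kind.polytope (b : Kind) (n : ℕ) : Set (Fin (b.gaps n) → ℝ) :=
  {t | Tight t (Finset.range (b.gaps n)) ∧
    ∀ A, b.IsBracket n A → bound A ≤ ∑ x ∈ A, coord t x}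

/-- The oriented cells of dimension `p` of the polytope `K_n` or `W_n`. -/
abbrev Cell (b : Kind) (n p : ℕ) : Type := OrientedFace (b.polytope n) p

/-- The permutation of the coordinates of `ℝ^n` by a permutation of the gaps of a cyclic word. -/
def rotate {n : ℕ} (ζ : Perm (Fin n)) (t : Fin n → ℝ) : Fin n → ℝ := fun x => t (ζ.symm x)

/-- The chains on the symmetrized polytopes `K̄_n = Σ_n × K_n` and `W̄_n = Σ_n ×_(ℤ_n) W_n ≅ Σ_(n-1) × W_n`.
The permutation `σ` puts the letter `x` at the place `σ x`. A chain on `Σ_n × W_n` which is invariant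
under the rotations is a chain on the quotient by the free action of the cyclic group `ℤ_n`. -/
def chains (k : Type*) [Field k] (b : Kind) (n p : ℕ) :
    Submodule k (Perm (Fin n) → Cell b n p → k) where
  carrier := {c | (∀ σ, IsChain k (c σ)) ∧
    match b, c with
    | .operad, _ => True
    | .module, c => ∀ σ (a a' : Cell .module n p),
        a'.face = rotate (finRotate n) '' a.face →
        (∀ i, a'.frame i = rotate (finRotate n) (a.frame i)) →
        c (finRotate n * σ) a' = c σ a}
  add_mem' := by
    rintro c c' ⟨h1, h2⟩ ⟨h3, h4⟩
    refine ⟨fun σ a a' haa => ?_, ?_⟩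
    · simp only [Pi.add_apply, h1 σ a a' haa, h3 σ a a' haa, mul_add]
    · cases b
      · trivial
      · intro σ a a' h5 h6
        exact congrArg₂ (· + ·) (h2 σ a a' h5 h6) (h4 σ a a' h5 h6)
  zero_mem' := by
    refine ⟨fun σ a a' haa => ?_, ?_⟩
    · simp
    · cases b
      · trivial
      · intro σ a a' h5 h6
        rfl
  smul_mem' := by
    rintro x c ⟨h1, h2⟩
    refine ⟨fun σ a a' haa => ?_, ?_⟩
    · simp only [Pi.smul_apply, h1 σ a a' haa, smul_eq_mul]
      ring
    · cases b
      · trivial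
      · intro σ a a' h5 h6
        exact congrArg (x * ·) (h2 σ a a' h5 h6)

/-- The chain on `K̄_n` or `W̄_n` given by the single oriented cell `a` of the copy numbered by `σ`
(for `W̄_n`, by the class of the pair of these under the rotations). -/
def cellChain (k : Type*) [Field k] : ∀ (b : Kind) {n p : ℕ} (_ : Perm (Fin n)) (_ : Cell b n p),
    Perm (Fin n) → Cell b n p → k
  | .operad, _, _, σ, a => open Classical in fun τ a' =>
      if τ = σ ∧ a'.face = a.face then ((orientationSign a.frame a'.frame : ℤ) : k) else 0
  | .module, n, _, σ, a => open Classical in fun τ a' =>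
      ∑ s ∈ Finset.range n,
        if τ = finRotate n ^ s * σ ∧ a'.face = rotate (finRotate n ^ s) '' a.face then
          ((orientationSign (fun i => rotate (finRotate n ^ s) (a.frame i)) a'.frame : ℤ) : k)
        else 0

/-- When a word with `h` gaps is inserted in place of the `j`-th letter of another word, the
gaps before that letter keep their numbers, then come the new gaps, and then the remaining ones. -/
def insertVec {g h : ℕ} (r : ℕ) (j : ℕ) (t : Fin g → ℝ) (u : Fin h → ℝ) : Fin r → ℝ := fun x =>
  if x.1 < j then coord t x.1
  else if x.1 < j + h then coord u (x.1 - j)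
  else coord t (x.1 - h)

/-- The bracket with the set `A` of gaps contains the `j`-th letter of a word of `m` letters. -/
def Kind.Touches (b : Kind) (m j : ℕ) (A : Finset ℕ) : Prop :=
  j ∈ A ∨ match b with
    | operad => ∃ x ∈ A, x + 1 = j
    | module => (j + m - 1) % m ∈ A

/-- The bracket with the set `A` of gaps in a word of `m` letters, after a word with `h` gaps has been
inserted in place of the `j`-th letter. -/
def Kind.inflate (b : Kind) (m j h : ℕ) (A : Finset ℕ) : Finset ℕ :=
  open Classical in
  A.image (fun x => if x < j then x else x + h) ∪
    if b.Touches m j A then Finset.Ico j (j + h) else ∅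

/-- The oriented cell `e` is the composite of the oriented cell `a` of `K_m` or `W_m` and the oriented
cell `c` of `K_n` at the `j`-th place. The bracketing of `e` is obtained by inserting
the bracketing of `c`, enclosed in a pair of brackets, in place of the `j`-th letter of the bracketing
of `a`; this identifies `K_m × K_n` or `W_m × K_n` with a face of codimension one. The
orientation of `e` is that of the product of `a` and `c`. -/
structure IsComposite {b : Kind} {m n r p q : ℕ} (j : ℕ) (a : Cell b m p) (c : Cell .operad n q)
    (e : Cell b r (p + q)) : Prop where
  face : e.face = {t | t ∈ b.polytope r ∧ Tight t (Finset.Ico j (j + (n - 1))) ∧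
    (∀ A, b.IsBracket m A → (∀ u ∈ a.face, Tight u A) → Tight t (b.inflate m j (n - 1) A)) ∧
    (∀ A, Kind.operad.IsBracket n A → (∀ u ∈ c.face, Tight u A) → Tight t (A.image (j + ·)))}
  frame : e.frame = Fin.append (fun i => insertVec (b.gaps r) j (a.frame i) (0 : Fin (n - 1) → ℝ))
    (fun i => insertVec (b.gaps r) j (0 : Fin (b.gaps m) → ℝ) (c.frame i))

end Cyclo

end

open Cyclo

/-!
The cobar construction and the cellular chains are compared through a third object. A face of the
associahedron or the cyclohedron is given by a set of brackets, and a bracket is encoded by the set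
of the gaps between the letters that it contains, a *tube*: a connected set of gaps. `TubeChain` is
the space of combinations of permutations (the letters of the word) decorated with lists of tubes,
modulo the rules that exchanging two tubes of a list changes the sign, that a list with a repeated
tube or with two incompatible tubes is zero, and that a rotation of a cyclic word acts by its sign.
Thus the boundary is simply the sum over all ways to append one tube to the list, and its square is
zero by antisymmetry (`TubeChain.boundary_boundary`). The composition
`graft` inflates the tubes of the first word and shifts those of the second one; the boundary is a
derivation of it (`TubeChain.boundary_comp`).

*The cobar construction.* As this model satisfies the axioms of an operad and of a right module over
it, the free operad and the free module map to it (`toTubes`); a generator goes to the word with the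
set of all gaps as its only tube. The decompositions of a permutation or a cyclic order along trees
with two vertices correspond to the brackets, with the right signs, so that the prescribed value of
the cobar differential on a generator goes to the boundary of its image (`toTubes_cobarOnGen`). The
map is bijective: the free object is spanned by the iterated composites `Comb`, in which words are
inserted one after the other (`mem_combSpan`), and such a composite is determined up to sign and
rotation by its tubes (`Comb.unique`), because the insertions can be reordered such that any
prescribed innermost bracket comes last. Hence the boundary of the model can be transported to the
cobar construction, where it is a derivation with the prescribed values on the generators
(`cobarDiff`).

*The polytopes.* The faces of the polytopes correspond to the sets of pairwise compatible tubes that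
contain the set of all gaps. The point is that the lower bounds grow fast enough: for each such set
there is a point at which exactly the inequalities of its tubes are equalities (`exists_weight`),
while the equalities for two incompatible tubes exclude each other. Therefore every exposed face is
cut out by its tubes (`eq_tubeFace`, `tubesOf_tubeFace`), and its codimension is their number.

*Orientations.* A list of tubes orients the face that it describes: a frame of the face is compared,
by the sign of a determinant, with the normal vectors of the tubes in the order of the list
(`orient`). An outward vector of a facet may be exchanged for the normal vector of the tube of this
facet (`orient_cons`), whence the cellular boundary adds a tube (`toCells_boundary`); the determinant
of a product is a product of determinants (`orient_graft`), whence composites of lists describe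
products of cells (`exists_isComposite`). Evaluating the images of the iterated composites at one
cell for each orbit of faces, one obtains a diagonal matrix, so that the composed map `toChains` is
an isomorphism (`bijective_toChains`). This also is how the injectivity of `toTubes` is proved.
-/

noncomputable section

namespace Cyclo

universe u

/-! ### Brackets as connected sets of gaps -/

/-- Two gaps of a cyclic word of `n` letters are neighbours. -/
def GapAdj (n x y : ℕ) : Prop := x + 1 = y ∨ y + 1 = x ∨ (x = 0 ∧ y + 1 = n) ∨ (y = 0 ∧ x + 1 = n)

/-- A nonempty set of gaps of a cyclic word of `n` letters that is connected: a nonempty part of it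
that contains, with a gap, all its neighbours in the set is the whole set. -/
def GapConnected (n : ℕ) (A : Finset ℕ) : Prop :=
  A.Nonempty ∧ (∀ x ∈ A, x < n) ∧
    ∀ X ⊆ A, X.Nonempty → (∀ x ∈ X, ∀ y ∈ A, GapAdj n x y → y ∈ X) → X = A

theorem GapAdj.symm {n x y : ℕ} (h : GapAdj n x y) : GapAdj n y x := by
  unfold GapAdj at *; omega

/-- An interval in `A` that meets a part of `A` closed under neighbours lies in this part. -/
theorem Icc_subset_of_closed {n : ℕ} {A X : Finset ℕ}
    (hX : ∀ x ∈ X, ∀ y ∈ A, GapAdj n x y → y ∈ X) {a b x : ℕ} (hab : ∀ y, a ≤ y → y ≤ b → y ∈ A)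
    (hx : x ∈ X) (hax : a ≤ x) (hxb : x ≤ b) : ∀ y, a ≤ y → y ≤ b → y ∈ X := by
  have up : ∀ d, x + d ≤ b → x + d ∈ X := by
    intro d
    induction d with
    | zero => intro _; exact hx
    | succ d ih =>
      intro hd
      exact hX _ (ih (by omega)) _ (hab _ (by omega) hd) (Or.inl rfl)
  have down : ∀ d, a + d ≤ x → x - d ∈ X := by
    intro d
    induction d with
    | zero => intro _; exact hx
    | succ d ih =>
      intro hd
      exact hX _ (ih (by omega)) _ (hab _ (by omega) (by omega)) (Or.inr (Or.inl (by omega)))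
  intro y h1 h2
  rcases le_total x y with h | h
  · have := up (y - x) (by omega)
    rwa [Nat.add_sub_cancel' h] at this
  · have := down (x - y) (by omega)
    rwa [Nat.sub_sub_self h] at this

theorem gapConnected_of_isBracket {n : ℕ} {A : Finset ℕ} (h : Kind.module.IsBracket n A) :
    GapConnected n A := by
  rcases h with ⟨i, j, hij, hj, rfl⟩ | ⟨-, i, j, hij, hj, rfl⟩
  · have hj' : j < n := hj
    refine ⟨⟨i, by simp [hij]⟩, fun x hx => by simp at hx; omega, ?_⟩
    rintro X hX ⟨x, hx⟩ hc
    refine Finset.Subset.antisymm hX fun y hy => ?_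
    have h1 := Finset.mem_Icc.mp (hX hx)
    have h2 := Finset.mem_Icc.mp hy
    exact Icc_subset_of_closed hc (fun y h3 h4 => Finset.mem_Icc.mpr ⟨h3, h4⟩) hx h1.1 h1.2 y h2.1 h2.2
  · refine ⟨⟨0, by simp⟩, fun x hx => by simp at hx; omega, ?_⟩
    rintro X hX ⟨x, hx⟩ hc
    have m1 : ∀ y, y ∈ Finset.range (i + 1) ∪ Finset.Ico j n ↔ (y ≤ i ∨ (j ≤ y ∧ y < n)) := by
      intro y; simp
    have lowA : ∀ y, 0 ≤ y → y ≤ i → y ∈ Finset.range (i + 1) ∪ Finset.Ico j n :=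
      fun y _ h => (m1 y).mpr (Or.inl h)
    have highA : ∀ y, j ≤ y → y ≤ n - 1 → y ∈ Finset.range (i + 1) ∪ Finset.Ico j n :=
      fun y h h' => (m1 y).mpr (Or.inr ⟨h, by omega⟩)
    have key : (0 ∈ X) ∧ (n - 1 ∈ X) := by
      rcases (m1 x).mp (hX hx) with h | h
      · have h0 := Icc_subset_of_closed hc lowA hx (Nat.zero_le _) h 0 le_rfl (Nat.zero_le _)
        exact ⟨h0, hc _ h0 _ (highA _ (by omega) le_rfl) (Or.inr (Or.inr (Or.inl ⟨rfl, by omega⟩)))⟩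
      · have h0 := Icc_subset_of_closed hc highA hx h.1 (by omega) (n - 1) (by omega) le_rfl
        exact ⟨hc _ h0 _ (lowA _ le_rfl (Nat.zero_le _)) (Or.inr (Or.inr (Or.inr ⟨rfl, by omega⟩))), h0⟩
    refine Finset.Subset.antisymm hX fun y hy => ?_
    rcases (m1 y).mp hy with h | h
    · exact Icc_subset_of_closed hc lowA key.1 le_rfl (Nat.zero_le _) y (Nat.zero_le _) h
    · exact Icc_subset_of_closed hc highA key.2 (by omega) le_rfl y h.1 (by omega)

/-- A connected set of gaps is an interval, or the complement of one if it contains the first and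
the last gap. -/
theorem isBracket_of_gapConnected {n : ℕ} {A : Finset ℕ} (h : GapConnected n A) :
    Kind.module.IsBracket n A := by
  obtain ⟨hne, hlt, hc⟩ := h
  have hn : 0 < n := by obtain ⟨x, hx⟩ := hne; have := hlt x hx; omega
  by_cases hwrap : 0 ∈ A ∧ n - 1 ∈ A
  -- `A` is everything below the first and above the last gap outside `A`, since this part of `A` is
  -- closed under neighbours.
  · by_cases hfull : (Finset.range n \ A).Nonempty
    · set C := Finset.range n \ A with hC
      have hmin := C.min'_mem hfull
      have hmax := C.max'_mem hfull
      have hle : C.min' hfull ≤ C.max' hfull := C.min'_le _ hmax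
      set a := C.min' hfull
      set b := C.max' hfull
      rw [hC, Finset.mem_sdiff, Finset.mem_range] at hmin hmax
      have ha : a ≠ 0 := fun h => hmin.2 (h ▸ hwrap.1)
      have hb : b ≠ n - 1 := fun h => hmax.2 (h ▸ hwrap.2)
      have low : ∀ x, x < a → x ∈ A := by
        intro x hx
        by_contra hxA
        have := C.min'_le x (by rw [hC, Finset.mem_sdiff, Finset.mem_range]; exact ⟨by omega, hxA⟩)
        omega
      have high : ∀ x, b < x → x < n → x ∈ A := by
        intro x hx hxn
        by_contra hxA
        have := C.le_max' x (by rw [hC, Finset.mem_sdiff, Finset.mem_range]; exact ⟨by omega, hxA⟩)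
        omega
      refine Or.inr ⟨rfl, a - 1, b + 1, by omega, by omega, (hc _ ?_ ⟨0, by simp⟩ ?_).symm⟩
      · intro x hx
        simp only [Finset.mem_union, Finset.mem_range, Finset.mem_Ico] at hx
        rcases hx with hx | hx
        · exact low x (by omega)
        · exact high x (by omega) hx.2
      · intro x hx y hy hadj
        have hyn := hlt y hy
        have h1 : y ≠ a := fun h => hmin.2 (h ▸ hy)
        have h2 : y ≠ b := fun h => hmax.2 (h ▸ hy)
        simp only [Finset.mem_union, Finset.mem_range, Finset.mem_Ico] at hx ⊢
        unfold GapAdj at hadj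
        omega
    · refine Or.inl ⟨0, n - 1, Nat.zero_le _, by show n - 1 < n; omega, ?_⟩
      ext x
      rw [Finset.not_nonempty_iff_eq_empty, Finset.sdiff_eq_empty_iff_subset] at hfull
      constructor
      · intro hx; have := hlt x hx; simp; omega
      · intro hx; apply hfull; simp at hx ⊢; omega
  -- `A` is the longest interval in `A` that starts with its least element.
  · set a := A.min' hne with ha
    have haA : a ∈ A := A.min'_mem hne
    have hamin : ∀ x ∈ A, a ≤ x := fun x hx => A.min'_le x hx
    have hex : ∃ d, a + d ∉ A := ⟨n, fun h => by have := hlt _ h; omega⟩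
    classical
    set d := Nat.find hex with hd
    have hdn : a + d ∉ A := Nat.find_spec hex
    have hdm : ∀ e, e < d → a + e ∈ A := fun e he => by
      have := Nat.find_min hex he; simpa using this
    have hd0 : d ≠ 0 := fun h => hdn (by rw [h]; exact haA)
    have hlast := hlt _ (hdm (d - 1) (by omega))
    refine Or.inl ⟨a, a + d - 1, by omega, by show a + d - 1 < n; omega, (hc _ ?_ ⟨a, by simp; omega⟩ ?_).symm⟩
    · intro x hx
      rw [Finset.mem_Icc] at hx
      have := hdm (x - a) (by omega)
      rwa [Nat.add_sub_cancel' hx.1] at this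
    · intro x hx y hy hadj
      have h1 := hamin y hy
      have h2 : y ≠ a + d := fun h => hdn (h ▸ hy)
      have hyn := hlt y hy
      have hw : ¬ (a = 0 ∧ a + d - 1 = n - 1) := by
        rintro ⟨h3, h4⟩
        refine hwrap ⟨h3 ▸ haA, ?_⟩
        have := hdm (d - 1) (by omega)
        rwa [← h4, Nat.add_sub_assoc (by omega)]
      have hw2 : ¬ (a = 0 ∧ y = n - 1) := by
        rintro ⟨h3, h4⟩
        exact hwrap ⟨h3 ▸ haA, h4 ▸ hy⟩
      rw [Finset.mem_Icc] at hx ⊢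
      unfold GapAdj at hadj
      omega

theorem isBracket_module_iff {n : ℕ} {A : Finset ℕ} :
    Kind.module.IsBracket n A ↔ GapConnected n A :=
  ⟨gapConnected_of_isBracket, isBracket_of_gapConnected⟩

theorem isBracket_operad_iff {n : ℕ} {A : Finset ℕ} :
    Kind.operad.IsBracket n A ↔ Kind.module.IsBracket n A ∧ n - 1 ∉ A := by
  constructor
  · rintro (⟨i, j, hij, hj, rfl⟩ | ⟨h, -⟩)
    · have hj' : j < n - 1 := hj
      exact ⟨Or.inl ⟨i, j, hij, by show j < n; omega, rfl⟩, by simp; omega⟩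
    · cases h
  · rintro ⟨⟨i, j, hij, hj, rfl⟩ | ⟨-, i, j, hij, hj, rfl⟩, hn⟩
    · have hj' : j < n := hj
      exact Or.inl ⟨i, j, hij, by show j < n - 1; simp at hn; omega, rfl⟩
    · simp at hn; omega

/-- Brackets of both kinds: connected sets of gaps of the cyclic word, which do not contain the
gap between the last and the first letter if the word is linear. -/
theorem isBracket_iff {b : Kind} {n : ℕ} {A : Finset ℕ} :
    b.IsBracket n A ↔ GapConnected n A ∧ (b = .operad → n - 1 ∉ A) := by
  cases b
  · simp [isBracket_operad_iff, isBracket_module_iff]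
  · simp [isBracket_module_iff]

theorem Kind.IsBracket.conn {b : Kind} {n : ℕ} {A : Finset ℕ} (h : b.IsBracket n A) :
    GapConnected n A := (isBracket_iff.mp h).1

theorem Kind.IsBracket.nonempty {b : Kind} {n : ℕ} {A : Finset ℕ} (h : b.IsBracket n A) :
    A.Nonempty := h.conn.1

theorem Kind.IsBracket.lt {b : Kind} {n : ℕ} {A : Finset ℕ} (h : b.IsBracket n A) {x : ℕ}
    (hx : x ∈ A) : x < b.gaps n := by
  have h1 := h.conn.2.1 x hx
  cases b
  · have h2 := (isBracket_iff.mp h).2 rfl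
    have : x ≠ n - 1 := fun h => h2 (h ▸ hx)
    show x < n - 1
    omega
  · exact h1

theorem Kind.IsBracket.subset_range {b : Kind} {n : ℕ} {A : Finset ℕ} (h : b.IsBracket n A) :
    A ⊆ Finset.range (b.gaps n) := fun _ hx => Finset.mem_range.mpr (h.lt hx)

theorem isBracket_range {b : Kind} {n : ℕ} (h : 0 < b.gaps n) :
    b.IsBracket n (Finset.range (b.gaps n)) :=
  Or.inl ⟨0, b.gaps n - 1, Nat.zero_le _, by omega, by ext; simp; omega⟩

theorem isBracket_singleton {b : Kind} {n x : ℕ} (h : x < b.gaps n) : b.IsBracket n {x} :=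
  Or.inl ⟨x, x, le_rfl, h, by simp⟩

theorem isBracket_Ico {b : Kind} {n x y : ℕ} (hxy : x < y) (h : y ≤ b.gaps n) :
    b.IsBracket n (Finset.Ico x y) :=
  Or.inl ⟨x, y - 1, by omega, by omega, by ext; simp; omega⟩

/-- The union of two connected sets that meet or touch is connected. -/
theorem GapConnected.union {n : ℕ} {A B : Finset ℕ} (hA : GapConnected n A) (hB : GapConnected n B)
    (h : ∃ x ∈ A, ∃ y ∈ B, x = y ∨ GapAdj n x y) : GapConnected n (A ∪ B) := by
  obtain ⟨x, hx, y, hy, hxy⟩ := h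
  refine ⟨hA.1.mono Finset.subset_union_left, ?_, ?_⟩
  · intro z hz
    rcases Finset.mem_union.mp hz with hz | hz
    exacts [hA.2.1 z hz, hB.2.1 z hz]
  · intro X hX hne hc
    -- A closed part of the union that meets one of the two sets contains it.
    have kA : (∃ z ∈ X, z ∈ A) → A ⊆ X := by
      rintro ⟨z, hz, hzA⟩
      have := hA.2.2 (X ∩ A) Finset.inter_subset_right ⟨z, Finset.mem_inter.mpr ⟨hz, hzA⟩⟩
        (fun u hu v hv huv => Finset.mem_inter.mpr ⟨hc u (Finset.mem_inter.mp hu).1 v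
          (Finset.mem_union_left _ hv) huv, hv⟩)
      rw [← this]; exact Finset.inter_subset_left
    have kB : (∃ z ∈ X, z ∈ B) → B ⊆ X := by
      rintro ⟨z, hz, hzA⟩
      have := hB.2.2 (X ∩ B) Finset.inter_subset_right ⟨z, Finset.mem_inter.mpr ⟨hz, hzA⟩⟩
        (fun u hu v hv huv => Finset.mem_inter.mpr ⟨hc u (Finset.mem_inter.mp hu).1 v
          (Finset.mem_union_right _ hv) huv, hv⟩)
      rw [← this]; exact Finset.inter_subset_left
    -- Through the neighbours `x` and `y` it passes from one set to the other.
    have hAB : A ⊆ X ↔ B ⊆ X := by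
      constructor
      · intro h
        refine kB ⟨y, ?_, hy⟩
        rcases hxy with rfl | hxy
        · exact h hx
        · exact hc x (h hx) y (Finset.mem_union_right _ hy) hxy
      · intro h
        refine kA ⟨x, ?_, hx⟩
        rcases hxy with rfl | hxy
        · exact h hy
        · exact hc y (h hy) x (Finset.mem_union_left _ hx) hxy.symm
    obtain ⟨z, hz⟩ := hne
    refine Finset.Subset.antisymm hX ?_
    rcases Finset.mem_union.mp (hX hz) with h | h
    · exact Finset.union_subset (kA ⟨z, hz, h⟩) (hAB.mp (kA ⟨z, hz, h⟩))
    · exact Finset.union_subset (hAB.mpr (kB ⟨z, hz, h⟩)) (kB ⟨z, hz, h⟩)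

/-- A connected set that meets `S` without lying in it crosses the border of `S` between two
neighbours. -/
theorem GapConnected.exists_adj {n : ℕ} {J : Finset ℕ} (hJ : GapConnected n J) (S : Finset ℕ)
    (h1 : ∃ x ∈ J, x ∈ S) (h2 : ¬ J ⊆ S) : ∃ x ∈ J, x ∈ S ∧ ∃ y ∈ J, y ∉ S ∧ GapAdj n x y := by
  by_contra hno
  push Not at hno
  obtain ⟨x, hx, hxS⟩ := h1
  have := hJ.2.2 (J ∩ S) Finset.inter_subset_left ⟨x, Finset.mem_inter.mpr ⟨hx, hxS⟩⟩
    (fun u hu v hv huv => by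
      rw [Finset.mem_inter] at hu ⊢
      exact ⟨hv, by by_contra hvS; exact hno u hu.1 hu.2 v hv hvS huv⟩)
  exact h2 (this ▸ Finset.inter_subset_right)

theorem Kind.IsBracket.union {b : Kind} {n : ℕ} {A B : Finset ℕ} (hA : b.IsBracket n A)
    (hB : b.IsBracket n B) (h : ∃ x ∈ A, ∃ y ∈ B, x = y ∨ GapAdj n x y) :
    b.IsBracket n (A ∪ B) := by
  rw [isBracket_iff] at *
  refine ⟨hA.1.union hB.1 h, fun hb hn => ?_⟩
  rcases Finset.mem_union.mp hn with hn | hn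
  exacts [hA.2 hb hn, hB.2 hb hn]

/-- Two brackets cannot occur in one bracketing: none contains the other, and they overlap or
are adjacent. -/
def Kind.Incompat (b : Kind) (n : ℕ) (A B : Finset ℕ) : Prop :=
  ¬ A ⊆ B ∧ ¬ B ⊆ A ∧ b.IsBracket n (A ∪ B)

theorem Kind.Incompat.symm {b : Kind} {n : ℕ} {A B : Finset ℕ} (h : b.Incompat n A B) :
    b.Incompat n B A := ⟨h.2.1, h.1, by rw [Finset.union_comm]; exact h.2.2⟩

/-- A bracket that is covered by some pairwise compatible brackets lies in one of them. -/
theorem exists_subset_of_subset_sup {b : Kind} {n : ℕ} {J : Finset ℕ} (hJ : b.IsBracket n J)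
    (F : Finset (Finset ℕ)) (hF : ∀ A ∈ F, b.IsBracket n A)
    (hFF : ∀ A ∈ F, ∀ B ∈ F, ¬ b.Incompat n A B) (hcov : ∀ x ∈ J, ∃ A ∈ F, x ∈ A) :
    ∃ A ∈ F, J ⊆ A := by
  classical
  obtain ⟨x₀, hx₀⟩ := hJ.nonempty
  obtain ⟨A₀, hA₀, hxA₀⟩ := hcov x₀ hx₀
  -- A largest member `S` that meets `J` contains `J`: otherwise `J` leaves `S` at some gap, and the
  -- member covering that gap would be incompatible with `S`.
  obtain ⟨S, hS, hmax⟩ := (F.filter fun A => ∃ x ∈ J, x ∈ A).exists_max_image Finset.card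
    ⟨A₀, Finset.mem_filter.mpr ⟨hA₀, x₀, hx₀, hxA₀⟩⟩
  rw [Finset.mem_filter] at hS
  by_contra hno
  push Not at hno
  obtain ⟨x, hxJ, hxS, y, hyJ, hyS, hxy⟩ := hJ.conn.exists_adj S hS.2 (hno S hS.1)
  obtain ⟨T, hT, hyT⟩ := hcov y hyJ
  refine hFF S hS.1 T hT ⟨fun hST => ?_, fun hTS => hyS (hTS hyT),
    (hF S hS.1).union (hF T hT) ⟨x, hxS, y, hyT, Or.inr hxy⟩⟩
  have h1 := hmax T (Finset.mem_filter.mpr ⟨hT, y, hyJ, hyT⟩)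
  exact hyS (Finset.eq_of_subset_of_card_le hST h1 ▸ hyT)

/-! ### Inserting a word in place of a letter -/

/-- The gap before the letter `j` of a cyclic word of `m` letters touches, with the gap `j`
after it, the letter `j`. -/
theorem touches_iff {b : Kind} {m j : ℕ} {A : Finset ℕ} (hj : j < m)
    (hA : ∀ x ∈ A, x < b.gaps m) :
    b.Touches m j A ↔ j ∈ A ∨ (if j = 0 then m - 1 else j - 1) ∈ A := by
  cases b
  · have hA' : ∀ x ∈ A, x < m - 1 := hA
    simp only [Kind.Touches]
    refine or_congr Iff.rfl ?_
    split_ifs with h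
    · subst h
      simp only [Nat.add_one_ne_zero, and_false, exists_false, false_iff]
      intro hm
      have := hA' _ hm
      omega
    · constructor
      · rintro ⟨x, hx, rfl⟩; exact hx
      · intro hx; exact ⟨_, hx, by omega⟩
  · simp only [Kind.Touches]
    refine or_congr Iff.rfl ?_
    split_ifs with h
    · subst h
      rw [Nat.zero_add, Nat.mod_eq_of_lt (by omega)]
    · have : (j + m - 1) % m = j - 1 := by
        rw [show j + m - 1 = (j - 1) + m by omega, Nat.add_mod_right, Nat.mod_eq_of_lt (by omega)]
      rw [this]

/-- The gaps of the old word keep their places relative to the letter `j`; the `h` gaps of the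
inserted word are added if the bracket contains a gap next to this letter. -/
theorem mem_inflate {b : Kind} {m j h : ℕ} {A : Finset ℕ} (hj : j < m)
    (hA : ∀ x ∈ A, x < b.gaps m) (x : ℕ) :
    x ∈ b.inflate m j h A ↔ (x < j ∧ x ∈ A) ∨
      (j ≤ x ∧ x < j + h ∧ (j ∈ A ∨ (if j = 0 then m - 1 else j - 1) ∈ A)) ∨
      (j + h ≤ x ∧ x - h ∈ A) := by
  classical
  unfold Kind.inflate
  rw [Finset.mem_union, Finset.mem_image]
  have h2 : x ∈ (open Classical in if b.Touches m j A then Finset.Ico j (j + h) else ∅) ↔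
      (j ≤ x ∧ x < j + h ∧ (j ∈ A ∨ (if j = 0 then m - 1 else j - 1) ∈ A)) := by
    rw [← touches_iff hj hA]
    split_ifs with ht
    · simp [ht]
    · simp [ht]
  rw [h2]
  constructor
  · rintro (⟨y, hy, rfl⟩ | h3)
    · by_cases hyj : y < j
      · rw [if_pos hyj]
        exact Or.inl ⟨hyj, hy⟩
      · rw [if_neg hyj]
        exact Or.inr (Or.inr ⟨by omega, by rwa [Nat.add_sub_cancel]⟩)
    · exact Or.inr (Or.inl h3)
  · rintro (⟨h3, h4⟩ | h3 | ⟨h3, h4⟩)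
    · exact Or.inl ⟨x, h4, if_pos h3⟩
    · exact Or.inr h3
    · exact Or.inl ⟨x - h, h4, by rw [if_neg (by omega)]; omega⟩

theorem gaps_le {b : Kind} {n : ℕ} : b.gaps n ≤ n := by
  cases b
  · exact Nat.sub_le n 1
  · exact le_rfl

/-- For brackets of linear words, the rule of cyclic words gives the same result. -/
theorem inflate_eq_module {b : Kind} {m j h : ℕ} {A : Finset ℕ} (hj : j < m)
    (hA : ∀ x ∈ A, x < b.gaps m) : b.inflate m j h A = Kind.module.inflate m j h A := by
  ext x
  rw [mem_inflate hj hA, mem_inflate (b := .module) hj fun x hx => (hA x hx).trans_le gaps_le]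

theorem gaps_add {b : Kind} {m : ℕ} (h : ℕ) (hm : 1 ≤ m) : b.gaps (m + h) = b.gaps m + h := by
  cases b
  · show m + h - 1 = m - 1 + h
    omega
  · rfl

theorem le_gaps {b : Kind} {n : ℕ} : n - 1 ≤ b.gaps n := by
  cases b
  · exact le_rfl
  · exact Nat.sub_le n 1

section Inflate

variable {b : Kind} {m j h : ℕ} {A B : Finset ℕ}

theorem mem_inflate_shift (hj : j < m) (hA : ∀ x ∈ A, x < b.gaps m) (x : ℕ) :
    (if x < j then x else x + h) ∈ b.inflate m j h A ↔ x ∈ A := by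
  rw [mem_inflate hj hA]
  by_cases hx : x < j
  · rw [if_pos hx]
    constructor
    · rintro (h1 | h1 | h1)
      · exact h1.2
      · omega
      · omega
    · exact fun h1 => Or.inl ⟨hx, h1⟩
  · rw [if_neg hx]
    constructor
    · rintro (h1 | h1 | h1)
      · omega
      · omega
      · rw [Nat.add_sub_cancel] at h1; exact h1.2
    · exact fun h1 => Or.inr (Or.inr ⟨by omega, by rwa [Nat.add_sub_cancel]⟩)

theorem inflate_lt (hj : j < m) (hA : ∀ x ∈ A, x < b.gaps m) :
    ∀ x ∈ b.inflate m j h A, x < b.gaps (m + h) := by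
  intro x hx
  rw [gaps_add h (by omega)]
  rcases (mem_inflate hj hA x).mp hx with h1 | h1 | h1
  · have := hA x h1.2; omega
  · obtain ⟨h2, h3, h4⟩ := h1
    rcases h4 with h4 | h4
    · have := hA _ h4; omega
    · have := hA _ h4
      have h5 : m - 1 ≤ b.gaps m := le_gaps
      split_ifs at this with h0 <;> omega
  · have := hA _ h1.2; omega

theorem inflate_subset_iff (hj : j < m) (hA : ∀ x ∈ A, x < b.gaps m) (hB : ∀ x ∈ B, x < b.gaps m) :
    b.inflate m j h A ⊆ b.inflate m j h B ↔ A ⊆ B := by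
  constructor
  · intro hs x hx
    exact (mem_inflate_shift hj hB x).mp (hs ((mem_inflate_shift (h := h) hj hA x).mpr hx))
  · intro hs x hx
    rw [mem_inflate hj hA] at hx
    rw [mem_inflate hj hB]
    exact hx.imp (And.imp_right (@hs _))
      (Or.imp (And.imp_right (And.imp_right (Or.imp (@hs _) (@hs _)))) (And.imp_right (@hs _)))

theorem inflate_inj (hj : j < m) (hA : ∀ x ∈ A, x < b.gaps m) (hB : ∀ x ∈ B, x < b.gaps m)
    (hAB : b.inflate m j h A = b.inflate m j h B) : A = B :=
  Finset.Subset.antisymm ((inflate_subset_iff hj hA hB).mp hAB.subset)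
    ((inflate_subset_iff hj hB hA).mp hAB.superset)

theorem inflate_union (hj : j < m) (hA : ∀ x ∈ A, x < b.gaps m) (hB : ∀ x ∈ B, x < b.gaps m) :
    b.inflate m j h (A ∪ B) = b.inflate m j h A ∪ b.inflate m j h B := by
  ext x
  rw [Finset.mem_union, mem_inflate hj hA, mem_inflate hj hB, mem_inflate hj fun x hx =>
    (Finset.mem_union.mp hx).elim (hA x) (hB x)]
  simp only [Finset.mem_union]
  tauto

theorem inflate_range (hj : j < m) (hg : 0 < b.gaps m) :
    b.inflate m j h (Finset.range (b.gaps m)) = Finset.range (b.gaps (m + h)) := by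
  ext x
  have h5 : m - 1 ≤ b.gaps m := le_gaps
  have h6 : b.gaps m ≤ m := gaps_le
  rw [mem_inflate hj (fun x hx => Finset.mem_range.mp hx), gaps_add h (by omega)]
  simp only [Finset.mem_range]
  split_ifs <;> omega

/-- Replacing a letter by a word does not change the connectedness of a set of gaps. -/
theorem inflate_conn_iff (hj : j < m) (hne : A.Nonempty) (hA : ∀ x ∈ A, x < m) :
    GapConnected (m + h) (Kind.module.inflate m j h A) ↔ GapConnected m A := by
  have hm := fun {C : Finset ℕ} (hC : ∀ x ∈ C, x < m) => mem_inflate (b := .module) (h := h) hj hC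
  have hs := fun {C : Finset ℕ} (hC : ∀ x ∈ C, x < m) =>
    mem_inflate_shift (b := .module) (h := h) hj hC
  constructor
  · rintro ⟨-, -, hc⟩
    -- A closed part `X` of `A` gives the closed part `inflate X` of `inflate A`.
    refine ⟨hne, hA, fun X hX hXne hXc => ?_⟩
    have hX' : ∀ x ∈ X, x < m := fun x hx => hA x (hX hx)
    refine inflate_inj (b := .module) (h := h) hj hX' hA
      (hc _ ((inflate_subset_iff (b := .module) hj hX' hA).mpr hX) ?_ ?_)
    · obtain ⟨x, hx⟩ := hXne
      exact ⟨_, (hs hX' x).mpr hx⟩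
    · have hcl := fun x hx y hy hxy => hXc x hx y hy hxy
      intro y hy z hz hyz
      have close : ∀ u v, u ∈ X → v ∈ A → GapAdj m u v → v ∈ X := fun u v hu hv => hXc u hu v hv
      have jp : j ≠ (if j = 0 then m - 1 else j - 1) →
          GapAdj m j (if j = 0 then m - 1 else j - 1) := by
        intro h0; unfold GapAdj; split_ifs at h0 ⊢ <;> omega
      rw [hm hA] at hz
      have hjp : j ∈ A → (if j = 0 then m - 1 else j - 1) ∈ A →
          (j ∈ X ↔ (if j = 0 then m - 1 else j - 1) ∈ X) := by
        intro h1 h2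
        by_cases h0 : j = (if j = 0 then m - 1 else j - 1)
        · rw [← h0]
        · exact ⟨fun h3 => hXc _ h3 _ h2 (jp h0), fun h3 => hXc _ h3 _ h1 (jp h0).symm⟩
      rw [hm hX'] at hy ⊢
      rcases hz with hz | hz | hz
      · refine Or.inl ⟨hz.1, ?_⟩
        rcases hy with hy | hy | hy
        · refine hXc _ hy.2 _ hz.2 ?_
          unfold GapAdj at *; omega
        · have hz1 : z = (if j = 0 then m - 1 else j - 1) := by
            unfold GapAdj at *; split_ifs <;> omega
          rw [hz1] at hz ⊢
          exact hy.2.2.elim (fun h1 => (hjp (hX h1) hz.2).mp h1) id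
        · refine hXc _ hy.2 _ hz.2 ?_
          have := hX' _ hy.2
          unfold GapAdj at *; omega
      · refine Or.inr (Or.inl ⟨hz.1, hz.2.1, ?_⟩)
        rcases hy with hy | hy | hy
        · right
          convert hy.2 using 1
          have := hX' _ hy.2
          unfold GapAdj at *; split_ifs <;> omega
        · exact hy.2.2
        · have h1 := hX' _ hy.2
          by_cases h3 : y - h = j
          · left; rw [← h3]; exact hy.2
          · right
            convert hy.2 using 1
            unfold GapAdj at *; split_ifs <;> omega
      · refine Or.inr (Or.inr ⟨hz.1, ?_⟩)
        have h1 := hA _ hz.2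
        rcases hy with hy | hy | hy
        · refine hXc _ hy.2 _ hz.2 ?_
          unfold GapAdj at *; omega
        · by_cases h3 : z - h = j
          · rw [h3] at hz ⊢
            exact hy.2.2.elim id (fun h4 => (hjp hz.2 (hX h4)).mpr h4)
          · have hz1 : z - h = (if j = 0 then m - 1 else j - 1) := by
              unfold GapAdj at *; split_ifs <;> omega
            rw [hz1] at hz ⊢
            exact hy.2.2.elim (fun h1 => (hjp (hX h1) hz.2).mp h1) id
        · refine hXc _ hy.2 _ hz.2 ?_
          have := hX' _ hy.2
          unfold GapAdj at *; omega
  · rintro ⟨-, -, hc⟩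
    have hr := inflate_lt (b := .module) (h := h) hj hA
    refine ⟨hne.elim fun x hx => ⟨_, (hs hA x).mpr hx⟩, hr, fun Y hY hYne hYc => ?_⟩
    -- A closed part `Y` that meets the inserted block contains all of it, together with the gaps of
    -- `inflate A` on both sides of it.
    have block : ∀ z, j ≤ z → z < j + h → z ∈ Y →
        (∀ y, j ≤ y → y < j + h → y ∈ Y) ∧ (j ∈ A → j + h ∈ Y) ∧
        ((if j = 0 then m - 1 else j - 1) ∈ A → (if j = 0 then m - 1 + h else j - 1) ∈ Y) := by
      intro z hz1 hz2 hz
      have hT := (hm hA z).mp (hY hz)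
      have hT' : j ∈ A ∨ (if j = 0 then m - 1 else j - 1) ∈ A := by
        rcases hT with h1 | h1 | h1
        · omega
        · exact h1.2.2
        · omega
      have hB : ∀ y, j ≤ y → y ≤ j + h - 1 → y ∈ Y :=
        Icc_subset_of_closed hYc (fun y h1 h2 => (hm hA y).mpr (Or.inr (Or.inl ⟨h1, by omega, hT'⟩)))
          hz hz1 (by omega)
      refine ⟨fun y h1 h2 => hB y h1 (by omega), fun h1 => ?_, fun h1 => ?_⟩
      · refine hYc _ (hB (j + h - 1) (by omega) le_rfl) _ ?_ (Or.inl (by omega))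
        have := (hs hA j).mpr h1
        rwa [if_neg (lt_irrefl j)] at this
      · refine hYc _ (hB j le_rfl (by omega)) _ ?_ (by unfold GapAdj; split_ifs <;> omega)
        have := (hs hA _).mpr h1
        split_ifs at this ⊢ <;> first | exact this | omega
    -- It meets the block if it contains a gap of `inflate A` on one of the two sides.
    have enter : ∀ x ∈ A, (if x < j then x else x + h) ∈ Y → 0 < h →
        (x = j ∨ x = (if j = 0 then m - 1 else j - 1)) → ∃ z, j ≤ z ∧ z < j + h ∧ z ∈ Y := by
      intro x hx hxY h0 hxj
      by_cases h1 : x = j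
      · refine ⟨j + h - 1, by omega, by omega, hYc _ hxY _ ((hm hA _).mpr (Or.inr (Or.inl
          ⟨by omega, by omega, Or.inl (h1 ▸ hx)⟩))) ?_⟩
        rw [if_neg (by omega)]; unfold GapAdj; omega
      · have h2 := hxj.resolve_left h1
        refine ⟨j, le_rfl, by omega, hYc _ hxY _ ((hm hA _).mpr (Or.inr (Or.inl
          ⟨by omega, by omega, Or.inr (h2 ▸ hx)⟩))) ?_⟩
        have := hA x hx
        unfold GapAdj; split_ifs at h2 ⊢ <;> omega
    -- The gaps of `A` whose images lie in `Y` therefore form a closed part of `A`.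
    have main := hc (A.filter fun x => (if x < j then x else x + h) ∈ Y) (Finset.filter_subset _ _) ?_ ?_
    · refine Finset.Subset.antisymm hY fun z hz => ?_
      have main' : ∀ x ∈ A, (if x < j then x else x + h) ∈ Y := fun x hx => by
        rw [← main] at hx; exact (Finset.mem_filter.mp hx).2
      rcases (hm hA z).mp hz with h1 | h1 | h1
      · have := main' z h1.2; rwa [if_pos h1.1] at this
      · obtain ⟨w, hw1, hw2, hw⟩ : ∃ z, j ≤ z ∧ z < j + h ∧ z ∈ Y := by
          rcases h1.2.2 with h3 | h3
          · exact enter _ h3 (main' _ h3) (by omega) (Or.inl rfl)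
          · exact enter _ h3 (main' _ h3) (by omega) (Or.inr rfl)
        exact (block w hw1 hw2 hw).1 z h1.1 h1.2.1
      · have := main' _ h1.2
        rwa [if_neg (by omega), Nat.sub_add_cancel (by omega)] at this
    · obtain ⟨z, hz⟩ := hYne
      rcases (hm hA z).mp (hY hz) with h1 | h1 | h1
      · exact ⟨z, Finset.mem_filter.mpr ⟨h1.2, by rwa [if_pos h1.1]⟩⟩
      · have hb := block z h1.1 h1.2.1 hz
        rcases h1.2.2 with h3 | h3
        · exact ⟨j, Finset.mem_filter.mpr ⟨h3, by rw [if_neg (lt_irrefl j)]; exact hb.2.1 h3⟩⟩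
        · refine ⟨_, Finset.mem_filter.mpr ⟨h3, ?_⟩⟩
          have := hb.2.2 h3
          split_ifs at this ⊢ <;> first | exact this | omega
      · exact ⟨z - h, Finset.mem_filter.mpr
          ⟨h1.2, by rwa [if_neg (by omega), Nat.sub_add_cancel (by omega)]⟩⟩
    · intro x hx y hy hxy
      rw [Finset.mem_filter] at hx ⊢
      refine ⟨hy, ?_⟩
      have hxm := hA x hx.1
      have hym := hA y hy
      by_cases hadj : GapAdj (m + h) (if x < j then x else x + h) (if y < j then y else y + h)
      · exact hYc _ hx.2 _ ((hs hA y).mpr hy) hadj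
      · have hh : 0 < h := by
          by_contra h0
          obtain rfl : h = 0 := by omega
          apply hadj
          split_ifs <;> exact hxy
        have hxj : (x = j ∨ x = (if j = 0 then m - 1 else j - 1)) ∧
            (y = j ∨ y = (if j = 0 then m - 1 else j - 1)) := by
          unfold GapAdj at *; split_ifs at * <;> omega
        obtain ⟨z, hz1, hz2, hz⟩ := enter x hx.1 hx.2 hh hxj.1
        have hb := (block z hz1 hz2 hz).2
        by_cases h1 : y = j
        · subst h1
          rw [if_neg (lt_irrefl _)]; exact hb.1 hy
        · have h2 := hxj.2.resolve_left h1
          have := hb.2 (h2 ▸ hy)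
          convert this using 1
          split_ifs at h2 ⊢ <;> omega

theorem inflate_isBracket_iff (hj : j < m) (hne : A.Nonempty) (hA : ∀ x ∈ A, x < b.gaps m) :
    b.IsBracket (m + h) (b.inflate m j h A) ↔ b.IsBracket m A := by
  have hA' : ∀ x ∈ A, x < m := fun x hx => (hA x hx).trans_le gaps_le
  rw [isBracket_iff, isBracket_iff, inflate_eq_module hj hA, inflate_conn_iff hj hne hA']
  refine and_congr Iff.rfl (imp_congr Iff.rfl (not_congr ?_))
  rw [← mem_inflate_shift (b := .module) (h := h) hj hA' (m - 1)]
  rw [if_neg (by omega), show m - 1 + h = m + h - 1 by omega]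

theorem inflate_incompat_iff (hj : j < m) (hA : b.IsBracket m A) (hB : b.IsBracket m B) :
    b.Incompat (m + h) (b.inflate m j h A) (b.inflate m j h B) ↔ b.Incompat m A B := by
  have hA' := fun x => hA.lt (x := x)
  have hB' := fun x => hB.lt (x := x)
  unfold Kind.Incompat
  rw [inflate_subset_iff hj hA' hB', inflate_subset_iff hj hB' hA', ← inflate_union hj hA' hB',
    inflate_isBracket_iff hj (hA.nonempty.mono Finset.subset_union_left)
      (fun x hx => (Finset.mem_union.mp hx).elim (hA' x) (hB' x))]

end Inflate

/-- The bracket with the set `A` of gaps in a word that is inserted in place of the `j`-th letter. -/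
abbrev shift (j : ℕ) (A : Finset ℕ) : Finset ℕ := A.image (j + ·)

theorem mem_shift {j : ℕ} {A : Finset ℕ} {x : ℕ} : x ∈ shift j A ↔ j ≤ x ∧ x - j ∈ A := by
  rw [Finset.mem_image]
  constructor
  · rintro ⟨y, hy, rfl⟩
    exact ⟨Nat.le_add_right _ _, by rwa [Nat.add_sub_cancel_left]⟩
  · rintro ⟨h1, h2⟩
    exact ⟨x - j, h2, Nat.add_sub_cancel' h1⟩

theorem shift_zero (A : Finset ℕ) : shift 0 A = A := by
  ext x; simp

theorem shift_shift (i j : ℕ) (A : Finset ℕ) : shift i (shift j A) = shift (i + j) A := by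
  ext x
  simp only [mem_shift, Nat.sub_sub]
  constructor
  · rintro ⟨h1, h2, h3⟩; exact ⟨by omega, h3⟩
  · rintro ⟨h1, h2⟩; exact ⟨by omega, by omega, h2⟩

theorem shift_subset_iff {j : ℕ} {A B : Finset ℕ} : shift j A ⊆ shift j B ↔ A ⊆ B :=
  Finset.image_subset_image_iff (add_right_injective j)

theorem shift_inj {j : ℕ} {A B : Finset ℕ} (h : shift j A = shift j B) : A = B :=
  Finset.image_injective (add_right_injective j) h

theorem shift_range (j h : ℕ) : shift j (Finset.range h) = Finset.Ico j (j + h) := by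
  ext x; rw [mem_shift, Finset.mem_range, Finset.mem_Ico]; omega

section Insert

variable {b : Kind} {m j h : ℕ}

theorem Kind.IsBracket.shift (hj : j < m) {A : Finset ℕ} (hA : Kind.operad.IsBracket (h + 1) A) :
    b.IsBracket (m + h) (shift j A) := by
  rcases hA with ⟨u, v, huv, hv, rfl⟩ | ⟨h0, -⟩
  · have hv' : v < h := hv
    refine Or.inl ⟨j + u, j + v, by omega, ?_, ?_⟩
    · have : m - 1 ≤ b.gaps m := le_gaps
      rw [gaps_add h (by omega)]; omega
    · ext x; rw [mem_shift, Finset.mem_Icc, Finset.mem_Icc]; omega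
  · cases h0

theorem exists_eq_shift (hj : j < m) {J : Finset ℕ} (hJ : b.IsBracket (m + h) J)
    (hs : J ⊆ Finset.Ico j (j + h)) :
    ∃ A, Kind.operad.IsBracket (h + 1) A ∧ J = shift j A := by
  rcases hJ with ⟨u, v, huv, hv, rfl⟩ | ⟨-, u, v, huv, hv, rfl⟩
  · have h1 := Finset.mem_Ico.mp (hs (Finset.mem_Icc.mpr ⟨le_rfl, huv⟩))
    have h2 := Finset.mem_Ico.mp (hs (Finset.mem_Icc.mpr ⟨huv, le_rfl⟩))
    refine ⟨Finset.Icc (u - j) (v - j), Or.inl ⟨u - j, v - j, by omega, ?_, rfl⟩, ?_⟩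
    · show v - j < h + 1 - 1
      omega
    · ext x; rw [mem_shift, Finset.mem_Icc, Finset.mem_Icc]; omega
  · have h1 := Finset.mem_Ico.mp (hs (show 0 ∈ _ by simp))
    have h2 := Finset.mem_Ico.mp (hs (show m + h - 1 ∈ _ by simp; omega))
    omega

theorem shift_isBracket_iff (hj : j < m) {A : Finset ℕ} (hA : ∀ x ∈ A, x < h) :
    b.IsBracket (m + h) (shift j A) ↔ Kind.operad.IsBracket (h + 1) A := by
  refine ⟨fun hs => ?_, Kind.IsBracket.shift hj⟩
  obtain ⟨B, hB, hAB⟩ := exists_eq_shift hj hs fun x hx => by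
    rw [mem_shift] at hx
    have := hA _ hx.2
    rw [Finset.mem_Ico]; omega
  exact shift_inj hAB ▸ hB

theorem shift_incompat_iff (hj : j < m) {A B : Finset ℕ} (hA : Kind.operad.IsBracket (h + 1) A)
    (hB : Kind.operad.IsBracket (h + 1) B) :
    b.Incompat (m + h) (shift j A) (shift j B) ↔ Kind.operad.Incompat (h + 1) A B := by
  unfold Kind.Incompat
  have hun : shift j A ∪ shift j B = shift j (A ∪ B) := (Finset.image_union A B).symm
  rw [shift_subset_iff, shift_subset_iff, hun, shift_isBracket_iff hj]
  intro x hx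
  exact (Finset.mem_union.mp hx).elim (fun hx => hA.lt hx) (fun hx => hB.lt hx)

theorem not_subset_block (hj : j < m) {A : Finset ℕ} (hA : b.IsBracket m A) :
    ¬ b.inflate m j h A ⊆ Finset.Ico j (j + h) := by
  intro hs
  obtain ⟨x, hx⟩ := hA.nonempty
  have := Finset.mem_Ico.mp (hs ((mem_inflate_shift (h := h) hj (fun x => hA.lt) x).mpr hx))
  split_ifs at this <;> omega

/-- The block of gaps of the inserted word either lies in the inflated bracket or does not touch it.
-/
theorem inflate_block (hj : j < m) {A : Finset ℕ} (hA : b.IsBracket m A) :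
    Finset.Ico j (j + h) ⊆ b.inflate m j h A ∨
      ∀ x ∈ Finset.Ico j (j + h), ∀ y ∈ b.inflate m j h A, ¬ (x = y ∨ GapAdj (m + h) x y) := by
  have hA' := fun x => hA.lt (x := x)
  by_cases hT : j ∈ A ∨ (if j = 0 then m - 1 else j - 1) ∈ A
  · left
    intro x hx
    rw [Finset.mem_Ico] at hx
    exact (mem_inflate hj hA' x).mpr (Or.inr (Or.inl ⟨hx.1, hx.2, hT⟩))
  · right
    intro x hx y hy hxy
    rw [Finset.mem_Ico] at hx
    rcases (mem_inflate hj hA' y).mp hy with h1 | h1 | h1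
    · refine hT (Or.inr ?_)
      have h2 := hA' _ h1.2
      convert h1.2 using 1
      unfold GapAdj at hxy; split_ifs <;> omega
    · exact hT h1.2.2
    · have h2 := (hA' _ h1.2).trans_le gaps_le
      by_cases h3 : y - h = j
      · exact hT (Or.inl (h3 ▸ h1.2))
      · refine hT (Or.inr ?_)
        convert h1.2 using 1
        unfold GapAdj at hxy; split_ifs <;> omega

/-- A bracket of the outer word and a bracket of the inserted word are always compatible. -/
theorem not_incompat_inflate_shift (hj : j < m) {A B : Finset ℕ} (hA : b.IsBracket m A)
    (hB : Kind.operad.IsBracket (h + 1) B) :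
    ¬ b.Incompat (m + h) (b.inflate m j h A) (shift j B) := by
  have hBI : shift j B ⊆ Finset.Ico j (j + h) := by
    rw [← shift_range, shift_subset_iff]
    exact hB.subset_range
  rintro ⟨h1, h2, h3⟩
  rcases inflate_block (h := h) hj hA with h4 | h4
  · exact h2 (hBI.trans h4)
  · have := h3.conn.2.2 (shift j B) Finset.subset_union_right (hB.shift (b := b) hj).nonempty
      fun x hx y hy hxy => by
        rcases Finset.mem_union.mp hy with hy | hy
        · exact (h4 x (hBI hx) y hy (Or.inr hxy)).elim
        · exact hy
    exact h1 (this ▸ Finset.subset_union_left)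

/-- A bracket of the composed word that is compatible with the bracket of the inserted word is either
a bracket of the inserted word or comes from a bracket of the other word. -/
theorem exists_eq_inflate (hj : j < m) (hh : 0 < h) {J : Finset ℕ} (hJ : b.IsBracket (m + h) J)
    (hc : ¬ b.Incompat (m + h) J (Finset.Ico j (j + h))) (hs : ¬ J ⊆ Finset.Ico j (j + h)) :
    ∃ A, b.IsBracket m A ∧ J = b.inflate m j h A := by
  classical
  have hI : b.IsBracket (m + h) (Finset.Ico j (j + h)) :=
    isBracket_Ico (by omega) (by
      have : m - 1 ≤ b.gaps m := le_gaps
      rw [gaps_add h (by omega)]; omega)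
  have hJlt := fun x => hJ.lt (x := x)
  rw [gaps_add h (by omega)] at hJlt
  have hg1 : m - 1 ≤ b.gaps m := le_gaps
  have hg2 : b.gaps m ≤ m := gaps_le
  -- The set of gaps of the outer word whose images lie in `J`.
  set A := (Finset.range (b.gaps m)).filter fun x => (if x < j then x else x + h) ∈ J with hA
  have hA' : ∀ x ∈ A, x < b.gaps m := fun x hx => Finset.mem_range.mp (Finset.mem_filter.mp hx).1
  have key : J = b.inflate m j h A := by
    ext x
    rw [mem_inflate hj hA']
    -- By compatibility `J` contains the inserted block or does not touch it. In the first case it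
    -- is connected to a gap outside the block, hence contains a gap next to the letter `j`.
    have hblock : j ≤ x → x < j + h →
        (x ∈ J ↔ (j ∈ A ∨ (if j = 0 then m - 1 else j - 1) ∈ A)) := by
      intro hx1 hx2
      by_cases hIJ : Finset.Ico j (j + h) ⊆ J
      · refine iff_of_true (hIJ (Finset.mem_Ico.mpr ⟨hx1, hx2⟩)) ?_
        obtain ⟨u, huJ, hu, v, hvJ, hv, huv⟩ := hJ.conn.exists_adj (Finset.Ico j (j + h))
          ⟨x, hIJ (Finset.mem_Ico.mpr ⟨hx1, hx2⟩), Finset.mem_Ico.mpr ⟨hx1, hx2⟩⟩ hs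
        rw [Finset.mem_Ico] at hu hv
        have hvlt := hJlt v hvJ
        by_cases h1 : v = j + h
        · left
          rw [hA, Finset.mem_filter, Finset.mem_range, if_neg (lt_irrefl j)]
          exact ⟨by omega, h1 ▸ hvJ⟩
        · right
          rw [hA, Finset.mem_filter, Finset.mem_range]
          have h2 : v = if j = 0 then m - 1 + h else j - 1 := by
            unfold GapAdj at huv; split_ifs <;> omega
          by_cases h0 : j = 0
          · rw [if_pos h0] at h2 ⊢
            rw [if_neg (by omega), ← h2]
            exact ⟨by omega, hvJ⟩
          · rw [if_neg h0] at h2 ⊢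
            rw [if_pos (by omega), ← h2]
            exact ⟨by omega, hvJ⟩
      · have hna : ∀ u ∈ J, ∀ v ∈ Finset.Ico j (j + h), ¬ (u = v ∨ GapAdj (m + h) u v) :=
          fun u hu v hv huv => hc ⟨hs, hIJ, hJ.union hI ⟨u, hu, v, hv, huv⟩⟩
        refine iff_of_false (fun hx => hna x hx x (Finset.mem_Ico.mpr ⟨hx1, hx2⟩) (Or.inl rfl)) ?_
        rintro (h1 | h1)
        · rw [hA, Finset.mem_filter, if_neg (lt_irrefl j)] at h1
          exact hna _ h1.2 (j + h - 1) (Finset.mem_Ico.mpr (by omega))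
            (Or.inr (by unfold GapAdj; omega))
        · rw [hA, Finset.mem_filter] at h1
          refine hna _ h1.2 j (Finset.mem_Ico.mpr (by omega)) (Or.inr ?_)
          unfold GapAdj; split_ifs <;> omega
    constructor
    · intro hx
      have hxlt := hJlt x hx
      rcases lt_or_ge x j with h1 | h1
      · refine Or.inl ⟨h1, ?_⟩
        rw [hA, Finset.mem_filter, Finset.mem_range, if_pos h1]
        exact ⟨by omega, hx⟩
      · rcases lt_or_ge x (j + h) with h2 | h2
        · exact Or.inr (Or.inl ⟨h1, h2, (hblock h1 h2).mp hx⟩)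
        · refine Or.inr (Or.inr ⟨h2, ?_⟩)
          rw [hA, Finset.mem_filter, Finset.mem_range, if_neg (by omega), Nat.sub_add_cancel (by omega)]
          exact ⟨by omega, hx⟩
    · rintro (h1 | h1 | h1)
      · have := (Finset.mem_filter.mp h1.2).2
        rwa [if_pos h1.1] at this
      · exact (hblock h1.1 h1.2.1).mpr h1.2.2
      · have := (Finset.mem_filter.mp h1.2).2
        rwa [if_neg (by omega), Nat.sub_add_cancel (by omega)] at this
  refine ⟨A, ?_, key⟩
  refine (inflate_isBracket_iff (h := h) hj ?_ hA').mp (key ▸ hJ)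
  obtain ⟨x, hx, hxI⟩ := Finset.not_subset.mp hs
  rw [key, mem_inflate hj hA'] at hx
  rw [Finset.mem_Ico] at hxI
  rcases hx with h1 | h1 | h1
  · exact ⟨_, h1.2⟩
  · omega
  · exact ⟨_, h1.2⟩

end Insert

/-! ### Iterated insertions -/

section Iterate

variable {b : Kind} {l : ℕ} {A : Finset ℕ}

theorem inflate_zero {j : ℕ} (hj : j < l) (hA : ∀ x ∈ A, x < b.gaps l) :
    b.inflate l j 0 A = A := by
  ext x
  rw [mem_inflate hj hA]
  simp only [add_zero, Nat.sub_zero]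
  constructor
  · rintro (h1 | h1 | h1)
    · exact h1.2
    · omega
    · exact h1.2
  · intro hx
    rcases lt_or_ge x j with h | h
    · exact Or.inl ⟨h, hx⟩
    · exact Or.inr (Or.inr ⟨h, hx⟩)

/-- Inserting a word, and another one in place of one of its letters, has the same effect on a
bracket of the outer word as inserting the composite at once. -/
theorem inflate_inflate_nested {i j h₁ h₂ : ℕ} (hi : i < l) (hj : j ≤ h₁)
    (hA : ∀ x ∈ A, x < b.gaps l) :
    b.inflate (l + h₁) (i + j) h₂ (b.inflate l i h₁ A) = b.inflate l i (h₁ + h₂) A := by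
  ext x
  have hm := mem_inflate (h := h₁) hi hA
  -- The letter `i + j` is touched exactly if the letter `i` was touched before.
  have touch : (i + j ∈ b.inflate l i h₁ A ∨
      (if i + j = 0 then l + h₁ - 1 else i + j - 1) ∈ b.inflate l i h₁ A) ↔
      (i ∈ A ∨ (if i = 0 then l - 1 else i - 1) ∈ A) := by
    rw [hm, hm]
    clear hm hA
    have e1 : l + h₁ - 1 - h₁ = l - 1 := by omega
    have e2 : i + j - h₁ = i ∨ j < h₁ := by omega
    by_cases hi0 : i = 0
    · subst hi0
      by_cases hj0 : j = 0
      · subst hj0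
        simp only [add_zero, if_true, e1]
        have e3 : h₁ = 0 ∨ 0 < h₁ := by omega
        rcases e3 with rfl | e3
        · grind
        · grind
      · have : 0 + j ≠ 0 := by omega
        simp only [this, if_false, if_true]
        rcases e2 with e2 | e2
        · rw [e2]; grind
        · grind
    · have : i + j ≠ 0 := by omega
      simp only [this, hi0, if_false]
      by_cases hj0 : j = 0
      · subst hj0
        grind
      · rcases e2 with e2 | e2
        · rw [e2]; grind
        · grind
  rw [mem_inflate (h := h₂) (show i + j < l + h₁ by omega) (inflate_lt hi hA), touch, hm, hm,
    mem_inflate hi hA, Nat.sub_sub, Nat.add_comm h₂ h₁]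
  clear touch hm hA
  generalize (i ∈ A ∨ (if i = 0 then l - 1 else i - 1) ∈ A) = T
  by_cases hT : T
  · simp only [hT, and_true]
    rcases lt_or_ge x i with h1 | h1
    · grind
    · rcases lt_or_ge x (i + (h₁ + h₂)) with h2 | h2
      · grind
      · grind
  · simp only [hT, and_false, false_or]
    rcases lt_or_ge x i with h1 | h1
    · grind
    · rcases lt_or_ge x (i + (h₁ + h₂)) with h2 | h2
      · grind
      · grind

/-- The middle word of a threefold composite: its brackets can be inflated before or after the
insertion. -/
theorem inflate_shift_nested {i j h₁ h₂ : ℕ} (hi : i < l) (hj : j ≤ h₁) (hA : ∀ x ∈ A, x < h₁) :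
    b.inflate (l + h₁) (i + j) h₂ (shift i A) =
      shift i (Kind.operad.inflate (h₁ + 1) j h₂ A) := by
  have h1 : ∀ x ∈ shift i A, x < b.gaps (l + h₁) := fun x hx => by
    rw [mem_shift] at hx
    have := hA _ hx.2
    have h2 : l - 1 ≤ b.gaps l := le_gaps
    rw [gaps_add h₁ (by omega)]; omega
  ext x
  have touch : (i + j ∈ shift i A ∨
      (if i + j = 0 then l + h₁ - 1 else i + j - 1) ∈ shift i A) ↔
      (j ∈ A ∨ (if j = 0 then h₁ + 1 - 1 else j - 1) ∈ A) := by
    rw [mem_shift, mem_shift, Nat.add_sub_cancel_left]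
    clear h1
    have h2 : h₁ ∉ A := fun h => lt_irrefl _ (hA _ h)
    by_cases hj0 : j = 0
    · subst hj0
      rw [if_pos rfl, Nat.add_sub_cancel]
      by_cases hi0 : i = 0
      · subst hi0
        rw [if_pos rfl, Nat.sub_zero]
        have h3 : l + h₁ - 1 ∉ A := fun h => by have := hA _ h; omega
        simp [h2, h3]
      · rw [if_neg (by omega)]
        simp only [h2, or_false]
        constructor
        · rintro (h | h)
          · exact h.2
          · omega
        · exact fun h => Or.inl ⟨le_add_right le_rfl, h⟩
    · rw [if_neg (by omega), if_neg hj0, show i + j - 1 - i = j - 1 by omega]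
      simp only [show i ≤ i + j by omega, show i ≤ i + j - 1 by omega, true_and]
  rw [mem_inflate (h := h₂) (show i + j < l + h₁ by omega) h1, touch, mem_shift, mem_shift, mem_shift,
    mem_inflate (b := .operad) (m := h₁ + 1) (h := h₂) (show j < h₁ + 1 by omega) hA,
    Nat.sub_right_comm x i h₂]
  clear touch h1
  generalize (j ∈ A ∨ (if j = 0 then h₁ + 1 - 1 else j - 1) ∈ A) = T
  by_cases hT : T
  · simp only [hT, and_true]
    grind
  · simp only [hT, and_false, false_or]
    grind

/-- Insertions in place of two different letters commute on the brackets of the outer word. -/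
theorem inflate_inflate_parallel {i j h₁ h₂ : ℕ} (hij : i < j) (hj : j < l)
    (hA : ∀ x ∈ A, x < b.gaps l) :
    b.inflate (l + h₁) (j + h₁) h₂ (b.inflate l i h₁ A) =
      b.inflate (l + h₂) i h₁ (b.inflate l j h₂ A) := by
  ext x
  have hi := hij.trans hj
  have hl : ∀ y, y ∈ A → y < l := fun y hy => (hA y hy).trans_le gaps_le
  -- Neither insertion changes whether the other letter is touched.
  have touch1 : (j + h₁ ∈ b.inflate l i h₁ A ∨
      (if j + h₁ = 0 then l + h₁ - 1 else j + h₁ - 1) ∈ b.inflate l i h₁ A) ↔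
      (j ∈ A ∨ (if j = 0 then l - 1 else j - 1) ∈ A) := by
    rw [mem_inflate hi hA, mem_inflate hi hA, if_neg (show ¬ j + h₁ = 0 by omega), if_neg (show ¬ j = 0 by omega),
      Nat.add_sub_cancel, show j + h₁ - 1 - h₁ = j - 1 by omega]
    clear hl hA
    grind
  have touch2 : (i ∈ b.inflate l j h₂ A ∨
      (if i = 0 then l + h₂ - 1 else i - 1) ∈ b.inflate l j h₂ A) ↔
      (i ∈ A ∨ (if i = 0 then l - 1 else i - 1) ∈ A) := by
    rw [mem_inflate hj hA, mem_inflate hj hA, if_neg (show ¬ j = 0 by omega),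
      show (if i = 0 then l + h₂ - 1 else i - 1) - h₂ = if i = 0 then l - 1 else i - 1 - h₂ by
        split_ifs <;> omega]
    clear hl hA
    split_ifs <;> grind
  rw [mem_inflate (h := h₂) (show j + h₁ < l + h₁ by omega) (inflate_lt hi hA),
    mem_inflate (h := h₁) (show i < l + h₂ by omega) (inflate_lt hj hA), touch1, touch2,
    mem_inflate hi hA, mem_inflate hi hA, mem_inflate hj hA, mem_inflate hj hA,
    Nat.sub_right_comm x h₁ h₂]
  have e1 : ∀ y, i + h₁ ≤ y → y < j + h₁ → y - h₁ < j := by omega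
  clear touch1 touch2 hl hA
  generalize (i ∈ A ∨ (if i = 0 then l - 1 else i - 1) ∈ A) = T
  generalize (j ∈ A ∨ (if j = 0 then l - 1 else j - 1) ∈ A) = T'
  rcases lt_or_ge x i with h1 | h1
  · grind
  rcases lt_or_ge x (i + h₁) with h2 | h2
  · grind
  rcases lt_or_ge x (j + h₁) with h3 | h3
  · grind
  rcases lt_or_ge x (j + h₁ + h₂) with h4 | h4
  · grind
  · grind

theorem inflate_shift_right {i j h₁ h₂ : ℕ} (hij : i < j) (hj : j < l) (hA : ∀ x ∈ A, x < h₁) :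
    b.inflate (l + h₁) (j + h₁) h₂ (shift i A) = shift i A := by
  have h1 : ∀ x ∈ shift i A, x < b.gaps (l + h₁) := fun x hx => by
    rw [mem_shift] at hx
    have := hA _ hx.2
    have h2 : l - 1 ≤ b.gaps l := le_gaps
    rw [gaps_add h₁ (by omega)]; omega
  ext x
  simp only [mem_inflate (h := h₂) (show j + h₁ < l + h₁ by omega) h1, mem_shift]
  clear h1
  split_ifs <;> grind

theorem inflate_shift_left {i j h₁ h₂ : ℕ} (hij : i < j) (hj : j < l) (hA : ∀ x ∈ A, x < h₂) :
    b.inflate (l + h₂) i h₁ (shift j A) = shift (j + h₁) A := by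
  have h1 : ∀ x ∈ shift j A, x < b.gaps (l + h₂) := fun x hx => by
    rw [mem_shift] at hx
    have := hA _ hx.2
    have h2 : l - 1 ≤ b.gaps l := le_gaps
    rw [gaps_add h₂ (by omega)]; omega
  ext x
  simp only [mem_inflate (h := h₁) (show i < l + h₂ by omega) h1, mem_shift]
  clear h1
  split_ifs <;> grind

end Iterate

/-! ### Composition of permutations -/

theorem inputs_inl_val {m n r : ℕ} (h : r + 1 = m + n) (i : Fin m) (y : Fin m) (hy : y ≠ i) :
    (inputs h i (Sum.inl ⟨y, hy⟩)).1 = if y.1 < i.1 then y.1 else y.1 + n - 1 := by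
  simp only [inputs, Equiv.coe_fn_mk, Sum.elim_inl]
  split_ifs <;> rfl

theorem inputs_inr_val {m n r : ℕ} (h : r + 1 = m + n) (i : Fin m) (z : Fin n) :
    (inputs h i (Sum.inr z)).1 = i.1 + z.1 := rfl

theorem permComp_inl {m n r : ℕ} (h : r + 1 = m + n) (i : Fin m) (σ : Perm (Fin m))
    (τ : Perm (Fin n)) (y : {y : Fin m // y ≠ i}) :
    permComp h i σ τ (inputs h i (Sum.inl y)) = inputs h (σ i) (Sum.inl (others σ i y)) := by
  simp [permComp]

theorem permComp_inr {m n r : ℕ} (h : r + 1 = m + n) (i : Fin m) (σ : Perm (Fin m))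
    (τ : Perm (Fin n)) (z : Fin n) :
    permComp h i σ τ (inputs h i (Sum.inr z)) = inputs h (σ i) (Sum.inr (τ z)) := by
  simp [permComp]

/-- A variant of `permComp_inl` up to equality of the place of insertion. -/
theorem permComp_inl_of_eq {m n r : ℕ} (h : r + 1 = m + n) (i i' : Fin m) (σ : Perm (Fin m))
    (τ : Perm (Fin n)) (hσ : σ i = i') (y y' : Fin m) (hy : y ≠ i) (hy' : y' ≠ i') (hyy : σ y = y') :
    permComp h i σ τ (inputs h i (Sum.inl ⟨y, hy⟩)) = inputs h i' (Sum.inl ⟨y', hy'⟩) := by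
  subst hσ hyy
  exact permComp_inl h i σ τ ⟨y, hy⟩

/-- A variant of `permComp_inr` up to equality of the place of insertion. -/
theorem permComp_inr_of_eq {m n r : ℕ} (h : r + 1 = m + n) (i i' : Fin m) (σ : Perm (Fin m))
    (τ : Perm (Fin n)) (hσ : σ i = i') (z : Fin n) :
    permComp h i σ τ (inputs h i (Sum.inr z)) = inputs h i' (Sum.inr (τ z)) := by
  subst hσ
  exact permComp_inr h i σ τ z

theorem inputs_inr_ne_inl {m n r : ℕ} (h : r + 1 = m + n) (i : Fin m) (z : Fin n)
    (y : {y : Fin m // y ≠ i}) : inputs h i (Sum.inr z) ≠ inputs h i (Sum.inl y) := fun he => by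
  cases (inputs h i).injective he

/-- Sequential associativity of the composition of permutations. -/
theorem permComp_assoc {l m n r₁ r₂ r : ℕ} (h₁ : r₁ + 1 = l + m) (h₂ : r₂ + 1 = m + n)
    (h₃ : r + 1 = r₁ + n) (h₄ : r + 1 = l + r₂) (i : Fin l) (j : Fin m) (i' : Fin r₁)
    (hi : i'.1 = i.1 + j.1) (σ : Perm (Fin l)) (τ : Perm (Fin m)) (ω : Perm (Fin n)) :
    permComp h₃ i' (permComp h₁ i σ τ) ω = permComp h₄ i σ (permComp h₂ j τ ω) := by
  have hi' : i' = inputs h₁ i (Sum.inr j) := Fin.ext hi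
  subst hi'
  -- the three sorts of inputs of the threefold composite
  have e1 : ∀ (i : Fin l) (j : Fin m) (z : Fin n), inputs h₃ (inputs h₁ i (Sum.inr j)) (Sum.inr z) =
      inputs h₄ i (Sum.inr (inputs h₂ j (Sum.inr z))) := fun i j z => Fin.ext (by
    simp only [inputs_inr_val]; omega)
  have e2 : ∀ (i : Fin l) (j y : Fin m) (hy : y ≠ j) (hy' : inputs h₁ i (Sum.inr y) ≠
      inputs h₁ i (Sum.inr j)), inputs h₃ (inputs h₁ i (Sum.inr j)) (Sum.inl ⟨_, hy'⟩) =
      inputs h₄ i (Sum.inr (inputs h₂ j (Sum.inl ⟨y, hy⟩))) := fun i j y hy hy' => Fin.ext (by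
    have := Fin.val_ne_of_ne hy
    rw [inputs_inl_val, inputs_inr_val, inputs_inr_val, inputs_inr_val, inputs_inl_val]
    split_ifs <;> omega)
  have e3 : ∀ (i w : Fin l) (j : Fin m) (hw : w ≠ i) (hw' : inputs h₁ i (Sum.inl ⟨w, hw⟩) ≠
      inputs h₁ i (Sum.inr j)), inputs h₃ (inputs h₁ i (Sum.inr j)) (Sum.inl ⟨_, hw'⟩) =
      inputs h₄ i (Sum.inl ⟨w, hw⟩) := fun i w j hw hw' => Fin.ext (by
    have := Fin.val_ne_of_ne hw
    simp only [inputs_inr_val, inputs_inl_val]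
    split_ifs <;> omega)
  ext x
  congr 1
  have f : permComp h₁ i σ τ (inputs h₁ i (Sum.inr j)) = inputs h₁ (σ i) (Sum.inr (τ j)) :=
    permComp_inr _ _ _ _ _
  obtain ⟨⟨w, hw⟩ | x, rfl⟩ := (inputs h₄ i).surjective x
  · have hw' := (inputs_inr_ne_inl h₁ i j ⟨w, hw⟩).symm
    rw [permComp_inl, ← e3 i w j hw hw', permComp_inl_of_eq h₃ _ _ _ ω f _ _ hw'
      (inputs_inr_ne_inl _ _ _ _).symm (permComp_inl _ _ _ _ _)]
    exact e3 _ _ _ _ _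
  · obtain ⟨⟨y, hy⟩ | z, rfl⟩ := (inputs h₂ j).surjective x
    · have hy' : ∀ (i : Fin l) (j y : Fin m), y ≠ j →
          inputs h₁ i (Sum.inr y) ≠ inputs h₁ i (Sum.inr j) := fun i j y hy he =>
        hy (Sum.inr_injective ((inputs h₁ i).injective he))
      rw [permComp_inr, permComp_inl, ← e2 i j y hy (hy' _ _ _ hy), permComp_inl_of_eq h₃ _ _ _ ω f
        _ _ _ (hy' _ _ _ (τ.injective.ne hy)) (permComp_inr _ _ _ _ _)]
      exact e2 _ _ _ _ _
    · rw [permComp_inr, permComp_inr, ← e1, permComp_inr_of_eq h₃ _ _ _ ω f]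
      exact e1 _ _ _

/-- Compositions of permutations at two different inputs commute. -/
theorem permComp_parallel {l m n r₁ r₂ r : ℕ} (h₁ : r₁ + 1 = l + m) (h₂ : r₂ + 1 = l + n)
    (h₃ : r + 1 = r₁ + n) (h₄ : r + 1 = r₂ + m) (i j : Fin l) (hij : i < j) (j' : Fin r₁)
    (hj : j'.1 + 1 = j.1 + m) (i' : Fin r₂) (hi : i'.1 = i.1) (σ : Perm (Fin l))
    (τ : Perm (Fin m)) (ω : Perm (Fin n)) :
    permComp h₃ j' (permComp h₁ i σ τ) ω = permComp h₄ i' (permComp h₂ j σ ω) τ := by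
  have hne : i ≠ j := hij.ne
  have hj' : j' = inputs h₁ i (Sum.inl ⟨j, hne.symm⟩) := Fin.ext (by
    rw [inputs_inl_val]; have : ¬ j.1 < i.1 := by omega
    simp only [this, if_false]; omega)
  have hi' : i' = inputs h₂ j (Sum.inl ⟨i, hne⟩) := Fin.ext (by
    rw [inputs_inl_val]; have : i.1 < j.1 := hij
    simp only [this, if_true]; omega)
  clear hj hi hij
  subst hj' hi'
  -- the three sorts of inputs of the threefold composite
  have e1 : ∀ (i j : Fin l) (hne : i ≠ j) (z : Fin n),
      inputs h₃ (inputs h₁ i (Sum.inl ⟨j, hne.symm⟩)) (Sum.inr z) =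
      inputs h₄ (inputs h₂ j (Sum.inl ⟨i, hne⟩)) (Sum.inl ⟨inputs h₂ j (Sum.inr z),
        inputs_inr_ne_inl _ _ _ _⟩) := fun i j hne z => Fin.ext (by
    have := Fin.val_ne_of_ne hne
    simp only [inputs_inr_val, inputs_inl_val]; split_ifs <;> omega)
  have e2 : ∀ (i j : Fin l) (hne : i ≠ j) (z : Fin m),
      inputs h₃ (inputs h₁ i (Sum.inl ⟨j, hne.symm⟩)) (Sum.inl ⟨inputs h₁ i (Sum.inr z),
        inputs_inr_ne_inl _ _ _ _⟩) =
      inputs h₄ (inputs h₂ j (Sum.inl ⟨i, hne⟩)) (Sum.inr z) := fun i j hne z => Fin.ext (by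
    have := Fin.val_ne_of_ne hne
    simp only [inputs_inr_val, inputs_inl_val]; split_ifs <;> omega)
  have e3 : ∀ (i j w : Fin l) (hne : i ≠ j) (hi : w ≠ i) (hj : w ≠ j)
      (hi' : inputs h₁ i (Sum.inl ⟨w, hi⟩) ≠ inputs h₁ i (Sum.inl ⟨j, hne.symm⟩))
      (hj' : inputs h₂ j (Sum.inl ⟨w, hj⟩) ≠ inputs h₂ j (Sum.inl ⟨i, hne⟩)),
      inputs h₃ (inputs h₁ i (Sum.inl ⟨j, hne.symm⟩)) (Sum.inl ⟨_, hi'⟩) =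
      inputs h₄ (inputs h₂ j (Sum.inl ⟨i, hne⟩)) (Sum.inl ⟨_, hj'⟩) :=
    fun i j w hne hi hj _ _ => Fin.ext (by
      have := Fin.val_ne_of_ne hne
      have := Fin.val_ne_of_ne hi
      have := Fin.val_ne_of_ne hj
      simp only [inputs_inl_val]; split_ifs <;> omega)
  have hσ : σ i ≠ σ j := σ.injective.ne hne
  have f1 : permComp h₁ i σ τ (inputs h₁ i (Sum.inl ⟨j, hne.symm⟩)) =
      inputs h₁ (σ i) (Sum.inl ⟨σ j, hσ.symm⟩) := permComp_inl _ _ _ _ _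
  have f2 : permComp h₂ j σ ω (inputs h₂ j (Sum.inl ⟨i, hne⟩)) =
      inputs h₂ (σ j) (Sum.inl ⟨σ i, hσ⟩) := permComp_inl _ _ _ _ _
  ext x
  congr 1
  obtain ⟨⟨x, hx⟩ | z, rfl⟩ := (inputs h₃ (inputs h₁ i (Sum.inl ⟨j, hne.symm⟩))).surjective x
  · obtain ⟨⟨w, hw⟩ | z, rfl⟩ := (inputs h₁ i).surjective x
    · have hwj : w ≠ j := by rintro rfl; exact hx rfl
      have hj' : inputs h₂ j (Sum.inl ⟨w, hwj⟩) ≠ inputs h₂ j (Sum.inl ⟨i, hne⟩) := fun he => by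
        have := (inputs h₂ j).injective he
        simp only [Sum.inl.injEq, Subtype.mk.injEq] at this
        exact hw this
      have hw1 : σ w ≠ σ i := σ.injective.ne hw
      have hw2 : σ w ≠ σ j := σ.injective.ne hwj
      have hi2 : inputs h₁ (σ i) (Sum.inl ⟨σ w, hw1⟩) ≠ inputs h₁ (σ i) (Sum.inl ⟨σ j, hσ.symm⟩) :=
        fun he => by
          have := (inputs h₁ (σ i)).injective he
          simp only [Sum.inl.injEq, Subtype.mk.injEq] at this
          exact hw2 this
      have hj2 : inputs h₂ (σ j) (Sum.inl ⟨σ w, hw2⟩) ≠ inputs h₂ (σ j) (Sum.inl ⟨σ i, hσ⟩) :=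
        fun he => by
          have := (inputs h₂ (σ j)).injective he
          simp only [Sum.inl.injEq, Subtype.mk.injEq] at this
          exact hw1 this
      rw [permComp_inl_of_eq h₃ _ _ _ ω f1 _ _ hx hi2 (permComp_inl _ _ _ _ _), e3 i j w hne hw hwj hx hj',
        permComp_inl_of_eq h₄ _ _ _ τ f2 _ _ hj' hj2 (permComp_inl _ _ _ _ _)]
      exact e3 _ _ _ hσ _ _ _ _
    · rw [permComp_inl_of_eq h₃ _ _ _ ω f1 _ _ hx (inputs_inr_ne_inl _ _ _ _) (permComp_inr _ _ _ _ _),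
        e2 i j hne z, permComp_inr_of_eq h₄ _ _ _ τ f2]
      exact e2 _ _ hσ _
  · rw [permComp_inr_of_eq h₃ _ _ _ ω f1, e1 i j hne z,
      permComp_inl_of_eq h₄ _ _ _ τ f2 _ _ _ (inputs_inr_ne_inl _ _ _ _) (permComp_inr _ _ _ _ _)]
    exact e1 _ _ hσ _

/-- If `i` is fixed, the composite is, up to relabelling, `σ` on the other letters together with
`τ`. -/
theorem sign_permComp_of_fixed {m n r : ℕ} (h : r + 1 = m + n) (i : Fin m) (σ : Perm (Fin m))
    (τ : Perm (Fin n)) (hσ : σ i = i) :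
    Perm.sign (permComp h i σ τ) = Perm.sign σ * Perm.sign τ := by
  have h1 : ∀ x, x ≠ i ↔ σ x ≠ i := fun x => by
    conv_rhs => rw [← hσ]
    exact (σ.injective.ne_iff).symm
  have key : permComp h i σ τ =
      (inputs h i).permCongr (Equiv.Perm.sumCongr (σ.subtypePerm (fun x => (h1 x).symm)) τ) := by
    ext x
    congr 1
    obtain ⟨⟨y, hy⟩ | z, rfl⟩ := (inputs h i).surjective x
    · rw [permComp_inl_of_eq h i i σ τ hσ y _ hy ((h1 y).mp hy) rfl]
      simp only [Equiv.permCongr_apply, Equiv.symm_apply_apply, Equiv.Perm.sumCongr_apply, Sum.map_inl]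
      rfl
    · rw [permComp_inr]
      simp only [Equiv.permCongr_apply, Equiv.symm_apply_apply, Equiv.Perm.sumCongr_apply, Sum.map_inr]
      rw [hσ]
  rw [key, Equiv.Perm.sign_permCongr, Equiv.Perm.sign_sumCongr, Equiv.Perm.sign_subtypePerm]
  intro x hx hxi
  exact hx (hxi ▸ hσ)

/-- Inserting `n` letters for the first of two neighbouring letters turns their transposition into a
cycle of length `n + 1`. -/
theorem sign_permComp_swap {m n r : ℕ} (h : r + 1 = m + n) (i j : Fin m) (hij : j.1 = i.1 + 1) :
    Perm.sign (permComp h i (swap i j) (1 : Perm (Fin n))) = (-1) ^ n := by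
  have hjm := j.2
  have : NeZero r := ⟨by omega⟩
  have key : permComp h i (swap i j) (1 : Perm (Fin n)) =
      (Fin.cycleIcc ⟨i.1, by omega⟩ ⟨i.1 + n, by omega⟩ : Perm (Fin r)) := by
    ext x
    obtain ⟨⟨y, hy⟩ | z, rfl⟩ := (inputs h i).surjective x
    · have hy' := Fin.val_ne_of_ne hy
      rw [permComp_inl_of_eq h i j _ _ (swap_apply_left i j) y _ hy
        (fun he => hy ((swap i j).injective (he.trans (swap_apply_left i j).symm))) rfl, inputs_inl_val]
      have hval := inputs_inl_val h i y hy
      by_cases hyj : y = j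
      · subst hyj
        rw [swap_apply_right, if_pos (by omega), Fin.cycleIcc_of_le_of_le, if_pos]
        · apply Fin.ext; rw [hval, if_neg (by omega)]; simp only; omega
        · rw [Fin.le_def, hval, if_neg (by omega)]; simp only; omega
        · rw [Fin.le_def, hval, if_neg (by omega)]; simp only; omega
      · have hyj' := Fin.val_ne_of_ne hyj
        rw [swap_apply_of_ne_of_ne hy hyj]
        rcases lt_or_ge y.1 i.1 with h1 | h1
        · rw [Fin.cycleIcc_of_lt, hval, if_pos (by omega), if_pos h1]
          rw [Fin.lt_def, hval, if_pos h1]; exact h1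
        · rw [Fin.cycleIcc_of_gt, hval, if_neg (by omega), if_neg (by omega)]
          rw [Fin.lt_def, hval, if_neg (by omega)]; simp only; omega
    · have hz := z.2
      rw [permComp_inr, inputs_inr_val, swap_apply_left, Fin.cycleIcc_of_le_of_le, if_neg]
      · rw [Fin.val_add_one_of_lt']
        · rw [inputs_inr_val, Perm.one_apply]; omega
        · rw [inputs_inr_val]; omega
      · intro he
        have := congrArg Fin.val he
        rw [inputs_inr_val] at this
        simp only at this
        omega
      · rw [Fin.le_def, inputs_inr_val]; exact Nat.le_add_right _ _
      · rw [Fin.le_def, inputs_inr_val]; simp only; omega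
  rw [key, Fin.sign_cycleIcc_of_le (by rw [Fin.le_def]; exact Nat.le_add_right _ _)]
  simp

/-- The sign of the composition of the suspension of the operad for commutative algebras. -/
theorem sign_permComp {m n r : ℕ} (h : r + 1 = m + n) (i : Fin m) (σ : Perm (Fin m))
    (τ : Perm (Fin n)) :
    Perm.sign (permComp h i σ τ) =
      Perm.sign σ * Perm.sign τ * (-1) ^ ((n + 1) * ((σ i).1 + i.1)) := by
  have split : permComp h i σ τ = permComp h i σ 1 * permComp h i 1 τ := by
    have := permComp_mul h i σ 1 1 τ
    rwa [mul_one, one_mul] at this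
  obtain _ | m := m
  · exact i.elim0
  have sq : ∀ a : ℕ, ((-1 : ℤˣ) ^ a) * (-1) ^ a = 1 := fun a => by
    rw [← mul_pow]; simp
  -- The formula for transpositions of neighbours; at the second of the two letters it follows from
  -- the first because the square of the transposition is trivial.
  have adj : ∀ (s : Fin m) (i : Fin (m + 1)),
      Perm.sign (permComp h i (swap s.castSucc s.succ) 1) =
        Perm.sign (swap s.castSucc s.succ) *
          (-1) ^ ((n + 1) * ((swap s.castSucc s.succ i).1 + i.1)) := by
    intro s i
    have hne : s.castSucc ≠ s.succ := (Fin.castSucc_lt_succ).ne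
    have e0 : Perm.sign (permComp h s.castSucc (swap s.castSucc s.succ) 1) = (-1) ^ n :=
      sign_permComp_swap h s.castSucc s.succ rfl
    by_cases h1 : i = s.castSucc
    · subst h1
      rw [e0, swap_apply_left, Perm.sign_swap hne, Fin.val_succ, Fin.val_castSucc,
        show (n + 1) * (s.1 + 1 + s.1) = n + 1 + 2 * ((n + 1) * s.1) by ring, pow_add, pow_mul,
        pow_succ]
      simp
    · by_cases h2 : i = s.succ
      · subst h2
        have e1 := permComp_mul h s.succ (swap s.castSucc s.succ) (swap s.castSucc s.succ) 1
          (1 : Perm (Fin n))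
        rw [swap_apply_right, swap_mul_self, one_mul, permComp_one_one] at e1
        have e2 := congrArg Perm.sign e1
        rw [Perm.sign_mul, Perm.sign_one, e0] at e2
        have e3 := congrArg (((-1 : ℤˣ) ^ n) * ·) e2
        simp only [← mul_assoc, sq, one_mul, mul_one] at e3
        rw [← e3, swap_apply_right, Perm.sign_swap hne, Fin.val_succ, Fin.val_castSucc,
          show (n + 1) * (s.1 + (s.1 + 1)) = n + 1 + 2 * ((n + 1) * s.1) by ring, pow_add, pow_mul,
          pow_succ]
        simp
      · have h3 : swap s.castSucc s.succ i = i := swap_apply_of_ne_of_ne h1 h2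
        rw [sign_permComp_of_fixed h i _ _ h3, h3, Perm.sign_one, mul_one, ← two_mul,
          Nat.mul_left_comm, pow_mul]
        simp
  -- Both sides are multiplicative in `σ`, and these transpositions generate.
  have key : ∀ σ : Perm (Fin (m + 1)), ∀ i, Perm.sign (permComp h i σ 1) =
      Perm.sign σ * (-1) ^ ((n + 1) * ((σ i).1 + i.1)) := by
    intro σ
    have hσ : σ ∈ Submonoid.closure (Set.range fun i : Fin m ↦ swap i.castSucc i.succ) := by
      rw [Equiv.Perm.mclosure_swap_castSucc_succ]; trivial
    induction hσ using Submonoid.closure_induction with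
    | mem σ hσ =>
      obtain ⟨s, rfl⟩ := hσ
      exact adj s
    | one =>
      intro i
      rw [permComp_one_one, Perm.sign_one, Perm.one_apply, ← two_mul, Nat.mul_left_comm, pow_mul]
      simp
    | mul ζ σ _ _ hζ hσ =>
      intro i
      have := permComp_mul h i ζ σ 1 (1 : Perm (Fin n))
      rw [one_mul] at this
      rw [this, Perm.sign_mul, hζ, hσ, Perm.sign_mul, Perm.mul_apply, Nat.mul_add, Nat.mul_add,
        Nat.mul_add, pow_add, pow_add, pow_add]
      have h1 := sq ((n + 1) * (σ i).1)
      calc _ = Perm.sign ζ * Perm.sign σ * ((-1) ^ ((n + 1) * ((ζ (σ i)).1)) *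
            (-1) ^ ((n + 1) * i.1)) * ((-1) ^ ((n + 1) * (σ i).1) * (-1) ^ ((n + 1) * (σ i).1)) := by
              ac_rfl
        _ = _ := by rw [h1, mul_one]
  rw [split, Perm.sign_mul, key, sign_permComp_of_fixed h i 1 τ rfl, Perm.sign_one, one_mul]
  ac_rfl

/-! ### Rotations of bracketings -/

/-- The symmetries of the words of `n` letters: cyclic words can be rotated. -/
def Kind.rotations : Kind → (n : ℕ) → Subgroup (Perm (Fin n))
  | operad, _ => ⊥
  | module, n => cyclicGroup n

theorem Kind.rotations_le (b : Kind) (n : ℕ) : b.rotations n ≤ cyclicGroup n := by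
  cases b
  · exact bot_le
  · exact le_rfl

theorem eq_one_of_mem_rotations {n : ℕ} {ζ : Perm (Fin n)} (h : ζ ∈ Kind.operad.rotations n) :
    ζ = 1 := Subgroup.mem_bot.mp h

theorem permComp_mem_rotations {b : Kind} {m n r : ℕ} (h : r + 1 = m + n) (hn : 1 ≤ n) (i : Fin m)
    {ζ : Perm (Fin m)} (hζ : ζ ∈ b.rotations m) :
    permComp h i ζ (1 : Perm (Fin n)) ∈ b.rotations r := by
  cases b
  · rw [eq_one_of_mem_rotations hζ, permComp_one_one]; exact one_mem _
  · exact permComp_cyclic h hn ζ hζ i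

theorem exists_rotate_pow {n : ℕ} {ζ : Perm (Fin n)} (h : ζ ∈ cyclicGroup n) :
    ∃ s : ℕ, ζ = finRotate n ^ s := by
  obtain ⟨s, hs⟩ := mem_powers_iff_mem_zpowers.mpr h
  exact ⟨s, hs.symm⟩

/-- A permutation of the letters as a map on natural numbers. -/
def permVal {n : ℕ} (ζ : Perm (Fin n)) (x : ℕ) : ℕ := if h : x < n then (ζ ⟨x, h⟩).1 else x

theorem permVal_fin {n : ℕ} (ζ : Perm (Fin n)) (x : Fin n) : permVal ζ x.1 = (ζ x).1 :=
  dif_pos x.2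

theorem permVal_one {n : ℕ} (x : ℕ) : permVal (1 : Perm (Fin n)) x = x := by
  unfold permVal; split_ifs <;> rfl

theorem permVal_lt {n : ℕ} (ζ : Perm (Fin n)) {x : ℕ} (hx : x < n) : permVal ζ x < n := by
  unfold permVal; rw [dif_pos hx]; exact (ζ _).2

theorem permVal_mul {n : ℕ} (ζ η : Perm (Fin n)) (x : ℕ) :
    permVal (ζ * η) x = permVal ζ (permVal η x) := by
  by_cases hx : x < n
  · have h1 := permVal_fin η ⟨x, hx⟩
    simp only at h1
    rw [h1, permVal_fin]
    exact permVal_fin (ζ * η) ⟨x, hx⟩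
  · simp [permVal, hx]

theorem permVal_inv_self {n : ℕ} (ζ : Perm (Fin n)) (x : ℕ) : permVal ζ⁻¹ (permVal ζ x) = x := by
  rw [← permVal_mul, inv_mul_cancel, permVal_one]

theorem permVal_self_inv {n : ℕ} (ζ : Perm (Fin n)) (x : ℕ) : permVal ζ (permVal ζ⁻¹ x) = x := by
  rw [← permVal_mul, mul_inv_cancel, permVal_one]

/-- The image of a set of gaps under a permutation. -/
def permTube {n : ℕ} (ζ : Perm (Fin n)) (A : Finset ℕ) : Finset ℕ := A.image (permVal ζ)

theorem mem_permTube {n : ℕ} {ζ : Perm (Fin n)} {A : Finset ℕ} {x : ℕ} :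
    x ∈ permTube ζ A ↔ permVal ζ⁻¹ x ∈ A := by
  unfold permTube
  rw [Finset.mem_image]
  constructor
  · rintro ⟨y, hy, rfl⟩; rwa [permVal_inv_self]
  · intro h; exact ⟨_, h, permVal_self_inv ζ x⟩

theorem permVal_mem_permTube {n : ℕ} {ζ : Perm (Fin n)} {A : Finset ℕ} {x : ℕ} :
    permVal ζ x ∈ permTube ζ A ↔ x ∈ A := by
  rw [mem_permTube, permVal_inv_self]

theorem permTube_one {n : ℕ} (A : Finset ℕ) : permTube (1 : Perm (Fin n)) A = A := by
  ext x; rw [mem_permTube, inv_one, permVal_one]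

theorem permTube_mul {n : ℕ} (ζ η : Perm (Fin n)) (A : Finset ℕ) :
    permTube (ζ * η) A = permTube ζ (permTube η A) := by
  ext x; rw [mem_permTube, mem_permTube, mem_permTube, mul_inv_rev, permVal_mul]

theorem permTube_inv_self {n : ℕ} (ζ : Perm (Fin n)) (A : Finset ℕ) :
    permTube ζ⁻¹ (permTube ζ A) = A := by
  rw [← permTube_mul, inv_mul_cancel, permTube_one]

theorem permTube_self_inv {n : ℕ} (ζ : Perm (Fin n)) (A : Finset ℕ) :
    permTube ζ (permTube ζ⁻¹ A) = A := by
  rw [← permTube_mul, mul_inv_cancel, permTube_one]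

theorem permTube_inj {n : ℕ} (ζ : Perm (Fin n)) {A B : Finset ℕ}
    (h : permTube ζ A = permTube ζ B) : A = B := by
  rw [← permTube_inv_self ζ A, h, permTube_inv_self]

theorem permTube_subset_iff {n : ℕ} (ζ : Perm (Fin n)) {A B : Finset ℕ} :
    permTube ζ A ⊆ permTube ζ B ↔ A ⊆ B := by
  constructor
  · intro h x hx
    exact permVal_mem_permTube.mp (h (permVal_mem_permTube.mpr hx))
  · exact fun h => Finset.image_subset_image h

theorem permTube_union {n : ℕ} (ζ : Perm (Fin n)) (A B : Finset ℕ) :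
    permTube ζ (A ∪ B) = permTube ζ A ∪ permTube ζ B := Finset.image_union _ _

theorem permTube_card {n : ℕ} (ζ : Perm (Fin n)) (A : Finset ℕ) : (permTube ζ A).card = A.card :=
  Finset.card_image_of_injective _ fun x y h => by
    rw [← permVal_inv_self ζ x, h, permVal_inv_self]

theorem permVal_rotate {n x : ℕ} (hx : x < n) :
    permVal (finRotate n) x = if x + 1 = n then 0 else x + 1 := by
  have := rotate_val ⟨x, hx⟩
  rw [← permVal_fin] at this
  exact this

theorem gapAdj_rotate {n : ℕ} {ζ : Perm (Fin n)} (hζ : ζ ∈ cyclicGroup n) {x y : ℕ} (hx : x < n)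
    (hy : y < n) (h : GapAdj n x y) : GapAdj n (permVal ζ x) (permVal ζ y) := by
  obtain ⟨s, rfl⟩ := exists_rotate_pow hζ
  induction s with
  | zero => rwa [pow_zero, permVal_one, permVal_one]
  | succ s ih =>
    have h1 := permVal_lt (finRotate n ^ s) hx
    have h2 := permVal_lt (finRotate n ^ s) hy
    have h3 := ih (Subgroup.npow_mem_zpowers _ _)
    rw [pow_succ', permVal_mul, permVal_mul, permVal_rotate h1, permVal_rotate h2]
    unfold GapAdj at *
    split_ifs <;> omega

theorem permVal_prev {n : ℕ} {ζ : Perm (Fin n)} (hζ : ζ ∈ cyclicGroup n) {x : ℕ} (hx : x < n) :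
    permVal ζ (if x = 0 then n - 1 else x - 1) =
      if permVal ζ x = 0 then n - 1 else permVal ζ x - 1 := by
  obtain ⟨s, rfl⟩ := exists_rotate_pow hζ
  induction s with
  | zero => rw [pow_zero, permVal_one, permVal_one]
  | succ s ih =>
    have h1 := permVal_lt (finRotate n ^ s) hx
    have h3 := ih (Subgroup.npow_mem_zpowers _ _)
    have h4 : (if permVal (finRotate n ^ s) x = 0 then n - 1
        else permVal (finRotate n ^ s) x - 1) < n := by split_ifs <;> omega
    rw [pow_succ', permVal_mul, permVal_mul, h3, permVal_rotate h1, permVal_rotate h4]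
    generalize permVal (finRotate n ^ s) x = y at *
    clear ih h3 h4 hζ hx x s
    have e1 : (if y = 0 then n - 1 else y - 1) + 1 = n ↔ y = 0 := by
      by_cases hy : y = 0
      · rw [if_pos hy]; omega
      · rw [if_neg hy]; omega
    have e2 : (if y + 1 = n then 0 else y + 1) = 0 ↔ y + 1 = n := by
      by_cases hy : y + 1 = n
      · rw [if_pos hy]; omega
      · rw [if_neg hy]; omega
    simp only [e1, e2]
    split_ifs <;> omega

theorem GapConnected.permTube {n : ℕ} {ζ : Perm (Fin n)} (hζ : ζ ∈ cyclicGroup n) {A : Finset ℕ}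
    (hA : GapConnected n A) : GapConnected n (permTube ζ A) := by
  refine ⟨hA.1.image _, fun x hx => ?_, fun X hX hne hc => ?_⟩
  · rw [← permVal_self_inv ζ x]
    exact permVal_lt ζ (hA.2.1 _ (mem_permTube.mp hx))
  · have := hA.2.2 (Cyclo.permTube ζ⁻¹ X) ?_ (hne.image _) ?_
    · rw [← this, permTube_self_inv]
    · rw [← permTube_inv_self ζ A]; exact (permTube_subset_iff _).mpr hX
    · intro x hx y hy hxy
      rw [mem_permTube, inv_inv] at hx ⊢
      have hxA := hX hx
      rw [permVal_mem_permTube] at hxA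
      exact hc _ hx _ (permVal_mem_permTube.mpr hy)
        (gapAdj_rotate hζ (hA.2.1 x hxA) (hA.2.1 y hy) hxy)

theorem Kind.IsBracket.permTube {b : Kind} {n : ℕ} {ζ : Perm (Fin n)} (hζ : ζ ∈ b.rotations n)
    {A : Finset ℕ} (hA : b.IsBracket n A) : b.IsBracket n (permTube ζ A) := by
  cases b
  · rwa [eq_one_of_mem_rotations hζ, permTube_one]
  · rw [isBracket_module_iff] at *
    exact hA.permTube hζ

theorem permTube_isBracket_iff {b : Kind} {n : ℕ} {ζ : Perm (Fin n)} (hζ : ζ ∈ b.rotations n)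
    {A : Finset ℕ} : b.IsBracket n (permTube ζ A) ↔ b.IsBracket n A :=
  ⟨fun h => by rw [← permTube_inv_self ζ A]; exact h.permTube (inv_mem hζ), fun h => h.permTube hζ⟩

theorem permTube_incompat_iff {b : Kind} {n : ℕ} {ζ : Perm (Fin n)} (hζ : ζ ∈ b.rotations n)
    {A B : Finset ℕ} : b.Incompat n (permTube ζ A) (permTube ζ B) ↔ b.Incompat n A B := by
  unfold Kind.Incompat
  rw [permTube_subset_iff, permTube_subset_iff, ← permTube_union, permTube_isBracket_iff hζ]

theorem permVal_lt_gaps {b : Kind} {n : ℕ} {ζ : Perm (Fin n)} (hζ : ζ ∈ b.rotations n) {x : ℕ}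
    (hx : x < b.gaps n) : permVal ζ x < b.gaps n := by
  cases b
  · rwa [eq_one_of_mem_rotations hζ, permVal_one]
  · exact permVal_lt ζ hx

theorem permTube_range {b : Kind} {n : ℕ} {ζ : Perm (Fin n)} (hζ : ζ ∈ b.rotations n) :
    permTube ζ (Finset.range (b.gaps n)) = Finset.range (b.gaps n) := by
  ext x
  rw [mem_permTube, Finset.mem_range, Finset.mem_range]
  constructor
  · intro h
    rw [← permVal_self_inv ζ x]
    exact permVal_lt_gaps hζ h
  · exact permVal_lt_gaps (inv_mem hζ)

theorem permVal_permComp_shift {m h r : ℕ} (hr : r + 1 = m + (h + 1)) (i : Fin m)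
    (ζ : Perm (Fin m)) {z : ℕ} (hz : z ≤ h) :
    permVal (permComp hr i ζ (1 : Perm (Fin (h + 1)))) (i.1 + z) = (ζ i).1 + z := by
  have h1 := permVal_fin (permComp hr i ζ (1 : Perm (Fin (h + 1))))
    (inputs hr i (Sum.inr ⟨z, by omega⟩))
  rw [permComp_inr] at h1
  exact h1

theorem permVal_permComp_ins {m h r : ℕ} (hr : r + 1 = m + (h + 1)) (i : Fin m)
    (ζ : Perm (Fin m)) {x : ℕ} (hx : x < m) :
    permVal (permComp hr i ζ (1 : Perm (Fin (h + 1)))) (if x < i.1 then x else x + h) =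
      if permVal ζ x < (ζ i).1 then permVal ζ x else permVal ζ x + h := by
  by_cases hxi : x = i.1
  · subst hxi
    rw [if_neg (lt_irrefl _), permVal_fin, if_neg (lt_irrefl _)]
    exact permVal_permComp_shift hr i ζ le_rfl
  · have hy : (⟨x, hx⟩ : Fin m) ≠ i := fun he => hxi (congrArg Fin.val he)
    have h1 := permVal_fin (permComp hr i ζ (1 : Perm (Fin (h + 1)))) (inputs hr i (Sum.inl ⟨_, hy⟩))
    rw [permComp_inl_of_eq hr i _ ζ 1 rfl _ _ hy (ζ.injective.ne hy) rfl, inputs_inl_val,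
      inputs_inl_val, ← permVal_fin ζ ⟨x, hx⟩] at h1
    exact h1

/-- Rotations are compatible with the insertion of words. -/
theorem permTube_inflate {b : Kind} {m h r : ℕ} (hr : r + 1 = m + (h + 1)) (i : Fin m)
    {ζ : Perm (Fin m)} (hζ : ζ ∈ b.rotations m) {A : Finset ℕ} (hA : ∀ x ∈ A, x < b.gaps m) :
    permTube (permComp hr i ζ (1 : Perm (Fin (h + 1)))) (b.inflate m i h A) =
      b.inflate m (ζ i) h (permTube ζ A) := by
  -- One inclusion suffices: applied to the inverse rotation it gives the other one.
  have key : ∀ (i : Fin m) {ζ : Perm (Fin m)} (_ : ζ ∈ b.rotations m) {A : Finset ℕ}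
      (_ : ∀ x ∈ A, x < b.gaps m),
      permTube (permComp hr i ζ (1 : Perm (Fin (h + 1)))) (b.inflate m i h A) ⊆
        b.inflate m (ζ i) h (permTube ζ A) := by
    intro i ζ hζ A hA y hy
    have hA' : ∀ x ∈ permTube ζ A, x < b.gaps m := fun x hx => by
      rw [← permVal_self_inv ζ x]
      exact permVal_lt_gaps hζ (hA _ (mem_permTube.mp hx))
    obtain ⟨x, hx, rfl⟩ := Finset.mem_image.mp hy
    have hins : ∀ x ∈ A, permVal (permComp hr i ζ (1 : Perm (Fin (h + 1))))
        (if x < i.1 then x else x + h) ∈ b.inflate m (ζ i) h (permTube ζ A) := fun x hx => by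
      rw [permVal_permComp_ins hr i ζ ((hA x hx).trans_le gaps_le), mem_inflate_shift (ζ i).2 hA',
        permVal_mem_permTube]
      exact hx
    rcases (mem_inflate i.2 hA x).mp hx with h1 | h1 | h1
    · have := hins x h1.2
      rwa [if_pos h1.1] at this
    · obtain ⟨z, rfl⟩ := Nat.exists_eq_add_of_le h1.1
      rw [permVal_permComp_shift hr i ζ (by omega), mem_inflate (ζ i).2 hA']
      refine Or.inr (Or.inl ⟨by omega, by omega, ?_⟩)
      rw [← permVal_fin ζ i, ← permVal_prev (b.rotations_le _ hζ) i.2, permVal_mem_permTube,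
        permVal_mem_permTube]
      exact h1.2.2
    · have := hins _ h1.2
      rwa [if_neg (by omega), Nat.sub_add_cancel (by omega)] at this
  refine Finset.Subset.antisymm (key i hζ hA) ?_
  have hA' : ∀ x ∈ permTube ζ A, x < b.gaps m := fun x hx => by
    rw [← permVal_self_inv ζ x]
    exact permVal_lt_gaps hζ (hA _ (mem_permTube.mp hx))
  have h1 := key (ζ i) (inv_mem hζ) hA'
  rw [show ζ⁻¹ (ζ i) = i from ζ.symm_apply_apply i, permTube_inv_self] at h1
  have h2 : permComp hr i ζ (1 : Perm (Fin (h + 1))) * permComp hr (ζ i) ζ⁻¹ 1 = 1 := by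
    have := permComp_mul hr (ζ i) ζ ζ⁻¹ (1 : Perm (Fin (h + 1))) 1
    rw [show ζ⁻¹ (ζ i) = i from ζ.symm_apply_apply i, mul_inv_cancel, one_mul, permComp_one_one] at this
    exact this.symm
  have h3 := (permTube_subset_iff (permComp hr i ζ (1 : Perm (Fin (h + 1))))).mpr h1
  rwa [← permTube_mul, h2, permTube_one] at h3

theorem permTube_shift {m h r : ℕ} (hr : r + 1 = m + (h + 1)) (i : Fin m)
    (ζ : Perm (Fin m)) {A : Finset ℕ} (hA : ∀ x ∈ A, x < h) :
    permTube (permComp hr i ζ (1 : Perm (Fin (h + 1)))) (shift i A) = shift (ζ i) A := by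
  unfold permTube shift
  rw [Finset.image_image]
  exact Finset.image_congr fun x hx => permVal_permComp_shift hr i ζ (hA x hx).le

/-! ### Chains of bracketings -/

section

variable {k : Type u} [Field k] {b : Kind} {n : ℕ} {p : ℤ}

section Swap

variable {α W : Type*} (K : Type*) [Ring K] [AddCommGroup W] [Module K W] {F : List α → W}

theorem move_right_of_swap (hF : ∀ u x y v, F (u ++ x :: y :: v) = -F (u ++ y :: x :: v))
    (u : List α) (x : α) (v w : List α) :
    F (u ++ x :: (v ++ w)) = (-1 : K) ^ v.length • F (u ++ v ++ x :: w) := by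
  induction v generalizing u with
  | nil => simp
  | cons y v ih =>
    rw [List.cons_append, hF]
    have := ih (u ++ [y])
    simp only [List.append_assoc, List.singleton_append] at this
    rw [this, List.length_cons, pow_succ, mul_neg_one, neg_smul]
    simp

/-- The Koszul sign of exchanging two blocks of entries of an antisymmetric function. -/
theorem append_swap_of_swap (hF : ∀ u x y v, F (u ++ x :: y :: v) = -F (u ++ y :: x :: v))
    (u v w x : List α) :
    F (u ++ (v ++ (w ++ x))) = (-1 : K) ^ (v.length * w.length) • F (u ++ (w ++ (v ++ x))) := by
  induction v generalizing u with
  | nil => simp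
  | cons y v ih =>
    have h1 := ih (u ++ [y])
    simp only [List.append_assoc, List.singleton_append] at h1
    rw [List.cons_append, h1, move_right_of_swap K hF, smul_smul, List.length_cons, ← pow_add,
      Nat.add_one_mul, List.append_assoc, List.cons_append]

end Swap

/-- A list of tubes of a word of `n` letters that describes a cell of dimension `p`: it contains the
set of all gaps, and every further tube lowers the dimension by one. -/
structure Kind.Good (b : Kind) (n : ℕ) (p : ℤ) (L : List (Finset ℕ)) : Prop where
  pos : 1 ≤ n
  bracket : ∀ A ∈ L, b.IsBracket n A
  full : 0 < b.gaps n → Finset.range (b.gaps n) ∈ L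
  length : (L.length : ℤ) + p = b.gaps n

theorem Kind.Good.perm {L L' : List (Finset ℕ)} (h : b.Good n p L) (hp : L.Perm L') :
    b.Good n p L' :=
  ⟨h.pos, fun A hA => h.bracket A (hp.mem_iff.mpr hA), fun hg => hp.mem_iff.mp (h.full hg),
    by rw [← hp.length_eq]; exact h.length⟩

theorem good_perm_iff {L L' : List (Finset ℕ)} (hp : L.Perm L') : b.Good n p L ↔ b.Good n p L' :=
  ⟨fun h => h.perm hp, fun h => h.perm hp.symm⟩

theorem Kind.Good.rotate {L : List (Finset ℕ)} (h : b.Good n p L) {ζ : Perm (Fin n)}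
    (hζ : ζ ∈ b.rotations n) : b.Good n p (L.map (permTube ζ)) := by
  refine ⟨h.pos, fun A hA => ?_, fun hg => ?_, by rw [List.length_map]; exact h.length⟩
  · obtain ⟨B, hB, rfl⟩ := List.mem_map.mp hA
    exact (h.bracket B hB).permTube hζ
  · rw [← permTube_range hζ]
    exact List.mem_map_of_mem (h.full hg)

/-- The relations between lists of tubes: transposing two tubes changes the sign, lists with
repeated or incompatible tubes vanish, and a rotation of the word acts by its sign. -/
inductive TubeRel (k : Type u) [Field k] (b : Kind) (n : ℕ) (p : ℤ) :
    (Perm (Fin n) × List (Finset ℕ) →₀ k) → Prop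
  | bad (σ L) : ¬ b.Good n p L → TubeRel k b n p (Finsupp.single (σ, L) 1)
  | dup (σ u A v) : TubeRel k b n p (Finsupp.single (σ, u ++ A :: A :: v) 1)
  | swap (σ u A B v) : TubeRel k b n p
      (Finsupp.single (σ, u ++ A :: B :: v) 1 + Finsupp.single (σ, u ++ B :: A :: v) 1)
  | incompat (σ u A B v) : b.Incompat n A B →
      TubeRel k b n p (Finsupp.single (σ, u ++ A :: B :: v) 1)
  | rot (σ L ζ) : ζ ∈ b.rotations n → TubeRel k b n p
      (Finsupp.single (ζ * σ, L.map (permTube ζ)) 1 - Finsupp.single (σ, L) (sgnPerm k ζ))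

/-- The combinatorial model of the cellular chains of degree `p`: linear combinations of
permutations decorated by lists of tubes. -/
def TubeChain (k : Type u) [Field k] (b : Kind) (n : ℕ) (p : ℤ) : Type u :=
  (Perm (Fin n) × List (Finset ℕ) →₀ k) ⧸ Submodule.span k {x | TubeRel k b n p x}

instance : AddCommGroup (TubeChain k b n p) :=
  inferInstanceAs (AddCommGroup (_ ⧸ Submodule.span k {x | TubeRel k b n p x}))

instance : Module k (TubeChain k b n p) :=
  inferInstanceAs (Module k (_ ⧸ Submodule.span k {x | TubeRel k b n p x}))

/-- The class of a permutation with a list of tubes. -/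
def cell (k : Type u) [Field k] (b : Kind) {n : ℕ} (p : ℤ) (σ : Perm (Fin n))
    (L : List (Finset ℕ)) : TubeChain k b n p :=
  Submodule.Quotient.mk (Finsupp.single (σ, L) 1)

theorem TubeRel.mk_eq_zero {x : Perm (Fin n) × List (Finset ℕ) →₀ k} (h : TubeRel k b n p x) :
    (Submodule.Quotient.mk x : _ ⧸ Submodule.span k {x | TubeRel k b n p x}) = 0 :=
  (Submodule.Quotient.mk_eq_zero _).mpr (Submodule.subset_span h)

theorem cell_of_not_good (σ : Perm (Fin n)) {L : List (Finset ℕ)} (h : ¬ b.Good n p L) :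
    cell k b p σ L = 0 := (TubeRel.bad σ L h).mk_eq_zero

theorem cell_dup (σ : Perm (Fin n)) (u : List (Finset ℕ)) (A : Finset ℕ) (v : List (Finset ℕ)) :
    cell k b p σ (u ++ A :: A :: v) = 0 := (TubeRel.dup σ u A v).mk_eq_zero

theorem cell_swap (σ : Perm (Fin n)) (u : List (Finset ℕ)) (A B : Finset ℕ)
    (v : List (Finset ℕ)) :
    cell k b p σ (u ++ A :: B :: v) = - cell k b p σ (u ++ B :: A :: v) :=
  eq_neg_of_add_eq_zero_left (TubeRel.swap σ u A B v).mk_eq_zero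

theorem cell_incompat (σ : Perm (Fin n)) (u : List (Finset ℕ)) {A B : Finset ℕ}
    (v : List (Finset ℕ)) (h : b.Incompat n A B) :
    cell k b p σ (u ++ A :: B :: v) = 0 := (TubeRel.incompat σ u A B v h).mk_eq_zero

theorem cell_rot (σ : Perm (Fin n)) (L : List (Finset ℕ)) {ζ : Perm (Fin n)}
    (h : ζ ∈ b.rotations n) :
    cell k b p (ζ * σ) (L.map (permTube ζ)) = sgnPerm k ζ • cell k b p σ L := by
  have h1 := (TubeRel.rot (k := k) (p := p) σ L ζ h).mk_eq_zero
  rw [show (Finsupp.single (σ, L) (sgnPerm k ζ) : Perm (Fin n) × List (Finset ℕ) →₀ k) =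
    sgnPerm k ζ • Finsupp.single (σ, L) 1 by rw [Finsupp.smul_single, smul_eq_mul, mul_one]] at h1
  exact sub_eq_zero.mp h1

/-- The conditions for a function of permutations and lists of tubes to define a linear map on
the model of the chains. -/
structure IsAdmissible {W : Type*} [AddCommGroup W] [Module k W] (b : Kind) (n : ℕ) (p : ℤ)
    (f : Perm (Fin n) → List (Finset ℕ) → W) : Prop where
  dup : ∀ σ u A v, b.Good n p (u ++ A :: A :: v) → f σ (u ++ A :: A :: v) = 0
  swap : ∀ σ u A B v, b.Good n p (u ++ A :: B :: v) →
    f σ (u ++ A :: B :: v) = - f σ (u ++ B :: A :: v)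
  incompat : ∀ σ u A B v, b.Good n p (u ++ A :: B :: v) → b.Incompat n A B →
    f σ (u ++ A :: B :: v) = 0
  rot : ∀ σ L ζ, b.Good n p L → ζ ∈ b.rotations n →
    f (ζ * σ) (L.map (permTube ζ)) = sgnPerm k ζ • f σ L

section Lift

variable {W : Type*} [AddCommGroup W] [Module k W]

open Classical in
/-- The linear map defined by an admissible function. -/
def TubeChain.lift {f : Perm (Fin n) → List (Finset ℕ) → W} (hf : IsAdmissible (k := k) b n p f) :
    TubeChain k b n p →ₗ[k] W :=
  Submodule.liftQ _ (Finsupp.linearCombination k fun x : Perm (Fin n) × List (Finset ℕ) =>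
    if b.Good n p x.2 then f x.1 x.2 else 0) (by
      rw [Submodule.span_le]
      rintro x hx
      rw [SetLike.mem_coe, LinearMap.mem_ker]
      cases hx with
      | bad σ L h => simp [h]
      | dup σ u A v =>
        by_cases h : b.Good n p (u ++ A :: A :: v)
        · simp [h, hf.dup _ _ _ _ h]
        · simp [h]
      | swap σ u A B v =>
        have hp : (u ++ B :: A :: v).Perm (u ++ A :: B :: v) :=
          (List.Perm.swap _ _ _).append_left u
        have h' := good_perm_iff (b := b) (n := n) (p := p) hp
        by_cases h : b.Good n p (u ++ A :: B :: v)
        · simp [h, h', hf.swap _ _ _ _ _ h]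
        · simp [h, h']
      | incompat σ u A B v hi =>
        by_cases h : b.Good n p (u ++ A :: B :: v)
        · simp [h, hf.incompat _ _ _ _ _ h hi]
        · simp [h]
      -- Rotated lists are good together, so that both terms are in the same case of the `if`.
      | rot σ L ζ hζ =>
        have h' : b.Good n p (L.map (permTube ζ)) ↔ b.Good n p L := by
          refine ⟨fun h => ?_, fun h => h.rotate hζ⟩
          have := h.rotate (inv_mem hζ)
          rw [List.map_map, show permTube ζ⁻¹ ∘ permTube ζ = id from
            funext fun A => permTube_inv_self ζ A, List.map_id] at this
          exact this
        by_cases h : b.Good n p L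
        · simp [h, h', hf.rot _ _ _ h hζ]
        · simp [h, h'])

theorem TubeChain.lift_cell {f : Perm (Fin n) → List (Finset ℕ) → W}
    (hf : IsAdmissible (k := k) b n p f) (σ : Perm (Fin n)) {L : List (Finset ℕ)}
    (hL : b.Good n p L) : TubeChain.lift hf (cell k b p σ L) = f σ L := by
  refine (Submodule.liftQ_apply _ _ _).trans ?_
  simp [hL]

theorem TubeChain.ext {F G : TubeChain k b n p →ₗ[k] W}
    (h : ∀ σ L, b.Good n p L → F (cell k b p σ L) = G (cell k b p σ L)) : F = G := by
  refine Submodule.linearMap_qext _ (Finsupp.lhom_ext' fun ⟨σ, L⟩ => LinearMap.ext_ring ?_)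
  by_cases hL : b.Good n p L
  · exact h σ L hL
  · change F (cell k b p σ L) = G (cell k b p σ L)
    rw [cell_of_not_good σ hL, map_zero, map_zero]

end Lift

theorem cell_move_right (σ : Perm (Fin n)) (u : List (Finset ℕ)) (A : Finset ℕ)
    (v w : List (Finset ℕ)) :
    cell k b p σ (u ++ A :: (v ++ w)) = (-1 : k) ^ v.length • cell k b p σ (u ++ v ++ A :: w) :=
  move_right_of_swap k (cell_swap σ) u A v w

theorem cell_append_swap (σ : Perm (Fin n)) (u v w x : List (Finset ℕ)) :
    cell k b p σ (u ++ (v ++ (w ++ x))) =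
      (-1 : k) ^ (v.length * w.length) • cell k b p σ (u ++ (w ++ (v ++ x))) :=
  append_swap_of_swap k (cell_swap σ) u v w x

/-- A permutation of the tubes changes at most the sign. -/
theorem cell_perm (σ : Perm (Fin n)) {L L' : List (Finset ℕ)} (h : L.Perm L') :
    ∃ ε : ℤˣ, ∀ (u v : List (Finset ℕ)),
      cell k b p σ (u ++ (L ++ v)) = ε • cell k b p σ (u ++ (L' ++ v)) := by
  induction h with
  | nil => exact ⟨1, fun u v => (one_smul _ _).symm⟩
  | cons A h ih =>
    obtain ⟨ε, hε⟩ := ih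
    refine ⟨ε, fun u v => ?_⟩
    simpa using hε (u ++ [A]) v
  | swap A B l =>
    refine ⟨-1, fun u v => ?_⟩
    rw [Units.neg_smul, one_smul]
    exact cell_swap σ u B A (l ++ v)
  | trans h1 h2 ih1 ih2 =>
    obtain ⟨ε, hε⟩ := ih1
    obtain ⟨ε', hε'⟩ := ih2
    exact ⟨ε * ε', fun u v => by rw [hε, hε', mul_smul]⟩

theorem cell_eq_zero_of_perm (σ : Perm (Fin n)) {L L' : List (Finset ℕ)} (h : L.Perm L')
    (h0 : cell k b p σ L' = 0) : cell k b p σ L = 0 := by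
  obtain ⟨ε, hε⟩ := cell_perm (k := k) (b := b) (p := p) σ h
  have := hε [] []
  simp only [List.nil_append, List.append_nil] at this
  rw [this, h0, smul_zero]

theorem cell_of_incompat (σ : Perm (Fin n)) {L : List (Finset ℕ)} {A B : Finset ℕ} (hA : A ∈ L)
    (hB : B ∈ L) (h : b.Incompat n A B) : cell k b p σ L = 0 := by
  have hne : B ≠ A := fun he => h.1 (he ▸ subset_rfl)
  obtain ⟨s, t, rfl⟩ := List.append_of_mem hA
  have hp : (s ++ A :: t).Perm (A :: (s ++ t)) := List.perm_middle
  have hB' : B ∈ s ++ t := by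
    have := hp.mem_iff.mp hB
    exact (List.mem_cons.mp this).resolve_left hne
  obtain ⟨s', t', h'⟩ := List.append_of_mem hB'
  rw [h'] at hp
  exact cell_eq_zero_of_perm σ (hp.trans (List.perm_middle.cons A))
    (cell_incompat σ [] (s' ++ t') h)

theorem cell_of_not_nodup (σ : Perm (Fin n)) {L : List (Finset ℕ)} (h : ¬ L.Nodup) :
    cell k b p σ L = 0 := by
  obtain ⟨A, hA⟩ := List.exists_duplicate_iff_not_nodup.mpr h
  obtain ⟨L', hp⟩ := (List.duplicate_iff_sublist.mp hA).exists_perm_append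
  exact cell_eq_zero_of_perm σ hp (cell_dup σ [] A L')

end

/-! ### Composition and symmetries of chains of bracketings -/

section

variable {k : Type u} [Field k] {b : Kind} {n : ℕ} {p : ℤ}

theorem sgnPow_add (p q : ℤ) : sgnPow k (p + q) = sgnPow k p * sgnPow k q := by
  simp [sgnPow, Int.negOnePow_add]

theorem sgnPow_natCast (m : ℕ) : sgnPow k (m : ℤ) = (-1) ^ m := by
  simp [sgnPow, Int.negOnePow_def]

theorem sgnPow_even {p : ℤ} (h : Even p) : sgnPow k p = 1 := by
  simp [sgnPow, Int.negOnePow_even p h]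

theorem sgnPow_congr {p q : ℤ} (h : Even (p - q)) : sgnPow k p = sgnPow k q := by
  rw [← sub_add_cancel p q, sgnPow_add, sgnPow_even h, one_mul]

theorem sgnPow_mul_self (p : ℤ) : sgnPow k p * sgnPow k p = 1 := by
  rw [← sgnPow_add, sgnPow_even ⟨p, rfl⟩]

theorem sgnPerm_mul (σ τ : Perm (Fin n)) : sgnPerm k (σ * τ) = sgnPerm k σ * sgnPerm k τ := by
  simp [sgnPerm]

theorem sgnPerm_inv (σ : Perm (Fin n)) : sgnPerm k σ⁻¹ = sgnPerm k σ := by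
  simp [sgnPerm]

theorem sgnPerm_mul_self (σ : Perm (Fin n)) : sgnPerm k σ * sgnPerm k σ = 1 := by
  rw [← sgnPerm_mul]
  simp only [sgnPerm, Perm.sign_mul]
  rw [Int.units_mul_self]
  simp

theorem sgnPerm_permComp {m h r : ℕ} (hr : r + 1 = m + (h + 1)) (i : Fin m) (σ : Perm (Fin m))
    (τ : Perm (Fin (h + 1))) : sgnPerm k (permComp hr i σ τ) =
      sgnPerm k σ * sgnPerm k τ * sgnPow k (h * (((σ i).1 : ℤ) + (i.1 : ℤ))) := by
  have h1 := sign_permComp hr i σ τ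
  have h2 : sgnPow k (h * (((σ i).1 : ℤ) + (i.1 : ℤ))) =
      sgnPow k (((h + 1 + 1) * ((σ i).1 + i.1) : ℕ) : ℤ) := by
    refine sgnPow_congr ⟨-((σ i).1 + i.1 : ℤ), ?_⟩
    push_cast
    ring
  rw [h2, sgnPow_natCast]
  unfold sgnPerm
  rw [h1]
  push_cast
  ring

theorem permComp_unit_left {h : n + 1 = 1 + n} (i : Fin 1) (τ : Perm (Fin n)) (σ : Perm (Fin 1)) :
    permComp h i σ τ = τ := by
  have hσ : (σ i).1 = 0 := by omega
  ext x
  have h1 := permComp_inr_of_eq h i (σ i) σ τ rfl x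
  have h2 : ∀ (i : Fin 1) (x : Fin n), inputs h i (Sum.inr x) = x := fun i x => by
    ext; rw [inputs_inr_val]; omega
  rw [h2, h2] at h1
  rw [h1]

theorem permComp_unit_right {h : n + 1 = n + 1} (i : Fin n) (σ : Perm (Fin n)) (τ : Perm (Fin 1)) :
    permComp h i σ τ = σ := by
  have h2 : ∀ (i : Fin n) (x : Fin 1), inputs h i (Sum.inr x) = i := fun i x => by
    ext; rw [inputs_inr_val]; omega
  have h3 : ∀ (i : Fin n) (y : Fin n) (hy : y ≠ i), inputs h i (Sum.inl ⟨y, hy⟩) = y :=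
    fun i y hy => by ext; rw [inputs_inl_val]; split_ifs <;> omega
  ext x
  by_cases hx : x = i
  · have h1 := permComp_inr_of_eq h i (σ i) σ τ rfl 0
    rw [h2, h2] at h1
    rw [hx, h1]
  · have h1 := permComp_inl_of_eq h i (σ i) σ τ rfl x (σ x) hx (σ.injective.ne hx) rfl
    rw [h3, h3] at h1
    rw [h1]

/-- The list of tubes of a composite. -/
def graft (b : Kind) (m j h : ℕ) (L L' : List (Finset ℕ)) : List (Finset ℕ) :=
  L.map (b.inflate m j h) ++ L'.map (shift j)

theorem Kind.Good.graft {m h j : ℕ} {p q : ℤ} (hj : j < m) {L L' : List (Finset ℕ)}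
    (hL : b.Good m p L) (hL' : Kind.operad.Good (h + 1) q L') :
    b.Good (m + h) (p + q) (graft b m j h L L') := by
  refine ⟨by have := hL.pos; omega, fun A hA => ?_, fun hg => ?_, ?_⟩
  · rcases List.mem_append.mp hA with hA | hA
    · obtain ⟨B, hB, rfl⟩ := List.mem_map.mp hA
      have h1 := hL.bracket B hB
      exact (inflate_isBracket_iff hj h1.nonempty fun x hx => h1.lt hx).mpr h1
    · obtain ⟨B, hB, rfl⟩ := List.mem_map.mp hA
      exact (hL'.bracket B hB).shift hj
  · rw [gaps_add h hL.pos] at hg ⊢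
    -- The set of all gaps comes from the outer word, or from the inserted word if the outer word
    -- has no gaps.
    rcases Nat.eq_zero_or_pos (b.gaps m) with h0 | h0
    · have h1 : j = 0 := by
        have := le_gaps (b := b) (n := m)
        omega
      refine List.mem_append_right _ (List.mem_map.mpr ⟨_, hL'.full ?_, ?_⟩)
      · simp only [Kind.gaps]; omega
      · rw [h1, shift_zero, h0]; simp [Kind.gaps]
    · refine List.mem_append_left _ (List.mem_map.mpr ⟨_, hL.full h0, ?_⟩)
      rw [inflate_range hj h0, gaps_add h hL.pos]
  · have h1 := hL.length
    have h2 := hL'.length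
    rw [gaps_add h hL.pos]
    simp only [Cyclo.graft, List.length_append, List.length_map]
    simp only [Kind.gaps] at h2
    push_cast at *
    omega

/-- The sign of the composition at the `j`-th place of cells of degrees `p` and `q`, the second one
given by a word with `h` gaps. It has `h - q` tubes, whose normal vectors move past the `p` vectors
of a frame of the first cell; the summand `j * h` comes from moving its `h` coordinates past the `j`
coordinates before them. -/
def graftSign (k : Type u) [Field k] (p q : ℤ) (j h : ℕ) : k :=
  sgnPow k ((h - q) * p + j * h)

section

variable {m h r : ℕ} (hr : r + 1 = m + (h + 1)) (i : Fin m) {q s : ℤ}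

/-- Composition with a fixed cell. -/
theorem admissible_right (σ : Perm (Fin m)) (L : List (Finset ℕ)) :
    IsAdmissible (k := k) .operad (h + 1) q (fun τ L' => graftSign k p q (σ i) h •
      cell k b s (permComp hr i σ τ) (graft b m (σ i) h L L')) where
  dup τ u A v hg := by
    simp only [graft, List.map_append, List.map_cons, ← List.append_assoc]
    rw [cell_dup, smul_zero]
  swap τ u A B v hg := by
    simp only [graft, List.map_append, List.map_cons, ← List.append_assoc]
    rw [cell_swap, smul_neg]
  incompat τ u A B v hg hi := by
    simp only [graft, List.map_append, List.map_cons, ← List.append_assoc]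
    obtain rfl : r = m + h := by omega
    rw [cell_incompat, smul_zero]
    have hA := hg.bracket A (by simp)
    have hB := hg.bracket B (by simp)
    exact (shift_incompat_iff (σ i).2 hA hB).mpr hi
  rot τ L' ζ hg hζ := by
    rw [eq_one_of_mem_rotations hζ]
    have : permTube (1 : Perm (Fin (h + 1))) = id := funext fun A => permTube_one A
    rw [one_mul, this, List.map_id]
    simp [sgnPerm]

/-- Compatibility of the composition with the relations in the outer factor. Rotations are respected
because the sign of the composite of a rotation accounts for the change of the place of insertion in
`graftSign`. -/
theorem admissible_left :
    IsAdmissible (k := k) b m p (fun σ L => (TubeChain.lift (admissible_right (p := p) hr i σ L) :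
      TubeChain k .operad (h + 1) q →ₗ[k] TubeChain k b r s)) where
  dup σ u A v hg := by
    refine TubeChain.ext fun τ L' hL' => ?_
    rw [TubeChain.lift_cell _ _ hL']
    simp only [graft, List.map_append, List.map_cons, List.append_assoc, List.cons_append]
    rw [cell_dup, smul_zero, LinearMap.zero_apply]
  swap σ u A B v hg := by
    refine TubeChain.ext fun τ L' hL' => ?_
    rw [LinearMap.neg_apply, TubeChain.lift_cell _ _ hL', TubeChain.lift_cell _ _ hL']
    simp only [graft, List.map_append, List.map_cons, List.append_assoc, List.cons_append]
    rw [cell_swap, smul_neg]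
  incompat σ u A B v hg hi := by
    refine TubeChain.ext fun τ L' hL' => ?_
    rw [TubeChain.lift_cell _ _ hL']
    simp only [graft, List.map_append, List.map_cons, List.append_assoc, List.cons_append]
    obtain rfl : r = m + h := by omega
    rw [cell_incompat, smul_zero, LinearMap.zero_apply]
    have hA := hg.bracket A (by simp)
    have hB := hg.bracket B (by simp)
    exact (inflate_incompat_iff (σ i).2 hA hB).mpr hi
  rot σ L ζ hg hζ := by
    refine TubeChain.ext fun τ L' hL' => ?_
    rw [LinearMap.smul_apply, TubeChain.lift_cell _ _ hL', TubeChain.lift_cell _ _ hL']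
    have h1 := permComp_mul hr i ζ σ 1 τ
    rw [one_mul] at h1
    have h2 : graft b m ((ζ * σ) i) h (L.map (permTube ζ)) L' =
        (graft b m (σ i) h L L').map (permTube (permComp hr (σ i) ζ 1)) := by
      simp only [graft, List.map_append, List.map_map]
      congr 1
      · refine List.map_congr_left fun A hA => ?_
        exact (permTube_inflate hr (σ i) hζ fun x hx => (hg.bracket A hA).lt hx).symm
      · refine List.map_congr_left fun A hA => ?_
        exact (permTube_shift hr (σ i) ζ fun x hx => (hL'.bracket A hA).lt hx).symm
    rw [h1, h2, cell_rot _ _ (permComp_mem_rotations hr (by omega) _ hζ), smul_smul, smul_smul,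
      sgnPerm_permComp]
    congr 1
    have h3 : sgnPerm k (1 : Perm (Fin (h + 1))) = 1 := by simp [sgnPerm]
    rw [h3, mul_one]
    unfold graftSign
    rw [mul_left_comm, ← sgnPow_add]
    congr 1
    refine sgnPow_congr ⟨h * ((ζ (σ i)).1 : ℤ), ?_⟩
    rw [Perm.mul_apply]
    ring

/-- The structure maps `∘_i` on the model of the chains. -/
def TubeChain.compAux : TubeChain k b m p →ₗ[k] TubeChain k .operad (h + 1) q →ₗ[k]
    TubeChain k b r s :=
  TubeChain.lift (admissible_left (k := k) hr i)

end

/-- The structure maps `∘_i` on the model of the chains. -/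
def TubeChain.comp : ∀ {m n r : ℕ} (_ : r + 1 = m + n) (_ : Fin m) {p q s : ℤ} (_ : p + q = s),
    TubeChain k b m p →ₗ[k] TubeChain k .operad n q →ₗ[k] TubeChain k b r s
  | _, 0, _, _, _, _, _, _, _ => 0
  | _, _ + 1, _, hr, i, _, _, _, _ => TubeChain.compAux hr i

theorem TubeChain.comp_cell {m h r : ℕ} (hr : r + 1 = m + (h + 1)) (i : Fin m) {p q s : ℤ}
    (hs : p + q = s) (σ : Perm (Fin m)) (τ : Perm (Fin (h + 1))) {L L' : List (Finset ℕ)}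
    (hL : b.Good m p L) (hL' : Kind.operad.Good (h + 1) q L') :
    TubeChain.comp hr i hs (cell k b p σ L) (cell k .operad q τ L') =
      graftSign k p q (σ i) h • cell k b s (permComp hr i σ τ) (graft b m (σ i) h L L') := by
  change TubeChain.compAux hr i _ _ = _
  rw [TubeChain.compAux, TubeChain.lift_cell _ _ hL, TubeChain.lift_cell _ _ hL']

theorem admissible_act (ρ : Perm (Fin n)) :
    IsAdmissible (k := k) b n p (fun σ L => cell k b p (σ * ρ) L) where
  dup σ u A v _ := cell_dup _ _ _ _
  swap σ u A B v _ := cell_swap _ _ _ _ _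
  incompat σ u A B v _ hi := cell_incompat _ _ _ hi
  rot σ L ζ _ hζ := by rw [mul_assoc, cell_rot _ _ hζ]

/-- The right action of the symmetric group on the model of the chains. -/
def TubeChain.act (ρ : Perm (Fin n)) : TubeChain k b n p →ₗ[k] TubeChain k b n p :=
  TubeChain.lift (admissible_act ρ)

theorem TubeChain.act_cell (ρ σ : Perm (Fin n)) (L : List (Finset ℕ)) :
    TubeChain.act ρ (cell k b p σ L) = cell k b p (σ * ρ) L := by
  by_cases hL : b.Good n p L
  · exact TubeChain.lift_cell _ _ hL
  · rw [cell_of_not_good _ hL, cell_of_not_good _ hL, map_zero]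

end

/-! ### The boundary: adding a tube -/

section

variable {k : Type u} [Field k] {b : Kind} {n : ℕ} {p : ℤ}

open Classical in
/-- The set of all brackets in a word of `n` letters. -/
def brackets (b : Kind) (n : ℕ) : Finset (Finset ℕ) :=
  (Finset.range (b.gaps n)).powerset.filter fun A => b.IsBracket n A

theorem mem_brackets {A : Finset ℕ} : A ∈ brackets b n ↔ b.IsBracket n A := by
  classical
  rw [brackets, Finset.mem_filter, Finset.mem_powerset]
  exact ⟨fun h => h.2, fun h => ⟨h.subset_range, h⟩⟩

theorem admissible_boundary (p' : ℤ) : IsAdmissible (k := k) b n p (fun σ L =>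
    ∑ A ∈ brackets b n, cell k b p' σ (L ++ [A])) where
  dup σ u A v _ := Finset.sum_eq_zero fun B _ => by
    rw [List.append_assoc]; exact cell_dup _ _ _ _
  swap σ u A B v _ := by
    rw [← Finset.sum_neg_distrib]
    refine Finset.sum_congr rfl fun C _ => ?_
    rw [List.append_assoc, List.append_assoc]
    exact cell_swap _ _ _ _ _
  incompat σ u A B v _ hi := Finset.sum_eq_zero fun C _ => by
    rw [List.append_assoc]; exact cell_incompat _ _ _ hi
  -- A rotation permutes the brackets.
  rot σ L ζ _ hζ := by
    rw [Finset.smul_sum]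
    symm
    refine Finset.sum_bij (fun A _ => permTube ζ A) (fun A hA => ?_) (fun A _ B _ h => permTube_inj ζ h)
      (fun A hA => ⟨permTube ζ⁻¹ A, ?_, permTube_self_inv ζ A⟩) fun A hA => ?_
    · exact mem_brackets.mpr ((mem_brackets.mp hA).permTube hζ)
    · exact mem_brackets.mpr ((mem_brackets.mp hA).permTube (inv_mem hζ))
    · rw [← cell_rot _ _ hζ, List.map_append, List.map_singleton]

/-- The boundary on the model of the chains: the sum over all ways to add one more tube. -/
def TubeChain.boundary {p p' : ℤ} (_ : p' + 1 = p) : TubeChain k b n p →ₗ[k] TubeChain k b n p' :=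
  TubeChain.lift (admissible_boundary p')

theorem TubeChain.boundary_cell {p p' : ℤ} (hp : p' + 1 = p) (σ : Perm (Fin n))
    {L : List (Finset ℕ)} (hL : b.Good n p L) :
    TubeChain.boundary hp (cell k b p σ L) = ∑ A ∈ brackets b n, cell k b p' σ (L ++ [A]) :=
  TubeChain.lift_cell _ _ hL

theorem Kind.Good.append {p p' : ℤ} (hp : p' + 1 = p) {L : List (Finset ℕ)} (hL : b.Good n p L)
    {A : Finset ℕ} (hA : b.IsBracket n A) : b.Good n p' (L ++ [A]) := by
  refine ⟨hL.pos, fun B hB => ?_, fun hg => List.mem_append_left _ (hL.full hg), ?_⟩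
  · rcases List.mem_append.mp hB with h | h
    · exact hL.bracket B h
    · rw [List.mem_singleton.mp h]; exact hA
  · have := hL.length
    rw [List.length_append, List.length_singleton]
    push_cast
    omega

/-- Adding two tubes in the two possible orders gives opposite cells. -/
theorem TubeChain.boundary_boundary {p p' p'' : ℤ} (hp : p' + 1 = p) (hp' : p'' + 1 = p')
    (x : TubeChain k b n p) : TubeChain.boundary hp' (TubeChain.boundary hp x) = 0 := by
  suffices h : (TubeChain.boundary hp') ∘ₗ (TubeChain.boundary hp) =
      (0 : TubeChain k b n p →ₗ[k] TubeChain k b n p'') from LinearMap.congr_fun h x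
  refine TubeChain.ext fun σ L hL => ?_
  rw [LinearMap.comp_apply, TubeChain.boundary_cell hp σ hL, map_sum, LinearMap.zero_apply]
  have h1 : ∀ A ∈ brackets b n, TubeChain.boundary hp' (cell k b p' σ (L ++ [A])) =
      ∑ B ∈ brackets b n, cell k b p'' σ (L ++ [A, B]) := fun A hA => by
    rw [TubeChain.boundary_cell hp' σ (hL.append hp (mem_brackets.mp hA))]
    simp only [List.append_assoc, List.singleton_append]
  rw [Finset.sum_congr rfl h1, ← Finset.sum_product']
  refine Finset.sum_involution (fun x _ => (x.2, x.1)) (fun x _ => ?_) (fun x _ hx he => hx ?_)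
    (fun x hx => ?_) (fun x _ => rfl)
  · rw [cell_swap σ L x.1 x.2 [], neg_add_cancel]
  · rw [← (congrArg Prod.fst he : x.2 = x.1)]
    exact cell_dup σ L x.2 []
  · rw [Finset.mem_product] at *
    exact ⟨hx.2, hx.1⟩

theorem TubeChain.boundary_act {p p' : ℤ} (hp : p' + 1 = p) (ρ : Perm (Fin n))
    (x : TubeChain k b n p) :
    TubeChain.boundary hp (TubeChain.act ρ x) = TubeChain.act ρ (TubeChain.boundary hp x) := by
  suffices h : (TubeChain.boundary hp) ∘ₗ (TubeChain.act ρ) =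
      (TubeChain.act ρ : TubeChain k b n p' →ₗ[k] _) ∘ₗ (TubeChain.boundary hp) from
    LinearMap.congr_fun h x
  refine TubeChain.ext fun σ L hL => ?_
  simp only [LinearMap.comp_apply, TubeChain.act_cell, TubeChain.boundary_cell hp _ hL, map_sum]

/-- The brackets in a composite word that are compatible with the inserted one are the brackets in
the outer word and the brackets in the inserted word. -/
theorem sum_brackets_graft {W : Type*} [AddCommMonoid W] {m j h : ℕ} (hj : j < m)
    (f : Finset ℕ → W)
    (hf : ∀ J, b.IsBracket (m + h) J → b.Incompat (m + h) J (Finset.Ico j (j + h)) → 0 < h →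
      f J = 0) :
    ∑ J ∈ brackets b (m + h), f J = ∑ A ∈ brackets b m, f (b.inflate m j h A) +
      ∑ A ∈ brackets .operad (h + 1), f (shift j A) := by
  have hlt : ∀ A ∈ brackets b m, ∀ x ∈ A, x < b.gaps m := fun A hA x hx =>
    (mem_brackets.mp hA).lt hx
  rw [← Finset.sum_image (f := f) (g := b.inflate m j h),
    ← Finset.sum_image (f := f) (g := shift j), ← Finset.sum_union]
  · symm
    refine Finset.sum_subset (fun J hJ => ?_) fun J hJ hn => ?_
    · rw [mem_brackets]
      rcases Finset.mem_union.mp hJ with hJ | hJ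
      · obtain ⟨A, hA, rfl⟩ := Finset.mem_image.mp hJ
        exact (inflate_isBracket_iff hj (mem_brackets.mp hA).nonempty (hlt A hA)).mpr
          (mem_brackets.mp hA)
      · obtain ⟨A, hA, rfl⟩ := Finset.mem_image.mp hJ
        exact (mem_brackets.mp hA).shift hj
    · rw [mem_brackets] at hJ
      rw [Finset.mem_union, not_or, Finset.mem_image, Finset.mem_image] at hn
      rcases Nat.eq_zero_or_pos h with rfl | hh
      · refine absurd ⟨J, mem_brackets.mpr hJ, ?_⟩ hn.1
        exact inflate_zero hj fun x hx => hJ.lt hx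
      · by_contra h0
        have hc : ¬ b.Incompat (m + h) J (Finset.Ico j (j + h)) := fun hc => h0 (hf J hJ hc hh)
        by_cases hs : J ⊆ Finset.Ico j (j + h)
        · obtain ⟨A, hA, rfl⟩ := exists_eq_shift hj hJ hs
          exact hn.2 ⟨A, mem_brackets.mpr hA, rfl⟩
        · obtain ⟨A, hA, rfl⟩ := exists_eq_inflate hj hh hJ hc hs
          exact hn.1 ⟨A, mem_brackets.mpr hA, rfl⟩
  · rw [Finset.disjoint_left]
    intro J h1 h2
    obtain ⟨A, hA, rfl⟩ := Finset.mem_image.mp h1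
    obtain ⟨A', hA', he⟩ := Finset.mem_image.mp h2
    refine not_subset_block hj (mem_brackets.mp hA) (h := h) ?_
    rw [← he, ← shift_range, shift_subset_iff]
    exact (mem_brackets.mp hA').subset_range
  · exact fun A _ B _ h => shift_inj h
  · exact fun A hA B hB h => inflate_inj hj (hlt A hA) (hlt B hB) h

/-- The boundary is a derivation of the compositions: a tube that is compatible with the tube of the
inserted word is a tube of one of the two words. -/
theorem TubeChain.boundary_comp {m n r : ℕ} (hr : r + 1 = m + n) (i : Fin m) {p p' q q' s s' : ℤ}
    (hp : p' + 1 = p) (hq : q' + 1 = q) (hs : s' + 1 = s) (hpq : p + q = s)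
    (x : TubeChain k b m p) (y : TubeChain k .operad n q) :
    TubeChain.boundary hs (TubeChain.comp hr i hpq x y) =
      TubeChain.comp hr i (by omega) (TubeChain.boundary hp x) y +
        sgnPow k p • TubeChain.comp hr i (by omega) x (TubeChain.boundary hq y) := by
  obtain _ | h := n
  · change TubeChain.boundary hs 0 = 0 + sgnPow k p • (0 : TubeChain k b r s')
    rw [map_zero, smul_zero, add_zero]
  suffices key : (TubeChain.comp (k := k) (b := b) hr i hpq).compr₂ (TubeChain.boundary hs) =
      (TubeChain.comp hr i (by omega : p' + q = s')) ∘ₗ (TubeChain.boundary hp) +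
        sgnPow k p • (TubeChain.comp hr i (by omega : p + q' = s')).compl₂
          (TubeChain.boundary hq) from LinearMap.congr_fun (LinearMap.congr_fun key x) y
  refine TubeChain.ext fun σ L hL => TubeChain.ext fun τ L' hL' => ?_
  obtain rfl : r = m + h := by omega
  have hj := (σ i).2
  simp only [LinearMap.compr₂_apply, LinearMap.add_apply, LinearMap.comp_apply,
    LinearMap.smul_apply, LinearMap.compl₂_apply, TubeChain.boundary_cell hp σ hL,
    TubeChain.boundary_cell hq τ hL', map_sum, LinearMap.sum_apply,
    TubeChain.comp_cell hr i hpq σ τ hL hL', map_smul]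
  rw [TubeChain.boundary_cell hs _ (hpq ▸ hL.graft hj hL'),
    sum_brackets_graft hj, smul_add, Finset.smul_sum, Finset.smul_sum, Finset.smul_sum]
  · congr 1
    · refine Finset.sum_congr rfl fun A hA => ?_
      rw [TubeChain.comp_cell hr i _ σ τ (hL.append hp (mem_brackets.mp hA)) hL']
      -- A new tube of the outer word has to pass the `h - q` tubes of the inserted word.
      have h1 := cell_move_right (k := k) (b := b) (p := s') (permComp hr i σ τ)
        (L.map (b.inflate m (σ i) h)) (b.inflate m (σ i) h A) (L'.map (shift (σ i))) []
      simp only [graft, List.map_append, List.map_singleton, List.append_assoc,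
        List.singleton_append, List.append_nil] at h1 ⊢
      rw [h1, smul_smul]
      congr 1
      rw [List.length_map, ← sgnPow_natCast]
      unfold graftSign
      rw [← sgnPow_add]
      refine sgnPow_congr ⟨0, ?_⟩
      have h2 := hL'.length
      simp only [Kind.gaps] at h2
      push_cast at h2
      rw [show (L'.length : ℤ) = h - q by omega, show p' = p - 1 by omega]
      ring
    · refine Finset.sum_congr rfl fun A hA => ?_
      rw [TubeChain.comp_cell hr i _ σ τ hL (hL'.append hq (mem_brackets.mp hA)), smul_smul]
      congr 1
      · unfold graftSign
        rw [← sgnPow_add]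
        refine sgnPow_congr ⟨-p, ?_⟩
        rw [show q' = q - 1 by omega]
        ring
      · simp only [graft, List.map_append, List.map_singleton, List.append_assoc]
  -- A tube incompatible with the one of the whole inserted word gives a vanishing cell.
  · intro J hJ hi hh
    refine cell_of_incompat _ (List.mem_append_right _ (List.mem_singleton_self J))
      (List.mem_append_left _ ?_) hi
    refine List.mem_append_right _ (List.mem_map.mpr ⟨_, hL'.full (by simpa [Kind.gaps] using hh), ?_⟩)
    rw [shift_range]
    simp [Kind.gaps]

end

/-! ### The operad axioms for chains of bracketings -/

section

variable {k : Type u} [Field k] {b : Kind} {n : ℕ} {p : ℤ}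

@[elab_as_elim]
theorem TubeChain.induction {P : TubeChain k b n p → Prop}
    (cell : ∀ σ L, b.Good n p L → P (cell k b p σ L)) (zero : P 0)
    (add : ∀ x y, P x → P y → P (x + y)) (smul : ∀ (a : k) x, P x → P (a • x))
    (x : TubeChain k b n p) : P x := by
  obtain ⟨y, rfl⟩ := Submodule.Quotient.mk_surjective _ x
  induction y using Finsupp.induction_linear with
  | zero => exact zero
  | add f g hf hg => exact add _ _ hf hg
  | single a c =>
    have h1 : (Finsupp.single a c : Perm (Fin n) × List (Finset ℕ) →₀ k) =
        c • Finsupp.single (a.1, a.2) 1 := by simp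
    rw [h1]
    refine smul c (Cyclo.cell k b p a.1 a.2) ?_
    by_cases hL : b.Good n p a.2
    · exact cell _ _ hL
    · rw [cell_of_not_good _ hL]; exact zero

/-- The unit of the operad of tube chains: the word of one letter, without brackets. -/
def TubeChain.unit (k : Type u) [Field k] : TubeChain k .operad 1 0 := cell k .operad 0 1 []

theorem good_unit : Kind.operad.Good 1 0 [] :=
  ⟨le_rfl, fun _ h => absurd h List.not_mem_nil, fun h => absurd h (by simp [Kind.gaps]),
    by simp [Kind.gaps]⟩

theorem TubeChain.act_one (x : TubeChain k b n p) : TubeChain.act 1 x = x := by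
  suffices h : TubeChain.act (k := k) (b := b) (p := p) (1 : Perm (Fin n)) = LinearMap.id from
    LinearMap.congr_fun h x
  refine TubeChain.ext fun σ L hL => ?_
  rw [TubeChain.act_cell, mul_one, LinearMap.id_apply]

theorem TubeChain.act_mul (σ τ : Perm (Fin n)) (x : TubeChain k b n p) :
    TubeChain.act (σ * τ) x = TubeChain.act τ (TubeChain.act σ x) := by
  suffices h : TubeChain.act (k := k) (b := b) (p := p) (σ * τ) =
    (TubeChain.act τ) ∘ₗ (TubeChain.act σ) from LinearMap.congr_fun h x
  refine TubeChain.ext fun ρ L hL => ?_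
  rw [LinearMap.comp_apply, TubeChain.act_cell, TubeChain.act_cell, TubeChain.act_cell, mul_assoc]

theorem TubeChain.unit_comp (h : n + 1 = 1 + n) (i : Fin 1) (hs : 0 + p = p)
    (x : TubeChain k .operad n p) : TubeChain.comp h i hs (TubeChain.unit k) x = x := by
  suffices key : TubeChain.comp h i hs (TubeChain.unit k) = LinearMap.id from
    LinearMap.congr_fun key x
  refine TubeChain.ext fun σ L hL => ?_
  obtain ⟨h', rfl⟩ := Nat.exists_eq_add_of_le' hL.pos
  have h0 : (((1 : Perm (Fin 1)) i).1) = 0 := by omega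
  rw [TubeChain.unit, TubeChain.comp_cell h i hs _ _ good_unit hL, LinearMap.id_apply,
    permComp_unit_left, h0]
  have h1 : graft .operad 1 0 h' [] L = L := by
    simp only [graft, List.map_nil, List.nil_append]
    rw [show shift 0 = id from funext fun A => shift_zero A, List.map_id]
  rw [h1, graftSign, sgnPow_even (by simp), one_smul]

theorem TubeChain.comp_unit (h : n + 1 = n + 1) (i : Fin n) (hs : p + 0 = p)
    (x : TubeChain k b n p) : TubeChain.comp h i hs x (TubeChain.unit k) = x := by
  suffices key : (TubeChain.comp h i hs).flip (TubeChain.unit k) =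
    (LinearMap.id : TubeChain k b n p →ₗ[k] _) from LinearMap.congr_fun key x
  refine TubeChain.ext fun σ L hL => ?_
  rw [LinearMap.flip_apply, TubeChain.unit, TubeChain.comp_cell (h := 0) h i hs _ _ hL good_unit,
    LinearMap.id_apply, permComp_unit_right]
  have h1 : graft b n (σ i) 0 L [] = L := by
    simp only [graft, List.map_nil, List.append_nil]
    refine (List.map_congr_left fun A hA => ?_).trans (List.map_id L)
    exact inflate_zero (σ i).2 fun x hx => (hL.bracket A hA).lt hx
  rw [h1, graftSign, sgnPow_even (by simp), one_smul]

theorem TubeChain.comp_act {m n r : ℕ} (h : r + 1 = m + n) (i : Fin m) {p q s : ℤ}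
    (hs : p + q = s) (σ : Perm (Fin m)) (τ : Perm (Fin n)) (x : TubeChain k b m p)
    (y : TubeChain k .operad n q) :
    TubeChain.comp h i hs (TubeChain.act σ x) (TubeChain.act τ y) =
      TubeChain.act (permComp h i σ τ) (TubeChain.comp h (σ i) hs x y) := by
  obtain _ | n := n
  · exact (map_zero (TubeChain.act _)).symm
  suffices key : (TubeChain.comp (k := k) (b := b) h i hs).compl₁₂ (TubeChain.act σ)
      (TubeChain.act τ) = (TubeChain.comp h (σ i) hs).compr₂ (TubeChain.act (permComp h i σ τ)) from
    LinearMap.congr_fun (LinearMap.congr_fun key x) y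
  refine TubeChain.ext fun σ' L hL => TubeChain.ext fun τ' L' hL' => ?_
  rw [LinearMap.compl₁₂_apply, LinearMap.compr₂_apply, TubeChain.act_cell, TubeChain.act_cell,
    TubeChain.comp_cell h _ hs _ _ hL hL', TubeChain.comp_cell h _ hs _ _ hL hL', map_smul,
    TubeChain.act_cell, permComp_mul, Perm.mul_apply]

theorem graft_assoc {l i j h₁ h₂ : ℕ} (hi : i < l) (hj : j ≤ h₁) {L L' : List (Finset ℕ)}
    (hL : ∀ A ∈ L, b.IsBracket l A) (hL' : ∀ A ∈ L', Kind.operad.IsBracket (h₁ + 1) A)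
    (L'' : List (Finset ℕ)) :
    graft b (l + h₁) (i + j) h₂ (graft b l i h₁ L L') L'' =
      graft b l i (h₁ + h₂) L (graft .operad (h₁ + 1) j h₂ L' L'') := by
  simp only [graft, List.map_append, List.map_map, List.append_assoc]
  congr 1
  · refine List.map_congr_left fun A hA => ?_
    exact inflate_inflate_nested hi hj fun x hx => (hL A hA).lt hx
  congr 1
  · refine List.map_congr_left fun A hA => ?_
    exact inflate_shift_nested hi hj fun x hx => (hL' A hA).lt hx
  · refine List.map_congr_left fun A hA => ?_
    exact (shift_shift i j A).symm

/-- Sequential associativity of the composition of chains of bracketings, for degrees `p`, `q`, `t`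
without a sign. -/
theorem TubeChain.assoc {l m n r₁ r₂ r : ℕ} (h₁ : r₁ + 1 = l + m) (h₂ : r₂ + 1 = m + n)
    (h₃ : r + 1 = r₁ + n) (h₄ : r + 1 = l + r₂) (i : Fin l) (j : Fin m) (i' : Fin r₁)
    (hi : i'.1 = i.1 + j.1) {p q t s₁ s₂ s : ℤ} (hs₁ : p + q = s₁) (hs₂ : q + t = s₂)
    (hs₃ : s₁ + t = s) (hs₄ : p + s₂ = s) (x : TubeChain k b l p) (y : TubeChain k .operad m q)
    (z : TubeChain k .operad n t) :
    TubeChain.comp h₃ i' hs₃ (TubeChain.comp h₁ i hs₁ x y) z =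
      TubeChain.comp h₄ i hs₄ x (TubeChain.comp h₂ j hs₂ y z) := by
  obtain _ | m := m
  · exact j.elim0
  obtain _ | n := n
  · exact (map_zero (TubeChain.comp h₄ i hs₄ x)).symm
  obtain rfl : r₁ = l + m := by omega
  obtain rfl : r₂ = m + n + 1 := by omega
  obtain rfl : r = l + (m + n) := by omega
  induction x using TubeChain.induction with
  | zero => simp
  | add x x' hx hx' => simp only [map_add, LinearMap.add_apply, hx, hx']
  | smul a x hx => simp only [map_smul, LinearMap.smul_apply, hx]
  | cell σ L hL =>
  induction y using TubeChain.induction with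
  | zero => simp
  | add x x' hx hx' => simp only [map_add, LinearMap.add_apply, hx, hx']
  | smul a x hx => simp only [map_smul, LinearMap.smul_apply, hx]
  | cell τ L' hL' =>
  induction z using TubeChain.induction with
  | zero => simp
  | add x x' hx hx' => simp only [map_add, hx, hx']
  | smul a x hx => simp only [map_smul, hx]
  | cell ω L'' hL'' =>
  have hj := j.2
  rw [TubeChain.comp_cell h₁ i hs₁ σ τ hL hL', TubeChain.comp_cell (h := n) h₂ j hs₂ τ ω hL' hL'',
    map_smul, map_smul, LinearMap.smul_apply,
    TubeChain.comp_cell h₃ i' hs₃ _ ω (hs₁ ▸ hL.graft (σ i).2 hL') hL'',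
    TubeChain.comp_cell (h := m + n) h₄ i hs₄ σ _ hL ?_, smul_smul, smul_smul,
    permComp_assoc h₁ h₂ h₃ h₄ i j i' hi]
  · have h5 : (permComp h₁ i σ τ i').1 = (σ i).1 + (τ j).1 := by
      rw [show i' = inputs h₁ i (Sum.inr j) from Fin.ext hi, permComp_inr, inputs_inr_val]
    rw [h5, graft_assoc (σ i).2 (by omega) hL.bracket hL'.bracket]
    congr 1
    unfold graftSign
    rw [← sgnPow_add, ← sgnPow_add]
    congr 1
    rw [← hs₁, ← hs₂]
    push_cast
    ring
  · have := hL'.graft (τ j).2 hL''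
    rw [hs₂] at this
    rwa [show m + 1 + n = m + n + 1 by omega] at this

/-- The two threefold composites at different places have the same tubes, with the blocks of the two
inserted words exchanged. -/
theorem graft_parallel {l i j h₁ h₂ : ℕ} (hij : i < j) (hj : j < l) {L L' L'' : List (Finset ℕ)}
    (hL : ∀ A ∈ L, b.IsBracket l A) (hL' : ∀ A ∈ L', Kind.operad.IsBracket (h₁ + 1) A)
    (hL'' : ∀ A ∈ L'', Kind.operad.IsBracket (h₂ + 1) A) :
    ∃ X, graft b (l + h₁) (j + h₁) h₂ (graft b l i h₁ L L') L'' =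
        X ++ L'.map (shift i) ++ L''.map (shift (j + h₁)) ∧
      graft b (l + h₂) i h₁ (graft b l j h₂ L L'') L' =
        X ++ L''.map (shift (j + h₁)) ++ L'.map (shift i) := by
  refine ⟨L.map (b.inflate (l + h₁) (j + h₁) h₂ ∘ b.inflate l i h₁), ?_, ?_⟩
  · simp only [graft, List.map_append, List.map_map, List.append_assoc]
    congr 2
    refine List.map_congr_left fun A hA => ?_
    exact inflate_shift_right hij hj fun x hx => (hL' A hA).lt hx
  · simp only [graft, List.map_append, List.map_map, List.append_assoc]
    congr 1
    · refine List.map_congr_left fun A hA => ?_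
      exact (inflate_inflate_parallel hij hj fun x hx => (hL A hA).lt hx).symm
    · congr 1
      refine List.map_congr_left fun A hA => ?_
      exact inflate_shift_left hij hj fun x hx => (hL'' A hA).lt hx

/-- Composites at two different inputs agree up to the Koszul sign of exchanging the two inserted
chains. -/
theorem TubeChain.parallel {l m n r₁ r₂ r : ℕ} (h₁ : r₁ + 1 = l + m) (h₂ : r₂ + 1 = l + n)
    (h₃ : r + 1 = r₁ + n) (h₄ : r + 1 = r₂ + m) (i j : Fin l) (hij : i < j) (j' : Fin r₁)
    (hj : j'.1 + 1 = j.1 + m) (i' : Fin r₂) (hi : i'.1 = i.1) {p q t s₁ s₂ s : ℤ}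
    (hs₁ : p + q = s₁) (hs₂ : p + t = s₂) (hs₃ : s₁ + t = s) (hs₄ : s₂ + q = s)
    (x : TubeChain k b l p) (y : TubeChain k .operad m q) (z : TubeChain k .operad n t) :
    TubeChain.comp h₃ j' hs₃ (TubeChain.comp h₁ i hs₁ x y) z =
      sgnPow k (q * t) • TubeChain.comp h₄ i' hs₄ (TubeChain.comp h₂ j hs₂ x z) y := by
  obtain _ | n := n
  · change (0 : TubeChain k b r s) = sgnPow k (q * t) • TubeChain.comp h₄ i' hs₄ 0 y
    rw [map_zero, LinearMap.zero_apply, smul_zero]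
  obtain _ | m := m
  · change TubeChain.comp h₃ j' hs₃ 0 z = sgnPow k (q * t) • (0 : TubeChain k b r s)
    rw [map_zero, LinearMap.zero_apply, smul_zero]
  obtain rfl : r₁ = l + m := by omega
  obtain rfl : r₂ = l + n := by omega
  induction x using TubeChain.induction with
  | zero => simp
  | add x x' hx hx' => simp only [map_add, LinearMap.add_apply, hx, hx', smul_add]
  | smul a x hx => simp only [map_smul, LinearMap.smul_apply, hx, smul_comm a]
  | cell σ L hL =>
  induction y using TubeChain.induction with
  | zero => simp
  | add x x' hx hx' => simp only [map_add, LinearMap.add_apply, hx, hx', smul_add]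
  | smul a x hx => simp only [map_smul, LinearMap.smul_apply, hx, smul_comm a]
  | cell τ L' hL' =>
  induction z using TubeChain.induction with
  | zero => simp
  | add x x' hx hx' => simp only [map_add, LinearMap.add_apply, hx, hx', smul_add]
  | smul a x hx => simp only [map_smul, LinearMap.smul_apply, hx, smul_comm a]
  | cell ω L'' hL'' =>
  have hne : i ≠ j := hij.ne
  have hσ : (σ i).1 ≠ (σ j).1 := fun h => hne (σ.injective (Fin.ext h))
  rw [TubeChain.comp_cell h₁ i hs₁ σ τ hL hL', TubeChain.comp_cell h₂ j hs₂ σ ω hL hL'',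
    map_smul, map_smul, LinearMap.smul_apply, LinearMap.smul_apply,
    TubeChain.comp_cell h₃ j' hs₃ _ ω (hs₁ ▸ hL.graft (σ i).2 hL') hL'',
    TubeChain.comp_cell h₄ i' hs₄ _ τ (hs₂ ▸ hL.graft (σ j).2 hL'') hL', smul_smul, smul_smul,
    smul_smul, permComp_parallel h₁ h₂ h₃ h₄ i j hij j' hj i' hi]
  have e1 : j' = inputs h₁ i (Sum.inl ⟨j, hne.symm⟩) := Fin.ext (by
    rw [inputs_inl_val, if_neg (by omega)]; omega)
  have e2 : i' = inputs h₂ j (Sum.inl ⟨i, hne⟩) := Fin.ext (by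
    rw [inputs_inl_val, if_pos (by omega)]; omega)
  have e3 : (permComp h₁ i σ τ j').1 = if (σ j).1 < (σ i).1 then (σ j).1 else (σ j).1 + m := by
    rw [e1, permComp_inl_of_eq h₁ i (σ i) σ τ rfl j (σ j) hne.symm (σ.injective.ne hne.symm) rfl,
      inputs_inl_val]
    rfl
  have e4 : (permComp h₂ j σ ω i').1 = if (σ i).1 < (σ j).1 then (σ i).1 else (σ i).1 + n := by
    rw [e2, permComp_inl_of_eq h₂ j (σ j) σ ω rfl i (σ i) hne (σ.injective.ne hne) rfl,
      inputs_inl_val]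
    rfl
  have l1 := hL'.length
  have l2 := hL''.length
  simp only [Kind.gaps] at l1 l2
  push_cast at l1 l2
  -- Exchanging the two blocks of tubes contributes a sign; with the grafting signs, both relative
  -- positions of `σ i` and `σ j` lead to the Koszul sign.
  have sgn : ∀ a c : ℕ, (graftSign k p q a m * graftSign k s₁ t (c + m : ℕ) n *
        (-1) ^ (L'.length * L''.length) =
      sgnPow k (q * t) * graftSign k p t c n * graftSign k s₂ q a m) ∧
      (graftSign k p q a m * graftSign k s₁ t c n * (-1) ^ (L'.length * L''.length) =
      sgnPow k (q * t) * graftSign k p t c n * graftSign k s₂ q (a + n : ℕ) m) := fun a c => by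
    unfold graftSign
    rw [← sgnPow_natCast]
    simp only [← sgnPow_add]
    rw [← hs₁, ← hs₂, show (m : ℤ) = L'.length + q by omega,
      show (n : ℤ) = L''.length + t by omega]
    constructor
    · refine sgnPow_congr ⟨q * L''.length + L'.length * L''.length, ?_⟩
      push_cast
      rw [show (m : ℤ) = L'.length + q by omega]
      ring
    · refine sgnPow_congr ⟨q * L''.length + L'.length * L''.length - m * n, ?_⟩
      push_cast
      rw [show (m : ℤ) = L'.length + q by omega, show (n : ℤ) = L''.length + t by omega]
      ring
  rcases lt_or_gt_of_ne hσ with h5 | h5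
  · rw [if_neg (by omega)] at e3
    rw [if_pos h5] at e4
    obtain ⟨X, h6, h7⟩ := graft_parallel h5 (σ j).2 hL.bracket hL'.bracket hL''.bracket
    rw [e3, e4, h6, h7]
    have h8 := cell_append_swap (k := k) (b := b) (p := s)
      (permComp h₄ i' (permComp h₂ j σ ω) τ) X (L'.map (shift (σ i)))
      (L''.map (shift ((σ j) + m))) []
    simp only [List.append_nil, ← List.append_assoc, List.length_map] at h8
    rw [h8, smul_smul]
    exact congrArg (· • _) (sgn _ _).1
  · rw [if_pos h5] at e3
    rw [if_neg (by omega)] at e4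
    obtain ⟨X, h6, h7⟩ := graft_parallel h5 (σ i).2 hL.bracket hL''.bracket hL'.bracket
    rw [e3, e4, h6, h7]
    have h8 := cell_append_swap (k := k) (b := b) (p := s)
      (permComp h₄ i' (permComp h₂ j σ ω) τ) X (L'.map (shift ((σ i) + n)))
      (L''.map (shift (σ j))) []
    simp only [List.append_nil, ← List.append_assoc, List.length_map] at h8
    rw [h8, smul_smul]
    exact congrArg (· • _) (sgn _ _).2

end

/-! ### The generators of the cobar construction and the comparison map -/

section

variable {k : Type u} [Field k] {b : Kind} {n : ℕ} {p : ℤ}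

section Dual

variable {X Y : Type*} {W : Type*} [AddCommGroup W] [Module k W]

theorem dual_eq_sum [Fintype X] (f : Module.Dual k (X →₀ k)) :
    f = ∑ c, f (Finsupp.single c 1) • (Finsupp.lapply c : (X →₀ k) →ₗ[k] k) := by
  classical
  refine Finsupp.lhom_ext' fun c => LinearMap.ext_ring ?_
  simp [Finsupp.single_apply]

/-- Linear maps on the dual of a finite free module are determined by the dual basis. -/
theorem dual_ext [Finite X] {F G : Module.Dual k (X →₀ k) →ₗ[k] W}
    (h : ∀ c, F (Finsupp.lapply c) = G (Finsupp.lapply c)) : F = G := by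
  have := Fintype.ofFinite X
  ext f
  rw [dual_eq_sum f]
  simp only [map_sum, map_smul, h]

/-- The linear map on the dual of a finite free module with prescribed values on the dual basis. -/
def evalDual [Finite X] (v : X → W) : Module.Dual k (X →₀ k) →ₗ[k] W :=
  have := Fintype.ofFinite X
  ∑ c, (LinearMap.toSpanSingleton k W (v c)) ∘ₗ (Module.Dual.eval k _ (Finsupp.single c 1))

theorem evalDual_lapply [Finite X] (v : X → W) (c : X) : evalDual (k := k) v (Finsupp.lapply c) = v c := by
  classical
  simp [evalDual, Finsupp.single_apply]

theorem dualDistribEquiv_symm [Fintype X] [Fintype Y]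
    (g : Module.Dual k ((X →₀ k) ⊗[k] (Y →₀ k))) :
    (TensorProduct.dualDistribEquiv k (X →₀ k) (Y →₀ k)).symm g =
      ∑ a, ∑ c, g (Finsupp.single a 1 ⊗ₜ Finsupp.single c 1) •
        ((Finsupp.lapply a : (X →₀ k) →ₗ[k] k) ⊗ₜ[k] (Finsupp.lapply c : (Y →₀ k) →ₗ[k] k)) := by
  classical
  rw [LinearEquiv.symm_apply_eq]
  refine TensorProduct.ext (Finsupp.lhom_ext' fun a => LinearMap.ext_ring
    (Finsupp.lhom_ext' fun c => LinearMap.ext_ring ?_))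
  simp [TensorProduct.dualDistribEquiv, TensorProduct.dualDistribEquivOfBasis,
    Finsupp.single_apply]

end Dual

/-- The permutations of the letters of a word, up to rotation in the case of cyclic words. -/
def Kind.Order : Kind → ℕ → Type
  | .operad, n => Perm (Fin n)
  | .module, n => CyclicOrder n

instance : Finite (b.Order n) := by
  cases b
  · exact inferInstanceAs (Finite (Perm (Fin n)))
  · exact inferInstanceAs (Finite (Quotient _))

/-- The class of a permutation. -/
def Kind.order : ∀ (b : Kind) {n : ℕ}, Perm (Fin n) → b.Order n
  | .operad, _, σ => σ
  | .module, _, σ => CyclicOrder.mk σ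

theorem order_surjective : Function.Surjective (b.order (n := n)) := by
  cases b
  · exact fun σ => ⟨σ, rfl⟩
  · exact fun c => Quotient.exists_rep c

theorem order_eq_iff {σ τ : Perm (Fin n)} :
    b.order σ = b.order τ ↔ ∃ ζ ∈ b.rotations n, σ = ζ * τ := by
  cases b
  · refine ⟨fun h => ⟨1, one_mem _, h⟩, ?_⟩
    rintro ⟨ζ, hζ, rfl⟩
    rw [eq_one_of_mem_rotations hζ, one_mul]
  · change CyclicOrder.mk σ = CyclicOrder.mk τ ↔ _
    refine (Quotient.eq (r := QuotientGroup.rightRel (cyclicGroup n))).trans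
      (QuotientGroup.rightRel_apply.trans ?_)
    constructor
    · intro h
      refine ⟨_, inv_mem h, ?_⟩
      simp
    · rintro ⟨ζ, hζ, rfl⟩
      rw [mul_inv_rev, mul_inv_cancel_left]
      exact inv_mem hζ

/-- The degree of a generator of the cobar construction, relative to the degree where the
dual of the suspension does not vanish. -/
def Kind.excess : Kind → ℕ → ℤ → ℤ
  | .operad, n, p => p + 1 - (n - 1)
  | .module, n, p => p - (n - 1)

theorem excess_eq (hn : 1 ≤ n) : b.excess n p = p + 1 - b.gaps n := by
  cases b
  · simp only [Kind.excess, Kind.gaps]; omega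
  · simp only [Kind.excess, Kind.gaps]; omega

/-- The index set of the dual basis of the generators. -/
abbrev GenIndex (b : Kind) (n : ℕ) (p : ℤ) : Type := {_c : b.Order n // 1 ≤ n ∧ b.excess n p = 0}

/-- The generators of the cobar construction on the duals of the suspensions of `Cycl` and `Ass`. -/
abbrev gens (k : Type u) [Field k] : Kind → Coll k :=
  cobarGens (cycl k).susp.dual (ass k).susp.dual

/-- The generators are the dual of a free module. -/
def genEquiv (k : Type u) [Field k] : ∀ (b : Kind) (n : ℕ) (p : ℤ),
    Module.Dual k (GenIndex b n p →₀ k) ≃ₗ[k] (gens k b).obj n p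
  | .operad, n, p => LinearEquiv.refl k (Module.Dual k
      ({_σ : Perm (Fin n) // 1 ≤ n ∧ p + 1 - ((n : ℤ) - 1) = 0} →₀ k))
  | .module, n, p => LinearEquiv.refl k (Module.Dual k
      ({_c : CyclicOrder n // 1 ≤ n ∧ p - ((n : ℤ) - 1) = 0} →₀ k))

/-- The dual basis of the generators. -/
def dualGen (k : Type u) [Field k] (b : Kind) {n : ℕ} {p : ℤ} (c : GenIndex b n p) :
    (gens k b).obj n p :=
  genEquiv k b n p (Finsupp.lapply c)

theorem gens_ext {W : Type*} [AddCommGroup W] [Module k W] {F G : (gens k b).obj n p →ₗ[k] W}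
    (h : ∀ c : GenIndex b n p, F (dualGen k b c) = G (dualGen k b c)) : F = G := by
  have h1 : F ∘ₗ (genEquiv k b n p).toLinearMap = G ∘ₗ (genEquiv k b n p).toLinearMap :=
    dual_ext h
  ext x
  obtain ⟨y, rfl⟩ := (genEquiv k b n p).surjective x
  exact LinearMap.congr_fun h1 y

/-- The action of a permutation on the index set of the generators. -/
def GenIndex.act : ∀ {b : Kind} {n : ℕ} {p : ℤ} (_ : Perm (Fin n)), GenIndex b n p → GenIndex b n p
  | .operad, _, _, ρ, c => ⟨(show Perm _ from c.1) * ρ, c.2⟩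
  | .module, _, _, ρ, c => ⟨(show CyclicOrder _ from c.1).act ρ, c.2⟩

theorem GenIndex.act_order (ρ σ : Perm (Fin n)) (h) :
    GenIndex.act ρ (⟨b.order σ, h⟩ : GenIndex b n p) = ⟨b.order (σ * ρ), h⟩ := by
  cases b <;> rfl

theorem gens_act_single (ρ : Perm (Fin n)) (f : Module.Dual k (GenIndex b n p →₀ k))
    (c : GenIndex b n p) :
    (genEquiv k b n p).symm ((gens k b).act ρ (genEquiv k b n p f)) (Finsupp.single c 1) =
      sgnPerm k ρ * f (Finsupp.single (c.act ρ⁻¹) 1) := by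
  have key : ∀ g : GenIndex b n p → GenIndex b n p,
      f (sgnPerm k ρ⁻¹ • Finsupp.mapDomain g (Finsupp.single c 1)) =
      sgnPerm k ρ * f (Finsupp.single (g c) 1) := fun g => by
    rw [map_smul, Finsupp.mapDomain_single, sgnPerm_inv, smul_eq_mul]
  cases b
  · exact key (GenIndex.act ρ⁻¹)
  · exact key (GenIndex.act ρ⁻¹)

theorem dualGen_act (ρ : Perm (Fin n)) (c : GenIndex b n p) :
    (gens k b).act ρ (dualGen k b c) = sgnPerm k ρ • dualGen k b (c.act ρ) := by
  classical
  refine (genEquiv k b n p).symm.injective ?_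
  refine Finsupp.lhom_ext' fun c' => LinearMap.ext_ring ?_
  refine (gens_act_single ρ _ c').trans ?_
  have h1 : ∀ (ρ : Perm (Fin n)) (c : GenIndex b n p), (c.act ρ).act ρ⁻¹ = c := fun ρ c => by
    obtain ⟨c, hc⟩ := c
    obtain ⟨σ, rfl⟩ := order_surjective c
    rw [GenIndex.act_order, GenIndex.act_order, mul_inv_cancel_right]
  have h2 : c'.act ρ⁻¹ = c ↔ c' = c.act ρ := by
    constructor
    · rintro rfl
      have := h1 ρ⁻¹ c'
      rw [inv_inv] at this
      exact this.symm
    · rintro rfl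
      exact h1 ρ c
  simp [dualGen, Finsupp.single_apply, h2]

/-- The composition of the classes of permutations. -/
def Kind.Order.comp : ∀ {b : Kind} {m n r : ℕ} (_ : r + 1 = m + n) (_ : 1 ≤ n) (_ : Fin m),
    b.Order m → Perm (Fin n) → b.Order r
  | .operad, _, _, _, h, _, i, c, τ => permComp h i c τ
  | .module, _, _, _, h, hn, i, c, τ => CyclicOrder.comp h hn i c τ

theorem Kind.Order.comp_order {m n r : ℕ} (h : r + 1 = m + n) (hn : 1 ≤ n) (i : Fin m)
    (σ : Perm (Fin m)) (τ : Perm (Fin n)) :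
    (b.order σ).comp h hn i τ = b.order (permComp h i σ τ) := by
  cases b <;> rfl

theorem excess_comp {m n r : ℕ} (h : r + 1 = m + n) {p q s : ℤ} (hs : p + q + 1 = s)
    (hm : b.excess m p = 0) (hn : Kind.operad.excess n q = 0) : b.excess r s = 0 := by
  cases b <;> simp only [Kind.excess] at * <;> omega

/-- The structure maps of the cooperad and the comodule on the generators. -/
theorem cobarDecomp_dualGen {m n r : ℕ} (h : r + 1 = m + n) (i : Fin m) (hi : i.1 = 0) {p q s : ℤ}
    (hs : p + q + 1 = s) (c : GenIndex b r s) [Fintype (GenIndex b m p)]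
    [Fintype (GenIndex .operad n q)] :
    open Classical in
    cobarDecomp (cyclDual k) (assDual k) b h i hs (dualGen k b c) =
      ∑ a : GenIndex b m p, ∑ d : GenIndex .operad n q,
        (if a.1.comp h d.2.1 i d.1 = c.1 then (1 : k) else 0) •
          (dualGen k b a ⊗ₜ[k] dualGen k .operad d) := by
  classical
  -- The transpose of a composition of basis elements; its sign is trivial as the place of
  -- composition is `0` and the degrees are those where the dual of the suspension lives.
  have key : ∀ {X Y Z : Type} [Fintype X] [Fintype Y] (c : Z) (ε : k) (G : X → Y → Z)
      (hε : X → ε = 1) (P : X → Y → Prop) (hP : ∀ a d, G a d = c ↔ P a d),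
      (TensorProduct.dualDistribEquiv k (X →₀ k) (Y →₀ k)).symm
        ((TensorProduct.lift (ε • Finsupp.linearCombination k fun a =>
          Finsupp.linearCombination k fun d => Finsupp.single (G a d) (1 : k))).dualMap
            (Finsupp.lapply c)) =
      ∑ a, ∑ d, (if P a d then (1 : k) else 0) •
        ((Finsupp.lapply a : (X →₀ k) →ₗ[k] k) ⊗ₜ[k] (Finsupp.lapply d : (Y →₀ k) →ₗ[k] k)) := by
    intro X Y Z _ _ c ε G hε P hP
    rw [dualDistribEquiv_symm]
    refine Finset.sum_congr rfl fun a _ => Finset.sum_congr rfl fun d _ => ?_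
    rw [LinearMap.dualMap_apply, TensorProduct.lift.tmul, hε a, one_smul]
    congr 1
    simp [Finsupp.single_apply, hP]
  cases b
  · refine key (X := GenIndex .operad m p) (Y := GenIndex .operad n q) (Z := GenIndex .operad r s)
      c (sgnPow k (((n : ℤ) - 1) * (p + 1 - (m - 1)) + (i : ℕ) * ((n : ℤ) - 1)))
      (fun a d => ⟨permComp h i a.1 d.1, by have := a.2; have := d.2; omega,
        excess_comp h hs a.2.2 d.2.2⟩) (fun a => ?_) _ fun a d => Subtype.ext_iff
    have := a.2.2
    simp only [Kind.excess] at this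
    rw [this, hi]
    exact sgnPow_even (by simp)
  · refine key (X := GenIndex .module m p) (Y := GenIndex .operad n q) (Z := GenIndex .module r s)
      c (sgnPow k (((n : ℤ) - 1) * (p - (m - 1)) + (i : ℕ) * ((n : ℤ) - 1)))
      (fun a d => ⟨CyclicOrder.comp h d.2.1 i a.1 d.1, by have := a.2; have := d.2; omega,
        excess_comp h hs a.2.2 d.2.2⟩) (fun a => ?_) _ fun a d => Subtype.ext_iff
    have := a.2.2
    simp only [Kind.excess] at this
    rw [this, hi]
    exact sgnPow_even (by simp)

/-- The class of a permutation with the set of all gaps as the only tube, with the sign of the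
permutation; the generators go to these. -/
def corolla (k : Type u) [Field k] (b : Kind) (n : ℕ) (p : ℤ) (c : b.Order n) : TubeChain k b n p :=
  sgnPerm k (order_surjective c).choose •
    cell k b p (order_surjective c).choose [Finset.range (b.gaps n)]

theorem corolla_order (σ : Perm (Fin n)) :
    corolla k b n p (b.order σ) = sgnPerm k σ • cell k b p σ [Finset.range (b.gaps n)] := by
  unfold corolla
  obtain ⟨ζ, hζ, h1⟩ := order_eq_iff.mp (order_surjective (b.order σ)).choose_spec
  rw [h1]
  have h2 := cell_rot (k := k) (p := p) σ [Finset.range (b.gaps n)] hζ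
  rw [List.map_singleton, permTube_range hζ] at h2
  rw [h2, smul_smul, sgnPerm_mul, mul_right_comm, sgnPerm_mul_self, one_mul]

theorem good_corolla (hn : b.minArity ≤ n) (h : b.excess n p = 0) :
    b.Good n p [Finset.range (b.gaps n)] := by
  have h1 := b.minArity_pos
  have hg : 0 < b.gaps n := by
    cases b <;> simp only [Kind.minArity, Kind.gaps] at * <;> omega
  refine ⟨by omega, fun A hA => ?_, fun _ => List.mem_singleton_self _, ?_⟩
  · rw [List.mem_singleton.mp hA]
    exact isBracket_range hg
  · rw [excess_eq (by omega)] at h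
    rw [List.length_singleton]
    push_cast
    omega

/-- The values of the comparison map on the generators. -/
def genMap (k : Type u) [Field k] (b : Kind) (n : ℕ) (p : ℤ) :
    (gens k b).obj n p →ₗ[k] TubeChain k b n p :=
  evalDual (fun c : GenIndex b n p => corolla k b n p c.1) ∘ₗ (genEquiv k b n p).symm.toLinearMap

theorem genMap_dualGen (c : GenIndex b n p) :
    genMap k b n p (dualGen k b c) = corolla k b n p c.1 := by
  simp [genMap, dualGen, evalDual_lapply]

/-- Equivariance on generators; the sign of the permutation, which the dual of a suspension carries,
is the one in `corolla`. -/
theorem genMap_act (ρ : Perm (Fin n)) (x : (gens k b).obj n p) :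
    genMap k b n p ((gens k b).act ρ x) = TubeChain.act ρ (genMap k b n p x) := by
  suffices h : genMap k b n p ∘ₗ (gens k b).act ρ = TubeChain.act ρ ∘ₗ genMap k b n p from
    LinearMap.congr_fun h x
  refine gens_ext fun c => ?_
  obtain ⟨c, hc⟩ := c
  obtain ⟨σ, rfl⟩ := order_surjective c
  rw [LinearMap.comp_apply, LinearMap.comp_apply, dualGen_act, map_smul, GenIndex.act_order,
    genMap_dualGen, genMap_dualGen, corolla_order, corolla_order, map_smul, TubeChain.act_cell,
    smul_smul, sgnPerm_mul, mul_left_comm, sgnPerm_mul_self, mul_one]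

/-- The value of a formal expression in the model of the chains. -/
def exprTubes (k : Type u) [Field k] : ∀ {b : Kind} {n : ℕ} {p : ℤ},
    FreeExpr (gens k) b n p → TubeChain k b n p
  | _, _, _, .gen _ x => genMap k _ _ _ x
  | _, _, _, .unit => TubeChain.unit k
  | _, _, _, .comp h i hs x y => TubeChain.comp h i hs (exprTubes k x) (exprTubes k y)
  | _, _, _, .act σ x => TubeChain.act σ (exprTubes k x)
  | _, _, _, .zero => 0
  | _, _, _, .add x y => exprTubes k x + exprTubes k y
  | _, _, _, .smul a x => a • exprTubes k x

/-- The model satisfies all relations that define the free pair. -/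
theorem exprTubes_rel {b : Kind} {n : ℕ} {p : ℤ} {x y : FreeExpr (gens k) b n p}
    (h : Rel (gens k) x y) : exprTubes k x = exprTubes k y := by
  induction h with
  | refl x => rfl
  | symm _ ih => exact ih.symm
  | trans _ _ ih ih' => exact ih.trans ih'
  | comp_congr h i hs _ _ ih ih' => simp only [exprTubes, ih, ih']
  | act_congr σ _ ih => simp only [exprTubes, ih]
  | add_congr _ _ ih ih' => simp only [exprTubes, ih, ih']
  | smul_congr a _ ih => simp only [exprTubes, ih]
  | add_comm x y => exact _root_.add_comm _ _
  | add_assoc x y z => exact _root_.add_assoc _ _ _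
  | zero_add x => exact _root_.zero_add _
  | zero_smul x => exact _root_.zero_smul _ _
  | one_smul x => exact _root_.one_smul _ _
  | mul_smul a c x => exact (smul_smul _ _ _).symm
  | smul_add a x y => exact _root_.smul_add _ _ _
  | add_smul a c x => exact _root_.add_smul _ _ _
  | gen_add hn x y => exact map_add _ _ _
  | gen_smul hn a x => exact map_smul _ _ _
  | gen_act hn σ x => exact genMap_act σ x
  | act_add σ x y => exact map_add _ _ _
  | act_smul σ a x => exact map_smul _ _ _
  | act_one x => exact TubeChain.act_one _
  | act_mul σ τ x => exact TubeChain.act_mul _ _ _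
  | comp_add_left h i hs x x' y => simp only [exprTubes, map_add, LinearMap.add_apply]
  | comp_smul_left h i hs a x y => simp only [exprTubes, map_smul, LinearMap.smul_apply]
  | comp_add_right h i hs x y y' => simp only [exprTubes, map_add]
  | comp_smul_right h i hs a x y => simp only [exprTubes, map_smul]
  | unit_comp h i hs x => exact TubeChain.unit_comp _ _ _ _
  | comp_unit h i hs x => exact TubeChain.comp_unit _ _ _ _
  | comp_act h i hs σ τ x y => exact TubeChain.comp_act _ _ _ _ _ _ _
  | assoc h₁ h₂ h₃ h₄ i j i' hi hs₁ hs₂ hs₃ hs₄ x y z =>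
    exact TubeChain.assoc h₁ h₂ h₃ h₄ i j i' hi _ _ _ _ _ _ _
  | parallel h₁ h₂ h₃ h₄ i j hij j' hj i' hi hs₁ hs₂ hs₃ hs₄ x y z =>
    exact TubeChain.parallel h₁ h₂ h₃ h₄ i j hij j' hj i' hi _ _ _ _ _ _ _

/-- The comparison map from the free pair to the model of the chains. -/
def toTubes (k : Type u) [Field k] (b : Kind) (n : ℕ) (p : ℤ) : Ω k b n p →ₗ[k] TubeChain k b n p where
  toFun := Quot.lift (exprTubes k) fun _ _ h => exprTubes_rel h
  map_add' := by rintro ⟨x⟩ ⟨y⟩; rfl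
  map_smul' := by rintro a ⟨x⟩; rfl

theorem toTubes_act (σ : Perm (Fin n)) (x : Ω k b n p) :
    toTubes k b n p (Free.act σ x) = TubeChain.act σ (toTubes k b n p x) := by
  obtain ⟨x⟩ := x; rfl

theorem toTubes_comp {m n r : ℕ} (h : r + 1 = m + n) (i : Fin m) {p q s : ℤ} (hs : p + q = s)
    (x : Ω k b m p) (y : Ω k .operad n q) : toTubes k b r s (Free.comp h i hs x y) =
      TubeChain.comp h i hs (toTubes k b m p x) (toTubes k .operad n q y) := by
  obtain ⟨x⟩ := x; obtain ⟨y⟩ := y; rfl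

theorem toTubes_gen (hn : b.minArity ≤ n) (x : (gens k b).obj n p) :
    toTubes k b n p (Free.gen hn x) = genMap k b n p x := rfl

end

/-! ### Unshuffles and composites of permutations -/

/-- A composite determines its factors, once the place where the block goes is known. -/
theorem permComp_injective {m n r : ℕ} (h : r + 1 = m + n) (i : Fin m) {a a' : Perm (Fin m)}
    {c c' : Perm (Fin n)} (hi : a i = a' i) (he : permComp h i a c = permComp h i a' c') :
    a = a' ∧ c = c' := by
  constructor
  · ext y
    by_cases hy : y = i
    · rw [hy, hi]
    · have h1 := permComp_inl_of_eq h i (a i) a c rfl y (a y) hy (a.injective.ne hy) rfl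
      have h2 := permComp_inl_of_eq h i (a i) a' c' hi.symm y (a' y) hy
        (by rw [hi]; exact a'.injective.ne hy) rfl
      rw [he, h2] at h1
      have := (inputs h (a i)).injective h1
      exact congrArg Fin.val (congrArg Subtype.val (Sum.inl.inj this)).symm
  · ext z
    have h1 := permComp_inr_of_eq h i (a i) a c rfl z
    have h2 := permComp_inr_of_eq h i (a i) a' c' hi.symm z
    rw [he, h2] at h1
    have := (inputs h (a i)).injective h1
    exact congrArg Fin.val (Sum.inr.inj this).symm

/-- A permutation that maps a block of letters to a block of letters is a composite. -/
theorem exists_permComp {m n r : ℕ} (h : r + 1 = m + n) (i j : Fin m) (π : Perm (Fin r))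
    (hπ : ∀ z : Fin n, ∃ z' : Fin n, π (inputs h i (Sum.inr z)) = inputs h j (Sum.inr z')) :
    ∃ a c, a i = j ∧ permComp h i a c = π := by
  classical
  -- Move the block back to its place; the resulting permutation preserves it, hence is a
  -- permutation of the block together with one of the other letters.
  set π' := (permComp h i (swap i j) (1 : Perm (Fin n)))⁻¹ * π with hπ'
  have h1 : ∀ z : Fin n, ∃ z' : Fin n, π' (inputs h i (Sum.inr z)) = inputs h i (Sum.inr z') :=
    fun z => by
    obtain ⟨z', hz'⟩ := hπ z
    refine ⟨z', ?_⟩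
    rw [hπ', Perm.mul_apply, hz', Perm.inv_eq_iff_eq,
      permComp_inr_of_eq h i j (swap i j) (1 : Perm (Fin n)) (swap_apply_left i j) z']
    rfl
  set θ : Perm ({y : Fin m // y ≠ i} ⊕ Fin n) :=
    (inputs h i).trans (π'.trans (inputs h i).symm) with hθ
  have h2 : Set.MapsTo θ (Set.range Sum.inr) (Set.range Sum.inr) := by
    rintro _ ⟨z, rfl⟩
    obtain ⟨z', hz'⟩ := h1 z
    refine ⟨z', ?_⟩
    rw [hθ, Equiv.trans_apply, Equiv.trans_apply, hz', Equiv.symm_apply_apply]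
  have h3 := (Perm.perm_mapsTo_inl_iff_mapsTo_inr θ).mpr h2
  obtain ⟨⟨α, β⟩, h5⟩ := Perm.mem_sumCongrHom_range_of_perm_mapsTo_inl h3
  have h6 : permComp h i (Perm.ofSubtype α) β = π' := by
    ext x
    obtain ⟨x, rfl⟩ := (inputs h i).surjective x
    have h7 : inputs h i (θ x) = π' (inputs h i x) := by simp [hθ]
    rw [← h7, ← h5]
    have h8 : Perm.ofSubtype α i = i := Perm.ofSubtype_apply_of_not_mem α (by simp)
    rcases x with ⟨y, hy⟩ | z
    · exact congrArg Fin.val (permComp_inl_of_eq h i i (Perm.ofSubtype α) β h8 y (α ⟨y, hy⟩) hy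
        (α ⟨y, hy⟩).2 (Perm.ofSubtype_apply_coe α ⟨y, hy⟩))
    · exact congrArg Fin.val (permComp_inr_of_eq h i i (Perm.ofSubtype α) β h8 z)
  refine ⟨swap i j * Perm.ofSubtype α, β, ?_, ?_⟩
  · rw [Perm.mul_apply, Perm.ofSubtype_apply_of_not_mem, swap_apply_left]
    simp
  · have h8 := permComp_mul h i (swap i j) (Perm.ofSubtype α) 1 β
    rw [Perm.ofSubtype_apply_of_not_mem α (by simp), one_mul] at h8
    rw [h8, h6, hπ', mul_inv_cancel_left]

theorem mem_unshuffles {n r : ℕ} {ρ : Perm (Fin r)} : ρ ∈ unshuffles r n ↔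
    (∀ x y : Fin r, x < y → y.1 < n → ρ⁻¹ x < ρ⁻¹ y) ∧
    (∀ x y : Fin r, x < y → n ≤ x.1 → ρ⁻¹ x < ρ⁻¹ y) := by
  simp [unshuffles]

/-- Any set of `n` letters is moved to the first `n` places by an unshuffle. -/
theorem exists_unshuffle {n r : ℕ} (B : Finset (Fin r)) (hB : B.card = n) :
    ∃ ρ ∈ unshuffles r n, ∀ x, (ρ x).1 < n ↔ x ∈ B := by
  obtain ⟨m, rfl⟩ : ∃ m, r = n + m := Nat.exists_eq_add_of_le (by
    rw [← hB]; simpa using Finset.card_le_univ B)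
  have hB' : Bᶜ.card = m := by rw [Finset.card_compl, hB]; simp
  -- The inverse unshuffle lists the elements of `B` in order, then those of its complement.
  set e : Perm (Fin (n + m)) := finSumFinEquiv.symm.trans (finSumEquivOfFinset hB hB') with he
  have e1 : ∀ z : Fin n, e (Fin.castAdd m z) = B.orderEmbOfFin hB z := fun z => by simp [he]
  have e2 : ∀ z : Fin m, e (Fin.natAdd n z) = Bᶜ.orderEmbOfFin hB' z := fun z => by simp [he]
  refine ⟨e⁻¹, mem_unshuffles.mpr ⟨fun x y hxy hy => ?_, fun x y hxy hx => ?_⟩, fun x => ?_⟩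
  · rw [inv_inv]
    have hx : x.1 < n := lt_trans hxy hy
    have h1 := e1 ⟨x, hx⟩
    have h2 := e1 ⟨y, hy⟩
    simp only [Fin.castAdd_mk, Fin.eta] at h1 h2
    rw [h1, h2]
    exact (B.orderEmbOfFin hB).strictMono hxy
  · rw [inv_inv]
    have h1 := e2 ⟨x - n, by omega⟩
    have h2 := e2 ⟨y - n, by omega⟩
    have hxy' : x.1 < y.1 := hxy
    rw [show Fin.natAdd n ⟨x.1 - n, _⟩ = x from Fin.ext (by simp; omega)] at h1
    rw [show Fin.natAdd n ⟨y.1 - n, _⟩ = y from Fin.ext (by simp; omega)] at h2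
    rw [h1, h2]
    refine (Bᶜ.orderEmbOfFin hB').strictMono (Fin.mk_lt_mk.mpr (by omega))
  · obtain ⟨x, rfl⟩ := e.surjective x
    rw [show e⁻¹ (e x) = x from e.symm_apply_apply x]
    refine Fin.addCases (fun z => ?_) (fun z => ?_) x
    · rw [e1]
      simp
    · rw [e2]
      have := Finset.orderEmbOfFin_mem Bᶜ hB' z
      simp only [Fin.val_natAdd, Finset.mem_compl] at this ⊢
      simp [this]

/-- An unshuffle is determined by the letters that it moves to the first `n` places. -/
theorem unshuffle_unique {n r : ℕ} (hn : n ≤ r) {ρ ρ' : Perm (Fin r)} (h : ρ ∈ unshuffles r n)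
    (h' : ρ' ∈ unshuffles r n) (he : ∀ x, (ρ x).1 < n ↔ (ρ' x).1 < n) : ρ = ρ' := by
  obtain ⟨m, rfl⟩ := Nat.exists_eq_add_of_le hn
  rw [mem_unshuffles] at h h'
  set B : Finset (Fin (n + m)) := Finset.univ.filter fun x => (ρ x).1 < n with hB
  have key : ∀ ρ₁ : Perm (Fin (n + m)), (∀ x, (ρ₁ x).1 < n ↔ x ∈ B) →
      B.card = n ∧ Bᶜ.card = m := fun ρ₁ h1 => by
    have h2 : B.card = n := by
      have : B = (Finset.univ : Finset (Fin n)).map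
          ⟨fun z => ρ₁⁻¹ (Fin.castAdd m z), fun a c hac => by simpa using hac⟩ := by
        ext x
        rw [← h1 x, Finset.mem_map]
        constructor
        · intro hx
          refine ⟨⟨_, hx⟩, Finset.mem_univ _, ?_⟩
          exact ρ₁.symm_apply_apply x
        · rintro ⟨z, -, rfl⟩
          change (ρ₁ (ρ₁⁻¹ (Fin.castAdd m z))).1 < n
          rw [show ρ₁ (ρ₁⁻¹ (Fin.castAdd m z)) = Fin.castAdd m z from ρ₁.apply_symm_apply _]
          exact z.2
      rw [this, Finset.card_map, Finset.card_univ, Fintype.card_fin]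
    refine ⟨h2, ?_⟩
    rw [Finset.card_compl, h2]
    simp
  have hρ : ∀ x, (ρ x).1 < n ↔ x ∈ B := fun x => by simp [hB]
  have hρ' : ∀ x, (ρ' x).1 < n ↔ x ∈ B := fun x => by rw [← he, hρ]
  obtain ⟨c1, c2⟩ := key ρ hρ
  -- The values of the inverse are the increasing enumerations of `B` and of its complement.
  have val : ∀ ρ₁ : Perm (Fin (n + m)), (∀ x, (ρ₁ x).1 < n ↔ x ∈ B) →
      (∀ x y : Fin (n + m), x < y → y.1 < n → ρ₁⁻¹ x < ρ₁⁻¹ y) →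
      (∀ x y : Fin (n + m), x < y → n ≤ x.1 → ρ₁⁻¹ x < ρ₁⁻¹ y) →
      (∀ z : Fin n, ρ₁⁻¹ (Fin.castAdd m z) = B.orderEmbOfFin c1 z) ∧
      (∀ z : Fin m, ρ₁⁻¹ (Fin.natAdd n z) = Bᶜ.orderEmbOfFin c2 z) := fun ρ₁ h1 h2 h3 => by
    constructor
    · refine congrFun (Finset.orderEmbOfFin_unique c1 (f := fun z => ρ₁⁻¹ (Fin.castAdd m z))
        (fun z => ?_) fun x y hxy => ?_)
      · rw [← h1, show ρ₁ (ρ₁⁻¹ (Fin.castAdd m z)) = Fin.castAdd m z from ρ₁.apply_symm_apply _]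
        exact z.2
      · exact h2 _ _ hxy y.2
    · refine congrFun (Finset.orderEmbOfFin_unique c2 (f := fun z => ρ₁⁻¹ (Fin.natAdd n z))
        (fun z => ?_) fun x y hxy => ?_)
      · rw [Finset.mem_compl, ← h1,
          show ρ₁ (ρ₁⁻¹ (Fin.natAdd n z)) = Fin.natAdd n z from ρ₁.apply_symm_apply _]
        simp
      · exact h3 _ _ (by simpa using hxy) (by simp)
  obtain ⟨v1, v2⟩ := val ρ hρ h.1 h.2
  obtain ⟨v1', v2'⟩ := val ρ' hρ' h'.1 h'.2
  refine inv_injective (Equiv.ext fun x => ?_)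
  refine Fin.addCases (fun z => ?_) (fun z => ?_) x
  · rw [v1, v1']
  · rw [v2, v2']

/-- Every permutation factors uniquely as a composite in which the upper vertex occupies a given
block, preceded by an unshuffle. -/
theorem exists_unshuffle_permComp {m n r : ℕ} (h : r + 1 = m + n) (i j : Fin m) (hi : i.1 = 0)
    (π : Perm (Fin r)) :
    ∃ ρ ∈ unshuffles r n, ∃ a c, a i = j ∧ permComp h i a c * ρ = π := by
  classical
  obtain ⟨ρ, hρ, h1⟩ := exists_unshuffle (n := n)
    ((Finset.univ : Finset (Fin n)).map
      ⟨fun z => π⁻¹ (inputs h j (Sum.inr z)), fun a c hac => by simpa using hac⟩) (by simp)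
  obtain ⟨a, c, hj, hac⟩ := exists_permComp h i j (π * ρ⁻¹) fun z => by
    set x := ρ⁻¹ (inputs h i (Sum.inr z)) with hx
    have h2 : (ρ x).1 < n := by
      rw [hx, show ρ (ρ⁻¹ (inputs h i (Sum.inr z))) = _ from ρ.apply_symm_apply _, inputs_inr_val]
      omega
    rw [h1, Finset.mem_map] at h2
    obtain ⟨z', -, h3⟩ := h2
    refine ⟨z', ?_⟩
    rw [Perm.mul_apply, ← hx, ← h3]
    exact π.apply_symm_apply _
  exact ⟨ρ, hρ, a, c, hj, by rw [hac, inv_mul_cancel_right]⟩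

theorem unshuffle_permComp_unique {m n r : ℕ} (h : r + 1 = m + n) (i : Fin m) (hi : i.1 = 0)
    {ρ ρ' : Perm (Fin r)} (hρ : ρ ∈ unshuffles r n) (hρ' : ρ' ∈ unshuffles r n)
    {a a' : Perm (Fin m)} {c c' : Perm (Fin n)} (ha : a i = a' i)
    (he : permComp h i a c * ρ = permComp h i a' c' * ρ') : ρ = ρ' ∧ a = a' ∧ c = c' := by
  have hm := i.2
  have h1 : ρ = ρ' := by
    refine unshuffle_unique (by omega) hρ hρ' ?_
    -- The unshuffle is known, as the letters moved to the front are those that end up in the block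
    -- at `a i`.
    have key : ∀ (a : Perm (Fin m)) (c : Perm (Fin n)) (ρ : Perm (Fin r)) (x : Fin r),
        (ρ x).1 < n ↔ ∃ z, (permComp h i a c * ρ) x = inputs h (a i) (Sum.inr z) := by
      intro a c ρ x
      rw [Perm.mul_apply]
      generalize ρ x = y
      obtain ⟨y, rfl⟩ := (inputs h i).surjective y
      rcases y with y | z
      · rw [permComp_inl, inputs_inl_val]
        constructor
        · intro hy
          have := y.2
          rw [Ne, Fin.ext_iff] at this
          rw [if_neg (by omega)] at hy
          omega
        · rintro ⟨z, hz⟩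
          exact absurd hz.symm (inputs_inr_ne_inl _ _ _ _)
      · rw [permComp_inr, inputs_inr_val]
        exact ⟨fun _ => ⟨_, rfl⟩, fun _ => by omega⟩
    intro x
    rw [key a c ρ, key a' c' ρ', he, ha]
  subst h1
  exact ⟨rfl, permComp_injective h i ha (mul_right_cancel he)⟩

/-! ### Decompositions of a cyclic order and brackets -/

section

variable {k : Type u} [Field k] {b : Kind} {n : ℕ} {p : ℤ}

/-- A place in a word that represents its orbit under the rotations. -/
def Kind.IsBase (b : Kind) (j : ℕ) : Prop := b = .module → j = 0

theorem exists_rotate_isBase {m : ℕ} (i : Fin m) : ∃ ζ ∈ b.rotations m, b.IsBase (ζ i).1 := by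
  cases b
  · exact ⟨1, one_mem _, fun h => by cases h⟩
  · refine ⟨finRotate m ^ (m - i.1), Subgroup.npow_mem_zpowers _ _, fun _ => ?_⟩
    rw [rotate_pow_val, Nat.add_sub_cancel' i.2.le, Nat.mod_self]

theorem eq_one_of_isBase {m : ℕ} {ζ : Perm (Fin m)} (hζ : ζ ∈ b.rotations m) {i : Fin m}
    (h1 : b.IsBase i.1) (h2 : b.IsBase (ζ i).1) : ζ = 1 := by
  cases b
  · exact eq_one_of_mem_rotations hζ
  · obtain ⟨s, rfl⟩ := exists_rotate_pow hζ
    have h3 := h1 rfl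
    have h4 := h2 rfl
    rw [rotate_pow_val, h3, zero_add] at h4
    ext x
    rw [rotate_pow_val, Nat.add_mod, h4, add_zero, Nat.mod_mod, Nat.mod_eq_of_lt x.2]
    rfl

open Classical in
/-- The sum over the decompositions of a permutation along an unshuffle, by the place of the upper
vertex and a rotation. -/
theorem sum_decompositions {W : Type*} [AddCommMonoid W] {m h r : ℕ} (hr : r + 1 = m + (h + 1))
    (i : Fin m) (hi : i.1 = 0) {p q : ℤ} (hm : 1 ≤ m ∧ b.excess m p = 0)
    (hn : 1 ≤ h + 1 ∧ Kind.operad.excess (h + 1) q = 0) [Fintype (GenIndex b m p)]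
    [Fintype (GenIndex .operad (h + 1) q)] (σ : Perm (Fin r)) (f : Perm (Fin r) → Fin m → W)
    (F : Perm (Fin r) → GenIndex b m p → GenIndex .operad (h + 1) q → W)
    (hF : ∀ ρ ∈ unshuffles r (h + 1), ∀ α β ζ, ζ ∈ b.rotations r → b.IsBase (α i).1 →
      permComp hr i α β * ρ = ζ * σ → F ρ ⟨b.order α, hm⟩ ⟨β, hn⟩ = f ζ (α i)) :
    ∑ ρ ∈ unshuffles r (h + 1), ∑ a : GenIndex b m p, ∑ d : GenIndex .operad (h + 1) q,
      (if a.1.comp hr d.2.1 i d.1 = b.order (σ * ρ⁻¹) then F ρ a d else 0) =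
    ∑ x ∈ (Finset.univ : Finset (Perm (Fin r) × Fin m)).filter
      (fun x => x.1 ∈ b.rotations r ∧ b.IsBase x.2.1), f x.1 x.2 := by
  have h1 : ∀ x : Perm (Fin r) × Fin m, ∃ t : Perm (Fin r) × Perm (Fin m) × Perm (Fin (h + 1)),
      t.1 ∈ unshuffles r (h + 1) ∧ t.2.1 i = x.2 ∧ permComp hr i t.2.1 t.2.2 * t.1 = x.1 * σ :=
    fun x => by
    obtain ⟨ρ, hρ, a, c, h2, h3⟩ := exists_unshuffle_permComp hr i x.2 hi (x.1 * σ)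
    exact ⟨(ρ, a, c), hρ, h2, h3⟩
  -- The summand for a rotation `ζ` and a place `j` is the decomposition of `ζ * σ` with its block
  -- at `j`. Surjectivity uses a rotation that moves the block to a base place.
  choose t ht1 ht2 ht3 using h1
  have h4 : ∑ ρ ∈ unshuffles r (h + 1), ∑ a : GenIndex b m p, ∑ d : GenIndex .operad (h + 1) q,
      (if a.1.comp hr d.2.1 i d.1 = b.order (σ * ρ⁻¹) then F ρ a d else 0) =
      ∑ y ∈ (unshuffles r (h + 1) ×ˢ (Finset.univ : Finset (GenIndex b m p)) ×ˢ
        (Finset.univ : Finset (GenIndex .operad (h + 1) q))).filter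
        (fun y => y.2.1.1.comp hr y.2.2.2.1 i y.2.2.1 = b.order (σ * y.1⁻¹)),
          F y.1 y.2.1 y.2.2 := by
    rw [Finset.sum_filter, Finset.sum_product]
    refine Finset.sum_congr rfl fun ρ _ => ?_
    rw [Finset.sum_product]
  rw [h4]
  symm
  refine Finset.sum_bij (fun x _ => ((t x).1, ⟨b.order (t x).2.1, hm⟩, ⟨(t x).2.2, hn⟩))
    (fun x hx => ?_) (fun x hx x' hx' he => ?_) (fun y hy => ?_) (fun x hx => ?_)
  · rw [Finset.mem_filter] at hx
    refine Finset.mem_filter.mpr ⟨Finset.mem_product.mpr ⟨ht1 x, Finset.mem_product.mpr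
      ⟨Finset.mem_univ _, Finset.mem_univ _⟩⟩, ?_⟩
    refine (Kind.Order.comp_order hr _ i _ _).trans ?_
    refine order_eq_iff.mpr ⟨x.1, hx.2.1, ?_⟩
    rw [← mul_assoc, ← ht3 x, mul_inv_cancel_right]
  · rw [Finset.mem_filter] at hx hx'
    have e1 : (t x).1 = (t x').1 := (Prod.ext_iff.mp he).1
    have e2 : b.order (t x).2.1 = b.order (t x').2.1 :=
      congrArg Subtype.val (Prod.ext_iff.mp (Prod.ext_iff.mp he).2).1
    have e3 : (t x).2.2 = (t x').2.2 := congrArg Subtype.val (Prod.ext_iff.mp (Prod.ext_iff.mp he).2).2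
    obtain ⟨η, hη, e4⟩ := order_eq_iff.mp e2
    have e5 : η = 1 := by
      refine eq_one_of_isBase hη hx'.2.2 ?_
      rw [← ht2 x', ← Perm.mul_apply, ← e4, ht2 x]
      exact hx.2.2
    rw [e5, one_mul] at e4
    refine Prod.ext ?_ ?_
    · have := ht3 x
      rw [e4, e3, e1, ht3 x'] at this
      exact (mul_right_cancel this).symm
    · rw [← ht2 x, ← ht2 x', e4]
  · rw [Finset.mem_filter, Finset.mem_product] at hy
    obtain ⟨ρ, ⟨c, hc⟩, ⟨β', hβ⟩⟩ := y
    obtain ⟨β, rfl⟩ : ∃ β : Perm (Fin (h + 1)), β = β' := ⟨β', rfl⟩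
    obtain ⟨α, rfl⟩ := order_surjective c
    have h5 : b.order (permComp hr i α β) = b.order (σ * ρ⁻¹) :=
      (Kind.Order.comp_order hr _ i _ _).symm.trans hy.2
    obtain ⟨ζ, hζ, h6⟩ := order_eq_iff.mp h5
    obtain ⟨η, hη, h7⟩ := exists_rotate_isBase (b := b) (α i)
    have h8 := permComp_mul hr i η α 1 β
    rw [one_mul, h6] at h8
    set Z := permComp hr (α i) η (1 : Perm (Fin (h + 1))) with hZ
    have hZm : Z ∈ b.rotations r := permComp_mem_rotations hr (by omega) _ hη
    refine ⟨(Z * ζ, (η * α) i), ?_, ?_⟩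
    · rw [Finset.mem_filter]
      exact ⟨Finset.mem_univ _, mul_mem hZm hζ, h7⟩
    · have h9 : permComp hr i (t (Z * ζ, (η * α) i)).2.1 (t (Z * ζ, (η * α) i)).2.2 *
          (t (Z * ζ, (η * α) i)).1 = permComp hr i (η * α) β * ρ := by
        rw [ht3, h8]
        simp only [mul_assoc, inv_mul_cancel, mul_one]
      obtain ⟨e1, e2, e3⟩ := unshuffle_permComp_unique hr i hi (ht1 _) hy.1.1 (ht2 _) h9
      refine Prod.ext e1 (Prod.ext (Subtype.ext ?_) (Subtype.ext e3))
      change b.order _ = b.order α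
      rw [e2]
      exact order_eq_iff.mpr ⟨η, hη, rfl⟩
  · rw [Finset.mem_filter] at hx
    rw [← ht2 x]
    refine (hF _ (ht1 x) _ _ _ hx.2.1 ?_ (ht3 x)).symm
    rw [ht2 x]
    exact hx.2.2

/-- A proper block of consecutive gaps has no rotational symmetry. -/
theorem permTube_range_eq {ζ : Perm (Fin n)} (hζ : ζ ∈ cyclicGroup n) {h : ℕ} (h1 : 0 < h)
    (h2 : h < n) (he : permTube ζ (Finset.range h) = Finset.range h) : ζ = 1 := by
  obtain ⟨s, rfl⟩ := exists_rotate_pow hζ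
  have hs := Nat.mod_lt s (show 0 < n by omega)
  have key : ∀ x < h, (x + s % n) % n < h := fun x hx => by
    have h3 : permVal (finRotate n ^ s) x ∈ Finset.range h := by
      rw [← he, permVal_mem_permTube]
      exact Finset.mem_range.mpr hx
    rw [Finset.mem_range, permVal_fin _ ⟨x, hx.trans h2⟩, rotate_pow_val] at h3
    rwa [Nat.add_mod_mod]
  have h3 : s % n = 0 := by
    by_contra h0
    have h4 := key 0 h1
    rw [zero_add, Nat.mod_mod] at h4
    have h5 := key (h - s % n) (by omega)
    rw [Nat.sub_add_cancel h4.le, Nat.mod_eq_of_lt h2] at h5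
    omega
  ext x
  rw [rotate_pow_val, Nat.add_mod, h3, add_zero, Nat.mod_mod, Nat.mod_eq_of_lt x.2]
  rfl

/-- Every bracket of a cyclic word is a rotation of an initial block of gaps. -/
theorem exists_rotate_eq_range {A : Finset ℕ} (hA : Kind.module.IsBracket n A) :
    ∃ ζ ∈ cyclicGroup n, permTube ζ A = Finset.range A.card := by
  have key : ∀ s : ℕ, (∀ x ∈ A, x < n ∧ (x + s) % n < A.card) →
      permTube (finRotate n ^ s) A = Finset.range A.card := fun s hs => by
    refine Finset.eq_of_subset_of_card_le (fun y hy => ?_) (by rw [permTube_card]; simp)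
    obtain ⟨x, hx, rfl⟩ := Finset.mem_image.mp hy
    rw [permVal_fin _ ⟨x, (hs x hx).1⟩, rotate_pow_val, Finset.mem_range]
    exact (hs x hx).2
  have hlt : ∀ x ∈ A, x < n := fun x hx => hA.lt hx
  rcases hA with ⟨i, j, hij, hj, rfl⟩ | ⟨-, i, j, hij, hj, rfl⟩
  · refine ⟨_, Subgroup.npow_mem_zpowers _ (n - i), key _ fun x hx => ⟨hlt x hx, ?_⟩⟩
    have hj' : j < n := hj
    rw [Finset.mem_Icc] at hx
    rw [Nat.card_Icc, show x + (n - i) = x - i + n by omega, Nat.add_mod_right,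
      Nat.mod_eq_of_lt (by omega)]
    omega
  · have hc : (Finset.range (i + 1) ∪ Finset.Ico j n).card = i + 1 + (n - j) := by
      rw [Finset.card_union_of_disjoint, Finset.card_range, Nat.card_Ico]
      rw [Finset.disjoint_left]
      intro x hx hx'
      rw [Finset.mem_range] at hx
      rw [Finset.mem_Ico] at hx'
      omega
    refine ⟨_, Subgroup.npow_mem_zpowers _ (n - j), key _ fun x hx => ⟨hlt x hx, ?_⟩⟩
    rw [hc]
    rw [Finset.mem_union, Finset.mem_range, Finset.mem_Ico] at hx
    rcases hx with hx | hx
    · exact (Nat.mod_le _ _).trans_lt (by omega)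
    · rw [show x + (n - j) = x - j + n by omega, Nat.add_mod_right, Nat.mod_eq_of_lt (by omega)]
      omega

open Classical in
/-- The proper brackets with `h` gaps correspond to the pairs of a rotation and a base place: a
linear bracket is given by its place, a cyclic one by the rotation that moves it to the front. -/
theorem sum_brackets_card {W : Type*} [AddCommMonoid W] {m h r : ℕ} (hr : r = m + h) (hh : 0 < h)
    (hg : h < b.gaps r) (f : Finset ℕ → W) :
    ∑ x ∈ (Finset.univ : Finset (Perm (Fin r) × Fin m)).filter
      (fun x => x.1 ∈ b.rotations r ∧ b.IsBase x.2.1),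
        f (permTube x.1⁻¹ (Finset.Ico x.2.1 (x.2.1 + h))) =
    ∑ A ∈ (brackets b r).filter (fun A => A.card = h), f A := by
  have hgr : b.gaps r ≤ r := gaps_le
  have hm : 0 < m := by omega
  refine Finset.sum_bij (fun x _ => permTube x.1⁻¹ (Finset.Ico x.2.1 (x.2.1 + h)))
    (fun x hx => ?_) (fun x hx y hy he => ?_) (fun A hA => ?_) (fun x hx => rfl)
  · rw [Finset.mem_filter] at hx
    have hx2 := x.2.2
    refine Finset.mem_filter.mpr ⟨mem_brackets.mpr (Kind.IsBracket.permTube (inv_mem hx.2.1)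
      (isBracket_Ico (by omega) ?_)), ?_⟩
    · have h3 := hx.2.2
      cases b
      · simp only [Kind.gaps] at *; omega
      · rw [h3 rfl]; omega
    · rw [permTube_card, Nat.card_Ico]; omega
  · rw [Finset.mem_filter] at hx hy
    obtain ⟨ζ, i⟩ := x
    obtain ⟨η, j⟩ := y
    simp only at *
    cases b
    · rw [eq_one_of_mem_rotations hx.2.1, eq_one_of_mem_rotations hy.2.1] at he ⊢
      rw [inv_one, permTube_one, permTube_one] at he
      refine Prod.ext rfl (Fin.ext ?_)
      have h1 : i.1 ∈ Finset.Ico j.1 (j.1 + h) := he ▸ Finset.mem_Ico.mpr ⟨le_rfl, by omega⟩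
      have h2 : j.1 ∈ Finset.Ico i.1 (i.1 + h) := he ▸ Finset.mem_Ico.mpr ⟨le_rfl, by omega⟩
      rw [Finset.mem_Ico] at h1 h2
      exact le_antisymm h2.1 h1.1
    · have hi : i.1 = 0 := hx.2.2 rfl
      have hj : j.1 = 0 := hy.2.2 rfl
      rw [hi, hj, zero_add, ← Finset.range_eq_Ico] at he
      have h3 := congrArg (permTube ζ) he
      rw [permTube_self_inv, ← permTube_mul] at h3
      have h4 : ζ * η⁻¹ = 1 :=
        permTube_range_eq (mul_mem hx.2.1 (inv_mem hy.2.1)) hh (hg.trans_le hgr) h3.symm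
      exact Prod.ext (mul_inv_eq_one.mp h4) (Fin.ext (hi.trans hj.symm))
  · rw [Finset.mem_filter, mem_brackets] at hA
    obtain ⟨hA, hc⟩ := hA
    cases b
    · rcases hA with ⟨i, j, hij, hj, rfl⟩ | ⟨h1, -⟩
      · rw [Nat.card_Icc] at hc
        simp only [Kind.gaps] at *
        refine ⟨(1, ⟨i, by omega⟩), ?_, ?_⟩
        · rw [Finset.mem_filter]
          exact ⟨Finset.mem_univ _, one_mem _, fun h => by cases h⟩
        · simp only
          rw [inv_one, permTube_one]
          ext x
          rw [Finset.mem_Ico, Finset.mem_Icc]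
          omega
      · cases h1
    · obtain ⟨ζ, hζ, h1⟩ := exists_rotate_eq_range hA
      refine ⟨(ζ, ⟨0, hm⟩), ?_, ?_⟩
      · rw [Finset.mem_filter]
        exact ⟨Finset.mem_univ _, hζ, fun _ => rfl⟩
      · simp only
        rw [zero_add, ← Finset.range_eq_Ico, ← hc, ← h1, permTube_inv_self]

end

/-! ### The cobar differential on generators -/

section

variable {k : Type u} [Field k] {b : Kind} {n : ℕ} {p : ℤ}

/-- The generators of an arity are concentrated in one degree. -/
theorem gens_subsingleton (h : b.excess n p ≠ 0) : Subsingleton ((gens k b).obj n p) := by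
  have : IsEmpty (GenIndex b n p) := ⟨fun c => h c.2.2⟩
  have h1 : Subsingleton (Module.Dual k (GenIndex b n p →₀ k)) :=
    ⟨fun f g => LinearMap.ext fun x => by rw [Subsingleton.elim x 0, map_zero, map_zero]⟩
  exact (genEquiv k b n p).symm.injective.subsingleton

/-- The contribution of one tree to the cobar differential, as a linear map. -/
def treeMap (k : Type u) [Field k] (b : Kind) {m n r : ℕ} (h : r + 1 = m + n)
    (hm : b.minArity ≤ m) (hn : 2 ≤ n) (ρ : Perm (Fin r)) {p q s s' : ℤ} (hs : p + q = s')
    (hs' : s' + 1 = s) : (gens k b).obj r s →ₗ[k] Ω k b r s' :=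
  have hpos : 0 < m := lt_of_lt_of_le b.minArity_pos hm
  sgnPow k p • Free.act ρ ∘ₗ
    (TensorProduct.lift ((Free.comp h ⟨0, hpos⟩ hs).compl₁₂ (Free.gen hm)
      (Free.gen (b := .operad) hn))) ∘ₗ
    (cobarDecomp (cyclDual k) (assDual k) b h ⟨0, hpos⟩ (by rw [hs, hs'])) ∘ₗ
    (gens k b).act ρ⁻¹

theorem treeMap_eq_zero {m n r : ℕ} (h : r + 1 = m + n)
    (hm : b.minArity ≤ m) (hn : 2 ≤ n) (ρ : Perm (Fin r)) {p q s s' : ℤ} (hs : p + q = s')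
    (hs' : s' + 1 = s) (hp : b.excess m p ≠ 0) (x : (gens k b).obj r s) :
    treeMap k b h hm hn ρ hs hs' x = 0 := by
  have h1 := gens_subsingleton (k := k) hp
  have h2 : ∀ y : (gens k b).obj m p ⊗[k] (gens k .operad).obj n q, y = 0 := fun y => by
    induction y using TensorProduct.induction_on with
    | zero => rfl
    | tmul x y => rw [Subsingleton.elim x 0, TensorProduct.zero_tmul]
    | add x y hx hy => rw [hx, hy, add_zero]
  unfold treeMap
  simp only [LinearMap.smul_apply, LinearMap.comp_apply]
  rw [h2 (cobarDecomp _ _ _ _ _ _ _), map_zero, map_zero, smul_zero]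

theorem cobarOnGen_eq {r : ℕ} {s s' : ℤ} (hs : s' + 1 = s) (x : (gens k b).obj r s) :
    cobarOnGen (cyclDual k) (assDual k) b hs x =
      ∑ n ∈ Finset.Icc 2 r, ∑ ρ ∈ unshuffles r n,
        if hn : 2 ≤ n ∧ b.minArity + n ≤ r + 1 then
          treeMap k b (m := r + 1 - n) (by omega) (by omega) hn.1 ρ
            (add_sub_cancel (b.gaps (r + 1 - n) - 1 : ℤ) s') hs x
        else 0 := by
  unfold cobarOnGen
  refine Finset.sum_congr rfl fun n _ => Finset.sum_congr rfl fun ρ _ => ?_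
  -- Only one splitting of the degree contributes.
  refine (finsum_eq_single _ (b.gaps (r + 1 - n) - 1 : ℤ) fun p hp => ?_).trans rfl
  split_ifs with hn
  · refine treeMap_eq_zero (m := r + 1 - n) (by omega) _ _ ρ _ hs (fun h0 => hp ?_) x
    have := b.minArity_pos
    rw [excess_eq (by omega)] at h0
    omega
  · rfl

/-- The comparison map sends the contribution of one tree to a sum of composites of corollas. -/
theorem toTubes_treeMap {m n r : ℕ} (h : r + 1 = m + n) (i : Fin m) (hi : i.1 = 0)
    (hm : b.minArity ≤ m) (hn : 2 ≤ n) (ρ σ : Perm (Fin r)) {p q s s' : ℤ} (hs : p + q = s')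
    (hs' : s' + 1 = s) (hc : 1 ≤ r ∧ b.excess r s = 0) [Fintype (GenIndex b m p)]
    [Fintype (GenIndex .operad n q)] :
    open Classical in
    toTubes k b r s' (treeMap k b h hm hn ρ hs hs' (dualGen k b ⟨b.order σ, hc⟩)) =
    ∑ a : GenIndex b m p, ∑ d : GenIndex .operad n q,
      (if a.1.comp h d.2.1 i d.1 = b.order (σ * ρ⁻¹) then
        (sgnPow k p * sgnPerm k ρ) • TubeChain.act ρ (TubeChain.comp h i hs
          (corolla k b m p a.1) (corolla k .operad n q d.1)) else 0) := by
  classical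
  obtain ⟨i, hi'⟩ := i
  obtain rfl : i = 0 := hi
  unfold treeMap
  simp only [LinearMap.smul_apply, LinearMap.comp_apply]
  rw [dualGen_act, map_smul, map_smul, GenIndex.act_order, cobarDecomp_dualGen (hi := rfl),
    sgnPerm_inv]
  have hd : ∀ d : GenIndex .operad n q, toTubes k .operad n q (Free.gen (b := .operad) hn
      (dualGen k .operad d)) = corolla k .operad n q d.1 := fun d => genMap_dualGen d
  simp only [map_sum, map_smul, TensorProduct.lift.tmul, LinearMap.compl₁₂_apply, toTubes_act,
    toTubes_comp, hd, toTubes_gen, genMap_dualGen, Finset.smul_sum, smul_smul]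
  refine Finset.sum_congr rfl fun a _ => Finset.sum_congr rfl fun d _ => ?_
  split_ifs with h1
  · rw [mul_one]
  · simp only [mul_zero]
    exact zero_smul k _

/-- A term of the cobar differential: the composite of two corollas is the cell with one more tube,
which is the block of the inserted letters, moved back by the rotation. -/
theorem corolla_comp_corolla {m h r : ℕ} (hr : r + 1 = m + (h + 1)) (i : Fin m) (hi : i.1 = 0)
    (hm : b.minArity ≤ m) (hh : 0 < h) {p q s : ℤ} (hs : p + q = s)
    (hp : b.excess m p = 0) (hq : Kind.operad.excess (h + 1) q = 0) {ρ σ ζ : Perm (Fin r)}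
    (hζ : ζ ∈ b.rotations r) {α : Perm (Fin m)} {β : Perm (Fin (h + 1))}
    (he : permComp hr i α β * ρ = ζ * σ) :
    (sgnPow k p * sgnPerm k ρ) • TubeChain.act ρ (TubeChain.comp hr i hs
      (corolla k b m p (b.order α)) (corolla k .operad (h + 1) q β)) =
    sgnPerm k σ • cell k b s σ ([Finset.range (b.gaps r)] ++
      [permTube ζ⁻¹ (Finset.Ico (α i).1 ((α i).1 + h))]) := by
  have hg1 := good_corolla hm hp
  have hg2 := good_corolla (b := .operad) (n := h + 1) (by simp only [Kind.minArity]; omega) hq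
  have h0 : 0 < b.gaps m := by
    cases b <;> simp only [Kind.minArity, Kind.gaps] at * <;> omega
  have h1 : corolla k .operad (h + 1) q β =
    sgnPerm k β • cell k .operad q β [Finset.range (Kind.operad.gaps (h + 1))] :=
    corolla_order (b := .operad) β
  have h2 : graft b m (α i) h [Finset.range (b.gaps m)] [Finset.range (Kind.operad.gaps (h + 1))] =
      ([Finset.range (b.gaps r)] ++ [permTube ζ⁻¹ (Finset.Ico (α i).1 ((α i).1 + h))]).map
        (permTube ζ) := by
    simp only [graft, List.map_singleton, List.map_append, permTube_self_inv, permTube_range hζ]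
    rw [inflate_range (α i).2 h0, shift_range]
    simp only [Kind.gaps, Nat.add_sub_cancel]
    rw [show r = m + h by omega]
  rw [corolla_order, h1]
  simp only [map_smul, LinearMap.smul_apply]
  rw [TubeChain.comp_cell hr i hs _ _ hg1 hg2, map_smul, TubeChain.act_cell, he, h2,
    cell_rot _ _ hζ]
  simp only [smul_smul]
  congr 1
  have h3 := sgnPerm_permComp (k := k) hr i α β
  have h4 : sgnPerm k (permComp hr i α β) = sgnPerm k ζ * sgnPerm k σ * sgnPerm k ρ := by
    have := congrArg (sgnPerm k) he
    rw [sgnPerm_mul, sgnPerm_mul] at this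
    rw [← this, mul_assoc, sgnPerm_mul_self, mul_one]
  -- The inserted word has a single tube: `h - q = 1`.
  have h5 : graftSign k p q (α i) h = sgnPow k p * sgnPow k (h * (((α i).1 : ℤ) + (i.1 : ℤ))) := by
    unfold graftSign
    rw [← sgnPow_add]
    simp only [Kind.excess] at hq
    push_cast at hq
    rw [show q = (h : ℤ) - 1 by omega, hi]
    refine sgnPow_congr ⟨0, ?_⟩
    push_cast
    ring
  have e1 := sgnPow_mul_self (k := k) p
  have e2 := sgnPerm_mul_self (k := k) ρ
  have e3 := sgnPerm_mul_self (k := k) ζ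
  rw [h5]
  calc _ = (sgnPow k p * sgnPow k p) * sgnPerm k ρ * sgnPerm k ζ * (sgnPerm k α * sgnPerm k β *
        sgnPow k (h * (((α i).1 : ℤ) + (i.1 : ℤ)))) := by ring
    _ = sgnPerm k ρ * sgnPerm k ζ * (sgnPerm k ζ * sgnPerm k σ * sgnPerm k ρ) := by
      rw [e1, ← h3, h4, one_mul]
    _ = (sgnPerm k ρ * sgnPerm k ρ) * (sgnPerm k ζ * sgnPerm k ζ) * sgnPerm k σ := by ring
    _ = sgnPerm k σ := by rw [e2, e3, one_mul, one_mul]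

/-- On generators, the comparison map is compatible with the differentials. -/
theorem toTubes_cobarOnGen {r : ℕ} (hr : b.minArity ≤ r) {s s' : ℤ} (hs : s' + 1 = s)
    (x : (gens k b).obj r s) :
    toTubes k b r s' (cobarOnGen (cyclDual k) (assDual k) b hs x) =
      TubeChain.boundary hs (genMap k b r s x) := by
  classical
  rw [cobarOnGen_eq]
  suffices key : toTubes k b r s' ∘ₗ (∑ n ∈ Finset.Icc 2 r, ∑ ρ ∈ unshuffles r n,
      if hn : 2 ≤ n ∧ b.minArity + n ≤ r + 1 then
          treeMap k b (m := r + 1 - n) (by omega) (by omega) hn.1 ρ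
            (add_sub_cancel (b.gaps (r + 1 - n) - 1 : ℤ) s') hs
        else 0) = TubeChain.boundary hs ∘ₗ genMap k b r s by
    refine Eq.trans ?_ (LinearMap.congr_fun key x)
    rw [LinearMap.comp_apply]
    congr 1
    simp only [LinearMap.sum_apply]
    refine Finset.sum_congr rfl fun n _ => Finset.sum_congr rfl fun ρ _ => ?_
    split_ifs <;> rfl
  refine gens_ext fun c => ?_
  obtain ⟨c, hc⟩ := c
  obtain ⟨σ, rfl⟩ := order_surjective c
  have hpos := b.minArity_pos
  have hG := good_corolla hr hc.2
  have hex := hc.2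
  rw [excess_eq hc.1] at hex
  rw [LinearMap.comp_apply, LinearMap.comp_apply, genMap_dualGen, corolla_order, map_smul,
    TubeChain.boundary_cell hs σ hG]
  -- The tube of all gaps gives a repetition. The other brackets are sorted by their size, which is
  -- the arity of the upper vertex diminished by one.
  set G := Finset.range (b.gaps r) with hGdef
  have hmaps : ∀ A ∈ (brackets b r).erase G, A.card + 1 ∈ Finset.Icc 2 r := fun A hA => by
    rw [Finset.mem_erase, mem_brackets] at hA
    have h1 := Finset.card_pos.mpr hA.2.nonempty
    have h2 := Finset.card_lt_card (hA.2.subset_range.ssubset_of_ne hA.1)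
    rw [Finset.card_range] at h2
    have h3 : b.gaps r ≤ r := gaps_le
    rw [Finset.mem_Icc]
    omega
  have h1 : ∑ A ∈ brackets b r, cell k b s' σ ([G] ++ [A]) =
      ∑ n ∈ Finset.Icc 2 r, ∑ A ∈ ((brackets b r).erase G).filter (fun A => A.card + 1 = n),
        cell k b s' σ ([G] ++ [A]) := by
    rw [Finset.sum_fiberwise_of_maps_to hmaps]
    symm
    refine Finset.sum_erase _ ?_
    exact cell_dup σ [] G []
  rw [h1, Finset.smul_sum]
  simp only [LinearMap.sum_apply, map_sum]
  refine Finset.sum_congr rfl fun n hn => ?_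
  rw [Finset.mem_Icc] at hn
  obtain ⟨h, rfl⟩ := Nat.exists_eq_add_of_le' (show 1 ≤ n by omega)
  by_cases hn' : b.minArity + (h + 1) ≤ r + 1
  · have hm : b.minArity ≤ r + 1 - (h + 1) := by omega
    have hr' : r + 1 = (r + 1 - (h + 1)) + (h + 1) := by omega
    have hgap : b.gaps r = b.gaps (r + 1 - (h + 1)) + h := by
      rw [← gaps_add h (by omega), ← show r = r + 1 - (h + 1) + h by omega]
    have hhg : h < b.gaps r := by
      cases b <;> simp only [Kind.minArity, Kind.gaps] at * <;> omega
    have hp : b.excess (r + 1 - (h + 1)) (b.gaps (r + 1 - (h + 1)) - 1 : ℤ) = 0 := by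
      rw [excess_eq (by omega)]; omega
    have hq : Kind.operad.excess (h + 1) (s' - (b.gaps (r + 1 - (h + 1)) - 1 : ℤ)) = 0 := by
      simp only [Kind.excess, Nat.cast_add, Nat.cast_one]
      omega
    have := Fintype.ofFinite (GenIndex b (r + 1 - (h + 1)) (b.gaps (r + 1 - (h + 1)) - 1 : ℤ))
    have := Fintype.ofFinite (GenIndex .operad (h + 1) (s' - (b.gaps (r + 1 - (h + 1)) - 1 : ℤ)))
    have h2 : ((brackets b r).erase G).filter (fun A => A.card + 1 = h + 1) =
        (brackets b r).filter (fun A => A.card = h) := by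
      ext A
      simp only [Finset.mem_filter, Finset.mem_erase, add_left_inj]
      constructor
      · rintro ⟨⟨-, h3⟩, h4⟩
        exact ⟨h3, h4⟩
      · rintro ⟨h3, h4⟩
        refine ⟨⟨?_, h3⟩, h4⟩
        rintro rfl
        rw [hGdef, Finset.card_range] at h4
        omega
    rw [h2, Finset.smul_sum, ← sum_brackets_card (m := r + 1 - (h + 1)) (by omega) (by omega) hhg]
    -- Trees with two vertices correspond to rotations and places, and these to brackets.
    refine Eq.trans ?_ (sum_decompositions hr' ⟨0, by omega⟩ rfl ⟨by omega, hp⟩ ⟨by omega, hq⟩ σ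
      (fun ζ j => sgnPerm k σ • cell k b s' σ ([G] ++ [permTube ζ⁻¹ (Finset.Ico j.1 (j.1 + h))]))
      (fun ρ a d => (sgnPow k (b.gaps (r + 1 - (h + 1)) - 1 : ℤ) * sgnPerm k ρ) •
        TubeChain.act ρ (TubeChain.comp hr' ⟨0, by omega⟩ (add_sub_cancel _ s')
          (corolla k b _ _ a.1) (corolla k .operad _ _ d.1)))
      (fun ρ hρ α β ζ hζ hb he => corolla_comp_corolla hr' ⟨0, by omega⟩ rfl hm (by omega) _ hp hq
        hζ he))
    refine Finset.sum_congr rfl fun ρ _ => ?_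
    rw [dif_pos ⟨hn.1, hn'⟩]
    exact toTubes_treeMap hr' ⟨0, by omega⟩ rfl hm _ ρ σ _ hs hc
  · rw [Finset.sum_eq_zero fun ρ _ => by rw [dif_neg (fun h2 => hn' h2.2)]; simp]
    rw [Finset.sum_eq_zero fun A hA => ?_, smul_zero]
    rw [Finset.mem_filter] at hA
    exfalso
    have h3 := hA.2
    have h4 := hA.1
    rw [Finset.mem_erase, mem_brackets] at h4
    have h2 := Finset.card_lt_card (h4.2.subset_range.ssubset_of_ne h4.1)
    rw [Finset.card_range] at h2
    cases b <;> simp only [Kind.minArity, Kind.gaps] at * <;> omega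

end

/-! ### Iterated composites -/

section

variable {k : Type u} [Field k] {b : Kind} {n : ℕ} {p : ℤ}

/-- The generator of the free operad or module that corresponds to the identical permutation. -/
def mu (k : Type u) [Field k] {b : Kind} {n : ℕ} {p : ℤ} (hn : b.minArity ≤ n)
    (hp : b.excess n p = 0) : Ω k b n p :=
  Free.gen hn (dualGen k b ⟨b.order 1, b.minArity_pos.trans_le hn, hp⟩)

/-- Iterated composites of generators, without permutations, together with their lists of tubes. -/
inductive Comb (k : Type u) [Field k] :
    ∀ {b : Kind} {n : ℕ} {p : ℤ}, List (Finset ℕ) → Ω k b n p → Prop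
  | unit : Comb k [] (Free.unit : Ω k .operad 1 0)
  | gen {b : Kind} {n : ℕ} {p : ℤ} (hn : b.minArity ≤ n) (hp : b.excess n p = 0) :
      Comb k [Finset.range (b.gaps n)] (mu k hn hp)
  | comp {b : Kind} {m h r : ℕ} {p q s : ℤ} (hr : r + 1 = m + (h + 1)) (j : Fin m)
      (hs : p + q = s) (hm : b.minArity ≤ m) (hh : Kind.operad.minArity ≤ h + 1)
      (hq : Kind.operad.excess (h + 1) q = 0) {L : List (Finset ℕ)} {x : Ω k b m p}
      (hx : Comb k L x) :
      Comb k (L.map (b.inflate m j h) ++ [Finset.Ico j.1 (j.1 + h)])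
        (Free.comp hr j hs x (mu k hh hq))

theorem graft_range (m j h : ℕ) (L : List (Finset ℕ)) :
    graft b m j h L [Finset.range (Kind.operad.gaps (h + 1))] =
      L.map (b.inflate m j h) ++ [Finset.Ico j (j + h)] := by
  simp only [graft, List.map_singleton, shift_range]
  simp [Kind.gaps]

theorem Comb.good {L : List (Finset ℕ)} {x : Ω k b n p} (h : Comb k L x) : b.Good n p L := by
  induction h with
  | unit => exact good_unit
  | gen hn hp => exact good_corolla hn hp
  | @comp b m h r p q s hr j hs hm hh hq L x hx ih =>
    have h1 := ih.graft j.2 (good_corolla hh hq)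
    rw [graft_range] at h1
    obtain rfl : r = m + h := by omega
    rw [← hs]
    exact h1

theorem Comb.degree_nonneg {L : List (Finset ℕ)} {x : Ω k b n p} (h : Comb k L x) : 0 ≤ p := by
  induction h with
  | unit => exact le_rfl
  | @gen b n p hn hp =>
    have := b.minArity_pos
    rw [excess_eq (by omega)] at hp
    have : 1 ≤ b.gaps n := by cases b <;> simp only [Kind.minArity, Kind.gaps] at * <;> omega
    omega
  | @comp b m h r p q s hr j hs hm hh hq L x hx ih =>
    simp only [Kind.excess, Kind.minArity] at hq hh
    push_cast at hq
    omega

theorem Comb.length_pos {L : List (Finset ℕ)} {x : Ω k b n p} (h : Comb k L x)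
    (hn : b.minArity ≤ n) : L ≠ [] := by
  cases h with
  | unit => simp [Kind.minArity] at hn
  | gen => simp
  | comp => simp

theorem toTubes_mu (hn : b.minArity ≤ n) (hp : b.excess n p = 0) :
    toTubes k b n p (mu k hn hp) = cell k b p 1 [Finset.range (b.gaps n)] := by
  rw [mu, toTubes_gen, genMap_dualGen, corolla_order]
  simp [sgnPerm]

/-- The scalar `sgnPow k p` acts like a unit of `ℤ`, so that signs need no ground field. -/
theorem exists_unit_sgnPow (p : ℤ) {W : Type*} [AddCommGroup W] [Module k W] (w : W) :
    ∃ ε : ℤˣ, sgnPow k p • w = ε • w := by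
  refine ⟨p.negOnePow, ?_⟩
  rw [sgnPow, Units.smul_def, ← Int.cast_smul_eq_zsmul k]

theorem Comb.toTubes {L : List (Finset ℕ)} {x : Ω k b n p} (h : Comb k L x) :
    ∃ ε : ℤˣ, Cyclo.toTubes k b n p x = ε • cell k b p 1 L := by
  induction h with
  | unit => exact ⟨1, (one_smul _ _).symm⟩
  | gen hn hp => exact ⟨1, by rw [toTubes_mu, one_smul]⟩
  | @comp b m h r p q s hr j hs hm hh hq L x hx ih =>
    obtain ⟨ε, hε⟩ := ih
    obtain ⟨ε', hε'⟩ := exists_unit_sgnPow (k := k) (((h : ℤ) - q) * p + (j.1 : ℤ) * h)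
      (cell k b s (permComp hr j 1 (1 : Perm (Fin (h + 1))))
        (graft b m j h L [Finset.range (Kind.operad.gaps (h + 1))]))
    refine ⟨ε * ε', ?_⟩
    rw [toTubes_comp, hε, toTubes_mu, Units.smul_def, map_zsmul, LinearMap.smul_apply,
      TubeChain.comp_cell hr j hs _ _ hx.good (good_corolla hh hq), graftSign, Perm.one_apply, hε',
      permComp_one_one, graft_range, mul_smul]
    rfl

/-- Two insertions at different places can be exchanged up to sign. -/
theorem comp_mu_parallel {l h₁ h₂ r₁ r₂ r : ℕ} (e₁ : r₁ + 1 = l + (h₁ + 1))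
    (e₂ : r₂ + 1 = l + (h₂ + 1)) (e₃ : r + 1 = r₁ + (h₂ + 1)) (e₄ : r + 1 = r₂ + (h₁ + 1))
    (i j : Fin l) (hij : i < j) (j' : Fin r₁) (hj : j'.1 = j.1 + h₁) (i' : Fin r₂)
    (hi : i'.1 = i.1) {p q t s₁ s₂ s : ℤ} (hs₁ : p + q = s₁) (hs₂ : p + t = s₂) (hs₃ : s₁ + t = s)
    (hs₄ : s₂ + q = s) (x : Ω k b l p) (y : Ω k .operad (h₁ + 1) q)
    (z : Ω k .operad (h₂ + 1) t) :
    ∃ ε : ℤˣ, Free.comp e₃ j' hs₃ (Free.comp e₁ i hs₁ x y) z =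
      ε • Free.comp e₄ i' hs₄ (Free.comp e₂ j hs₂ x z) y := by
  obtain ⟨ε, hε⟩ := exists_unit_sgnPow (k := k) (q * t)
    (Free.comp e₄ i' hs₄ (Free.comp e₂ j hs₂ x z) y)
  refine ⟨ε, ?_⟩
  rw [← hε]
  obtain ⟨x⟩ := x; obtain ⟨y⟩ := y; obtain ⟨z⟩ := z
  exact Free.sound (.parallel e₁ e₂ e₃ e₄ i j hij j' (by omega) i' hi hs₁ hs₂ hs₃ hs₄ x y z)

/-- A minimal tube of an iterated composite can be split off last. -/
theorem Comb.exists_last {L : List (Finset ℕ)} {x : Ω k b n p} (hx : Comb k L x) {A : Finset ℕ}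
    (hA : A ∈ L) (hmin : ∀ B ∈ L, B ⊆ A → B = A) (hG : A ≠ Finset.range (b.gaps n)) :
    ∃ (m h : ℕ) (q t : ℤ) (hr : n + 1 = m + (h + 1)) (j : Fin m) (hs : q + t = p)
      (hh : Kind.operad.minArity ≤ h + 1) (ht : Kind.operad.excess (h + 1) t = 0)
      (L' : List (Finset ℕ)) (y : Ω k b m q) (ε : ℤˣ), b.minArity ≤ m ∧ Comb k L' y ∧
        A = Finset.Ico j.1 (j.1 + h) ∧ L.Perm (L'.map (b.inflate m j h) ++ [A]) ∧
        x = ε • Free.comp hr j hs y (mu k hh ht) := by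
  induction hx generalizing A with
  | unit => simp at hA
  | gen hn hp => exact absurd (List.mem_singleton.mp hA) hG
  | @comp b m h r p q s hr j hs hm hh hq L x hx ih =>
    by_cases hAI : A = Finset.Ico j.1 (j.1 + h)
    · exact ⟨m, h, p, q, hr, j, hs, hh, hq, L, x, 1, hm, hx, hAI, by rw [hAI],
        (one_smul _ _).symm⟩
    obtain ⟨A', hA', rfl⟩ : ∃ A' ∈ L, b.inflate m j h A' = A := by
      rcases List.mem_append.mp hA with h1 | h1
      · exact List.mem_map.mp h1
      · exact absurd (List.mem_singleton.mp h1) hAI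
    have hgood := hx.good
    have hbr := hgood.bracket
    have hlt : ∀ B ∈ L, ∀ x ∈ B, x < b.gaps m := fun B hB x hx => (hbr B hB).lt hx
    obtain rfl : r = m + h := by omega
    have hg0 : 0 < b.gaps m := by
      cases b <;> simp only [Kind.minArity, Kind.gaps] at * <;> omega
    obtain ⟨l, h', q', t', hr', j', hs', hh', ht', L', y, ε, hl, hy, rfl, hp', rfl⟩ := ih hA'
      (fun B hB hBA => inflate_inj j.2 (hlt B hB) (hlt _ hA')
        (hmin _ (List.mem_append_left _ (List.mem_map_of_mem hB))
          ((inflate_subset_iff j.2 (hlt B hB) (hlt _ hA')).mpr hBA)))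
      (fun h1 => hG (by rw [h1, inflate_range j.2 hg0]))
    obtain rfl : m = l + h' := by omega
    have hh1 : 1 ≤ h := by simp only [Kind.minArity] at hh; omega
    have hh1' : 1 ≤ h' := by simp only [Kind.minArity] at hh'; omega
    have hgood' := hy.good
    have hR : ∀ h, 1 ≤ h → ∀ B ∈ [Finset.range (Kind.operad.gaps (h + 1))],
        Kind.operad.IsBracket (h + 1) B := fun h hh B hB => by
      rw [List.mem_singleton.mp hB]
      exact isBracket_range (by simp only [Kind.gaps]; omega)
    -- By minimality, the last inserted word is not inside `A`, so that the two insertions take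
    -- place at different letters and can be exchanged.
    have hnot : j.1 < j'.1 ∨ j'.1 + h' < j.1 := by
      by_contra hcon
      refine hAI (hmin (Finset.Ico j.1 (j.1 + h))
        (List.mem_append_right _ (List.mem_singleton_self _)) fun x hx => ?_).symm
      rw [Finset.mem_Ico] at hx
      refine (mem_inflate j.2 (hlt _ hA') x).mpr (Or.inr (Or.inl ⟨hx.1, hx.2, ?_⟩))
      rw [Finset.mem_Ico, Finset.mem_Ico]
      split_ifs <;> omega
    have hperm : (L.map (b.inflate (l + h') j h) ++ [Finset.Ico j.1 (j.1 + h)]).Perm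
        (graft b (l + h') j h (graft b l j' h' L' [Finset.range (Kind.operad.gaps (h' + 1))])
          [Finset.range (Kind.operad.gaps (h + 1))]) := by
      rw [graft_range, graft_range]
      exact (hp'.map _).append_right _
    -- The last insertion is to the left of `A`, or else to the right of it.
    rcases hnot with hlt' | hlt'
    · have hi : j.1 < l := by have := j'.2; omega
      have hI : b.inflate (l + h') j h (Finset.Ico j'.1 (j'.1 + h')) =
          Finset.Ico (j'.1 + h) (j'.1 + h + h') := by
        rw [← shift_range, inflate_shift_left hlt' j'.2 fun x => Finset.mem_range.mp, shift_range]
      obtain ⟨X, h1, h2⟩ := graft_parallel (b := b) hlt' j'.2 hgood'.bracket (hR h hh1) (hR h' hh1')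
      obtain ⟨ε', hε'⟩ := comp_mu_parallel (k := k) (b := b) (r₁ := l + h) (by omega) hr' (by omega)
        hr ⟨j.1, hi⟩ j' hlt' ⟨j'.1 + h, by have := j'.2; omega⟩ rfl j rfl (q := q)
        rfl hs' (show q' + q + t' = s by omega) hs y (mu k hh hq) (mu k hh' ht')
      refine ⟨l + h, h', q' + q, t', by omega, ⟨j'.1 + h, by have := j'.2; omega⟩, by omega, hh', ht',
        _, _, ε * ε', by omega, Comb.comp (r := l + h) (by omega) ⟨j.1, hi⟩ rfl hl hh hq hy, hI, ?_, ?_⟩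
      · refine hperm.trans ?_
        rw [h2, hI, ← graft_range, ← graft_range, h1, List.append_assoc, List.append_assoc]
        exact List.perm_append_comm.append_left _
      · rw [mul_smul, hε', Units.smul_def ε, map_zsmul, LinearMap.smul_apply, ← Units.smul_def,
          smul_smul ε', Int.units_mul_self, one_smul]
    · have hi : j.1 - h' < l := by have := j.2; omega
      have hI : b.inflate (l + h') j h (Finset.Ico j'.1 (j'.1 + h')) =
          Finset.Ico j'.1 (j'.1 + h') := by
        have := inflate_shift_right (b := b) (h₂ := h) (show j'.1 < j.1 - h' by omega) hi
          (A := Finset.range h') fun x => Finset.mem_range.mp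
        rwa [Nat.sub_add_cancel (by omega), shift_range] at this
      obtain ⟨X, h1, h2⟩ := graft_parallel (b := b) (show j'.1 < j.1 - h' by omega) hi
        hgood'.bracket (hR h' hh1') (hR h hh1)
      rw [Nat.sub_add_cancel (show h' ≤ j.1 by omega)] at h1 h2
      obtain ⟨ε', hε'⟩ := comp_mu_parallel (k := k) (b := b) (r₂ := l + h) hr' (by omega) hr
        (by omega) j' ⟨j.1 - h', hi⟩ (by rw [Fin.lt_def]; simp only; omega) j
        (by simp only; omega) ⟨j'.1, by have := j'.2; omega⟩ rfl hs' (rfl : q' + q = _) hs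
        (show q' + q + t' = s by omega) y (mu k hh' ht') (mu k hh hq)
      refine ⟨l + h, h', q' + q, t', by omega, ⟨j'.1, by have := j'.2; omega⟩, by omega, hh', ht',
        _, _, ε * ε', by omega, Comb.comp (r := l + h) (by omega) ⟨j.1 - h', hi⟩ rfl hl hh hq hy,
        hI, ?_, ?_⟩
      · refine hperm.trans ?_
        rw [h1, hI, ← graft_range, ← graft_range, h2, List.append_assoc, List.append_assoc]
        exact List.perm_append_comm.append_left _
      · rw [mul_smul, ← hε', Units.smul_def ε, map_zsmul, LinearMap.smul_apply, ← Units.smul_def]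

end

/-! ### Iterated composites span the cobar construction -/

section

variable {k : Type u} [Field k] {b : Kind} {n : ℕ} {p : ℤ}

theorem exists_rotate_eq (i j : Fin n) : ∃ ζ ∈ cyclicGroup n, ζ i = j := by
  obtain ⟨ζ, hζ, h1⟩ := exists_rotate_isBase (b := .module) i
  obtain ⟨η, hη, h2⟩ := exists_rotate_isBase (b := .module) j
  refine ⟨η⁻¹ * ζ, mul_mem (inv_mem hη) hζ, ?_⟩
  rw [Perm.mul_apply, Perm.inv_eq_iff_eq]
  exact Fin.ext ((h1 rfl).trans (h2 rfl).symm)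

/-- A nontrivial rotation fixes no proper bracket. -/
theorem eq_one_of_permTube_eq {ζ : Perm (Fin n)} (hζ : ζ ∈ b.rotations n) {A : Finset ℕ}
    (hA : b.IsBracket n A) (hc : A.card < n) (he : permTube ζ A = A) : ζ = 1 := by
  cases b
  · exact eq_one_of_mem_rotations hζ
  · obtain ⟨θ, hθ, h1⟩ := exists_rotate_eq_range hA
    have h2 : θ * ζ * θ⁻¹ = 1 := permTube_range_eq (mul_mem (mul_mem hθ hζ) (inv_mem hθ))
      (Finset.card_pos.mpr hA.nonempty) hc
      (by rw [permTube_mul, permTube_mul, ← h1, permTube_inv_self, he])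
    exact conj_eq_one_iff.mp h2

/-- The rotations act on the generator of the identical permutation by their signs. -/
theorem act_mu (η : Perm (Fin n)) (hη : η ∈ b.rotations n) (hn : b.minArity ≤ n)
    (hp : b.excess n p = 0) : ∃ ε : ℤˣ, mu k hn hp = ε • Free.act η (mu k hn hp) := by
  have h1 : Free.act η (mu k hn hp) = Free.gen hn ((gens k b).act η
      (dualGen k b ⟨b.order 1, b.minArity_pos.trans_le hn, hp⟩)) :=
    (Free.sound (.gen_act hn η _)).symm
  rw [dualGen_act, GenIndex.act_order, map_smul] at h1
  have h2 : b.order (1 * η) = b.order 1 := order_eq_iff.mpr ⟨η, hη, by group⟩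
  refine ⟨Perm.sign η, ?_⟩
  rw [h1, mu, Units.smul_def, ← Int.cast_smul_eq_zsmul k, smul_smul]
  simp only [h2]
  have h3 : (((Perm.sign η : ℤˣ) : ℤ) : k) * sgnPerm k η = 1 := sgnPerm_mul_self η
  rw [h3, one_smul]

/-- Permutations of the inputs of the first factor can be pulled out of a composite with a
generator. -/
theorem act_comp_mu {m h r : ℕ} {p q s : ℤ} (hr : r + 1 = m + (h + 1)) (j : Fin m)
    (hs : p + q = s) (hh : Kind.operad.minArity ≤ h + 1)
    (hq : Kind.operad.excess (h + 1) q = 0) (σ : Perm (Fin m)) (x : Ω k b m p) :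
    Free.comp hr j hs (Free.act σ x) (mu k hh hq) =
      Free.act (permComp hr j σ 1) (Free.comp hr (σ j) hs x (mu k hh hq)) := by
  have h1 : Free.act 1 (mu k hh hq) = mu k hh hq := Free.sound (.act_one _)
  conv_lhs => rw [← h1]
  obtain ⟨x⟩ := x
  exact Free.sound (.comp_act hr j hs σ 1 x _)

/-- Up to sign and rotation, an iterated composite is determined by its set of tubes. -/
theorem Comb.unique {L L' : List (Finset ℕ)} {x y : Ω k b n p} (hx : Comb k L x)
    (hy : Comb k L' y) {η : Perm (Fin n)} (hη : η ∈ b.rotations n)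
    (hL : L'.Perm (L.map (permTube η))) : ∃ ε : ℤˣ, x = ε • Free.act η y := by
  induction hx generalizing L' with
  | unit =>
    obtain rfl := eq_one_of_mem_rotations hη
    refine ⟨1, ?_⟩
    rw [one_smul]
    have h0 : L' = [] := List.perm_nil.mp hL
    have h1 : Free.act 1 y = y := by obtain ⟨y⟩ := y; exact Free.sound (.act_one _)
    rw [h1]
    cases hy with
    | unit => rfl
    | gen => simp at h0
    | comp => simp at h0
  | gen hn hp =>
    have h0 := hL.length_eq
    cases hy with
    | unit => simp at h0
    | gen => exact act_mu η hη hn hp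
    | comp hr j hs hm hh hq hx =>
      have := hx.length_pos hm
      simp at h0
      exact absurd h0 this
  | @comp b m h r p q s hr j hs hm hh hq L x hx ih =>
    obtain rfl : r = m + h := by omega
    have hh1 : 0 < h := by simp only [Kind.minArity] at hh; omega
    have hm1 : 0 < m := lt_of_lt_of_le b.minArity_pos hm
    have hg : 0 < b.gaps m := by cases b <;> simp only [Kind.minArity, Kind.gaps] at * <;> omega
    have hxg := hx.good
    have hIb : b.IsBracket (m + h) (Finset.Ico j.1 (j.1 + h)) := by
      refine isBracket_Ico (by omega) ?_
      rw [gaps_add h hm1]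
      have := le_gaps (b := b) (n := m)
      omega
    set I := Finset.Ico j.1 (j.1 + h) with hI
    have hIc : I.card = h := by simp [hI]
    set J := permTube η I with hJ
    have hJc : J.card = h := by rw [hJ, permTube_card, hIc]
    -- The image `J` of the tube that is inserted last into `x` is a minimal tube of `y`, so that
    -- the corresponding insertion can be made the last one of `y`.
    obtain ⟨m', h', q', t, hr', j', hs', hh', ht, Ly, y1, ε, hm', hy1, hJe, hLp, rfl⟩ :=
      hy.exists_last (A := J) (hL.mem_iff.mpr (List.mem_map_of_mem
        (List.mem_append_right _ (List.mem_singleton_self _))))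
        (fun B hB hBJ => by
          obtain ⟨B', hB', rfl⟩ := List.mem_map.mp (hL.mem_iff.mp hB)
          rw [hJ, permTube_subset_iff] at hBJ
          rcases List.mem_append.mp hB' with h1 | h1
          · obtain ⟨B'', h2, rfl⟩ := List.mem_map.mp h1
            exact absurd hBJ (not_subset_block j.2 (hxg.bracket _ h2))
          · rw [List.mem_singleton.mp h1])
        (fun h1 => by
          have := congrArg Finset.card h1
          rw [hJc, Finset.card_range, gaps_add h hm1] at this
          omega)
    have hh0 : h' = h := by rw [← hJc, hJe]; simp
    subst hh0
    obtain rfl : m' = m := by omega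
    obtain rfl : t = q := by
      rw [excess_eq (by omega)] at hq ht
      omega
    obtain rfl : q' = p := by omega
    obtain ⟨ζ, hζ, hζj⟩ : ∃ ζ ∈ b.rotations m', ζ j = j' := by
      cases b
      · refine ⟨1, one_mem _, Fin.ext ?_⟩
        obtain rfl := eq_one_of_mem_rotations hη
        rw [permTube_one] at hJ
        have h1 : j.1 ∈ J := by rw [hJ, hI, Finset.mem_Ico]; omega
        have h2 : j'.1 ∈ I := by rw [← hJ, hJe, Finset.mem_Ico]; omega
        rw [hJe, Finset.mem_Ico] at h1
        rw [hI, Finset.mem_Ico] at h2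
        exact le_antisymm h2.1 h1.1
      · exact exists_rotate_eq j j'
    have hZ := permComp_mem_rotations hr (by omega) j hζ
    have hZI : permTube (permComp hr j ζ (1 : Perm (Fin (h' + 1)))) I = J := by
      rw [hI, ← shift_range, permTube_shift hr j ζ fun x => Finset.mem_range.mp, shift_range, hζj,
        hJe]
    -- The rotation is the one that a rotation `ζ` of the shorter word induces, since both move `I`
    -- to `J`.
    have hZη : permComp hr j ζ (1 : Perm (Fin (h' + 1))) = η := by
      have := eq_one_of_permTube_eq (mul_mem (inv_mem hZ) hη) hIb (by omega)
        (by rw [permTube_mul, ← hJ, ← hZI, permTube_inv_self])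
      exact inv_mul_eq_one.mp this
    have hlt : ∀ B ∈ L, ∀ x ∈ B, x < b.gaps m' := fun B hB x hx => (hxg.bracket B hB).lt hx
    have hlt' : ∀ B ∈ Ly, ∀ x ∈ B, x < b.gaps m' := fun B hB x hx => (hy1.good.bracket B hB).lt hx
    have hP : (Ly.map (b.inflate m' j' h')).Perm
        ((L.map (permTube ζ)).map (b.inflate m' j' h')) := by
      refine (List.perm_append_right_iff [J]).mp (hLp.symm.trans (hL.trans ?_))
      rw [List.map_append, List.map_map, List.map_map, List.map_singleton, ← hJ]
      refine List.Perm.append_right _ (List.Perm.of_eq (List.map_congr_left fun B hB => ?_))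
      simp only [Function.comp_apply]
      rw [← hZη, permTube_inflate hr j hζ (hlt B hB), hζj]
    -- As inflation is injective, the shorter words have corresponding tubes.
    have hP' : Ly.Perm (L.map (permTube ζ)) := by
      classical
      have key : ∀ X : List (Finset ℕ), (∀ B ∈ X, ∀ x ∈ B, x < b.gaps m') →
          (X.map (b.inflate m' j' h')).map (Function.invFunOn (b.inflate m' j' h')
            {B | ∀ x ∈ B, x < b.gaps m'}) = X := fun X hX => by
        rw [List.map_map]
        refine (List.map_congr_left fun B hB => ?_).trans (List.map_id _)
        have h1 : ∃ a ∈ {B : Finset ℕ | ∀ x ∈ B, x < b.gaps m'},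
            b.inflate m' j' h' a = b.inflate m' j' h' B := ⟨B, hX B hB, rfl⟩
        exact inflate_inj j'.2 (Function.invFunOn_mem h1) (hX B hB) (Function.invFunOn_eq h1)
      have := hP.map (Function.invFunOn (b.inflate m' j' h') {B | ∀ x ∈ B, x < b.gaps m'})
      rwa [key _ hlt', key _ fun B hB x hx => by
        obtain ⟨B', hB', rfl⟩ := List.mem_map.mp hB
        exact ((hxg.bracket B' hB').permTube hζ).lt hx] at this
    obtain ⟨ε', rfl⟩ := ih hy1 hζ hP'
    refine ⟨ε' * ε, ?_⟩
    rw [Units.smul_def, map_zsmul, LinearMap.smul_apply, act_comp_mu, ← hZη, hζj, Units.smul_def,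
      Units.smul_def, map_zsmul, Units.val_mul, mul_smul, smul_smul (ε : ℤ) (ε : ℤ),
      ← Units.val_mul ε ε, Int.units_mul_self, Units.val_one, one_smul]

/-- A compatible set of tubes that avoid the last gap, and the set of all gaps, are the tubes of an
iterated composite. -/
theorem exists_comb (hn : b.minArity ≤ n) {L : List (Finset ℕ)} (hL : b.Good n p L)
    (hd : L.Nodup) (hc : ∀ A ∈ L, ∀ B ∈ L, ¬ b.Incompat n A B)
    (hl : ∀ A ∈ L, A ≠ Finset.range (b.gaps n) → n - 1 ∉ A) :
    ∃ (L' : List (Finset ℕ)) (x : Ω k b n p), L.Perm L' ∧ Comb k L' x := by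
  induction hN : L.length generalizing n p L with
  | zero =>
    have h0 := hL.full (by cases b <;> simp only [Kind.minArity, Kind.gaps] at * <;> omega)
    rw [List.length_eq_zero_iff.mp hN] at h0
    simp at h0
  | succ N ih =>
    have hg : 0 < b.gaps n := by cases b <;> simp only [Kind.minArity, Kind.gaps] at * <;> omega
    by_cases hprop : ∃ A ∈ L, A ≠ Finset.range (b.gaps n)
    swap
    · push Not at hprop
      obtain rfl : L = [Finset.range (b.gaps n)] := by
        have h2 := List.eq_replicate_iff.mpr ⟨rfl, hprop⟩
        rw [h2] at hd ⊢
        have h3 := List.nodup_replicate.mp hd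
        obtain h4 : L.length = 1 := by omega
        rw [h4]
        rfl
      have hp : b.excess n p = 0 := by
        have := hL.length
        rw [excess_eq hL.pos]
        simp at this
        omega
      exact ⟨_, _, .refl _, .gen hn hp⟩
    -- A smallest proper tube is an interval of letters; the other tubes come from the word in which
    -- these letters are replaced by one.
    obtain ⟨A, ⟨hA, hAG⟩, hmin⟩ := Set.exists_min_image
      {A | A ∈ L ∧ A ≠ Finset.range (b.gaps n)} Finset.card
      (L.finite_toSet.subset fun _ h => h.1) hprop
    have hAb := hL.bracket A hA
    obtain ⟨j, h, hh0, rfl, hjn⟩ : ∃ j h, 0 < h ∧ A = Finset.Ico j (j + h) ∧ j + h < n := by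
      have h1 : Kind.operad.IsBracket n A :=
        isBracket_iff.mpr ⟨hAb.conn, fun _ => hl A hA hAG⟩
      rcases h1 with ⟨i, j, hij, hj, rfl⟩ | h1
      · simp only [Kind.gaps] at hj
        refine ⟨i, j + 1 - i, by omega, ?_, by omega⟩
        ext x
        simp only [Finset.mem_Icc, Finset.mem_Ico]
        omega
      · exact absurd h1.1 (by simp)
    obtain ⟨m, rfl⟩ : ∃ m, n = m + h := ⟨n - h, by omega⟩
    have hj : j < m := by omega
    have hm1 : 1 ≤ m := by omega
    have hcard : h < b.gaps (m + h) := by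
      have h1 := Finset.card_lt_card (Finset.ssubset_iff_subset_ne.mpr ⟨hAb.subset_range, hAG⟩)
      simpa using h1
    have hm : b.minArity ≤ m := by
      cases b <;> simp only [Kind.minArity, Kind.gaps] at * <;> omega
    have hgm : 0 < b.gaps m := by rw [gaps_add h hm1] at hcard; omega
    obtain ⟨L1, hL1⟩ : ∃ L1, L.Perm (Finset.Ico j (j + h) :: L1) :=
      ⟨_, List.perm_cons_erase hA⟩
    have hd1 := hL1.nodup_iff.mp hd
    rw [List.nodup_cons] at hd1
    have hsub : ∀ B ∈ L1, B ∈ L := fun B hB => hL1.mem_iff.mpr (List.mem_cons_of_mem _ hB)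
    have hL1' : L1 ∈ Set.range (List.map
        (fun B : {B // b.IsBracket m B} => b.inflate m j h B.1)) := by
      rw [Set.range_list_map]
      intro B hB
      have hBL := hsub B hB
      obtain ⟨B', h1, h2⟩ := exists_eq_inflate hj hh0 (hL.bracket B hBL) (hc B hBL _ hA)
        (fun hBA => by
          have hBG : B ≠ Finset.range (b.gaps (m + h)) := fun h1 => by
            rw [h1] at hBA
            have := Finset.card_le_card hBA
            simp at this
            omega
          rw [Finset.eq_of_subset_of_card_le hBA (hmin B ⟨hBL, hBG⟩)] at hB
          exact hd1.1 hB)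
      exact ⟨⟨B', h1⟩, h2.symm⟩
    obtain ⟨L2, rfl⟩ := hL1'
    have hbr : ∀ B ∈ L2.map Subtype.val, b.IsBracket m B := fun B hB => by
      obtain ⟨B', _, rfl⟩ := List.mem_map.mp hB
      exact B'.2
    have hmap : L2.map (fun B => b.inflate m j h B.1) =
        (L2.map Subtype.val).map (b.inflate m j h) := by rw [List.map_map]; rfl
    rw [hmap] at hL1 hd1 hsub
    set L3 := L2.map Subtype.val with hL3
    have hlen : L.length = L3.length + 1 := by rw [hL1.length_eq]; simp
    have hin : ∀ B ∈ L3, b.inflate m j h B ∈ L := fun B hB =>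
      hsub _ (List.mem_map_of_mem hB)
    have hgood : b.Good m (p - (h - 1)) L3 := by
      refine ⟨hm1, hbr, fun _ => ?_, ?_⟩
      · have h1 := hL1.mem_iff.mp (hL.full hg)
        rcases List.mem_cons.mp h1 with h2 | h2
        · exact absurd h2.symm hAG
        · obtain ⟨B, hB, h3⟩ := List.mem_map.mp h2
          rw [← inflate_range hj hgm] at h3
          rwa [← inflate_inj hj (fun x => (hbr B hB).lt) (fun x => Finset.mem_range.mp) h3]
      · have := hL.length
        rw [hlen, gaps_add h hm1] at this
        push_cast at this
        omega
    obtain ⟨L', x, hp1, hx⟩ := ih (p := p - (h - 1)) hm hgood (hd1.2.of_map _)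
      (fun B hB C hC hBC => hc _ (hin B hB) _ (hin C hC)
        ((inflate_incompat_iff hj (hbr B hB) (hbr C hC)).mpr hBC))
      (fun B hB hBG hmB => by
        have h1 := (mem_inflate_shift (h := h) hj (fun x => (hbr B hB).lt (x := x)) (m - 1)).mpr hmB
        rw [if_neg (by omega)] at h1
        refine hl _ (hin B hB) (fun h2 => hBG ?_) (by rwa [show m + h - 1 = m - 1 + h by omega])
        rw [← inflate_range hj hgm] at h2
        exact inflate_inj hj (fun x => (hbr B hB).lt) (fun x => Finset.mem_range.mp) h2)
      (by omega)
    have hq : Kind.operad.excess (h + 1) (h - 1 : ℤ) = 0 := by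
      simp only [Kind.excess]; push_cast; ring
    refine ⟨_, _, ?_, Comb.comp (m := m) (h := h) (r := m + h) rfl ⟨j, hj⟩ (sub_add_cancel p _) hm
      (by simp only [Kind.minArity]; omega) hq hx⟩
    exact hL1.trans ((List.perm_append_singleton _ _).symm.trans
      (List.Perm.append_right _ (hp1.map _)))

/-- Some rotation moves a gap that belongs to no proper tube to the last place. -/
theorem exists_rotate_avoid (hn : 1 ≤ n) {L : List (Finset ℕ)} (hL : b.Good n p L)
    (hc : ∀ A ∈ L, ∀ B ∈ L, ¬ b.Incompat n A B) :
    ∃ ζ ∈ b.rotations n, ∀ A ∈ L.map (permTube ζ), A ≠ Finset.range (b.gaps n) → n - 1 ∉ A := by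
  cases b
  · refine ⟨1, one_mem _, fun A hA _ hmem => ?_⟩
    obtain ⟨B, hB, rfl⟩ := List.mem_map.mp hA
    rw [permTube_one] at hmem
    exact absurd ((hL.bracket B hB).lt hmem) (by simp [Kind.gaps])
  -- Otherwise compatible proper tubes would cover the cyclic word, hence one of them would be the
  -- set of all gaps.
  · have hx : ∃ x < n, ∀ A ∈ L, A ≠ Finset.range n → x ∉ A := by
      by_contra hcon
      push Not at hcon
      obtain ⟨A, hA, h1⟩ := exists_subset_of_subset_sup (b := .module) (n := n)
        (isBracket_range (show 0 < n from hn)) (L.toFinset.filter (· ≠ Finset.range n))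
        (fun A hA => hL.bracket A (List.mem_toFinset.mp (Finset.mem_filter.mp hA).1))
        (fun A hA B hB => hc A (List.mem_toFinset.mp (Finset.mem_filter.mp hA).1) B
          (List.mem_toFinset.mp (Finset.mem_filter.mp hB).1))
        (fun x hx => by
          obtain ⟨A, h1, h2, h3⟩ := hcon x (Finset.mem_range.mp hx)
          exact ⟨A, Finset.mem_filter.mpr ⟨List.mem_toFinset.mpr h1, h2⟩, h3⟩)
      rw [Finset.mem_filter, List.mem_toFinset] at hA
      exact hA.2 (Finset.Subset.antisymm (hL.bracket A hA.1).subset_range h1)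
    obtain ⟨x, hx, hxA⟩ := hx
    obtain ⟨ζ, hζ, h1⟩ := exists_rotate_eq ⟨x, hx⟩ ⟨n - 1, by omega⟩
    refine ⟨ζ, hζ, fun A hA hAG hmem => ?_⟩
    obtain ⟨B, hB, rfl⟩ := List.mem_map.mp hA
    refine hxA B hB (fun h2 => hAG ?_) ?_
    · rw [h2]; exact permTube_range (b := .module) hζ
    · have h3 : permVal ζ x = n - 1 := (permVal_fin ζ ⟨x, hx⟩).trans (congrArg Fin.val h1)
      rwa [mem_permTube, ← h3, permVal_inv_self] at hmem

/-- Up to a rotation, every compatible list of tubes comes from an iterated composite. -/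
theorem exists_rotate_comb {L : List (Finset ℕ)} (hL : b.Good n p L)
    (hd : L.Nodup) (hc : ∀ A ∈ L, ∀ B ∈ L, ¬ b.Incompat n A B) :
    ∃ ζ ∈ b.rotations n, ∃ (L' : List (Finset ℕ)) (x : Ω k b n p),
      (L.map (permTube ζ)).Perm L' ∧ Comb k L' x := by
  by_cases hn : b.minArity ≤ n
  · obtain ⟨ζ, hζ, h1⟩ := exists_rotate_avoid hL.pos hL hc
    refine ⟨ζ, hζ, exists_comb hn (hL.rotate hζ) (hd.map fun A B => permTube_inj ζ) ?_ h1⟩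
    intro A hA B hB
    obtain ⟨A', hA', rfl⟩ := List.mem_map.mp hA
    obtain ⟨B', hB', rfl⟩ := List.mem_map.mp hB
    rw [permTube_incompat_iff hζ]
    exact hc A' hA' B' hB'
  · have := hL.pos
    obtain ⟨rfl, rfl⟩ : b = .operad ∧ n = 1 := by
      cases b
      · simp only [Kind.minArity] at hn; exact ⟨rfl, by omega⟩
      · simp only [Kind.minArity] at hn; omega
    have h0 : L = [] := List.eq_nil_iff_forall_not_mem.mpr fun A hA => by
      obtain ⟨x, hx⟩ := (hL.bracket A hA).nonempty
      exact absurd ((hL.bracket A hA).lt hx) (by simp [Kind.gaps])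
    subst h0
    have h2 := hL.length
    simp [Kind.gaps] at h2
    subst h2
    exact ⟨1, one_mem _, [], _, .refl _, .unit⟩

/-- The span of the iterated composites of generators and permutations. -/
def combSpan (k : Type u) [Field k] (b : Kind) (n : ℕ) (p : ℤ) : Submodule k (Ω k b n p) :=
  Submodule.span k {z | ∃ (σ : Perm (Fin n)) (L : List (Finset ℕ)) (y : Ω k b n p),
    Comb k L y ∧ z = Free.act σ y}

theorem act_act (σ τ : Perm (Fin n)) (x : Ω k b n p) :
    Free.act τ (Free.act σ x) = Free.act (σ * τ) x := by
  obtain ⟨x⟩ := x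
  exact Free.sound (.symm (.act_mul σ τ x))

theorem act_one_eq (x : Ω k b n p) : Free.act 1 x = x := by
  obtain ⟨x⟩ := x
  exact Free.sound (.act_one x)

theorem Comb.mem_combSpan {L : List (Finset ℕ)} {x : Ω k b n p} (hx : Comb k L x) :
    x ∈ combSpan k b n p := Submodule.subset_span ⟨1, L, x, hx, (act_one_eq x).symm⟩

theorem act_mem_combSpan (τ : Perm (Fin n)) {x : Ω k b n p} (hx : x ∈ combSpan k b n p) :
    Free.act τ x ∈ combSpan k b n p := by
  refine Submodule.span_induction ?_ ?_ ?_ ?_ hx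
  · rintro _ ⟨σ, L, y, hy, rfl⟩
    rw [act_act]
    exact Submodule.subset_span ⟨_, L, y, hy, rfl⟩
  · rw [map_zero]; exact zero_mem _
  · intro x y _ _ h1 h2
    rw [map_add]; exact add_mem h1 h2
  · intro a x _ h1
    rw [map_smul]; exact Submodule.smul_mem _ a h1

theorem Comb.comp_mu_mem {m h r : ℕ} {p q s : ℤ} (hr : r + 1 = m + (h + 1)) (j : Fin m)
    (hs : p + q = s) (hh : Kind.operad.minArity ≤ h + 1)
    (hq : Kind.operad.excess (h + 1) q = 0) {L : List (Finset ℕ)} {x : Ω k b m p}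
    (hx : Comb k L x) : Free.comp hr j hs x (mu k hh hq) ∈ combSpan k b r s := by
  by_cases hm : b.minArity ≤ m
  · exact (Comb.comp hr j hs hm hh hq hx).mem_combSpan
  · cases hx with
    | unit =>
      obtain rfl : r = h + 1 := by omega
      obtain rfl : q = s := by omega
      have h1 : Free.comp hr j hs Free.unit (mu k hh hq) = mu k hh hq :=
        Free.sound (.unit_comp _ _ _ _)
      rw [h1]
      exact (Comb.gen hh hq).mem_combSpan
    | gen hn => exact absurd hn hm
    | comp hr' j' hs' hm' hh' hq' hx' =>
      exact absurd (hm'.trans (by have := j'.2; omega)) hm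

theorem comp_mu_mem {m h r : ℕ} {p q s : ℤ} (hr : r + 1 = m + (h + 1)) (j : Fin m)
    (hs : p + q = s) (hh : Kind.operad.minArity ≤ h + 1)
    (hq : Kind.operad.excess (h + 1) q = 0) {x : Ω k b m p} (hx : x ∈ combSpan k b m p) :
    Free.comp hr j hs x (mu k hh hq) ∈ combSpan k b r s := by
  refine Submodule.span_induction ?_ ?_ ?_ ?_ hx
  · rintro _ ⟨σ, L, y, hy, rfl⟩
    rw [act_comp_mu]
    exact act_mem_combSpan _ (hy.comp_mu_mem hr _ hs hh hq)
  · rw [map_zero, LinearMap.zero_apply]; exact zero_mem _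
  · intro x y _ _ h1 h2
    rw [map_add, LinearMap.add_apply]; exact add_mem h1 h2
  · intro a x _ h1
    rw [map_smul, LinearMap.smul_apply]; exact Submodule.smul_mem _ a h1

/-- Composites of iterated composites are iterated composites, by associativity. -/
theorem Comb.comp_mem {m n r : ℕ} {p q s : ℤ} (hr : r + 1 = m + n) (j : Fin m)
    (hs : p + q = s) {L L' : List (Finset ℕ)} {x : Ω k b m p} {y : Ω k .operad n q}
    (hx : Comb k L x) (hy : Comb k L' y) : Free.comp hr j hs x y ∈ combSpan k b r s := by
  -- The kind is made variable for the induction on the second factor.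
  suffices key : ∀ {b' : Kind} {n : ℕ} {q : ℤ} {L' : List (Finset ℕ)} {y : Ω k b' n q},
      Comb k L' y → ∀ (hb : b' = .operad) {r : ℕ} {s : ℤ} (hr : r + 1 = m + n) (hs : p + q = s),
      Free.comp hr j hs x (hb ▸ y : Ω k .operad n q) ∈ combSpan k b r s from key hy rfl hr hs
  intro b' n q L' y hy hb r s hr hs
  induction hy generalizing r s with
  | unit =>
    change Free.comp hr j hs x Free.unit ∈ _
    obtain rfl : r = m := by omega
    obtain rfl : s = p := by omega
    have h1 : Free.comp hr j hs x Free.unit = x := by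
      obtain ⟨x⟩ := x
      exact Free.sound (.comp_unit _ _ _ _)
    rw [h1]
    exact hx.mem_combSpan
  | @gen b' n q hn hq =>
    subst hb
    obtain _ | n := n
    · simp [Kind.minArity] at hn
    · exact hx.comp_mu_mem hr j hs hn hq
  | @comp b' l h n' q t s' hr' i hs' hm hh ht L y hy ih =>
    subst hb
    have h2 := i.2
    have h1 := ih (r := m + l - 1) (s := p + q) rfl (by omega) rfl
    have h3 : Free.comp hr j hs x (Free.comp hr' i hs' y (mu k hh ht)) =
        Free.comp (show r + 1 = m + l - 1 + (h + 1) by omega) ⟨j.1 + i.1, by omega⟩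
          (show p + q + t = s by omega)
          (Free.comp (show m + l - 1 + 1 = m + l by omega) j rfl x y) (mu k hh ht) := by
      obtain ⟨x⟩ := x
      obtain ⟨y⟩ := y
      exact Free.sound (.symm (.assoc _ _ _ _ _ _ _ rfl _ _ _ _ _ _ _))
    rw [h3]
    exact Cyclo.comp_mu_mem _ _ _ _ _ h1

theorem comp_mem_combSpan {m n r : ℕ} {p q s : ℤ} (hr : r + 1 = m + n) (j : Fin m)
    (hs : p + q = s) {x : Ω k b m p} {y : Ω k .operad n q} (hx : x ∈ combSpan k b m p)
    (hy : y ∈ combSpan k .operad n q) : Free.comp hr j hs x y ∈ combSpan k b r s := by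
  refine Submodule.span_induction₂ (p := fun x y _ _ => Free.comp hr j hs x y ∈ combSpan k b r s)
    ?_ ?_ ?_ ?_ ?_ ?_ ?_ hx hy
  · rintro _ _ ⟨σ, L, x, hx, rfl⟩ ⟨τ, L', y, hy, rfl⟩
    have h1 : Free.comp hr j hs (Free.act σ x) (Free.act τ y) =
        Free.act (permComp hr j σ τ) (Free.comp hr (σ j) hs x y) := by
      obtain ⟨x⟩ := x
      obtain ⟨y⟩ := y
      exact Free.sound (.comp_act _ _ _ _ _ _ _)
    rw [h1]
    exact act_mem_combSpan _ (hx.comp_mem hr _ hs hy)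
  · intro y _; rw [map_zero, LinearMap.zero_apply]; exact zero_mem _
  · intro x _; rw [map_zero]; exact zero_mem _
  · intro x y z _ _ _ h1 h2; rw [map_add, LinearMap.add_apply]; exact add_mem h1 h2
  · intro x y z _ _ _ h1 h2; rw [map_add]; exact add_mem h1 h2
  · intro a x y _ _ h1; rw [map_smul, LinearMap.smul_apply]; exact Submodule.smul_mem _ a h1
  · intro a x y _ _ h1; rw [map_smul]; exact Submodule.smul_mem _ a h1

theorem gen_mem_combSpan (hn : b.minArity ≤ n) (x : (gens k b).obj n p) :
    Free.gen hn x ∈ combSpan k b n p := by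
  have h1 : (combSpan k b n p).mkQ ∘ₗ Free.gen hn = 0 := gens_ext fun c => by
    rw [LinearMap.comp_apply, LinearMap.zero_apply, Submodule.mkQ_apply,
      Submodule.Quotient.mk_eq_zero]
    obtain ⟨c, hc⟩ := c
    obtain ⟨σ, rfl⟩ := order_surjective c
    have h2 := dualGen_act (k := k) σ (⟨b.order 1, hc⟩ : GenIndex b n p)
    rw [GenIndex.act_order, one_mul] at h2
    have h3 : dualGen k b ⟨b.order σ, hc⟩ =
        sgnPerm k σ • (gens k b).act σ (dualGen k b ⟨b.order 1, hc⟩) := by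
      rw [h2, smul_smul, sgnPerm_mul_self, one_smul]
    have h4 : Free.gen hn ((gens k b).act σ (dualGen k b ⟨b.order 1, hc⟩)) =
        Free.act σ (mu k hn hc.2) := Free.sound (.gen_act hn σ _)
    rw [h3, map_smul, h4]
    exact Submodule.smul_mem _ _ (act_mem_combSpan σ (Comb.gen hn hc.2).mem_combSpan)
  have h2 := LinearMap.congr_fun h1 x
  rwa [LinearMap.comp_apply, LinearMap.zero_apply, Submodule.mkQ_apply,
    Submodule.Quotient.mk_eq_zero] at h2

/-- The iterated composites of generators and permutations span the cobar construction. -/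
theorem mem_combSpan (x : Ω k b n p) : x ∈ combSpan k b n p := by
  obtain ⟨x⟩ := x
  suffices key : ∀ {b : Kind} {n : ℕ} {p : ℤ} (e : FreeExpr (gens k) b n p),
      Free.mk e ∈ combSpan k b n p from key x
  intro b n p e
  induction e with
  | gen hn x => exact gen_mem_combSpan hn x
  | unit => exact Comb.unit.mem_combSpan
  | comp h i hs x y hx hy => exact comp_mem_combSpan h i hs hx hy
  | act σ x hx => exact act_mem_combSpan σ hx
  | zero => exact zero_mem _
  | add x y hx hy => exact add_mem hx hy
  | smul a x hx => exact Submodule.smul_mem _ a hx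

/-- The cobar construction vanishes in negative degrees. -/
theorem cobar_subsingleton (h : p < 0) : Subsingleton (Ω k b n p) := by
  have h1 : combSpan k b n p = ⊥ := by
    refine Submodule.span_eq_bot.mpr ?_
    rintro _ ⟨σ, L, y, hy, rfl⟩
    exact absurd hy.degree_nonneg (not_le.mpr h)
  refine subsingleton_of_forall_eq 0 fun x => ?_
  have := mem_combSpan x
  rwa [h1, Submodule.mem_bot] at this

/-- A compatible list of tubes and a permutation come from an iterated composite. -/
theorem exists_toTubes_eq {L : List (Finset ℕ)} (hL : b.Good n p L)
    (hd : L.Nodup) (hc : ∀ A ∈ L, ∀ B ∈ L, ¬ b.Incompat n A B) (σ : Perm (Fin n)) :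
    ∃ x : Ω k b n p, toTubes k b n p x = cell k b p σ L := by
  obtain ⟨ζ, hζ, L', y, hp, hy⟩ := exists_rotate_comb (k := k) hL hd hc
  obtain ⟨ε, hε⟩ := hy.toTubes
  obtain ⟨ε', hε'⟩ := cell_perm (k := k) (b := b) (p := p) (ζ * σ) hp
  have h1 := hε' [] []
  simp only [List.nil_append, List.append_nil] at h1
  rw [cell_rot σ L hζ] at h1
  refine ⟨sgnPerm k ζ • (ε' * ε) • Free.act (ζ * σ) y, ?_⟩
  rw [Units.smul_def, map_smul, map_zsmul, toTubes_act, hε, Units.smul_def, map_zsmul,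
    TubeChain.act_cell, one_mul, smul_smul ((ε' * ε : ℤˣ) : ℤ), ← Units.val_mul, mul_assoc,
    Int.units_mul_self, mul_one, ← Units.smul_def, ← h1, smul_smul, sgnPerm_mul_self, one_smul]

/-- Cells with repeated or incompatible tubes vanish; the other ones come from iterated composites.
-/
theorem toTubes_surjective : Function.Surjective (toTubes k b n p) := by
  intro x
  refine TubeChain.induction (P := fun x => ∃ z, toTubes k b n p z = x) ?_ ⟨0, map_zero _⟩ ?_ ?_ x
  · intro σ L hL
    by_cases h : L.Nodup ∧ ∀ A ∈ L, ∀ B ∈ L, ¬ b.Incompat n A B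
    · exact exists_toTubes_eq hL h.1 h.2 σ
    · refine ⟨0, ?_⟩
      rw [map_zero]
      by_cases hd : L.Nodup
      · have h2 := not_and.mp h hd
        push Not at h2
        obtain ⟨A, hA, B, hB, h3⟩ := h2
        exact (cell_of_incompat σ hA hB h3).symm
      · exact (cell_of_not_nodup σ hd).symm
  · rintro x y ⟨x', rfl⟩ ⟨y', rfl⟩
    exact ⟨x' + y', map_add _ _ _⟩
  · rintro a x ⟨x', rfl⟩
    exact ⟨a • x', map_smul _ _ _⟩

end

section

variable {b : Kind} {n : ℕ}

/-! ### The geometry of associahedra and cyclohedra -/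

/-- A set of tubes that are pairwise compatible and contain the set of all gaps (if there are any
gaps). -/
structure Kind.Nested (b : Kind) (n : ℕ) (B : Finset (Finset ℕ)) : Prop where
  bracket : ∀ A ∈ B, b.IsBracket n A
  compat : ∀ A ∈ B, ∀ C ∈ B, ¬ b.Incompat n A C
  full : 0 < b.gaps n → Finset.range (b.gaps n) ∈ B

theorem subset_or_disjoint {A C : Finset ℕ} (hA : b.IsBracket n A) (hC : b.IsBracket n C)
    (h : ¬ b.Incompat n A C) : A ⊆ C ∨ C ⊆ A ∨ Disjoint A C := by
  by_contra hcon
  push Not at hcon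
  obtain ⟨h1, h2, h3⟩ := hcon
  obtain ⟨x, hxA, hxC⟩ := Finset.not_disjoint_iff.mp h3
  exact h ⟨h1, h2, hA.union hC ⟨x, hxA, x, hxC, Or.inl rfl⟩⟩

/-- The inequality on the bounds of the polytopes that makes the faces correspond to nested sets of
tubes. -/
theorem pow_three_add_le {x y : ℕ} (hx : 1 ≤ x) (hy : 1 ≤ y) : (3 : ℝ) ^ x + 3 ^ y ≤ 3 ^ (x + y) := by
  have h1 : (3 : ℝ) ≤ 3 ^ x := by simpa using pow_le_pow_right₀ (by norm_num : (1 : ℝ) ≤ 3) hx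
  have h2 : (3 : ℝ) ≤ 3 ^ y := by simpa using pow_le_pow_right₀ (by norm_num : (1 : ℝ) ≤ 3) hy
  rw [pow_add]
  nlinarith

/-- If the coordinates in each tube of a nested family sum up to the bound, then those in the union
of the family do not exceed the bound. -/
theorem sum_biUnion_le {t : ℕ → ℝ} (F : Finset (Finset ℕ)) (hF : ∀ A ∈ F, b.IsBracket n A)
    (hFF : ∀ A ∈ F, ∀ C ∈ F, ¬ b.Incompat n A C) (ht : ∀ A ∈ F, ∑ x ∈ A, t x = 3 ^ A.card) :
    ∑ x ∈ F.biUnion id, t x ≤ 3 ^ (F.biUnion id).card := by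
  classical
  induction hN : F.card using Nat.strong_induction_on generalizing F with
  | _ N ih =>
    rcases F.eq_empty_or_nonempty with rfl | hne
    · simp
    obtain ⟨A, hA, hmax⟩ := F.exists_max_image Finset.card hne
    -- Every member is contained in a largest one, `A`, or disjoint from it.
    set F' := F.filter (Disjoint A) with hF'
    have hU : F.biUnion id = A ∪ F'.biUnion id := by
      ext x
      simp only [Finset.mem_biUnion, id, Finset.mem_union, hF', Finset.mem_filter]
      constructor
      · rintro ⟨C, hC, hx⟩
        rcases subset_or_disjoint (hF A hA) (hF C hC) (hFF A hA C hC) with h1 | h1 | h1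
        · exact Or.inl (Finset.eq_of_subset_of_card_le h1 (hmax C hC) ▸ hx)
        · exact Or.inl (h1 hx)
        · exact Or.inr ⟨C, ⟨hC, h1⟩, hx⟩
      · rintro (hx | ⟨C, ⟨hC, _⟩, hx⟩)
        · exact ⟨A, hA, hx⟩
        · exact ⟨C, hC, hx⟩
    have hd : Disjoint A (F'.biUnion id) :=
      (Finset.disjoint_biUnion_right _ _ _).mpr fun C hC => (Finset.mem_filter.mp hC).2
    have hAF' : A ∉ F' := fun h1 => (hF A hA).nonempty.ne_empty
      (Finset.disjoint_self_iff_empty A |>.mp (Finset.mem_filter.mp h1).2)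
    have hlt : F'.card < N := hN ▸ Finset.card_lt_card ⟨Finset.filter_subset _ _,
      fun h1 => hAF' (h1 hA)⟩
    have h2 := ih _ hlt F' (fun C hC => hF C (Finset.mem_filter.mp hC).1)
      (fun C hC D hD => hFF C (Finset.mem_filter.mp hC).1 D (Finset.mem_filter.mp hD).1)
      (fun C hC => ht C (Finset.mem_filter.mp hC).1) rfl
    rw [hU, Finset.sum_union hd, Finset.card_union_of_disjoint hd, ht A hA]
    rcases (F'.biUnion id).eq_empty_or_nonempty with h3 | h3
    · simp [h3]
    · exact (add_le_add_right h2 _).trans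
        (pow_three_add_le (Finset.card_pos.mpr (hF A hA).nonempty) (Finset.card_pos.mpr h3))

/-- The estimate for a bracket `J` with `j` gaps in a tube with `c + u` gaps, of which `u` belong to
smaller tubes: `o` of the other `c` gaps, which have equal coordinates, are in `J`. -/
theorem pow_lt_mul_div {c u o j : ℕ} {R : ℝ} (ho : 1 ≤ o) (hoc : o ≤ c) (hR : R ≤ 3 ^ u)
    (hj : j ≤ o + u) (hj' : j < c + u) : (3 : ℝ) ^ j < o * ((3 ^ (c + u) - R) / c) := by
  have h1 : (1 : ℝ) ≤ 3 := by norm_num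
  have hc : (0 : ℝ) < c := by exact_mod_cast lt_of_lt_of_le ho hoc
  rw [← mul_div_assoc, lt_div_iff₀ hc]
  have hu : (0 : ℝ) < 3 ^ u := by positivity
  have ho' : (1 : ℝ) ≤ o := by exact_mod_cast ho
  -- If all of the `c` gaps are in `J`, then `J` misses some of the `u` gaps, since it is proper.
  rcases hoc.eq_or_lt with rfl | hlt
  · have h2 : (3 : ℝ) ^ j ≤ 3 ^ (o - 1) * 3 ^ u := by
      rw [← pow_add]; exact pow_le_pow_right₀ h1 (by omega)
    have h3 : (3 : ℝ) ^ (o + u) = 3 * 3 ^ (o - 1) * 3 ^ u := by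
      rw [← pow_succ', ← pow_add]; congr 1; omega
    have h4 : (1 : ℝ) ≤ 3 ^ (o - 1) := one_le_pow₀ h1
    rw [h3, mul_comm]
    refine mul_lt_mul_of_pos_left ?_ (by linarith)
    nlinarith
  · obtain ⟨d, rfl⟩ : ∃ d, c = o + d := ⟨c - o, by omega⟩
    have hd : (1 : ℝ) ≤ d := by exact_mod_cast (by omega : 1 ≤ d)
    have h2 : (3 : ℝ) ^ j ≤ 3 ^ o * 3 ^ u := by
      rw [← pow_add]; exact pow_le_pow_right₀ h1 hj
    have h3 : 1 + (d : ℝ) * 2 ≤ 3 ^ d := by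
      have := one_add_mul_le_pow (by norm_num : (-2 : ℝ) ≤ 2) d
      norm_num at this
      exact this
    have h5 : (3 : ℝ) ≤ 3 ^ o := by simpa using pow_le_pow_right₀ h1 ho
    have h4 : (3 : ℝ) ^ o * (o + d) < o * (3 ^ o * 3 ^ d - 1) := by
      have h6 : (3 : ℝ) ^ o * (o * (1 + d * 2)) ≤ 3 ^ o * (o * 3 ^ d) := by gcongr
      have h7 : (o : ℝ) < 3 ^ o * (o * d) := by nlinarith [mul_le_mul ho' hd (by norm_num) (by linarith)]
      have h8 : (3 : ℝ) ^ o * d ≤ 3 ^ o * (o * d) := by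
        refine mul_le_mul_of_nonneg_left ?_ (by positivity)
        nlinarith
      nlinarith
    have h9 : (3 : ℝ) ^ j * ((o + d : ℕ) : ℝ) ≤ 3 ^ u * (3 ^ o * (o + d)) := by
      push_cast
      nlinarith [mul_le_mul_of_nonneg_right h2 (by linarith : (0 : ℝ) ≤ (o : ℝ) + d)]
    have h10 : (3 : ℝ) ^ u * (o * (3 ^ o * 3 ^ d - 1)) ≤ o * (3 ^ (o + d + u) - R) := by
      rw [pow_add, pow_add]
      nlinarith [mul_le_mul_of_nonneg_left hR (by linarith : (0 : ℝ) ≤ o)]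
    exact h9.trans_lt ((mul_lt_mul_of_pos_left h4 hu).trans_le h10)

/-- Coordinates for which exactly the brackets in a nested family attain the bound, among those
that are contained in members of the family. -/
theorem exists_weight (B : Finset (Finset ℕ)) (hB : ∀ A ∈ B, b.IsBracket n A)
    (hBB : ∀ A ∈ B, ∀ C ∈ B, ¬ b.Incompat n A C) :
    ∃ t : ℕ → ℝ, (∀ A ∈ B, ∀ x ∈ A, 0 < t x) ∧ (∀ A ∈ B, ∑ x ∈ A, t x = 3 ^ A.card) ∧
      ∀ J, b.IsBracket n J → J ∉ B → (∃ A ∈ B, J ⊆ A) → 3 ^ J.card < ∑ x ∈ J, t x := by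
  classical
  induction hN : B.card generalizing B with
  | zero =>
    rw [Finset.card_eq_zero] at hN
    subst hN
    exact ⟨0, by simp, by simp, by simp⟩
  | succ N ih =>
    -- A largest member `A`; the gaps of `A` that are in no smaller member get equal coordinates,
    -- chosen such that the coordinates in `A` sum up to the bound.
    obtain ⟨A, hA, hmax⟩ := B.exists_max_image Finset.card
      (Finset.card_pos.mp (by omega))
    obtain ⟨t, hpos, hsum, hlt⟩ := ih (B.erase A) (fun C hC => hB C (Finset.mem_of_mem_erase hC))
      (fun C hC D hD => hBB C (Finset.mem_of_mem_erase hC) D (Finset.mem_of_mem_erase hD))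
      (by rw [Finset.card_erase_of_mem hA]; omega)
    set F := (B.erase A).filter (· ⊆ A) with hF
    set U := F.biUnion id with hU
    have hFB : ∀ C ∈ F, C ∈ B.erase A := fun C hC => (Finset.mem_filter.mp hC).1
    have hUA : U ⊆ A := Finset.biUnion_subset.mpr fun C hC => (Finset.mem_filter.mp hC).2
    have hR : ∑ x ∈ U, t x ≤ 3 ^ U.card := sum_biUnion_le F
      (fun C hC => hB C (Finset.mem_of_mem_erase (hFB C hC)))
      (fun C hC D hD => hBB C (Finset.mem_of_mem_erase (hFB C hC)) D
        (Finset.mem_of_mem_erase (hFB D hD))) (fun C hC => hsum C (hFB C hC))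
    have hcover : ∀ J, b.IsBracket n J → J ⊆ U → ∃ C ∈ F, J ⊆ C := fun J hJ hJU =>
      exists_subset_of_subset_sup hJ F (fun C hC => hB C (Finset.mem_of_mem_erase (hFB C hC)))
        (fun C hC D hD => hBB C (Finset.mem_of_mem_erase (hFB C hC)) D
          (Finset.mem_of_mem_erase (hFB D hD)))
        (fun x hx => by
          obtain ⟨C, hC, hxC⟩ := Finset.mem_biUnion.mp (hJU hx)
          exact ⟨C, hC, hxC⟩)
    have hAU : ¬ A ⊆ U := fun h1 => by
      obtain ⟨C, hC, hAC⟩ := hcover A (hB A hA) h1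
      exact (Finset.mem_erase.mp (hFB C hC)).1
        ((Finset.mem_filter.mp hC).2.antisymm hAC)
    set w : ℝ := (3 ^ A.card - ∑ x ∈ U, t x) / ((A \ U).card : ℝ) with hw
    have hc : 0 < (A \ U).card := Finset.card_pos.mpr (Finset.sdiff_nonempty.mpr hAU)
    have hcu : (A \ U).card + U.card = A.card := Finset.card_sdiff_add_card_eq_card hUA
    have hw0 : 0 < w := by
      have h1 : (3 : ℝ) ^ U.card < 3 ^ A.card := pow_lt_pow_right₀ (by norm_num) (by omega)
      exact div_pos (by linarith) (by exact_mod_cast hc)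
    set t' : ℕ → ℝ := fun x => if x ∈ A \ U then w else t x with ht'
    have hdis : ∀ C ∈ B.erase A, ∀ x ∈ C, x ∉ A \ U := fun C hC x hxC hx => by
      rw [Finset.mem_sdiff] at hx
      have hCB := Finset.mem_of_mem_erase hC
      rcases subset_or_disjoint (hB A hA) (hB C hCB) (hBB A hA C hCB) with h1 | h1 | h1
      · exact (Finset.mem_erase.mp hC).1 (Finset.eq_of_subset_of_card_le h1 (hmax C hCB)).symm
      · exact hx.2 (Finset.mem_biUnion.mpr ⟨C, Finset.mem_filter.mpr ⟨hC, h1⟩, hxC⟩)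
      · exact Finset.disjoint_left.mp h1 hx.1 hxC
    have hold : ∀ C ∈ B.erase A, ∀ J ⊆ C, ∑ x ∈ J, t' x = ∑ x ∈ J, t x := fun C hC J hJ =>
      Finset.sum_congr rfl fun x hx => if_neg (hdis C hC x (hJ hx))
    have hposU : ∀ x ∈ U, 0 < t x := fun x hx => by
      obtain ⟨C, hC, hxC⟩ := Finset.mem_biUnion.mp hx
      exact hpos C (hFB C hC) x hxC
    have hposA : ∀ x ∈ A, 0 < t' x := fun x hx => by
      simp only [ht']
      split_ifs with h1
      · exact hw0
      · exact hposU x (by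
          by_contra h2
          exact h1 (Finset.mem_sdiff.mpr ⟨hx, h2⟩))
    refine ⟨t', fun C hC x hx => ?_, fun C hC => ?_, fun J hJ hJB hJA => ?_⟩
    · by_cases hCA : C = A
      · exact hposA x (hCA ▸ hx)
      · have hC' := Finset.mem_erase.mpr ⟨hCA, hC⟩
        simp only [ht', if_neg (hdis C hC' x hx)]
        exact hpos C hC' x hx
    · by_cases hCA : C = A
      · subst hCA
        rw [← Finset.sum_sdiff hUA, Finset.sum_congr rfl (g := fun _ => w) fun x hx => if_pos hx,
          Finset.sum_congr (s₁ := U) rfl (g := t) fun x hx => if_neg fun h1 =>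
            (Finset.mem_sdiff.mp h1).2 hx, Finset.sum_const, nsmul_eq_mul, hw,
          mul_div_cancel₀ _ (by exact_mod_cast hc.ne')]
        ring
      · have hC' := Finset.mem_erase.mpr ⟨hCA, hC⟩
        rw [hold C hC' C subset_rfl, hsum C hC']
    · by_cases hex : ∃ C ∈ B.erase A, J ⊆ C
      · obtain ⟨C, hC, hJC⟩ := hex
        rw [hold C hC J hJC]
        exact hlt J hJ (fun h1 => hJB (Finset.mem_of_mem_erase h1)) ⟨C, hC, hJC⟩
      · have hJA' : J ⊆ A := by
          obtain ⟨C, hC, hJC⟩ := hJA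
          by_cases hCA : C = A
          · exact hCA ▸ hJC
          · exact absurd ⟨C, Finset.mem_erase.mpr ⟨hCA, hC⟩, hJC⟩ hex
        -- A bracket in no smaller member contains one of the new gaps.
        have hJU : (J \ U).Nonempty := Finset.sdiff_nonempty.mpr fun h1 => by
          obtain ⟨C, hC, hJC⟩ := hcover J hJ h1
          exact hex ⟨C, hFB C hC, hJC⟩
        have hsub : J \ U ⊆ A \ U := Finset.sdiff_subset_sdiff hJA' subset_rfl
        have hJlt : J.card < A.card := Finset.card_lt_card
          (Finset.ssubset_iff_subset_ne.mpr ⟨hJA', fun h1 => hJB (h1 ▸ hA)⟩)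
        have hJcard : J.card ≤ (J \ U).card + U.card := by
          have h1 := Finset.card_sdiff_add_card_inter J U
          have h2 := Finset.card_le_card (Finset.inter_subset_right (s₁ := J) (s₂ := U))
          omega
        have h1 := pow_lt_mul_div (Finset.card_pos.mpr hJU) (Finset.card_le_card hsub) hR hJcard
          (by omega)
        rw [hcu, ← hw] at h1
        refine h1.trans_le ?_
        rw [← Finset.sum_inter_add_sum_sdiff J U, Finset.sum_congr (s₁ := J \ U) rfl (g := fun _ => w)
          fun x hx => if_pos (hsub hx), Finset.sum_const, nsmul_eq_mul]
        have h2 : 0 ≤ ∑ x ∈ J ∩ U, t' x := Finset.sum_nonneg fun x hx =>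
          (hposA x (hJA' (Finset.mem_inter.mp hx).1)).le
        linarith

end

/-! ### Faces and nested sets of tubes -/

section

variable {b : Kind} {n : ℕ} {p : ℤ} {g : ℕ}

/-- The indicator vector of a set of gaps. -/
def ind {g : ℕ} (A : Finset ℕ) : Fin g → ℝ := fun x => if x.1 ∈ A then 1 else 0

theorem sum_coord (A : Finset ℕ) (t : Fin g → ℝ) : ∑ x ∈ A, coord t x = ind A ⬝ᵥ t := by
  have h1 : ∑ x ∈ A, coord t x = ∑ x ∈ Finset.range g, if x ∈ A then coord t x else 0 := by
    rw [← Finset.sum_filter]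
    symm
    refine Finset.sum_subset (fun x hx => (Finset.mem_filter.mp hx).2) fun x hx hx' => ?_
    rw [Finset.mem_filter, Finset.mem_range, not_and_or] at hx'
    exact dif_neg (hx'.resolve_right (not_not.mpr hx))
  rw [h1, Finset.sum_range, dotProduct]
  refine Finset.sum_congr rfl fun x _ => ?_
  simp [ind, coord]

theorem bound_eq {A : Finset ℕ} (h : A.Nonempty) : bound A = 3 ^ A.card := if_neg h.ne_empty

theorem tight_iff {A : Finset ℕ} {t : Fin g → ℝ} : Tight t A ↔ ind A ⬝ᵥ t = bound A := by
  rw [Tight, sum_coord]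

theorem mem_polytope {t : Fin (b.gaps n) → ℝ} : t ∈ b.polytope n ↔
    ind (Finset.range (b.gaps n)) ⬝ᵥ t = bound (Finset.range (b.gaps n)) ∧
      ∀ A, b.IsBracket n A → bound A ≤ ind A ⬝ᵥ t := by
  simp only [Kind.polytope, Set.mem_ofPred_eq, Tight, sum_coord]

theorem convex_polytope : Convex ℝ (b.polytope n) := by
  intro x hx y hy s t hs ht hst
  rw [mem_polytope] at *
  refine ⟨?_, fun A hA => ?_⟩
  · rw [dotProduct_add, dotProduct_smul, dotProduct_smul, hx.1, hy.1, ← add_smul, hst, one_smul]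
  · rw [dotProduct_add, dotProduct_smul, dotProduct_smul, smul_eq_mul, smul_eq_mul]
    have h1 := mul_le_mul_of_nonneg_left (hx.2 A hA) hs
    have h2 := mul_le_mul_of_nonneg_left (hy.2 A hA) ht
    have h3 : s * bound A + t * bound A = bound A := by rw [← add_mul, hst, one_mul]
    linarith

/-- The tubes on whose hyperplanes a set of vectors lies. -/
def tubesOf (b : Kind) (n : ℕ) (F : Set (Fin (b.gaps n) → ℝ)) : Finset (Finset ℕ) :=
  open Classical in (brackets b n).filter fun A => ∀ t ∈ F, Tight t A

theorem mem_tubesOf {F : Set (Fin (b.gaps n) → ℝ)} {A : Finset ℕ} :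
    A ∈ tubesOf b n F ↔ b.IsBracket n A ∧ ∀ t ∈ F, Tight t A := by
  classical
  rw [tubesOf, Finset.mem_filter, mem_brackets]

/-- The face of the polytope that is cut out by the hyperplanes of a set of tubes. -/
def tubeFace (b : Kind) (n : ℕ) (B : Finset (Finset ℕ)) : Set (Fin (b.gaps n) → ℝ) :=
  {t | t ∈ b.polytope n ∧ ∀ A ∈ B, Tight t A}

/-- The direction of the face that is cut out by a set of tubes. -/
def tubeSpace (g : ℕ) (B : Finset (Finset ℕ)) : Submodule ℝ (Fin g → ℝ) where
  carrier := {v | ∀ A ∈ B, ind A ⬝ᵥ v = 0}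
  add_mem' h1 h2 A hA := by rw [dotProduct_add, h1 A hA, h2 A hA, add_zero]
  zero_mem' A _ := dotProduct_zero _
  smul_mem' a v h A hA := by rw [dotProduct_smul, h A hA, smul_zero]

theorem mem_tubeSpace {B : Finset (Finset ℕ)} {v : Fin g → ℝ} :
    v ∈ tubeSpace g B ↔ ∀ A ∈ B, ind A ⬝ᵥ v = 0 := Iff.rfl

theorem sub_mem_tubeSpace {B : Finset (Finset ℕ)} {s t : Fin (b.gaps n) → ℝ}
    (hs : ∀ A ∈ B, Tight s A) (ht : ∀ A ∈ B, Tight t A) : s - t ∈ tubeSpace _ B := fun A hA => by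
  rw [dotProduct_sub, tight_iff.mp (hs A hA), tight_iff.mp (ht A hA), sub_self]

/-- A point in the relative interior of a face. -/
theorem exists_tight_iff {B : Finset (Finset ℕ)} (hB : b.Nested n B) :
    ∃ t ∈ b.polytope n, ∀ A, b.IsBracket n A → (Tight t A ↔ A ∈ B) := by
  obtain ⟨t, -, hsum, hlt⟩ := exists_weight B hB.bracket hB.compat
  have hc : ∀ A, b.IsBracket n A →
      ∑ x ∈ A, coord (fun x : Fin (b.gaps n) => t x.1) x = ∑ x ∈ A, t x := fun A hA =>
    Finset.sum_congr rfl fun x hx => dif_pos (hA.lt hx)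
  have key : ∀ A, b.IsBracket n A → A ∉ B →
      bound A < ∑ x ∈ A, coord (fun x : Fin (b.gaps n) => t x.1) x := fun A hA hAB => by
    rw [hc A hA, bound_eq hA.nonempty]
    obtain ⟨x, hx⟩ := hA.nonempty
    exact hlt A hA hAB ⟨_, hB.full (lt_of_le_of_lt (Nat.zero_le _) (hA.lt hx)), hA.subset_range⟩
  have key' : ∀ A ∈ B, Tight (fun x : Fin (b.gaps n) => t x.1) A := fun A hA => by
    rw [Tight, hc A (hB.bracket A hA), hsum A hA, bound_eq (hB.bracket A hA).nonempty]
  refine ⟨fun x => t x.1, ⟨?_, fun A hA => ?_⟩, fun A hA => ⟨fun h => ?_, key' A⟩⟩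
  · rcases Nat.eq_zero_or_pos (b.gaps n) with h | h
    · rw [h, Finset.range_zero]
      simp [Tight, bound]
    · exact key' _ (hB.full h)
  · by_cases h : A ∈ B
    · exact (key' A h).ge
    · exact (key A hA h).le
  · by_contra h1
    exact (key A hA h1).ne' h

/-- A point on no further hyperplanes can be moved in all directions of the face. -/
theorem exists_add_mem_polytope {B : Finset (Finset ℕ)}
    (hfull : 0 < b.gaps n → Finset.range (b.gaps n) ∈ B)
    {t v : Fin (b.gaps n) → ℝ} (ht : t ∈ b.polytope n)
    (h : ∀ A, b.IsBracket n A → Tight t A → A ∈ B) (hv : v ∈ tubeSpace _ B) :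
    ∃ ε : ℝ, 0 < ε ∧ t + ε • v ∈ b.polytope n := by
  -- The other inequalities are strict at `t`, hence hold for small `ε`.
  have h1 : ∀ A ∈ brackets b n, ∀ᶠ ε in nhdsWithin (0 : ℝ) (Set.Ioi 0),
      bound A ≤ ind A ⬝ᵥ (t + ε • v) := by
    intro A hA
    have hAb := mem_brackets.mp hA
    by_cases hAB : A ∈ B
    · refine Filter.Eventually.of_forall fun ε => ?_
      rw [dotProduct_add, dotProduct_smul, hv A hAB, smul_zero, add_zero]
      exact (mem_polytope.mp ht).2 A hAb
    · have h2 : bound A < ind A ⬝ᵥ t := lt_of_le_of_ne ((mem_polytope.mp ht).2 A hAb)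
        fun h3 => hAB (h A hAb (tight_iff.mpr h3.symm))
      have h3 : Filter.Tendsto (fun ε : ℝ => ind A ⬝ᵥ t + ε * (ind A ⬝ᵥ v)) (nhds 0)
          (nhds (ind A ⬝ᵥ t + 0 * (ind A ⬝ᵥ v))) := Continuous.tendsto (by fun_prop) 0
      rw [zero_mul, add_zero] at h3
      filter_upwards [(h3.mono_left nhdsWithin_le_nhds).eventually (lt_mem_nhds h2)] with ε hε
      rw [dotProduct_add, dotProduct_smul, smul_eq_mul]
      exact hε.le
  obtain ⟨ε, h2, hε⟩ := (((brackets b n).eventually_all.mpr h1).and self_mem_nhdsWithin).exists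
  refine ⟨ε, hε, mem_polytope.mpr ⟨?_, fun A hA => h2 A (mem_brackets.mpr hA)⟩⟩
  rw [dotProduct_add, (mem_polytope.mp ht).1, dotProduct_smul]
  rcases Nat.eq_zero_or_pos (b.gaps n) with h3 | h3
  · have h4 : ind (Finset.range (b.gaps n)) ⬝ᵥ v = 0 :=
      Finset.sum_eq_zero fun x _ => absurd x.2 (by omega)
    rw [h4, smul_zero, add_zero]
  · rw [hv _ (hfull h3), smul_zero, add_zero]

/-- Different nested sets of tubes cut out different faces. -/
theorem tubesOf_tubeFace {B : Finset (Finset ℕ)} (hB : b.Nested n B) :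
    tubesOf b n (tubeFace b n B) = B := by
  ext A
  rw [mem_tubesOf]
  refine ⟨fun h => ?_, fun h => ⟨hB.bracket A h, fun t ht => ht.2 A h⟩⟩
  obtain ⟨t, ht, h1⟩ := exists_tight_iff hB
  exact (h1 A h.1).mp (h.2 t ⟨ht, fun C hC => (h1 C (hB.bracket C hC)).mpr hC⟩)

theorem tubeFace_nonempty {B : Finset (Finset ℕ)} (hB : b.Nested n B) :
    (tubeFace b n B).Nonempty := by
  obtain ⟨t, ht, h1⟩ := exists_tight_iff hB
  exact ⟨t, ht, fun C hC => (h1 C (hB.bracket C hC)).mpr hC⟩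

/-- The face is where the sum of the bounded functionals attains its minimum. -/
theorem isExposed_tubeFace {B : Finset (Finset ℕ)} (hB : ∀ A ∈ B, b.IsBracket n A) :
    IsExposed ℝ (b.polytope n) (tubeFace b n B) := by
  rintro ⟨s, hs⟩
  set l : (Fin (b.gaps n) → ℝ) →ₗ[ℝ] ℝ := -∑ A ∈ B, dotProductBilin ℝ ℝ (ind A) with hl
  have hlt : ∀ t, l t = -∑ A ∈ B, ind A ⬝ᵥ t := fun t => by
    simp [hl, LinearMap.sum_apply]
  refine ⟨l.toContinuousLinearMap, ?_⟩
  ext t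
  simp only [LinearMap.coe_toContinuousLinearMap', hlt, tubeFace, Set.mem_ofPred_eq, neg_le_neg_iff]
  refine and_congr_right fun ht => ⟨fun h y hy => ?_, fun h A hA => ?_⟩
  · refine Finset.sum_le_sum fun A hA => ?_
    rw [tight_iff.mp (h A hA)]
    exact (mem_polytope.mp hy).2 A (hB A hA)
  · have h1 : ∀ A ∈ B, bound A ≤ ind A ⬝ᵥ t := fun A hA => (mem_polytope.mp ht).2 A (hB A hA)
    have h2 : ∑ A ∈ B, ind A ⬝ᵥ t ≤ ∑ A ∈ B, bound A := (h s hs.1).trans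
      (Finset.sum_congr rfl fun A hA => tight_iff.mp (hs.2 A hA)).le
    exact tight_iff.mpr (((Finset.sum_eq_sum_iff_of_le h1).mp
      (le_antisymm (Finset.sum_le_sum h1) h2) A hA).symm)

/-- Incompatible tubes are never tight at a common point, as `3 ^ (a + 1)` exceeds `2 * 3 ^ a`. -/
theorem not_incompat_of_tight {t : Fin (b.gaps n) → ℝ} (ht : t ∈ b.polytope n) {A C : Finset ℕ}
    (hA : b.IsBracket n A) (hC : b.IsBracket n C) (h1 : Tight t A) (h2 : Tight t C) :
    ¬ b.Incompat n A C := by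
  intro h
  have hpos : 0 ≤ ∑ x ∈ A ∩ C, coord t x := Finset.sum_nonneg fun x hx => by
    have h3 := ht.2 {x} (isBracket_singleton (hA.lt (Finset.mem_inter.mp hx).1))
    rw [Finset.sum_singleton, bound_eq (Finset.singleton_nonempty x)] at h3
    exact le_trans (by positivity) h3
  have hU := ht.2 _ h.2.2
  have h3 := Finset.sum_union_inter (s₁ := A) (s₂ := C) (f := coord t)
  rw [h1, h2, bound_eq hA.nonempty, bound_eq hC.nonempty] at h3
  rw [bound_eq h.2.2.nonempty] at hU
  have key : ∀ X : Finset ℕ, X ⊂ A ∪ C → (3 : ℝ) * 3 ^ X.card ≤ 3 ^ (A ∪ C).card := fun X hX => by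
    rw [← pow_succ']
    exact pow_le_pow_right₀ (by norm_num) (Finset.card_lt_card hX)
  have h4 := key A ⟨Finset.subset_union_left, fun h5 => h.2.1 (Finset.subset_union_right.trans h5)⟩
  have h5 := key C ⟨Finset.subset_union_right, fun h5 => h.1 (Finset.subset_union_left.trans h5)⟩
  have h6 : (0 : ℝ) < 3 ^ (A ∪ C).card := by positivity
  linarith

theorem nested_tubesOf {F : Set (Fin (b.gaps n) → ℝ)} (hF : F ⊆ b.polytope n) (hne : F.Nonempty) :
    b.Nested n (tubesOf b n F) := by
  obtain ⟨t, ht⟩ := hne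
  refine ⟨fun A hA => (mem_tubesOf.mp hA).1, fun A hA C hC => ?_, fun hg => ?_⟩
  · rw [mem_tubesOf] at hA hC
    exact not_incompat_of_tight (hF ht) hA.1 hC.1 (hA.2 t ht) (hC.2 t ht)
  · exact mem_tubesOf.mpr ⟨isBracket_range hg, fun s hs => (hF hs).1⟩

/-- Every nonempty exposed face is cut out by its tubes. -/
theorem eq_tubeFace {F : Set (Fin (b.gaps n) → ℝ)} (hF : IsExposed ℝ (b.polytope n) F)
    (hne : F.Nonempty) : F = tubeFace b n (tubesOf b n F) := by
  classical
  have hFP := hF.subset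
  refine Set.Subset.antisymm (fun t ht => ⟨hFP ht, fun A hA => (mem_tubesOf.mp hA).2 t ht⟩)
    fun t ht => ?_
  -- An average of points of `F` lies on no hyperplane that does not contain `F`.
  have hint : ∀ S ⊆ brackets b n \ tubesOf b n F, ∃ s ∈ F, ∀ A ∈ S, ¬ Tight s A := by
    intro S hS
    induction S using Finset.induction_on with
    | empty => exact ⟨_, hne.some_mem, by simp⟩
    | insert A S hAS ih =>
      obtain ⟨s, hs, h1⟩ := ih ((Finset.subset_insert _ _).trans hS)
      have hA := Finset.mem_sdiff.mp (hS (Finset.mem_insert_self A S))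
      have h2 : ∃ s' ∈ F, ¬ Tight s' A := by
        by_contra hcon
        push Not at hcon
        exact hA.2 (mem_tubesOf.mpr ⟨mem_brackets.mp hA.1, hcon⟩)
      obtain ⟨s', hs', h2⟩ := h2
      refine ⟨(1 / 2 : ℝ) • s + (1 / 2 : ℝ) • s', hF.convex convex_polytope hs hs'
        (by norm_num) (by norm_num) (by norm_num), fun C hC hT => ?_⟩
      have hCb : b.IsBracket n C := mem_brackets.mp (Finset.mem_sdiff.mp (hS hC)).1
      have h3 := (mem_polytope.mp (hFP hs)).2 C hCb
      have h4 := (mem_polytope.mp (hFP hs')).2 C hCb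
      rw [tight_iff, dotProduct_add, dotProduct_smul, dotProduct_smul, smul_eq_mul,
        smul_eq_mul] at hT
      rcases Finset.mem_insert.mp hC with rfl | hC
      · exact h2 (tight_iff.mpr (by linarith))
      · exact h1 C hC (tight_iff.mpr (by linarith))
  obtain ⟨s, hs, h1⟩ := hint _ subset_rfl
  have hnest := nested_tubesOf hFP hne
  obtain ⟨ε, hε, h2⟩ := exists_add_mem_polytope hnest.full (hFP hs)
    (fun A hA hT => by
      by_contra h3
      exact h1 A (Finset.mem_sdiff.mpr ⟨mem_brackets.mpr hA, h3⟩) hT)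
    (sub_mem_tubeSpace (fun A hA => (mem_tubesOf.mp hA).2 s hs) ht.2)
  -- The functional that exposes `F` is maximal at `s`, also in the direction opposite to `t`; hence
  -- it is as large at `t` as at `s`.
  obtain ⟨l, hl⟩ := hF hne
  rw [hl] at hs ⊢
  refine ⟨ht.1, fun y hy => (hs.2 y hy).trans ?_⟩
  have h3 := hs.2 _ h2
  rw [map_add, map_smul, map_sub, smul_eq_mul] at h3
  by_contra h4
  nlinarith

/-- The direction space of a face is the common kernel of the functionals of its tubes. -/
theorem vectorSpan_tubeFace {B : Finset (Finset ℕ)} (hB : b.Nested n B) :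
    vectorSpan ℝ (tubeFace b n B) = tubeSpace _ B := by
  refine le_antisymm (Submodule.span_le.mpr ?_) fun v hv => ?_
  · rintro _ ⟨s, hs, t, ht, rfl⟩
    exact sub_mem_tubeSpace hs.2 ht.2
  · obtain ⟨t, ht, h1⟩ := exists_tight_iff hB
    obtain ⟨ε, hε, h2⟩ := exists_add_mem_polytope hB.full ht (fun A hA => (h1 A hA).mp) hv
    have hT : ∀ A ∈ B, Tight t A := fun A hA => (h1 A (hB.bracket A hA)).mpr hA
    have h3 : t + ε • v ∈ tubeFace b n B := ⟨h2, fun A hA => by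
      rw [tight_iff, dotProduct_add, dotProduct_smul, hv A hA, smul_zero, add_zero]
      exact tight_iff.mp (hT A hA)⟩
    have h4 := vsub_mem_vectorSpan ℝ h3 (⟨ht, hT⟩ : t ∈ tubeFace b n B)
    rw [vsub_eq_sub, add_sub_cancel_left] at h4
    have h5 := Submodule.smul_mem _ ε⁻¹ h4
    rwa [smul_smul, inv_mul_cancel₀ hε.ne', one_smul] at h5

/-- The indicator vectors of a nested set of tubes are linearly independent. -/
theorem linearIndependent_ind {B : Finset (Finset ℕ)} (hB : ∀ A ∈ B, b.IsBracket n A)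
    (hBB : ∀ A ∈ B, ∀ C ∈ B, ¬ b.Incompat n A C) :
    LinearIndependent ℝ (fun A : B => (ind A.1 : Fin (b.gaps n) → ℝ)) := by
  classical
  rw [Fintype.linearIndependent_iff]
  intro c hc
  by_contra hcon
  push Not at hcon
  -- A largest tube `A` with a nonzero coefficient has a gap that lies in no smaller tube; the
  -- coordinate of this gap shows that the coefficient vanishes.
  obtain ⟨A, hA, hmax⟩ := (Finset.univ.filter fun A : B => c A ≠ 0).exists_max_image
    (fun A => A.1.card) ⟨hcon.choose, by simpa using hcon.choose_spec⟩
  have hown : ∃ x ∈ A.1, ∀ C ∈ B, C ⊆ A.1 → x ∈ C → C = A.1 := by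
    by_contra hcon'
    push Not at hcon'
    obtain ⟨C, hC, h1⟩ := exists_subset_of_subset_sup (hB A.1 A.2)
      (B.filter fun C => C ⊆ A.1 ∧ C ≠ A.1) (fun C hC => hB C (Finset.mem_filter.mp hC).1)
      (fun C hC D hD => hBB C (Finset.mem_filter.mp hC).1 D (Finset.mem_filter.mp hD).1)
      (fun x hx => by
        obtain ⟨C, h1, h2, h3, h4⟩ := hcon' x hx
        exact ⟨C, Finset.mem_filter.mpr ⟨h1, h2, h4⟩, h3⟩)
    rw [Finset.mem_filter] at hC
    exact hC.2.2 (hC.2.1.antisymm h1)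
  obtain ⟨x, hx, hx'⟩ := hown
  have h1 := congrFun hc ⟨x, (hB A.1 A.2).lt hx⟩
  rw [Finset.sum_apply, Finset.sum_eq_single A] at h1
  · simp only [Pi.smul_apply, ind, hx, if_true, smul_eq_mul, mul_one, Pi.zero_apply] at h1
    exact (Finset.mem_filter.mp hA).2 h1
  · intro C _ hCA
    by_cases hxC : x ∈ C.1
    · have hcC : c C = 0 := by
        by_contra h2
        have h3 := hmax C (Finset.mem_filter.mpr ⟨Finset.mem_univ _, h2⟩)
        rcases subset_or_disjoint (hB A.1 A.2) (hB C.1 C.2) (hBB _ A.2 _ C.2) with h4 | h4 | h4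
        · exact hCA (Subtype.ext (Finset.eq_of_subset_of_card_le h4 h3).symm)
        · exact hCA (Subtype.ext (hx' C.1 C.2 h4 hxC))
        · exact Finset.disjoint_left.mp h4 hx hxC
      simp [hcC]
    · simp [ind, hxC]
  · simp

/-- The codimension of a face is the number of its tubes. -/
theorem finrank_tubeSpace {B : Finset (Finset ℕ)} (hB : b.Nested n B) :
    B.card + Module.finrank ℝ (tubeSpace (b.gaps n) B) = b.gaps n := by
  classical
  set M : Matrix B (Fin (b.gaps n)) ℝ := fun A => ind A.1 with hM
  have h1 : M.rank = Fintype.card B :=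
    LinearIndependent.rank_matrix (linearIndependent_ind hB.bracket hB.compat)
  have h2 : LinearMap.ker M.mulVecLin = tubeSpace _ B := by
    ext v
    rw [LinearMap.mem_ker, mem_tubeSpace]
    refine ⟨fun h A hA => congrFun h ⟨A, hA⟩, fun h => funext fun A => h A.1 A.2⟩
  have h3 := M.mulVecLin.finrank_range_add_finrank_ker
  rw [h2, ← Matrix.rank, h1, Fintype.card_coe, Module.finrank_fin_fun] at h3
  exact h3

theorem exists_cell {B : Finset (Finset ℕ)} (hB : b.Nested n B) {q : ℕ}
    (hq : B.card + q = b.gaps n) {f : Fin q → Fin (b.gaps n) → ℝ} (hf : LinearIndependent ℝ f)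
    (hfB : ∀ i, f i ∈ tubeSpace _ B) :
    ∃ a : Cell b n q, a.face = tubeFace b n B ∧ a.frame = f := by
  refine ⟨⟨tubeFace b n B, tubeFace_nonempty hB, isExposed_tubeFace hB.bracket, f, hf, ?_⟩, rfl, rfl⟩
  rw [vectorSpan_tubeFace hB]
  refine Submodule.eq_of_le_of_finrank_eq (Submodule.span_le.mpr ?_) ?_
  · rintro _ ⟨i, rfl⟩
    exact hfB i
  · have := finrank_tubeSpace hB
    rw [finrank_span_eq_card hf, Fintype.card_fin]
    omega

theorem exists_frame {B : Finset (Finset ℕ)} (hB : b.Nested n B) {q : ℕ}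
    (hq : B.card + q = b.gaps n) :
    ∃ f : Fin q → Fin (b.gaps n) → ℝ, LinearIndependent ℝ f ∧ ∀ i, f i ∈ tubeSpace _ B := by
  have h1 : Module.finrank ℝ (tubeSpace (b.gaps n) B) = q := by
    have := finrank_tubeSpace hB
    omega
  have e := Module.finBasisOfFinrankEq ℝ _ h1
  exact ⟨fun i => (e i).1, e.linearIndependent.map' (Submodule.subtype _) (Submodule.ker_subtype _),
    fun i => (e i).2⟩

/-- The tubes of an oriented cell. -/
abbrev OrientedFace.tubes {q : ℕ} (a : Cell b n q) : Finset (Finset ℕ) := tubesOf b n a.face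

theorem OrientedFace.nested {q : ℕ} (a : Cell b n q) : b.Nested n a.tubes :=
  nested_tubesOf a.exposed.subset a.nonempty

theorem OrientedFace.face_eq {q : ℕ} (a : Cell b n q) : a.face = tubeFace b n a.tubes :=
  eq_tubeFace a.exposed a.nonempty

theorem OrientedFace.span_eq {q : ℕ} (a : Cell b n q) :
    Submodule.span ℝ (Set.range a.frame) = tubeSpace _ a.tubes := by
  rw [a.span_frame, ← vectorSpan_tubeFace a.nested, ← a.face_eq]

theorem OrientedFace.frame_mem {q : ℕ} (a : Cell b n q) (i : Fin q) :
    a.frame i ∈ tubeSpace _ a.tubes := by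
  rw [← a.span_eq]
  exact Submodule.subset_span ⟨i, rfl⟩

theorem OrientedFace.card_tubes {q : ℕ} (a : Cell b n q) : a.tubes.card + q = b.gaps n := by
  have h1 := finrank_tubeSpace a.nested
  rwa [← a.span_eq, finrank_span_eq_card a.independent, Fintype.card_fin] at h1

end

section

variable {g : ℕ}

/-! ### Orientations by determinants -/

/-- The determinant of a list of vectors, zero if the number of vectors is not the dimension. -/
def listDet {g : ℕ} (R : List (Fin g → ℝ)) : ℝ :=
  if R.length = g then (Matrix.of fun i : Fin g => R.getD i.1 0).det else 0

theorem listDet_of_length {R : List (Fin g → ℝ)} (h : R.length = g) :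
    listDet R = (Matrix.of fun i : Fin g => R.getD i.1 0).det := if_pos h

theorem listDet_swap (u : List (Fin g → ℝ)) (x y : Fin g → ℝ) (v : List (Fin g → ℝ)) :
    listDet (u ++ x :: y :: v) = -listDet (u ++ y :: x :: v) := by
  by_cases h : (u ++ x :: y :: v).length = g
  · have h' : (u ++ y :: x :: v).length = g := by simpa using h
    have hl : u.length + v.length + 2 = g := by simpa [add_assoc] using h
    rw [listDet_of_length h, listDet_of_length h']
    set i₀ : Fin g := ⟨u.length, by omega⟩ with hi₀
    set i₁ : Fin g := ⟨u.length + 1, by omega⟩ with hi₁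
    have hne : i₀ ≠ i₁ := fun h => by simp [hi₀, hi₁] at h
    have h1 := Matrix.det_permute (swap i₀ i₁)
      (Matrix.of fun i : Fin g => (u ++ y :: x :: v).getD i.1 0)
    rw [Perm.sign_swap hne] at h1
    simp only [Units.val_neg, Units.val_one, Int.cast_neg, Int.cast_one, neg_one_mul] at h1
    rw [← h1]
    congr 1
    ext i c
    simp only [Matrix.of_apply, Matrix.submatrix_apply, id]
    by_cases hi : i = i₀
    · subst hi
      rw [swap_apply_left]
      simp [hi₀, hi₁]
    by_cases hi' : i = i₁
    · subst hi'
      rw [swap_apply_right]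
      simp [hi₀, hi₁]
    rw [swap_apply_of_ne_of_ne hi hi']
    simp only [hi₀, hi₁, Fin.ext_iff] at hi hi'
    rcases lt_or_ge i.1 u.length with h2 | h2
    · rw [List.getD_append _ _ _ _ h2, List.getD_append _ _ _ _ h2]
    · obtain ⟨d, hd⟩ : ∃ d, i.1 = u.length + (d + 2) := ⟨i.1 - u.length - 2, by omega⟩
      rw [List.getD_append_right _ _ _ _ h2, List.getD_append_right _ _ _ _ h2, hd,
        Nat.add_sub_cancel_left]
      rfl
  · rw [listDet, listDet, if_neg h, if_neg (by simpa using h), neg_zero]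

theorem listDet_append_swap (u v w x : List (Fin g → ℝ)) :
    listDet (u ++ (v ++ (w ++ x))) =
      (-1 : ℝ) ^ (v.length * w.length) * listDet (u ++ (w ++ (v ++ x))) :=
  append_swap_of_swap ℝ listDet_swap u v w x

/-- Permuting the coordinates. -/
theorem listDet_map_perm (π : Perm (Fin g)) (R : List (Fin g → ℝ)) :
    listDet (R.map fun v => v ∘ π) = ((Perm.sign π : ℤ) : ℝ) * listDet R := by
  rw [listDet, listDet, List.length_map]
  split_ifs with h
  · rw [← Matrix.det_permute' π]
    congr 1
    ext i c
    have h1 : (R.map fun v => v ∘ π).getD i.1 0 = (R.getD i.1 0) ∘ π :=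
      List.getD_map R 0 (fun v : Fin g → ℝ => v ∘ π)
    rw [Matrix.of_apply, h1]
    rfl
  · rw [mul_zero]

section Rows

variable {q : ℕ} {X : List (Fin g → ℝ)} {f : Fin q → Fin g → ℝ}

/-- The rows of the matrix given by a list and a frame. -/
def rowEquiv (X : List (Fin g → ℝ)) (h : X.length + q = g) : Fin X.length ⊕ Fin q ≃ Fin g :=
  finSumFinEquiv.trans (finCongr h)

theorem row_eq (h : X.length + q = g) (i : Fin X.length ⊕ Fin q) :
    (X ++ List.ofFn f).getD (rowEquiv X h i).1 0 = Sum.elim X.get f i := by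
  rcases i with i | i
  · rw [List.getD_append _ _ _ _ (by simp [rowEquiv])]
    simp [rowEquiv]
  · simp [rowEquiv]

theorem listDet_eq (h : X.length + q = g) : listDet (X ++ List.ofFn f) =
    ((Matrix.of (Sum.elim X.get f)).submatrix (rowEquiv X h).symm id).det := by
  rw [listDet_of_length (by simpa using h)]
  congr 1
  ext i c
  obtain ⟨i, rfl⟩ := (rowEquiv X h).surjective i
  rw [Matrix.of_apply, row_eq, Matrix.submatrix_apply, symm_apply_apply]
  rfl

/-- Changing the frame by a matrix multiplies the determinant by that of the matrix. -/
theorem listDet_transition (h : X.length + q = g) (A : Matrix (Fin q) (Fin q) ℝ) :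
    listDet (X ++ List.ofFn fun i => ∑ j, A i j • f j) = A.det * listDet (X ++ List.ofFn f) := by
  rw [listDet_eq h, listDet_eq h]
  set M : Matrix (Fin X.length ⊕ Fin q) (Fin g) ℝ := Matrix.of (Sum.elim X.get f) with hM
  set P : Matrix (Fin X.length ⊕ Fin q) (Fin X.length ⊕ Fin q) ℝ := Matrix.fromBlocks 1 0 0 A
    with hP
  have h1 : Matrix.of (Sum.elim X.get fun i => ∑ j, A i j • f j) = P * M := by
    ext i c
    rw [Matrix.mul_apply, Fintype.sum_sum_type]
    rcases i with i | i
    · simp [hP, hM, Matrix.one_apply]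
    · simp [hP, hM, Finset.sum_apply]
  rw [h1, ← Matrix.submatrix_mul_equiv _ _ _ (rowEquiv X h).symm, Matrix.det_mul,
    Matrix.det_submatrix_equiv_self, hP, Matrix.det_fromBlocks_zero₂₁, Matrix.det_one, one_mul]

theorem listDet_ne_zero_iff (h : X.length + q = g) :
    listDet (X ++ List.ofFn f) ≠ 0 ↔ LinearIndependent ℝ (Sum.elim X.get f) := by
  rw [listDet_eq h, ← isUnit_iff_ne_zero, ← Matrix.isUnit_iff_isUnit_det,
    ← Matrix.linearIndependent_rows_iff_isUnit]
  exact linearIndependent_equiv (rowEquiv X h).symm (f := Sum.elim X.get f)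

/-- Exchanging a vector of a basis for another one multiplies the determinant by a coordinate. -/
theorem exists_coordinates {v w : Fin g → ℝ} (h : X.length + 1 + q = g)
    (h0 : listDet (X ++ [v] ++ List.ofFn f) ≠ 0) :
    ∃ (c : Fin X.length → ℝ) (β : ℝ) (d : Fin q → ℝ),
      w = ∑ i, c i • X.get i + β • v + ∑ j, d j • f j ∧
      listDet (X ++ [w] ++ List.ofFn f) = β * listDet (X ++ [v] ++ List.ofFn f) := by
  have hX : ∀ v, X ++ [v] ++ List.ofFn f = X ++ List.ofFn (Fin.cons v f : Fin (q + 1) → _) := by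
    intro v
    rw [List.ofFn_succ]
    simp
  have h' : X.length + (q + 1) = g := by omega
  rw [hX] at h0
  simp only [hX]
  have hli := (listDet_ne_zero_iff h').mp h0
  have hspan : w ∈ Submodule.span ℝ (Set.range (Sum.elim X.get (Fin.cons v f : Fin (q + 1) → _))) := by
    rw [hli.span_eq_top_of_card_eq_finrank' (by simp; omega)]
    trivial
  obtain ⟨c, hc⟩ := (Submodule.mem_span_range_iff_exists_fun ℝ).mp hspan
  rw [Fintype.sum_sum_type] at hc
  simp only [Sum.elim_inl, Sum.elim_inr, Fin.sum_univ_succ, Fin.cons_zero, Fin.cons_succ] at hc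
  refine ⟨fun i => c (.inl i), c (.inr 0), fun j => c (.inr j.succ), by rw [← hc, add_assoc], ?_⟩
  set A := (Matrix.of (Sum.elim X.get (Fin.cons v f : Fin (q + 1) → _))).submatrix
    (rowEquiv X h').symm id with hA
  have h1 := Matrix.det_updateRow_sum A (rowEquiv X h' (.inr 0)) (fun i => c ((rowEquiv X h').symm i))
  rw [listDet_eq h', listDet_eq h', ← hA, ← smul_eq_mul]
  rw [symm_apply_apply] at h1
  rw [← h1]
  congr 1
  ext i x
  obtain ⟨i, rfl⟩ := (rowEquiv X h').surjective i
  rw [Matrix.submatrix_apply, symm_apply_apply, id]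
  by_cases hi : i = .inr 0
  · subst hi
    rw [Matrix.updateRow_self, ← (rowEquiv X h').sum_comp, Fintype.sum_sum_type]
    simp only [symm_apply_apply, Fin.sum_univ_succ]
    have h2 := congrFun hc x
    simp only [Pi.add_apply, Finset.sum_apply, Pi.smul_apply, smul_eq_mul] at h2
    simp [hA, Finset.sum_apply, ← h2]
  · rw [Matrix.updateRow_ne (fun h2 => hi ((rowEquiv X h').injective h2)), hA,
      Matrix.submatrix_apply, symm_apply_apply]
    rcases i with i | i
    · rfl
    · obtain ⟨i, rfl⟩ := Fin.exists_succ_eq.mpr (fun h3 : i = 0 => hi (by rw [h3]))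
      rfl

end Rows

/-- The permutation of the coordinates that moves the last `h` coordinates to the places from `j`
on. -/
theorem exists_block_perm {m h j : ℕ} (hj : j ≤ m) :
    ∃ π : Perm (Fin (m + h)), (∀ x : Fin m, (π (Fin.castAdd h x)).1 = if x.1 < j then x.1 else x.1 + h) ∧
      (∀ z : Fin h, (π (Fin.natAdd m z)).1 = j + z.1) ∧
      Perm.sign π = (-1) ^ (h * (m - j)) := by
  have hr : m + h + 1 = m + 1 + h := by omega
  set σ := Fin.cycleIcc (⟨j, by omega⟩ : Fin (m + 1)) (Fin.last m) with hσ
  have hle : (⟨j, by omega⟩ : Fin (m + 1)) ≤ Fin.last m := Fin.le_last _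
  have hl : σ (Fin.last m) = ⟨j, by omega⟩ := Fin.cycleIcc_of_last hle
  -- The cycle that moves a letter from the last place to the place `j`, with this letter replaced
  -- by a block of `h` letters.
  refine ⟨permComp hr (Fin.last m) σ 1, fun x => ?_, fun z => ?_, ?_⟩
  · have h1 : σ x.castSucc = (⟨j, by omega⟩ : Fin (m + 1)).succAbove x := by
      have := congrFun (Fin.cycleIcc_comp_succAbove _ _ hle) x
      rwa [Function.comp_apply, Fin.succAbove_last] at this
    have h2 := permComp_inl_of_eq hr (Fin.last m) _ σ (1 : Perm (Fin h)) hl x.castSucc _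
      (Fin.castSucc_lt_last x).ne (Fin.succAbove_ne _ x) h1
    have h3 : inputs hr (Fin.last m) (Sum.inl ⟨x.castSucc, (Fin.castSucc_lt_last x).ne⟩) =
        Fin.castAdd h x := by
      ext
      rw [inputs_inl_val]
      simp
    rw [h3] at h2
    rw [h2, inputs_inl_val]
    simp only [Fin.succAbove, Fin.lt_def, Fin.val_castSucc]
    split_ifs with h4 <;> simp only [Fin.val_castSucc, Fin.val_succ] at * <;> omega
  · have h2 := permComp_inr_of_eq hr (Fin.last m) _ σ (1 : Perm (Fin h)) hl z
    have h3 : inputs hr (Fin.last m) (Sum.inr z) = Fin.natAdd m z := by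
      ext
      rw [inputs_inr_val]
      simp
    rw [h3] at h2
    rw [h2, inputs_inr_val]
    simp
  · rw [sign_permComp, hl, hσ, Fin.sign_cycleIcc_of_le hle, Perm.sign_one, mul_one, ← pow_add]
    simp only [Fin.val_last]
    obtain ⟨d, rfl⟩ : ∃ d, m = j + d := ⟨m - j, by omega⟩
    rw [Nat.add_sub_cancel_left]
    have : d + (h + 1) * (j + (j + d)) = h * d + 2 * (d + (h + 1) * j) := by ring
    rw [this, pow_add, pow_mul, pow_mul (-1) 2]
    simp

/-- The determinant of the list of vectors of a composite cell. -/
theorem listDet_blocks {m h j : ℕ} (hj : j ≤ m) {R : List (Fin (m + h) → ℝ)} {Y : List (Fin h → ℝ)}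
    (hR : R.length = m) (hY : Y.length = h) :
    listDet (R ++ Y.map (insertVec (m + h) j (0 : Fin m → ℝ))) = (-1) ^ (h * (m - j)) *
      (listDet (R.map fun v => fun x : Fin m => coord v (if x.1 < j then x.1 else x.1 + h)) *
        listDet Y) := by
  obtain ⟨π, h1, h2, h3⟩ := exists_block_perm (h := h) hj
  have h4 := listDet_map_perm π (R ++ Y.map (insertVec (m + h) j (0 : Fin m → ℝ)))
  have h5 : listDet ((R ++ Y.map (insertVec (m + h) j (0 : Fin m → ℝ))).map fun v => v ∘ π) =
      listDet (R.map fun v => fun x : Fin m => coord v (if x.1 < j then x.1 else x.1 + h)) *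
        listDet Y := by
    rw [listDet_of_length (by simp [hR, hY]), listDet_of_length (by simp [hR]),
      listDet_of_length hY, ← Matrix.det_submatrix_equiv_self finSumFinEquiv]
    -- With the coordinates moved, the matrix is block triangular.
    have h6 := Matrix.det_fromBlocks_zero₂₁
      (Matrix.of fun i : Fin m => (R.map fun v => fun x : Fin m =>
        coord v (if x.1 < j then x.1 else x.1 + h)).getD i.1 0)
      (Matrix.of fun (i : Fin m) (z : Fin h) => R.getD i.1 0 (π (Fin.natAdd m z)))
      (Matrix.of fun i : Fin h => Y.getD i.1 0)
    rw [← h6]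
    congr 1
    ext i c
    rw [Matrix.submatrix_apply, Matrix.of_apply]
    rcases i with i | i
    · have hi : i.1 < R.length := by rw [hR]; exact i.2
      rw [finSumFinEquiv_apply_left, Fin.val_castAdd, List.map_append,
        List.getD_append _ _ _ _ (by simpa using hi)]
      rcases c with c | c
      · rw [finSumFinEquiv_apply_left, Matrix.fromBlocks_apply₁₁, Matrix.of_apply]
        simp only [List.getD_eq_getElem _ _ (show i.1 < (R.map _).length by simpa using hi),
          List.getElem_map, Function.comp_apply]
        have h7 : (if c.1 < j then c.1 else c.1 + h) < m + h := by have := c.2; split_ifs <;> omega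
        rw [coord, dif_pos h7]
        exact congrArg _ (Fin.ext (h1 c))
      · rw [finSumFinEquiv_apply_right, Matrix.fromBlocks_apply₁₂, Matrix.of_apply]
        simp only [List.getD_eq_getElem _ _ (show i.1 < (R.map _).length by simpa using hi),
          List.getD_eq_getElem _ _ hi, List.getElem_map, Function.comp_apply]
    · have hi : i.1 < Y.length := by rw [hY]; exact i.2
      rw [finSumFinEquiv_apply_right, Fin.val_natAdd, List.map_append,
        List.getD_append_right _ _ _ _ (by simp [hR])]
      simp only [List.length_map, hR, Nat.add_sub_cancel_left, List.map_map,
        List.getD_eq_getElem _ _ (show i.1 < (Y.map _).length by simpa using hi),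
        List.getElem_map, Function.comp_apply, insertVec]
      rcases c with c | c
      · rw [finSumFinEquiv_apply_left, Matrix.fromBlocks_apply₂₁, h1]
        have := c.2
        by_cases hc : c.1 < j
        · simp [hc, coord]
        · simp [hc, coord, show ¬ c.1 + h < j by omega]
      · rw [finSumFinEquiv_apply_right, Matrix.fromBlocks_apply₂₂, h2]
        simp [coord, List.getElem?_eq_getElem hi]
  rw [h5, h3] at h4
  have h7 : ((-1 : ℝ) ^ (h * (m - j))) * (-1) ^ (h * (m - j)) = 1 := by
    rw [← mul_pow]; simp
  push_cast at h4
  rw [h4, ← mul_assoc, h7, one_mul]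

end

/-! ### Oriented cells and lists of tubes -/

section

variable {b : Kind} {n q : ℕ} {g : ℕ}

theorem coe_sign_mul (x y : ℝ) :
    ((SignType.sign (x * y) : SignType) : ℤ) = (SignType.sign x : ℤ) * (SignType.sign y : ℤ) := by
  rw [sign_mul]
  exact map_mul SignType.castHom _ _

theorem coe_sign_neg_one_pow (m : ℕ) : ((SignType.sign ((-1 : ℝ) ^ m) : SignType) : ℤ) = (-1) ^ m := by
  rcases neg_one_pow_eq_or ℝ m with h | h <;> rcases Nat.even_or_odd m with h' | h' <;>
    simp [h'.neg_one_pow]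

/-- The orientation that the list of normal vectors given by a list of tubes, followed by a frame,
defines on the ambient space. The signs in front make the cellular boundary and the products of
orientations correspond to the operations on lists of tubes. It is zero if the vectors are linearly
dependent, or if their number is not the dimension. -/
def orient {g q : ℕ} (L : List (Finset ℕ)) (f : Fin q → Fin g → ℝ) : ℤ :=
  (∏ x ∈ Finset.range g, (-1) ^ x) * (-1) ^ q *
    (SignType.sign (listDet (L.map ind ++ List.ofFn f)) : ℤ)

theorem orient_swap (u : List (Finset ℕ)) (A C : Finset ℕ) (v : List (Finset ℕ))
    (f : Fin q → Fin g → ℝ) : orient (u ++ A :: C :: v) f = -orient (u ++ C :: A :: v) f := by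
  simp only [orient, List.map_append, List.map_cons, List.append_assoc, List.cons_append]
  rw [listDet_swap, Left.sign_neg, SignType.coe_neg]
  ring

theorem orient_transition {L : List (Finset ℕ)} (h : L.length + q = g) (f : Fin q → Fin g → ℝ)
    (A : Matrix (Fin q) (Fin q) ℝ) :
    orient L (fun i => ∑ j, A i j • f j) = (SignType.sign A.det : ℤ) * orient L f := by
  rw [orient, orient, listDet_transition (by simpa using h), coe_sign_mul]
  ring

/-- The map on the coordinates induced by a rotation of the word. -/
def Kind.rot (b : Kind) {n : ℕ} (ζ : Perm (Fin n)) (t : Fin (b.gaps n) → ℝ) : Fin (b.gaps n) → ℝ :=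
  fun x => coord t (permVal ζ⁻¹ x.1)

theorem rot_module (ζ : Perm (Fin n)) (t : Fin n → ℝ) : Kind.module.rot ζ t = rotate ζ t := by
  funext x
  have h1 : permVal ζ⁻¹ x.1 = (ζ⁻¹ x).1 := permVal_fin _ _
  change coord t (permVal ζ⁻¹ x.1) = t (ζ⁻¹ x)
  rw [h1, coord, dif_pos (ζ⁻¹ x).2]

theorem rot_one (t : Fin (b.gaps n) → ℝ) : b.rot (1 : Perm (Fin n)) t = t := by
  funext x
  rw [Kind.rot, inv_one, permVal_one, coord, dif_pos x.2]

/-- A rotation of the word permutes the coordinates, with the same sign. -/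
theorem exists_perm_rot {ζ : Perm (Fin n)} (hζ : ζ ∈ b.rotations n) :
    ∃ π : Perm (Fin (b.gaps n)), Perm.sign π = Perm.sign ζ ∧ (∀ t, b.rot ζ t = t ∘ π) ∧
      ∀ A, (ind (permTube ζ A) : Fin (b.gaps n) → ℝ) = ind A ∘ π := by
  cases b
  · obtain rfl := eq_one_of_mem_rotations hζ
    refine ⟨1, by simp, fun t => rot_one t, fun A => by rw [permTube_one]; rfl⟩
  · refine ⟨ζ⁻¹, Perm.sign_inv _, fun t => rot_module ζ t, fun A => ?_⟩
    funext x
    have h1 : permVal ζ⁻¹ x.1 = (ζ⁻¹ x).1 := permVal_fin _ _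
    change (if x.1 ∈ permTube ζ A then (1 : ℝ) else 0) = if (ζ⁻¹ x).1 ∈ A then 1 else 0
    simp only [mem_permTube, h1]

/-- A rotation of tubes and frame changes the orientation by its sign. -/
theorem orient_rotate {ζ : Perm (Fin n)} (hζ : ζ ∈ b.rotations n) (L : List (Finset ℕ))
    (f : Fin q → Fin (b.gaps n) → ℝ) :
    orient (L.map (permTube ζ)) (fun i => b.rot ζ (f i)) = Perm.sign ζ * orient L f := by
  obtain ⟨π, h1, h2, h3⟩ := exists_perm_rot hζ
  have h4 : (L.map (permTube ζ)).map ind ++ List.ofFn (fun i => b.rot ζ (f i)) =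
      (L.map ind ++ List.ofFn f).map fun v => v ∘ π := by
    rw [List.map_append, List.map_map, List.map_map, List.map_ofFn]
    congr 1
    · exact List.map_congr_left fun A _ => h3 A
    · congr 1
      funext i
      exact h2 _
  rw [orient, orient, h4, listDet_map_perm, coe_sign_mul, h1]
  rcases Int.units_eq_one_or (Perm.sign ζ) with h5 | h5 <;> simp [h5]

theorem ind_dotProduct_rot {ζ : Perm (Fin n)} (hζ : ζ ∈ b.rotations n) (A : Finset ℕ)
    (t : Fin (b.gaps n) → ℝ) : ind (permTube ζ A) ⬝ᵥ b.rot ζ t = ind A ⬝ᵥ t := by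
  obtain ⟨π, -, h2, h3⟩ := exists_perm_rot hζ
  rw [h2, h3, comp_equiv_dotProduct_comp_equiv]

theorem bound_permTube (ζ : Perm (Fin n)) (A : Finset ℕ) : bound (permTube ζ A) = bound A := by
  have h1 : permTube ζ A = ∅ ↔ A = ∅ := Finset.image_eq_empty
  simp only [bound, permTube_card, h1]

theorem tight_rot {ζ : Perm (Fin n)} (hζ : ζ ∈ b.rotations n) (A : Finset ℕ)
    (t : Fin (b.gaps n) → ℝ) : Tight (b.rot ζ t) (permTube ζ A) ↔ Tight t A := by
  rw [tight_iff, tight_iff, ind_dotProduct_rot hζ, bound_permTube]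

theorem rot_mem_polytope {ζ : Perm (Fin n)} (hζ : ζ ∈ b.rotations n) (t : Fin (b.gaps n) → ℝ) :
    b.rot ζ t ∈ b.polytope n ↔ t ∈ b.polytope n := by
  have h0 := ind_dotProduct_rot hζ (Finset.range (b.gaps n)) t
  rw [permTube_range hζ] at h0
  rw [mem_polytope, mem_polytope, h0]
  refine and_congr Iff.rfl ⟨fun h A hA => ?_, fun h A hA => ?_⟩
  · have h1 := h _ (hA.permTube hζ)
    rwa [ind_dotProduct_rot hζ, bound_permTube] at h1
  · rw [← permTube_self_inv ζ A, ind_dotProduct_rot hζ, bound_permTube]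
    exact h _ (hA.permTube (inv_mem hζ))

theorem tubesOf_image {ζ : Perm (Fin n)} (hζ : ζ ∈ b.rotations n) (F : Set (Fin (b.gaps n) → ℝ)) :
    tubesOf b n (b.rot ζ '' F) = (tubesOf b n F).image (permTube ζ) := by
  ext A
  obtain ⟨C, rfl⟩ : ∃ C, permTube ζ C = A := ⟨_, permTube_self_inv ζ A⟩
  rw [mem_tubesOf, Finset.mem_image]
  constructor
  · rintro ⟨h1, h2⟩
    exact ⟨C, mem_tubesOf.mpr ⟨(permTube_isBracket_iff hζ).mp h1, fun t ht =>
      (tight_rot hζ C t).mp (h2 _ ⟨t, ht, rfl⟩)⟩, rfl⟩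
  · rintro ⟨D, hD, h1⟩
    obtain rfl := permTube_inj ζ h1
    rw [mem_tubesOf] at hD
    refine ⟨hD.1.permTube hζ, ?_⟩
    rintro _ ⟨t, ht, rfl⟩
    exact (tight_rot hζ _ t).mpr (hD.2 t ht)

theorem rot_image_tubeFace {ζ : Perm (Fin n)} (hζ : ζ ∈ b.rotations n) (B : Finset (Finset ℕ)) :
    b.rot ζ '' tubeFace b n B = tubeFace b n (B.image (permTube ζ)) := by
  obtain ⟨π, -, h2, -⟩ := exists_perm_rot hζ
  have key : ∀ t, b.rot ζ t ∈ tubeFace b n (B.image (permTube ζ)) ↔ t ∈ tubeFace b n B := fun t => by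
    refine and_congr (rot_mem_polytope hζ t) ⟨fun h A hA => ?_, fun h A hA => ?_⟩
    · exact (tight_rot hζ A t).mp (h _ (Finset.mem_image_of_mem _ hA))
    · obtain ⟨C, hC, rfl⟩ := Finset.mem_image.mp hA
      exact (tight_rot hζ C t).mpr (h C hC)
  ext t
  constructor
  · rintro ⟨s, hs, rfl⟩
    exact (key s).mpr hs
  · intro ht
    have h3 : b.rot ζ (t ∘ π.symm) = t := by
      rw [h2, Function.comp_assoc, Equiv.symm_comp_self, Function.comp_id]
    exact ⟨t ∘ π.symm, (key _).mp (by rwa [h3]), h3⟩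

/-- The sign of the cell described by a list of tubes with respect to an oriented cell: zero if
these are different cells. -/
def OrientedFace.value (a : Cell b n q) (L : List (Finset ℕ)) : ℤ :=
  open Classical in if L.Nodup ∧ L.toFinset = a.tubes then orient L a.frame else 0

theorem value_of {a : Cell b n q} {L : List (Finset ℕ)} (hd : L.Nodup)
    (h : L.toFinset = a.tubes) : a.value L = orient L a.frame := by
  classical exact if_pos ⟨hd, by convert h⟩

theorem value_eq_zero {a : Cell b n q} {L : List (Finset ℕ)} (h : ¬ (L.Nodup ∧ L.toFinset = a.tubes)) :
    a.value L = 0 := by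
  classical exact if_neg (by convert h)

theorem length_of_tubes {a : Cell b n q} {L : List (Finset ℕ)} (hd : L.Nodup)
    (h : L.toFinset = a.tubes) : L.length + q = b.gaps n := by
  rw [← List.toFinset_card_of_nodup hd, h, a.card_tubes]

theorem nodup_map_permTube (ζ : Perm (Fin n)) {L : List (Finset ℕ)} :
    (L.map (permTube ζ)).Nodup ↔ L.Nodup :=
  List.nodup_map_iff fun _ _ => permTube_inj ζ

theorem toFinset_map_permTube (ζ : Perm (Fin n)) (L : List (Finset ℕ)) :
    (L.map (permTube ζ)).toFinset = L.toFinset.image (permTube ζ) := by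
  ext A
  simp

theorem image_permTube_inj (ζ : Perm (Fin n)) {B C : Finset (Finset ℕ)} :
    B.image (permTube ζ) = C.image (permTube ζ) ↔ B = C :=
  (Finset.image_injective fun _ _ => permTube_inj ζ).eq_iff

/-- A frame of the rotated cell in terms of the rotated frame. -/
theorem exists_transition {ζ : Perm (Fin n)} (hζ : ζ ∈ b.rotations n) {a a' : Cell b n q}
    (h : a'.face = b.rot ζ '' a.face) :
    ∃ A : Matrix (Fin q) (Fin q) ℝ, ∀ i, a'.frame i = ∑ j, A i j • b.rot ζ (a.frame j) := by
  obtain ⟨π, -, h2, h3⟩ := exists_perm_rot hζ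
  have h4 : ∀ i, a'.frame i ∘ π.symm ∈ Submodule.span ℝ (Set.range a.frame) := fun i => by
    rw [a.span_eq, mem_tubeSpace]
    intro C hC
    have h5 : permTube ζ C ∈ a'.tubes := by
      rw [OrientedFace.tubes, h, tubesOf_image hζ]
      exact Finset.mem_image_of_mem _ hC
    have h6 := a'.frame_mem i _ h5
    rw [h3] at h6
    rw [← h6, ← comp_equiv_dotProduct_comp_equiv _ _ π, Function.comp_assoc, Equiv.symm_comp_self,
      Function.comp_id]
  choose A hA using fun i => (Submodule.mem_span_range_iff_exists_fun ℝ).mp (h4 i)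
  refine ⟨A, fun i => ?_⟩
  funext x
  have h5 := congrFun (hA i) (π x)
  rw [Function.comp_apply, symm_apply_apply] at h5
  rw [← h5]
  simp [Finset.sum_apply, h2]

/-- Rotating a list of tubes and the cell that it describes. -/
theorem value_rotate {ζ : Perm (Fin n)} (hζ : ζ ∈ b.rotations n) {a a' : Cell b n q}
    (h : a'.face = b.rot ζ '' a.face) (L : List (Finset ℕ)) :
    a'.value (L.map (permTube ζ)) =
      orientationSign (fun i => b.rot ζ (a.frame i)) a'.frame * (Perm.sign ζ * a.value L) := by
  classical
  have ht : a'.tubes = a.tubes.image (permTube ζ) := by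
    rw [OrientedFace.tubes, h, tubesOf_image hζ]
  by_cases hL : L.Nodup ∧ L.toFinset = a.tubes
  · have hex := exists_transition hζ h
    rw [value_of hL.1 hL.2, value_of ((nodup_map_permTube ζ).mpr hL.1)
      (by rw [ht, toFinset_map_permTube, hL.2]), orientationSign]
    rw [dif_pos hex, ← orient_rotate hζ, ← orient_transition
      (by rw [List.length_map]; exact length_of_tubes hL.1 hL.2)]
    congr 1
    funext i
    exact hex.choose_spec i
  · rw [value_eq_zero hL, value_eq_zero, mul_zero, mul_zero]
    rwa [ht, toFinset_map_permTube, nodup_map_permTube, image_permTube_inj]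

theorem value_rotate_frame {ζ : Perm (Fin n)} (hζ : ζ ∈ b.rotations n) {a a' : Cell b n q}
    (h : a'.face = b.rot ζ '' a.face) (hf : ∀ i, a'.frame i = b.rot ζ (a.frame i))
    (L : List (Finset ℕ)) :
    a'.value (L.map (permTube ζ)) = Perm.sign ζ * a.value L := by
  have ht : a'.tubes = a.tubes.image (permTube ζ) := by
    rw [OrientedFace.tubes, h, tubesOf_image hζ]
  by_cases hL : L.Nodup ∧ L.toFinset = a.tubes
  · rw [value_of hL.1 hL.2, value_of ((nodup_map_permTube ζ).mpr hL.1)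
      (by rw [ht, toFinset_map_permTube, hL.2]), ← orient_rotate hζ]
    congr 1
    exact funext hf
  · rw [value_eq_zero hL, value_eq_zero, mul_zero]
    rwa [ht, toFinset_map_permTube, nodup_map_permTube, image_permTube_inj]

/-- Two orientations of the same face. -/
theorem value_of_face_eq {a a' : Cell b n q} (h : a.face = a'.face) (L : List (Finset ℕ)) :
    a'.value L = orientationSign a.frame a'.frame * a.value L := by
  have h1 := value_rotate (one_mem (b.rotations n)) (a := a) (a' := a') (by
    simp only [rot_one, Set.image_id']
    exact h.symm) L
  have h2 : L.map (permTube (1 : Perm (Fin n))) = L :=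
    (List.map_congr_left fun A _ => permTube_one A).trans (List.map_id _)
  rw [h2] at h1
  simpa [rot_one] using h1

/-- The normal vectors of the tubes and a frame of the face form a basis. -/
theorem linearIndependent_tubes {L : List (Finset ℕ)} (hd : L.Nodup) (hL : b.Nested n L.toFinset)
    {f : Fin q → Fin (b.gaps n) → ℝ} (hf : LinearIndependent ℝ f)
    (hfL : ∀ i, f i ∈ tubeSpace _ L.toFinset) :
    LinearIndependent ℝ (Sum.elim (L.map ind).get f) := by
  have h1 : LinearIndependent ℝ (L.map (ind (g := b.gaps n))).get := by
    have h2 := (linearIndependent_ind hL.bracket hL.compat).comp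
      (fun i : Fin (L.map (ind (g := b.gaps n))).length =>
        (⟨L.get (i.cast (List.length_map _)), List.mem_toFinset.mpr (List.get_mem _ _)⟩ : L.toFinset))
      (fun i j hij => by
        have := List.nodup_iff_injective_get.mp hd (congrArg Subtype.val hij)
        exact Fin.ext (by simpa using congrArg Fin.val this))
    convert h2 using 1
    funext i
    simp
  -- The frame is orthogonal to the normal vectors, so that the two spans are disjoint.
  refine h1.sum_type hf (Submodule.disjoint_def.mpr fun x hx hx' => ?_)
  have h3 : x ∈ tubeSpace _ L.toFinset := Submodule.span_le.mpr (by
    rintro _ ⟨i, rfl⟩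
    exact hfL i) hx'
  rw [← dotProduct_self_eq_zero]
  refine Submodule.span_induction (p := fun y _ => y ⬝ᵥ x = 0) ?_ (zero_dotProduct _) ?_ ?_ hx
  · rintro _ ⟨i, rfl⟩
    have := h3 (L.get (i.cast (List.length_map _))) (List.mem_toFinset.mpr (List.get_mem _ _))
    simpa using this
  · intro y z _ _ hy hz
    rw [add_dotProduct, hy, hz, add_zero]
  · intro r y _ hy
    rw [smul_dotProduct, hy, smul_zero]

theorem isUnit_orient {L : List (Finset ℕ)} (hd : L.Nodup) (hL : b.Nested n L.toFinset)
    (h : L.length + q = b.gaps n) {f : Fin q → Fin (b.gaps n) → ℝ} (hf : LinearIndependent ℝ f)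
    (hfL : ∀ i, f i ∈ tubeSpace _ L.toFinset) : IsUnit (orient L f) := by
  have h1 := (listDet_ne_zero_iff (X := L.map ind) (by simpa using h)).mpr
    (linearIndependent_tubes hd hL hf hfL)
  rw [orient, IsUnit.mul_iff, IsUnit.mul_iff]
  refine ⟨⟨?_, (isUnit_neg_one).pow _⟩, ?_⟩
  · rw [IsUnit.prod_iff]
    exact fun x _ => (isUnit_neg_one).pow _
  · rcases lt_or_gt_of_ne h1 with h2 | h2
    · rw [sign_neg h2]; exact isUnit_neg_one
    · rw [sign_pos h2]; exact isUnit_one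

theorem isUnit_value {a : Cell b n q} {L : List (Finset ℕ)} (hd : L.Nodup)
    (h : L.toFinset = a.tubes) : IsUnit (a.value L) := by
  rw [value_of hd h]
  exact isUnit_orient hd (h ▸ a.nested) (length_of_tubes hd h) a.independent (h ▸ a.frame_mem)

/-- The outward normal vector `ν` of a facet may be replaced by minus the normal vector of the
tube of this facet. -/
theorem orient_cons {L : List (Finset ℕ)} {A : Finset ℕ} {f : Fin q → Fin g → ℝ}
    {ν : Fin g → ℝ} (h : L.length + 1 + q = g) (hL : ∀ C ∈ L, ind C ⬝ᵥ ν = 0)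
    (hfL : ∀ C ∈ L, ∀ i, ind C ⬝ᵥ f i = 0) (hfA : ∀ i, ind A ⬝ᵥ f i = 0) (hA : ind A ⬝ᵥ ν < 0)
    (h0 : listDet ((L ++ [A]).map ind ++ List.ofFn f) ≠ 0) :
    orient L (Fin.cons ν f : Fin (q + 1) → _) = orient (L ++ [A]) f := by
  rw [List.map_append, List.map_singleton] at h0
  obtain ⟨c, β, d, h1, h2⟩ := exists_coordinates (w := ν) (by simpa using h) h0
  -- The part `u` of `ν` outside the span of the frame satisfies `u ⬝ᵥ u = β * (ind A ⬝ᵥ ν)`, where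
  -- `β` is the coefficient of `ind A` in it. Hence `β < 0`.
  set u := ν - ∑ j, d j • f j with hu
  have hdf : ∀ C, (∀ i, ind C ⬝ᵥ f i = 0) → ind C ⬝ᵥ u = ind C ⬝ᵥ ν := fun C hC => by
    rw [hu, dotProduct_sub, dotProduct_sum, Finset.sum_eq_zero, sub_zero]
    intro j _
    rw [dotProduct_smul, hC, smul_zero]
  have hu' : u = ∑ i, c i • (L.map ind).get i + β • ind A := by
    rw [hu, sub_eq_iff_eq_add, ← h1]
  have h3 : u ⬝ᵥ u = β * (ind A ⬝ᵥ ν) := by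
    nth_rewrite 1 [hu']
    rw [add_dotProduct, sum_dotProduct, Finset.sum_eq_zero, zero_add, smul_dotProduct, hdf A hfA,
      smul_eq_mul]
    intro i _
    obtain ⟨C, hC, h4⟩ := List.mem_map.mp (List.get_mem (L.map (ind (g := g))) i)
    rw [← h4, smul_dotProduct, hdf C (hfL C hC), hL C hC, smul_zero]
  have h4 : 0 < u ⬝ᵥ u := by
    refine lt_of_le_of_ne (Finset.sum_nonneg fun i _ => mul_self_nonneg _) fun h5 => ?_
    rw [eq_comm, dotProduct_self_eq_zero] at h5
    rw [← hdf A hfA, h5, dotProduct_zero] at hA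
    exact lt_irrefl _ hA
  have hβ : β < 0 := by
    by_contra h5
    push Not at h5
    nlinarith
  have h5 : L.map ind ++ List.ofFn (Fin.cons ν f : Fin (q + 1) → _) =
      L.map ind ++ [ν] ++ List.ofFn f := by
    rw [List.ofFn_succ]
    simp
  -- The negative sign of `β` is the one by which the factors `(-1) ^ q` and `(-1) ^ (q + 1)`
  -- differ.
  rw [orient, orient, h5, h2, coe_sign_mul, sign_neg hβ, List.map_append, List.map_singleton,
    pow_succ]
  simp

theorem prod_neg_one_pow_add (m h : ℕ) : (∏ x ∈ Finset.range (m + h), (-1 : ℤ) ^ x) =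
    (∏ x ∈ Finset.range m, (-1) ^ x) * (∏ x ∈ Finset.range h, (-1) ^ x) * (-1) ^ (m * h) := by
  rw [Finset.prod_range_add]
  simp only [pow_add, Finset.prod_mul_distrib, Finset.prod_const, Finset.card_range, ← pow_mul]
  ring

theorem insertVec_ind_shift {m h j r : ℕ} {A : Finset ℕ} (hA : ∀ x ∈ A, x < h) :
    insertVec r j (0 : Fin m → ℝ) (ind A : Fin h → ℝ) = ind (shift j A) := by
  funext x
  simp only [insertVec, ind, mem_shift, coord, Pi.zero_apply, dite_eq_ite, ite_self]
  by_cases h1 : x.1 < j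
  · simp [h1, show ¬ j ≤ x.1 by omega]
  · by_cases h2 : x.1 < j + h
    · simp [h1, h2, show j ≤ x.1 by omega, show x.1 - j < h by omega]
    · have h3 : x.1 - j ∉ A := fun h4 => by have := hA _ h4; omega
      simp [h1, h2, h3]

/-- The orientation of a composite. -/
theorem orient_graft {m h j r p : ℕ} (hj : j < m) {L L' : List (Finset ℕ)}
    (hr : b.gaps r = b.gaps m + h) (hL : ∀ A ∈ L, b.IsBracket m A) (hL' : ∀ A ∈ L', ∀ x ∈ A, x < h)
    (hp : L.length + p = b.gaps m) (hq : L'.length + q = h) (f : Fin p → Fin (b.gaps m) → ℝ)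
    (f' : Fin q → Fin h → ℝ) :
    orient (graft b m j h L L') (Fin.append
      (fun i => insertVec (b.gaps r) j (f i) (0 : Fin h → ℝ))
      (fun i => insertVec (b.gaps r) j (0 : Fin (b.gaps m) → ℝ) (f' i))) =
    (-1) ^ (L'.length * p + j * h) * orient L f * orient L' f' := by
  rw [hr]
  have hjm : j ≤ b.gaps m := by have := le_gaps (b := b) (n := m); omega
  set out := fun v : Fin (b.gaps m) → ℝ => insertVec (b.gaps m + h) j v (0 : Fin h → ℝ) with hout
  set inn := fun v : Fin h → ℝ => insertVec (b.gaps m + h) j (0 : Fin (b.gaps m) → ℝ) v with hinn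
  -- The vectors of the composite, in the order of the list; the normal vectors of the second cell
  -- have to pass the frame of the first one.
  have h1 : (graft b m j h L L').map ind ++ List.ofFn (Fin.append (fun i => out (f i))
      fun i => inn (f' i)) = (L.map fun A => ind (b.inflate m j h A)) ++
        ((L'.map ind).map inn ++ (List.ofFn (fun i => out (f i)) ++
          (List.ofFn f').map inn)) := by
    rw [List.ofFn_fin_append, graft, List.map_append, List.map_map, List.map_map, List.map_map,
      List.map_ofFn, List.append_assoc]
    congr 2
    refine List.map_congr_left fun A hA => ?_
    exact (insertVec_ind_shift (hL' A hA)).symm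
  have h2 := listDet_blocks (j := j) (h := h) hjm
    (R := (L.map fun A => ind (b.inflate m j h A)) ++ List.ofFn (fun i => out (f i)))
    (Y := L'.map ind ++ List.ofFn f') (by simpa using hp) (by simpa using hq)
  -- Restricting to the outer coordinates recovers the vectors of the first cell.
  have h3 : ((L.map fun A => (ind (b.inflate m j h A) : Fin (b.gaps m + h) → ℝ)) ++
      List.ofFn (fun i => out (f i))).map (fun v => fun x : Fin (b.gaps m) =>
        coord v (if x.1 < j then x.1 else x.1 + h)) = L.map ind ++ List.ofFn f := by
    have hx : ∀ x : Fin (b.gaps m), (if x.1 < j then x.1 else x.1 + h) < b.gaps m + h := fun x => by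
      have := x.2
      split_ifs <;> omega
    rw [List.map_append, List.map_map, List.map_ofFn]
    congr 1
    · refine List.map_congr_left fun A hA => ?_
      funext x
      simp only [Function.comp_apply, coord, hx, dif_pos, ind,
        mem_inflate_shift hj (fun x => (hL A hA).lt)]
    · congr 1
      funext i x
      simp only [Function.comp_apply, coord, hx, dif_pos, hout, insertVec]
      by_cases h4 : x.1 < j
      · simp [h4]
      · simp [h4, show ¬ x.1 + h < j by omega]
  rw [h3, List.map_append, List.append_assoc] at h2
  rw [orient, orient, orient, h1, listDet_append_swap, h2, coe_sign_mul, coe_sign_mul, coe_sign_mul,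
    coe_sign_neg_one_pow, coe_sign_neg_one_pow, prod_neg_one_pow_add, pow_add, pow_add]
  simp only [List.length_map, List.length_ofFn]
  obtain ⟨d, hd⟩ : ∃ d, b.gaps m = j + d := ⟨b.gaps m - j, by omega⟩
  have h5 : (-1 : ℤ) ^ (b.gaps m * h) * (-1) ^ (h * (b.gaps m - j)) = (-1) ^ (j * h) := by
    rw [← pow_add, hd, Nat.add_sub_cancel_left,
      show (j + d) * h + h * d = j * h + 2 * (h * d) by ring, pow_add, pow_mul (-1) 2]
    simp
  linear_combination ((∏ x ∈ Finset.range (b.gaps m), (-1 : ℤ) ^ x) *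
    (∏ x ∈ Finset.range h, (-1) ^ x) * (-1) ^ p * (-1) ^ q * (-1) ^ (L'.length * p) *
    (SignType.sign (listDet (L.map ind ++ List.ofFn f)) : ℤ) *
    (SignType.sign (listDet (L'.map ind ++ List.ofFn f')) : ℤ)) * h5

end

section

variable {k : Type u} [Field k] {b : Kind} {n q : ℕ}

/-! ### From lists of tubes to cellular chains -/

theorem value_swap (a : Cell b n q) (u : List (Finset ℕ)) (A C : Finset ℕ)
    (v : List (Finset ℕ)) : a.value (u ++ A :: C :: v) = -a.value (u ++ C :: A :: v) := by
  have hp : (u ++ A :: C :: v).Perm (u ++ C :: A :: v) := (List.Perm.swap C A v).append_left u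
  have ht : (u ++ A :: C :: v).toFinset = (u ++ C :: A :: v).toFinset :=
    List.toFinset_eq_of_perm _ _ hp
  by_cases h : (u ++ A :: C :: v).Nodup ∧ (u ++ A :: C :: v).toFinset = a.tubes
  · rw [value_of h.1 h.2, value_of (hp.nodup_iff.mp h.1) (ht ▸ h.2), orient_swap]
  · rw [value_eq_zero h, value_eq_zero, neg_zero]
    rwa [← hp.nodup_iff, ← ht]

theorem value_of_incompat (a : Cell b n q) {L : List (Finset ℕ)} {A C : Finset ℕ} (hA : A ∈ L)
    (hC : C ∈ L) (h : b.Incompat n A C) : a.value L = 0 := value_eq_zero fun h1 =>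
  a.nested.compat A (h1.2 ▸ List.mem_toFinset.mpr hA) C (h1.2 ▸ List.mem_toFinset.mpr hC) h

open Classical in
/-- The function on oriented cells given by a permutation and a list of tubes. -/
def cellFun (k : Type u) [Field k] (b : Kind) {n : ℕ} (q : ℕ) (σ : Perm (Fin n))
    (L : List (Finset ℕ)) : Perm (Fin n) → Cell b n q → k := fun τ a =>
  if τ * σ⁻¹ ∈ b.rotations n then
    sgnPerm k (τ * σ⁻¹) * ((a.value (L.map (permTube (τ * σ⁻¹))) : ℤ) : k)
  else 0

/-- Reversing the orientation changes the sign, and rotations are compensated by the sign in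
`cellFun`. -/
theorem cellFun_mem_chains (σ : Perm (Fin n)) (L : List (Finset ℕ)) :
    cellFun k b q σ L ∈ chains k b n q := by
  refine ⟨fun τ a a' h => ?_, ?_⟩
  · unfold cellFun
    split_ifs with h1
    · rw [value_of_face_eq h]
      push_cast
      ring
    · rw [mul_zero]
  · cases b
    · trivial
    · intro τ a a' h1 h2
      have hf : finRotate n ∈ Kind.module.rotations n := Subgroup.mem_zpowers _
      have h3 := value_rotate_frame hf (a := a) (a' := a')
        (by rw [h1]; exact Set.image_congr fun t _ => (rot_module _ t).symm)
        (fun i => (h2 i).trans (rot_module _ _).symm) (L.map (permTube (τ * σ⁻¹)))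
      have h4 : (L.map (permTube (τ * σ⁻¹))).map (permTube (finRotate n)) =
          L.map (permTube (finRotate n * τ * σ⁻¹)) := by
        rw [List.map_map]
        exact List.map_congr_left fun A _ => by
          rw [Function.comp_apply, ← permTube_mul, mul_assoc]
      unfold cellFun
      rw [mul_assoc, Subgroup.mul_mem_cancel_left _ hf, ← mul_assoc, ← h4, h3]
      split_ifs
      · rw [mul_assoc (finRotate n), sgnPerm_mul]
        push_cast
        have h5 := sgnPerm_mul_self (k := k) (finRotate n)
        unfold sgnPerm at *
        linear_combination ((((Perm.sign (τ * σ⁻¹) : ℤˣ) : ℤ) : k) *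
          ((a.value (L.map (permTube (τ * σ⁻¹))) : ℤ) : k)) * h5
      · rfl

theorem admissible_cellFun : IsAdmissible (k := k) b n (q : ℤ)
    (fun σ L => (⟨cellFun k b q σ L, cellFun_mem_chains σ L⟩ : chains k b n q)) where
  dup σ u A v _ := by
    refine Subtype.ext (funext₂ fun τ a => ?_)
    have h0 : a.value ((u ++ A :: A :: v).map (permTube (τ * σ⁻¹))) = 0 := value_eq_zero fun h => by
      rw [nodup_map_permTube] at h
      simp [List.nodup_append] at h
    simp only [cellFun, h0, Int.cast_zero, mul_zero, ite_self]
    rfl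
  swap σ u A C v _ := by
    refine Subtype.ext (funext₂ fun τ a => ?_)
    have h0 := value_swap a (u.map (permTube (τ * σ⁻¹))) (permTube (τ * σ⁻¹) A)
      (permTube (τ * σ⁻¹) C) (v.map (permTube (τ * σ⁻¹)))
    simp only [cellFun, List.map_append, List.map_cons, h0, Submodule.coe_neg, Pi.neg_apply]
    split_ifs <;> simp
  incompat σ u A C v _ h := by
    refine Subtype.ext (funext₂ fun τ a => ?_)
    simp only [cellFun]
    split_ifs with h1
    · rw [value_of_incompat a (A := permTube (τ * σ⁻¹) A) (C := permTube (τ * σ⁻¹) C)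
        (List.mem_map_of_mem (by simp)) (List.mem_map_of_mem (by simp))
        ((permTube_incompat_iff h1).mpr h)]
      simp
    · rfl
  rot σ L ζ _ hζ := by
    refine Subtype.ext (funext₂ fun τ a => ?_)
    simp only [cellFun, Submodule.coe_smul, Pi.smul_apply, smul_eq_mul]
    have h1 : τ * (ζ * σ)⁻¹ = τ * σ⁻¹ * ζ⁻¹ := by rw [mul_inv_rev, mul_assoc]
    have h2 : (L.map (permTube ζ)).map (permTube (τ * σ⁻¹ * ζ⁻¹)) = L.map (permTube (τ * σ⁻¹)) := by
      rw [List.map_map]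
      exact List.map_congr_left fun A _ => by
        rw [Function.comp_apply, ← permTube_mul, inv_mul_cancel_right]
    rw [h1, h2, Subgroup.mul_mem_cancel_right _ (inv_mem hζ), sgnPerm_mul, sgnPerm_inv]
    split_ifs <;> ring

/-- The cellular chain described by a combination of lists of tubes. -/
def toCells (k : Type u) [Field k] (b : Kind) (n q : ℕ) :
    TubeChain k b n (q : ℤ) →ₗ[k] chains k b n q := TubeChain.lift admissible_cellFun

theorem toCells_cell (σ : Perm (Fin n)) {L : List (Finset ℕ)} (hL : b.Good n q L) :
    (toCells k b n q (cell k b q σ L)).1 = cellFun k b q σ L :=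
  congrArg Subtype.val (TubeChain.lift_cell admissible_cellFun σ hL)

theorem toCells_act (ρ : Perm (Fin n)) (x : TubeChain k b n (q : ℤ)) (σ : Perm (Fin n)) :
    (toCells k b n q (TubeChain.act ρ x)).1 σ = (toCells k b n q x).1 (σ * ρ⁻¹) := by
  refine TubeChain.induction (P := fun x => (toCells k b n q (TubeChain.act ρ x)).1 σ =
    (toCells k b n q x).1 (σ * ρ⁻¹)) (fun τ L hL => ?_) (by simp) (fun x y hx hy => ?_)
    (fun c x hx => ?_) x
  · rw [TubeChain.act_cell, toCells_cell _ hL, toCells_cell _ hL]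
    have h1 : σ * (τ * ρ)⁻¹ = σ * ρ⁻¹ * τ⁻¹ := by rw [mul_inv_rev, mul_assoc]
    funext a
    unfold cellFun
    rw [h1]
  · simp only [map_add, Submodule.coe_add, Pi.add_apply, hx, hy]
  · simp only [map_smul, Submodule.coe_smul, Pi.smul_apply, hx]

open Classical in
/-- There are only finitely many faces. -/
theorem boundary_eq_sum (c : Cell b n (q + 1) → k) (a : Cell b n q) :
    boundary c a = ∑ F ∈ (brackets b n).powerset.image (tubeFace b n),
      if h : ∃ a' : Cell b n (q + 1), a'.face = F ∧ IsInduced a' a then c h.choose else 0 := by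
  unfold boundary
  refine finsum_eq_sum_of_support_subset _ fun F hF => ?_
  rw [Function.mem_support] at hF
  have h1 : ∃ a' : Cell b n (q + 1), a'.face = F ∧ IsInduced a' a := by
    by_contra h1
    exact hF (dif_neg h1)
  obtain ⟨a', h2, -⟩ := h1
  refine Finset.mem_coe.mpr (Finset.mem_image.mpr ⟨a'.tubes, ?_, by rw [← h2, ← a'.face_eq]⟩)
  exact Finset.mem_powerset.mpr fun A hA => mem_brackets.mpr (mem_tubesOf.mp hA).1

theorem boundary_add (c c' : Cell b n (q + 1) → k) :
    boundary (c + c') = boundary c + boundary c' := by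
  classical
  funext a
  rw [Pi.add_apply, boundary_eq_sum, boundary_eq_sum, boundary_eq_sum, ← Finset.sum_add_distrib]
  refine Finset.sum_congr rfl fun F _ => ?_
  split_ifs <;> simp

theorem boundary_smul (x : k) (c : Cell b n (q + 1) → k) : boundary (x • c) = x • boundary c := by
  classical
  funext a
  rw [Pi.smul_apply, boundary_eq_sum, boundary_eq_sum, Finset.smul_sum]
  refine Finset.sum_congr rfl fun F _ => ?_
  split_ifs <;> simp

/-- A vector pointing out of a face through its facet is negative on the normal vector of the tube
of this facet. -/
theorem ind_dotProduct_neg {a : Cell b n q} {A : Finset ℕ} {B : Finset (Finset ℕ)}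
    (hA : insert A B = a.tubes) {x y : Fin (b.gaps n) → ℝ} (hx : x ∈ tubeFace b n B)
    (hxa : x ∉ a.face) (hy : y ∈ a.face) : ind A ⬝ᵥ (y - x) < 0 := by
  have hAa : A ∈ a.tubes := hA ▸ Finset.mem_insert_self _ _
  have h1 := tight_iff.mp ((mem_tubesOf.mp hAa).2 y hy)
  rw [dotProduct_sub, h1, sub_neg]
  refine lt_of_le_of_ne ((mem_polytope.mp hx.1).2 A (mem_tubesOf.mp hAa).1) fun h2 => hxa ?_
  rw [a.face_eq, ← hA]
  refine ⟨hx.1, fun C hC => ?_⟩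
  rcases Finset.mem_insert.mp hC with rfl | hC
  · exact tight_iff.mpr h2.symm
  · exact hx.2 C hC

/-- The facet relation of an oriented cell with its coface obtained by omitting a tube. -/
theorem exists_isInduced {a : Cell b n q} {A : Finset ℕ} {B : Finset (Finset ℕ)} (hAB : A ∉ B)
    (hA : insert A B = a.tubes) (hfull : 0 < b.gaps n → Finset.range (b.gaps n) ∈ B) :
    ∃ a' : Cell b n (q + 1), a'.face = tubeFace b n B ∧ IsInduced a' a := by
  have hBa : B ⊆ a.tubes := hA ▸ Finset.subset_insert _ _
  have hB : b.Nested n B := ⟨fun C hC => a.nested.bracket C (hBa hC),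
    fun C hC D hD => a.nested.compat C (hBa hC) D (hBa hD), hfull⟩
  obtain ⟨x, hx, hxB⟩ := exists_tight_iff hB
  have hAa : A ∈ a.tubes := hA ▸ Finset.mem_insert_self _ _
  have hxF : x ∈ tubeFace b n B := ⟨hx, fun C hC => (hxB C (hB.bracket C hC)).mpr hC⟩
  have hxa : x ∉ a.face := fun h1 =>
    hAB ((hxB A (a.nested.bracket A hAa)).mp ((mem_tubesOf.mp hAa).2 x h1))
  obtain ⟨y, hy⟩ := a.nonempty
  have hyF : y ∈ tubeFace b n B := by
    rw [a.face_eq] at hy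
    exact ⟨hy.1, fun C hC => hy.2 C (hBa hC)⟩
  have hcard : B.card + (q + 1) = b.gaps n := by
    have h1 := a.card_tubes
    rw [← hA, Finset.card_insert_of_notMem hAB] at h1
    omega
  obtain ⟨a', h1, h2⟩ := exists_cell hB hcard (f := (Fin.cons (y - x) a.frame : Fin (q + 1) → _))
    (linearIndependent_finCons.mpr ⟨a.independent, fun h1 => by
      rw [a.span_eq] at h1
      exact (ind_dotProduct_neg hA hxF hxa hy).ne (h1 A hAa)⟩)
    (Fin.cases (sub_mem_tubeSpace hyF.2 hxF.2) fun i C hC => a.frame_mem i C (hBa hC))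
  refine ⟨a', h1, ?_, x, ⟨h1 ▸ hxF, hxa⟩, y, hy, h2⟩
  rw [h1, a.face_eq]
  exact fun t ht => ⟨ht.1, fun C hC => ht.2 C (hBa hC)⟩

/-- The cellular boundary of a cell given by a list of tubes adds one more tube. -/
theorem boundary_value {L : List (Finset ℕ)}
    (hfull : 0 < b.gaps n → Finset.range (b.gaps n) ∈ L) (a : Cell b n q) :
    boundary (fun a' : Cell b n (q + 1) => ((a'.value L : ℤ) : k)) a =
      ∑ A ∈ brackets b n, ((a.value (L ++ [A]) : ℤ) : k) := by
  classical
  have htF : ∀ A, (L ++ [A]).toFinset = insert A L.toFinset := fun A => by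
    rw [List.toFinset_append, Finset.union_comm]; rfl
  have hnd : ∀ A, (L ++ [A]).Nodup ↔ L.Nodup ∧ A ∉ L := fun A => by
    rw [(List.perm_append_singleton A L).nodup_iff, List.nodup_cons, and_comm]
  unfold boundary
  -- The only possible coface of `a` that `L` describes is the one obtained by omitting the tube of
  -- `a` that is not in `L`.
  by_cases hex : L.Nodup ∧ ∃ A ∉ L.toFinset, insert A L.toFinset = a.tubes
  · obtain ⟨hd, A, hAL, hA⟩ := hex
    have hAb : A ∈ a.tubes := hA ▸ Finset.mem_insert_self _ _
    have hLa : L.toFinset ⊆ a.tubes := hA ▸ Finset.subset_insert _ _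
    have hind := exists_isInduced hAL hA fun h => List.mem_toFinset.mpr (hfull h)
    rw [finsum_eq_single _ (tubeFace b n L.toFinset), dif_pos hind,
      Finset.sum_eq_single A]
    · have hnA : (L ++ [A]).Nodup := (hnd A).mpr ⟨hd, fun h => hAL (List.mem_toFinset.mpr h)⟩
      have hsp := hind.choose_spec
      generalize hind.choose = a' at hsp
      obtain ⟨h1, h2, x, hx, y, hy, h3⟩ := hsp
      have hLn : b.Nested n L.toFinset := ⟨fun C hC => a.nested.bracket C (hLa hC),
        fun C hC D hD => a.nested.compat C (hLa hC) D (hLa hD),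
        fun h => List.mem_toFinset.mpr (hfull h)⟩
      have ht' : L.toFinset = a'.tubes := by rw [OrientedFace.tubes, h1, tubesOf_tubeFace hLn]
      beta_reduce
      rw [value_of hd ht', value_of hnA ((htF A).trans hA), h3]
      have hlen := length_of_tubes hnA ((htF A).trans hA)
      rw [List.length_append, List.length_singleton] at hlen
      have hx' : x ∈ tubeFace b n L.toFinset := h1 ▸ hx.1
      have hy' : y ∈ tubeFace b n L.toFinset := h1 ▸ h2 hy
      refine congrArg _ (orient_cons hlen
        (fun C hC => sub_mem_tubeSpace hy'.2 hx'.2 C (List.mem_toFinset.mpr hC))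
        (fun C hC i => a.frame_mem i C (hLa (List.mem_toFinset.mpr hC)))
        (fun i => a.frame_mem i A hAb) (ind_dotProduct_neg hA hx' hx.2 hy) ?_)
      refine (listDet_ne_zero_iff (by simpa using hlen)).mpr (linearIndependent_tubes (b := b) (n := n)
        hnA ?_ a.independent ?_)
      · rw [htF, hA]
        exact a.nested
      · rw [htF, hA]
        exact a.frame_mem
    · intro C _ hCA
      rw [value_eq_zero, Int.cast_zero]
      rintro ⟨h1, h2⟩
      rw [htF, ← hA] at h2
      have h3 : C ∈ insert A L.toFinset := h2 ▸ Finset.mem_insert_self _ _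
      rcases Finset.mem_insert.mp h3 with h4 | h4
      · exact hCA h4
      · exact ((hnd C).mp h1).2 (List.mem_toFinset.mp h4)
    · intro h
      exact absurd (mem_brackets.mpr (a.nested.bracket A hAb)) h
    · intro F hF
      split_ifs with h
      · beta_reduce
        rw [value_eq_zero, Int.cast_zero]
        rintro ⟨-, h2⟩
        exact hF (by rw [h2, ← h.choose.face_eq, h.choose_spec.1])
      · rfl
  · rw [Finset.sum_eq_zero, finsum_eq_zero_of_forall_eq_zero]
    · intro F
      split_ifs with h
      · beta_reduce
        rw [value_eq_zero, Int.cast_zero]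
        rintro ⟨h1, h2⟩
        refine hex ⟨h1, Finset.exists_eq_insert_iff.mpr ⟨?_, ?_⟩⟩
        · rw [h2]
          intro A hA
          rw [mem_tubesOf] at hA ⊢
          exact ⟨hA.1, fun t ht => hA.2 t (h.choose_spec.2.1 ht)⟩
        · rw [h2]
          have h3 := h.choose.card_tubes
          have h4 := a.card_tubes
          omega
      · rfl
    · intro A _
      rw [value_eq_zero, Int.cast_zero]
      rintro ⟨h1, h2⟩
      rw [htF] at h2
      have h3 := (hnd A).mp h1
      exact hex ⟨h3.1, A, fun h => h3.2 (List.mem_toFinset.mp h), h2⟩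

/-- The cellular boundary corresponds to adding a tube. -/
theorem toCells_boundary (x : TubeChain k b n ((q + 1 : ℕ) : ℤ)) (τ : Perm (Fin n)) :
    (toCells k b n q (TubeChain.boundary (Nat.cast_succ q).symm x)).1 τ =
      boundary ((toCells k b n (q + 1) x).1 τ) := by
  refine TubeChain.induction (P := fun x =>
    (toCells k b n q (TubeChain.boundary (Nat.cast_succ q).symm x)).1 τ =
      boundary ((toCells k b n (q + 1) x).1 τ)) (fun σ L hL => ?_) ?_ (fun x y hx hy => ?_)
    (fun c x hx => ?_) x
  · rw [TubeChain.boundary_cell _ σ hL, toCells_cell σ hL, map_sum]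
    have h1 : (∑ A ∈ brackets b n, toCells k b n q (cell k b q σ (L ++ [A]))).1 τ =
        ∑ A ∈ brackets b n, cellFun k b q σ (L ++ [A]) τ := by
      rw [Submodule.coe_sum, Finset.sum_apply]
      exact Finset.sum_congr rfl fun A hA => by
        rw [toCells_cell σ (hL.append (Nat.cast_succ q).symm (mem_brackets.mp hA))]
    rw [h1]
    by_cases hζ : τ * σ⁻¹ ∈ b.rotations n
    · have h2 : cellFun k b (q + 1) σ L τ = sgnPerm k (τ * σ⁻¹) • fun a : Cell b n (q + 1) =>
          ((a.value (L.map (permTube (τ * σ⁻¹))) : ℤ) : k) := by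
        funext a
        simp [cellFun, hζ]
      funext a
      rw [h2, boundary_smul, Pi.smul_apply, boundary_value (hL.rotate hζ).full, Finset.sum_apply,
        Finset.smul_sum]
      -- A rotation permutes the brackets.
      refine Finset.sum_bij (fun A _ => permTube (τ * σ⁻¹) A)
        (fun A hA => mem_brackets.mpr ((mem_brackets.mp hA).permTube hζ))
        (fun A _ C _ h => permTube_inj _ h)
        (fun A hA => ⟨permTube (τ * σ⁻¹)⁻¹ A,
          mem_brackets.mpr ((mem_brackets.mp hA).permTube (inv_mem hζ)), permTube_self_inv _ A⟩)
        fun A _ => ?_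
      simp [cellFun, hζ]
    · have h2 : cellFun k b (q + 1) σ L τ = (0 : k) • 0 := by
        funext a
        simp [cellFun, hζ]
      rw [h2, boundary_smul, zero_smul]
      refine Finset.sum_eq_zero fun A _ => ?_
      funext a
      simp [cellFun, hζ]
  · have h1 : boundary (0 : Cell b n (q + 1) → k) = 0 := by
      rw [← zero_smul k (0 : Cell b n (q + 1) → k), boundary_smul, zero_smul]
    rw [map_zero, map_zero, map_zero]
    exact h1.symm
  · simp only [map_add, Submodule.coe_add, Pi.add_apply, hx, hy, boundary_add]
  · simp only [map_smul, Submodule.coe_smul, Pi.smul_apply, hx, boundary_smul]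

theorem exists_lt_rotate_pow {ζ : Perm (Fin n)} (hζ : ζ ∈ cyclicGroup n) (hn : 1 ≤ n) :
    ∃ s < n, ζ = finRotate n ^ s ∧ ∀ s' < n, ζ = finRotate n ^ s' → s' = s := by
  obtain ⟨s, rfl⟩ := exists_rotate_pow hζ
  refine ⟨s % n, Nat.mod_lt _ hn, ?_, fun s' hs' h => ?_⟩
  · ext x
    rw [rotate_pow_val, rotate_pow_val, Nat.add_mod_mod]
  · have h1 := congrArg Fin.val (Equiv.congr_fun h ⟨0, hn⟩)
    rw [rotate_pow_val, rotate_pow_val, zero_add, zero_add, Nat.mod_eq_of_lt hs'] at h1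
    exact h1.symm

open Classical in
/-- The chain of an oriented cell, in a form that covers both kinds of polytopes. -/
theorem cellChain_apply (hn : 1 ≤ n) (σ τ : Perm (Fin n)) (a a' : Cell b n q) :
    cellChain k b σ a τ a' =
      if τ * σ⁻¹ ∈ b.rotations n ∧ a'.face = b.rot (τ * σ⁻¹) '' a.face then
        ((orientationSign (fun i => b.rot (τ * σ⁻¹) (a.frame i)) a'.frame : ℤ) : k) else 0 := by
  cases b
  · have h1 : τ * σ⁻¹ ∈ Kind.operad.rotations n ↔ τ = σ := by
      rw [Kind.rotations, Subgroup.mem_bot, mul_inv_eq_one]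
    simp only [h1]
    by_cases hτ : τ = σ
    · subst hτ
      simp [cellChain, rot_one]
    · simp [cellChain, hτ]
  · have h2 : ∀ (ζ : Perm (Fin n)), Kind.module.rot ζ = rotate ζ := fun ζ => funext fun t =>
      rot_module ζ t
    simp only [h2]
    change (∑ s ∈ Finset.range n, _) = _
    by_cases hζ : τ * σ⁻¹ ∈ cyclicGroup n
    · obtain ⟨s, hs, h3, h4⟩ := exists_lt_rotate_pow hζ hn
      rw [Finset.sum_eq_single s]
      · have h5 : τ = finRotate n ^ s * σ ↔ True := by
          rw [← mul_inv_eq_iff_eq_mul, h3]; simp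
        have h6 : finRotate n ^ s ∈ Kind.module.rotations n ↔ True :=
          iff_true_intro (h3 ▸ hζ)
        simp only [h5, h3, h6, true_and]
        exact if_congr Iff.rfl rfl rfl
      · intro s' hs' hne
        refine if_neg fun h5 => hne (h4 s' (Finset.mem_range.mp hs') ?_)
        rw [h5.1, mul_inv_cancel_right]
      · intro h
        exact absurd (Finset.mem_range.mpr hs) h
    · have h6 : τ * σ⁻¹ ∈ Kind.module.rotations n ↔ False := iff_false_intro hζ
      simp only [h6, false_and, if_false]
      refine Finset.sum_eq_zero fun s _ => if_neg fun h5 => hζ ?_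
      rw [h5.1, mul_inv_cancel_right]
      exact Subgroup.npow_mem_zpowers _ _

/-- A list of the tubes of an oriented cell gives the chain of this cell, with the sign `value`. -/
theorem cellFun_eq (hn : 1 ≤ n) (σ : Perm (Fin n)) {L : List (Finset ℕ)} {a : Cell b n q}
    (h : L.toFinset = a.tubes) :
    cellFun k b q σ L = ((a.value L : ℤ) : k) • cellChain k b σ a := by
  classical
  funext τ a'
  rw [Pi.smul_apply, Pi.smul_apply, cellChain_apply hn, smul_eq_mul]
  by_cases hζ : τ * σ⁻¹ ∈ b.rotations n
  · by_cases hf : a'.face = b.rot (τ * σ⁻¹) '' a.face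
    · rw [if_pos ⟨hζ, hf⟩, cellFun, if_pos hζ, value_rotate hζ hf]
      push_cast
      have h5 := sgnPerm_mul_self (k := k) (τ * σ⁻¹)
      unfold sgnPerm at *
      linear_combination (((orientationSign (fun i => b.rot (τ * σ⁻¹) (a.frame i)) a'.frame : ℤ) : k) *
        ((a.value L : ℤ) : k)) * h5
    · rw [if_neg fun h1 => hf h1.2, mul_zero, cellFun, if_pos hζ, value_eq_zero, Int.cast_zero,
        mul_zero]
      rintro ⟨-, h2⟩
      rw [toFinset_map_permTube, h] at h2
      exact hf (by rw [a'.face_eq, ← h2, ← rot_image_tubeFace hζ, ← a.face_eq])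
  · rw [if_neg fun h1 => hζ h1.1, mul_zero, cellFun, if_neg hζ]

end

section

variable {k : Type u} [Field k] {b : Kind} {n q : ℕ}

/-! ### The comparison map is bijective -/

/-- The lists that describe faces: their tubes are distinct and pairwise compatible. -/
def Kind.Proper (b : Kind) (n : ℕ) (L : List (Finset ℕ)) : Prop :=
  L.Nodup ∧ ∀ A ∈ L, ∀ C ∈ L, ¬ b.Incompat n A C

/-- The tubes of a composite are distinct and pairwise compatible. -/
theorem Kind.Proper.graft {m h j : ℕ} (hj : j < m) {L L' : List (Finset ℕ)}
    (hL : ∀ A ∈ L, b.IsBracket m A) (hL' : ∀ A ∈ L', Kind.operad.IsBracket (h + 1) A)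
    (h1 : b.Proper m L) (h2 : Kind.operad.Proper (h + 1) L') :
    b.Proper (m + h) (graft b m j h L L') := by
  have hlt : ∀ A ∈ L, ∀ x ∈ A, x < b.gaps m := fun A hA x => (hL A hA).lt
  refine ⟨List.nodup_append'.mpr ⟨?_, ?_, ?_⟩, fun A hA C hC => ?_⟩
  · exact h1.1.map_on fun A hA C hC => inflate_inj hj (hlt A hA) (hlt C hC)
  · exact h2.1.map fun A C => shift_inj
  · intro A hA hA'
    obtain ⟨C, hC, rfl⟩ := List.mem_map.mp hA
    obtain ⟨C', hC', he⟩ := List.mem_map.mp hA'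
    refine not_subset_block hj (hL C hC) (h := h) ?_
    rw [← he, ← shift_range, shift_subset_iff]
    exact (hL' C' hC').subset_range
  · rcases List.mem_append.mp hA with hA | hA <;> rcases List.mem_append.mp hC with hC | hC <;>
      obtain ⟨A, hA', rfl⟩ := List.mem_map.mp hA <;> obtain ⟨C, hC', rfl⟩ := List.mem_map.mp hC
    · rw [inflate_incompat_iff hj (hL A hA') (hL C hC')]
      exact h1.2 A hA' C hC'
    · exact not_incompat_inflate_shift hj (hL A hA') (hL' C hC')
    · exact fun h3 => not_incompat_inflate_shift hj (hL C hC') (hL' A hA') h3.symm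
    · rw [shift_incompat_iff hj (hL' A hA') (hL' C hC')]
      exact h2.2 A hA' C hC'

theorem proper_singleton (n : ℕ) : b.Proper n [Finset.range (b.gaps n)] := by
  refine ⟨List.nodup_singleton _, fun A hA C hC h => ?_⟩
  rw [List.mem_singleton.mp hA, List.mem_singleton.mp hC] at h
  exact h.2.1 subset_rfl

theorem Comb.proper {p : ℤ} {L : List (Finset ℕ)} {x : Ω k b n p} (h : Comb k L x) :
    b.Proper n L := by
  induction h with
  | unit => exact ⟨List.nodup_nil, fun _ h => absurd h List.not_mem_nil⟩
  | gen hn hp => exact proper_singleton _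
  | @comp b m h r p q s hr j hs hm hh hq L x hx ih =>
    obtain rfl : r = m + h := by omega
    rw [← graft_range]
    exact ih.graft j.2 hx.good.bracket (good_corolla hh hq).bracket (proper_singleton (h + 1))

theorem Kind.Nested.good {B : Finset (Finset ℕ)} (hB : b.Nested n B) (hn : 1 ≤ n)
    (hq : B.card + q = b.gaps n) : b.Good n (q : ℤ) B.toList where
  pos := hn
  bracket A hA := hB.bracket A (Finset.mem_toList.mp hA)
  full h := Finset.mem_toList.mpr (hB.full h)
  length := by rw [Finset.length_toList]; exact_mod_cast hq

theorem Kind.Nested.proper {B : Finset (Finset ℕ)} (hB : b.Nested n B) : b.Proper n B.toList :=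
  ⟨B.nodup_toList, fun A hA C hC =>
    hB.compat A (Finset.mem_toList.mp hA) C (Finset.mem_toList.mp hC)⟩

theorem Kind.Good.nested {p : ℤ} {L : List (Finset ℕ)} (h : b.Good n p L) (hc : b.Proper n L) :
    b.Nested n L.toFinset where
  bracket A hA := h.bracket A (List.mem_toFinset.mp hA)
  compat A hA C hC := hc.2 A (List.mem_toFinset.mp hA) C (List.mem_toFinset.mp hC)
  full hn := List.mem_toFinset.mpr (h.full hn)

theorem orientationSign_self {E : Type*} [AddCommGroup E] [Module ℝ E] {f : Fin q → E}
    (hf : LinearIndependent ℝ f) : orientationSign f f = 1 := by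
  have h : ∃ A : Matrix (Fin q) (Fin q) ℝ, ∀ i, f i = ∑ j, A i j • f j :=
    ⟨1, fun i => by simp [Matrix.one_apply]⟩
  rw [orientationSign, dif_pos h]
  have h1 : h.choose = 1 := by
    ext i j
    have h2 := (h.choose_spec i).symm
    have h3 := Fintype.linearIndependent_iff.mp hf (fun j => h.choose i j - (1 : Matrix _ _ ℝ) i j)
      (by simp only [sub_smul, Finset.sum_sub_distrib, h2]; simp [Matrix.one_apply]) j
    exact sub_eq_zero.mp h3
  rw [h1, Matrix.det_one, sign_one]
  rfl

theorem rot_mul {ζ η : Perm (Fin n)} (hζ : ζ ∈ b.rotations n) (t : Fin (b.gaps n) → ℝ) :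
    b.rot (ζ * η) t = b.rot ζ (b.rot η t) := by
  funext x
  have h1 : permVal ζ⁻¹ x.1 < b.gaps n := permVal_lt_gaps (inv_mem hζ) x.2
  simp only [Kind.rot, mul_inv_rev, permVal_mul]
  have h2 : coord (b.rot η t) (permVal ζ⁻¹ x.1) = b.rot η t ⟨permVal ζ⁻¹ x.1, h1⟩ := dif_pos h1
  exact h2.symm

/-- The image of an oriented cell under a rotation. -/
theorem exists_rot_cell {ζ : Perm (Fin n)} (hζ : ζ ∈ b.rotations n) (a : Cell b n q) :
    ∃ a' : Cell b n q, a'.face = b.rot ζ '' a.face ∧ ∀ i, a'.frame i = b.rot ζ (a.frame i) := by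
  have h1 : b.Nested n (a.tubes.image (permTube ζ)) := by
    rw [← tubesOf_image hζ]
    refine nested_tubesOf ?_ (a.nonempty.image _)
    rintro _ ⟨t, ht, rfl⟩
    exact (rot_mem_polytope hζ t).mpr (a.exposed.subset ht)
  obtain ⟨π, -, hπ, -⟩ := exists_perm_rot hζ
  have h2 : LinearIndependent ℝ fun i => b.rot ζ (a.frame i) := by
    have h3 := a.independent.map' (LinearMap.funLeft ℝ ℝ π)
      (LinearMap.ker_eq_bot.mpr (LinearMap.funLeft_injective_of_surjective ℝ ℝ π π.surjective))
    rwa [show (fun i => b.rot ζ (a.frame i)) = LinearMap.funLeft ℝ ℝ π ∘ a.frame from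
      funext fun i => hπ _]
  obtain ⟨a', h4, h5⟩ := exists_cell h1 (q := q)
    (by rw [Finset.card_image_of_injective _ fun _ _ => permTube_inj ζ, a.card_tubes]) h2
    fun i A hA => by
      obtain ⟨C, hC, rfl⟩ := Finset.mem_image.mp hA
      rw [ind_dotProduct_rot hζ]
      exact a.frame_mem i C hC
  exact ⟨a', by rw [h4, ← rot_image_tubeFace hζ, ← a.face_eq], congrFun h5⟩

/-- The value of a chain is invariant under the simultaneous rotation of letters and cells. -/
theorem chain_rotate {c : Perm (Fin n) → Cell b n q → k} (hc : c ∈ chains k b n q)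
    {ζ : Perm (Fin n)} (hζ : ζ ∈ b.rotations n) (σ : Perm (Fin n)) {a a' : Cell b n q}
    (h1 : a'.face = b.rot ζ '' a.face) (h2 : ∀ i, a'.frame i = b.rot ζ (a.frame i)) :
    c (ζ * σ) a' = c σ a := by
  cases b
  · obtain rfl := eq_one_of_mem_rotations hζ
    have h3 : a.face = a'.face := by rw [h1]; simp only [rot_one, Set.image_id']
    have h4 : a'.frame = a.frame := funext fun i => (h2 i).trans (rot_one _)
    rw [one_mul, hc.1 σ a a' h3, h4, orientationSign_self a.independent, Int.cast_one, one_mul]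
  · obtain ⟨s, rfl⟩ := exists_rotate_pow hζ
    have hf : finRotate n ∈ Kind.module.rotations n := Subgroup.mem_zpowers _
    clear hζ
    induction s generalizing a' with
    | zero =>
      have h3 : a.face = a'.face := by
        rw [h1, pow_zero]; simp only [rot_one, Set.image_id']
      have h4 : a'.frame = a.frame := funext fun i => (h2 i).trans (by rw [pow_zero, rot_one])
      rw [pow_zero, one_mul, hc.1 σ a a' h3, h4, orientationSign_self a.independent, Int.cast_one,
        one_mul]
    | succ s ih =>
      obtain ⟨a'', h3, h4⟩ := exists_rot_cell (pow_mem hf s) a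
      rw [← ih h3 h4, pow_succ', mul_assoc]
      refine hc.2 _ _ _ ?_ fun i => ?_
      · rw [h1, h3, pow_succ']
        refine Eq.trans ?_ (Set.image_image (rotate (finRotate n))
          (Kind.module.rot (finRotate n ^ s)) a.face).symm
        exact Set.image_congr fun t _ => (rot_mul hf t).trans (rot_module _ _)
      · rw [h2, h4, pow_succ', rot_mul hf]
        exact rot_module _ _

/-- A linear map is bijective if it takes a spanning family to one that is dual, up to nonzero
scalars, to a family of functionals that separates points. -/
theorem bijective_of_dual {V W ι : Type*} [AddCommGroup V] [Module k V] [AddCommGroup W]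
    [Module k W] [Finite ι] (φ : V →ₗ[k] W) (u : ι → V) (e : ι → W →ₗ[k] k)
    (hne : ∀ i, e i (φ (u i)) ≠ 0) (h0 : ∀ i j, i ≠ j → e j (φ (u i)) = 0)
    (hu : Submodule.span k (Set.range u) = ⊤) (he : ∀ w, (∀ i, e i w = 0) → w = 0) :
    Function.Bijective φ := by
  have := Fintype.ofFinite ι
  have key : ∀ (c : ι → k) j, e j (φ (∑ i, c i • u i)) = c j * e j (φ (u j)) := fun c j => by
    simp only [map_sum, map_smul, smul_eq_mul]
    exact Finset.sum_eq_single j (fun i _ hi => by rw [h0 i j hi, mul_zero])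
      fun h => absurd (Finset.mem_univ j) h
  refine ⟨(injective_iff_map_eq_zero φ).mpr fun x hx => ?_, fun w => ?_⟩
  · obtain ⟨c, rfl⟩ := (Submodule.mem_span_range_iff_exists_fun k).mp (hu ▸ Submodule.mem_top (x := x))
    refine Finset.sum_eq_zero fun j _ => ?_
    have h1 := key c j
    rw [hx, map_zero] at h1
    rw [(mul_eq_zero.mp h1.symm).resolve_right (hne j), zero_smul]
  · refine ⟨∑ i, (e i w / e i (φ (u i))) • u i, sub_eq_zero.mp (he _ fun j => ?_)⟩
    rw [map_sub, key, div_mul_cancel₀ _ (hne j), sub_self]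

/-- A nested set of tubes and a permutation come from an iterated composite. -/
theorem exists_comb_of_nested {B : Finset (Finset ℕ)} (hB : b.Nested n B) (hn : 1 ≤ n)
    (hq : B.card + q = b.gaps n) (σ : Perm (Fin n)) :
    ∃ ζ ∈ b.rotations n, ∃ (L : List (Finset ℕ)) (y : Ω k b n (q : ℤ)),
      (B.toList.map (permTube ζ)).Perm L ∧ Comb k L y ∧
      ∃ c : k, c ≠ 0 ∧ toTubes k b n q (Free.act (ζ * σ) y) = c • cell k b q σ B.toList := by
  obtain ⟨ζ, hζ, L', y, hp, hy⟩ := exists_rotate_comb (k := k) (hB.good hn hq) hB.proper.1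
    hB.proper.2
  refine ⟨ζ, hζ, L', y, hp, hy, ?_⟩
  obtain ⟨ε, hε⟩ := hy.toTubes
  obtain ⟨ε', hε'⟩ := cell_perm (k := k) (b := b) (p := q) (ζ * σ) hp
  have h1 := hε' [] []
  simp only [List.nil_append, List.append_nil] at h1
  rw [cell_rot σ _ hζ] at h1
  have h2 : cell k b (q : ℤ) (ζ * σ) L' = ε' • sgnPerm k ζ • cell k b q σ B.toList := by
    rw [h1, smul_smul, Int.units_mul_self, one_smul]
  refine ⟨((ε * ε' : ℤˣ) : ℤ) * sgnPerm k ζ, ?_, ?_⟩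
  · refine mul_ne_zero ?_ ?_
    · rcases Int.units_eq_one_or (ε * ε') with h | h <;> simp [h]
    · exact fun h => by simpa [h] using sgnPerm_mul_self (k := k) ζ
  · rw [toTubes_act, hε, Units.smul_def, map_zsmul, TubeChain.act_cell, one_mul, h2,
      Units.smul_def, mul_smul, Int.cast_smul_eq_zsmul, Units.val_mul, mul_smul]

end

section

variable {k : Type u} [Field k] {b : Kind} {n q : ℕ}

/-- The comparison map from the cobar construction to cellular chains. -/
def toChains (k : Type u) [Field k] (b : Kind) (n q : ℕ) : Ω k b n (q : ℤ) →ₗ[k] chains k b n q :=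
  toCells k b n q ∘ₗ toTubes k b n q

theorem cellFun_self (σ : Perm (Fin n)) (L : List (Finset ℕ)) (a : Cell b n q) :
    cellFun k b q σ L σ a = ((a.value L : ℤ) : k) := by
  have h1 : L.map (permTube (1 : Perm (Fin n))) = L := by
    rw [funext permTube_one, List.map_id']
  rw [cellFun, mul_inv_cancel, if_pos (one_mem _), h1]
  simp [sgnPerm]

theorem exists_cell_tubes {B : Finset (Finset ℕ)} (hB : b.Nested n B) (hq : B.card + q = b.gaps n) :
    ∃ a : Cell b n q, a.tubes = B := by
  obtain ⟨f, hf, hfB⟩ := exists_frame hB hq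
  obtain ⟨a, h1, -⟩ := exists_cell hB hq hf hfB
  exact ⟨a, by rw [OrientedFace.tubes, h1, tubesOf_tubeFace hB]⟩

/-- The indices of a basis of the chains: a permutation that puts the first letter at the first
place in the case of cyclic words, which makes it unique in its class modulo rotations, and the set
of tubes of a face of dimension `q`. -/
abbrev BasisIndex (b : Kind) (n q : ℕ) (hn : 1 ≤ n) : Type :=
  {i : Perm (Fin n) × (brackets b n).powerset //
    b.IsBase (i.1 ⟨0, hn⟩).1 ∧ b.Nested n i.2.1 ∧ i.2.1.card + q = b.gaps n}

/-- The iterated composites span the source, the values at the basis cells determine a chain, and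
the values of the former at the latter form a diagonal matrix without zeros on the diagonal. -/
theorem bijective_toChains (hn : 1 ≤ n) : Function.Bijective (toChains k b n q) := by
  choose a ha using fun i : BasisIndex b n q hn => exists_cell_tubes i.2.2.1 i.2.2.2
  choose ζ hζ L y hp hy c hc hcell using fun i : BasisIndex b n q hn =>
    exists_comb_of_nested (k := k) i.2.2.1 hn i.2.2.2 i.1.1
  let e : BasisIndex b n q hn → chains k b n q →ₗ[k] k := fun i =>
    LinearMap.proj (a i) ∘ₗ LinearMap.proj i.1.1 ∘ₗ (chains k b n q).subtype
  have he : ∀ i w, e i w = w.1 i.1.1 (a i) := fun _ _ => rfl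
  have hval : ∀ i j, e j (toChains k b n q (Free.act (ζ i * i.1.1) (y i))) =
      c i * cellFun k b q i.1.1 i.1.2.1.toList j.1.1 (a j) := fun i j => by
    rw [he, toChains, LinearMap.comp_apply, hcell, map_smul, Submodule.coe_smul,
      toCells_cell _ (i.2.2.1.good hn i.2.2.2)]
    rfl
  refine bijective_of_dual _ (fun i => Free.act (ζ i * i.1.1) (y i)) e (fun i => ?_)
    (fun i j hij => ?_) ?_ fun w hw => ?_
  · rw [hval, cellFun_self]
    refine mul_ne_zero (hc i) ?_
    rcases Int.isUnit_iff.mp (isUnit_value (a := a i) i.1.2.1.nodup_toList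
      (by rw [Finset.toList_toFinset, ha])) with h | h <;> simp [h]
  · rw [hval]
    refine mul_eq_zero_of_right _ ?_
    unfold cellFun
    split_ifs with h1
    · have h2 : j.1.1 * i.1.1⁻¹ = 1 := eq_one_of_isBase h1 i.2.1
        (by simpa using j.2.1)
      have h3 : j.1.1 = i.1.1 := mul_inv_eq_one.mp h2
      rw [value_eq_zero, Int.cast_zero, mul_zero]
      rintro ⟨-, h4⟩
      rw [h2, funext permTube_one, List.map_id', Finset.toList_toFinset, ha] at h4
      exact hij (Subtype.ext (Prod.ext h3.symm (Subtype.ext h4)))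
    · rfl
  -- An iterated composite with any permutation is, up to sign, the chosen one: rotate the first
  -- letter to its base place, and use that the tubes determine the composite.
  · rw [eq_top_iff]
    rintro x -
    refine Submodule.span_le.mpr ?_ (mem_combSpan x)
    rintro _ ⟨τ, L₀, y₀, hy₀, rfl⟩
    obtain ⟨η, hη, hb⟩ := exists_rotate_isBase (b := b) (τ ⟨0, hn⟩)
    have hg := hy₀.good.rotate hη
    have hpr : b.Proper n (L₀.map (permTube η)) :=
      ⟨(nodup_map_permTube η).mpr hy₀.proper.1, fun A hA C hC => by
        obtain ⟨A, hA', rfl⟩ := List.mem_map.mp hA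
        obtain ⟨C, hC', rfl⟩ := List.mem_map.mp hC
        rw [permTube_incompat_iff hη]
        exact hy₀.proper.2 A hA' C hC'⟩
    have hN := hg.nested hpr
    have hcard : (L₀.map (permTube η)).toFinset.card + q = b.gaps n := by
      rw [List.toFinset_card_of_nodup hpr.1]
      exact_mod_cast hg.length
    let i : BasisIndex b n q hn := ⟨(η * τ, ⟨(L₀.map (permTube η)).toFinset,
      Finset.mem_powerset.mpr fun A hA => mem_brackets.mpr (hN.bracket A hA)⟩), hb, hN, hcard⟩
    have h1 : (L i).Perm (L₀.map (permTube (ζ i * η))) := by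
      refine (hp i).symm.trans ?_
      have h2 : (L₀.map (permTube η)).toFinset.toList.Perm (L₀.map (permTube η)) :=
        List.toFinset_toList hpr.1
      have h3 := h2.map (permTube (ζ i))
      rw [List.map_map] at h3
      rwa [show permTube (ζ i * η) = permTube (ζ i) ∘ permTube η from
        funext fun A => permTube_mul (ζ i) η A]
    obtain ⟨ε, hε⟩ := Comb.unique hy₀ (hy i) (mul_mem (hζ i) hη) h1
    have h4 : Free.act τ y₀ = ε • Free.act (ζ i * i.1.1) (y i) := by
      rw [hε, Units.smul_def, map_zsmul, act_act, mul_assoc, Units.smul_def]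
    rw [SetLike.mem_coe, h4, Units.smul_def]
    exact zsmul_mem (Submodule.subset_span (Set.mem_range_self i)) _
  -- A chain is determined by its values at the basis cells, by invariance under rotations and
  -- changes of orientation.
  · refine Subtype.ext (funext₂ fun τ a' => ?_)
    obtain ⟨η, hη, hb⟩ := exists_rotate_isBase (b := b) (τ ⟨0, hn⟩)
    obtain ⟨a'', h1, h2⟩ := exists_rot_cell hη a'
    rw [← chain_rotate w.2 hη τ h1 h2]
    let i : BasisIndex b n q hn := ⟨(η * τ, ⟨a''.tubes,
      Finset.mem_powerset.mpr fun A hA => mem_brackets.mpr (a''.nested.bracket A hA)⟩), hb,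
      a''.nested, a''.card_tubes⟩
    have h3 : (a i).face = a''.face := by
      rw [(a i).face_eq, ha i, ← a''.face_eq]
    have h4 : w.1 (η * τ) (a i) = 0 := hw i
    rw [w.2.1 (η * τ) (a i) a'' h3, h4, mul_zero]
    rfl

theorem toTubes_injective (p : ℤ) : Function.Injective (toTubes k b n p) := by
  rcases lt_or_ge p 0 with hp | hp
  · have := cobar_subsingleton (k := k) (b := b) (n := n) hp
    exact Function.injective_of_subsingleton _
  rcases Nat.eq_zero_or_pos n with rfl | hn
  -- There are no iterated composites in arity `0`.
  · have h1 : combSpan k b 0 p = ⊥ := by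
      rw [combSpan, Submodule.span_eq_bot]
      rintro _ ⟨σ, L, y, hy, rfl⟩
      exact absurd hy.good.pos (by omega)
    have h2 : ∀ x : Ω k b 0 p, x = 0 := fun x => by
      have := mem_combSpan x
      rwa [h1, Submodule.mem_bot] at this
    exact fun x y _ => (h2 x).trans (h2 y).symm
  · lift p to ℕ using hp
    exact Function.Injective.of_comp (bijective_toChains hn).1

/-- Elements of the cobar construction are combinations of permutations and lists of tubes. -/
def tubesEquiv (k : Type u) [Field k] (b : Kind) (n : ℕ) (p : ℤ) : Ω k b n p ≃ₗ[k] TubeChain k b n p :=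
  LinearEquiv.ofBijective (toTubes k b n p) ⟨toTubes_injective p, toTubes_surjective⟩

/-- The cobar differential, transported from combinations of lists of tubes. -/
def cobarDiff (k : Type u) [Field k] (b : Kind) (n : ℕ) {p p' : ℤ} (hp : p' + 1 = p) :
    Ω k b n p →ₗ[k] Ω k b n p' :=
  (tubesEquiv k b n p').symm.toLinearMap ∘ₗ TubeChain.boundary hp ∘ₗ toTubes k b n p

theorem toTubes_cobarDiff {p p' : ℤ} (hp : p' + 1 = p) (x : Ω k b n p) :
    toTubes k b n p' (cobarDiff k b n hp x) = TubeChain.boundary hp (toTubes k b n p x) :=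
  (tubesEquiv k b n p').apply_symm_apply _

theorem isCobarDifferential_cobarDiff :
    IsCobarDifferential (cyclDual k) (assDual k) (cobarDiff k) where
  act b n p p' hp σ x := toTubes_injective _ (by
    rw [toTubes_cobarDiff, toTubes_act, toTubes_act, toTubes_cobarDiff, TubeChain.boundary_act])
  comp b m n r h i p p' q q' s s' hp hq hs hpq x y := toTubes_injective _ (by
    rw [toTubes_cobarDiff, toTubes_comp, TubeChain.boundary_comp h i hp hq hs hpq, map_add,
      map_smul, toTubes_comp, toTubes_comp, toTubes_cobarDiff, toTubes_cobarDiff])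
  gen b n hn p p' hp x := toTubes_injective _ (by
    rw [toTubes_cobarDiff, toTubes_gen, toTubes_cobarOnGen hn])

theorem cobarDiff_cobarDiff {p p' p'' : ℤ} (hp : p' + 1 = p) (hp' : p'' + 1 = p')
    (x : Ω k b n p) : cobarDiff k b n hp' (cobarDiff k b n hp x) = 0 :=
  toTubes_injective _ (by
    rw [toTubes_cobarDiff, toTubes_cobarDiff, TubeChain.boundary_boundary, map_zero])

theorem toChains_cobarDiff (x : Ω k b n ((q + 1 : ℕ) : ℤ)) (σ : Perm (Fin n)) :
    (toChains k b n q (cobarDiff k b n (Nat.cast_succ q).symm x)).1 σ =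
      boundary ((toChains k b n (q + 1) x).1 σ) := by
  rw [toChains, LinearMap.comp_apply, toTubes_cobarDiff, toCells_boundary]
  rfl

theorem toChains_act (x : Ω k b n (q : ℤ)) (ρ σ : Perm (Fin n)) :
    (toChains k b n q (Free.act ρ x)).1 σ = (toChains k b n q x).1 (σ * ρ⁻¹) := by
  rw [toChains, LinearMap.comp_apply, toTubes_act, toCells_act]
  rfl

/-! ### Composition of cells, and the top cell -/

/-- Every cell is the image of some element under the comparison map, of the form of a sign times a
list of tubes. -/
theorem exists_toChains_eq (hn : 1 ≤ n) (σ : Perm (Fin n)) (a : Cell b n q) :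
    ∃ x : Ω k b n (q : ℤ),
      toTubes k b n q x = ((a.value a.tubes.toList : ℤ) : k) • cell k b q σ a.tubes.toList ∧
      (toChains k b n q x).1 = cellChain k b σ a := by
  have hg := a.nested.good hn a.card_tubes
  obtain ⟨x, hx⟩ := exists_toTubes_eq (k := k) hg a.nested.proper.1 a.nested.proper.2 σ
  refine ⟨((a.value a.tubes.toList : ℤ) : k) • x, by rw [map_smul, hx], ?_⟩
  rw [map_smul, toChains, LinearMap.comp_apply, hx, Submodule.coe_smul, toCells_cell σ hg,
    cellFun_eq hn σ (Finset.toList_toFinset _), smul_smul]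
  rcases Int.isUnit_iff.mp (isUnit_value (a := a) a.tubes.nodup_toList
    (Finset.toList_toFinset _)) with h | h <;> simp [h]

/-- The sum of the coordinates in a set of gaps, separated into those of the outer and of the
inserted word. -/
theorem ind_dotProduct_insertVec {g h j : ℕ} (hj : j ≤ g) {A C C' : Finset ℕ}
    (hC : ∀ x < g, (if x < j then x else x + h) ∈ A ↔ x ∈ C) (hC' : ∀ z < h, j + z ∈ A ↔ z ∈ C')
    (t : Fin g → ℝ) (u : Fin h → ℝ) :
    ind A ⬝ᵥ insertVec (g + h) j t u = ind C ⬝ᵥ t + ind C' ⬝ᵥ u := by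
  obtain ⟨π, h1, h2, -⟩ := exists_block_perm (h := h) hj
  rw [dotProduct, ← Equiv.sum_comp π, Fin.sum_univ_add]
  congr 1
  · refine Finset.sum_congr rfl fun x _ => ?_
    simp only [ind, insertVec, h1, hC x.1 x.2]
    by_cases h3 : x.1 < j
    · simp [h3, coord]
    · simp [h3, coord, show ¬ x.1 + h < j by omega]
  · refine Finset.sum_congr rfl fun z _ => ?_
    simp only [ind, insertVec, h2, hC' z.1 z.2]
    simp [coord]

/-- A tube of the outer word contains all or none of the gaps of the inserted word, so that it only
sees the outer coordinates if the inner ones have sum zero. -/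
theorem ind_inflate_dotProduct {m h j : ℕ} (hj : j < m) {A : Finset ℕ}
    (hA : ∀ x ∈ A, x < b.gaps m) {t : Fin (b.gaps m) → ℝ} {u : Fin h → ℝ}
    (hu : 0 < h → ind (Finset.range h) ⬝ᵥ u = 0) :
    ind (b.inflate m j h A) ⬝ᵥ insertVec (b.gaps m + h) j t u = ind A ⬝ᵥ t := by
  have hjm : j ≤ b.gaps m := by have := le_gaps (b := b) (n := m); omega
  have hu' : ind (Finset.range h) ⬝ᵥ u = 0 := by
    rcases Nat.eq_zero_or_pos h with rfl | hh
    · exact Finset.sum_empty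
    · exact hu hh
  have h1 : ∀ x < b.gaps m, (if x < j then x else x + h) ∈ b.inflate m j h A ↔ x ∈ A :=
    fun x _ => mem_inflate_shift hj hA x
  by_cases hT : j ∈ A ∨ (if j = 0 then m - 1 else j - 1) ∈ A
  · rw [ind_dotProduct_insertVec hjm h1 (C' := Finset.range h), hu', add_zero]
    intro z hz
    rw [mem_inflate hj hA, Finset.mem_range]
    exact iff_of_true (Or.inr (Or.inl ⟨by omega, by omega, hT⟩)) hz
  · rw [ind_dotProduct_insertVec hjm h1 (C' := ∅)]
    · simp [ind, dotProduct]
    · intro z hz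
      rw [mem_inflate hj hA]
      refine iff_of_false ?_ (Finset.notMem_empty z)
      rintro (h2 | h2 | h2)
      · omega
      · exact hT h2.2.2
      · omega

/-- A tube of the inserted word only sees the inner coordinates. -/
theorem ind_shift_dotProduct {m h j : ℕ} (hj : j < m) (A : Finset ℕ)
    (hA : ∀ x ∈ A, x < h) (t : Fin (b.gaps m) → ℝ) (u : Fin h → ℝ) :
    ind (shift j A) ⬝ᵥ insertVec (b.gaps m + h) j t u = ind A ⬝ᵥ u := by
  have hjm : j ≤ b.gaps m := by have := le_gaps (b := b) (n := m); omega
  rw [ind_dotProduct_insertVec hjm (C := ∅) (C' := A)]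
  · simp [ind, dotProduct]
  · intro x _
    rw [mem_shift]
    refine iff_of_false ?_ (Finset.notMem_empty x)
    rintro ⟨h1, h2⟩
    have := hA _ h2
    split_ifs at * <;> omega
  · intro z _
    rw [mem_shift, Nat.add_sub_cancel_left]
    exact and_iff_right (Nat.le_add_right _ _)

/-- The product of two cells is the face of the composite whose tubes are those of the grafted list,
with the sign by which grafted lists are composed. -/
theorem exists_isComposite {m h r p : ℕ} (hr : r + 1 = m + (h + 1)) {j : ℕ} (hj : j < m)
    (a : Cell b m p) (c : Cell .operad (h + 1) q) :
    ∃ e : Cell b r (p + q), IsComposite j a c e ∧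
      e.tubes = (graft b m j h a.tubes.toList c.tubes.toList).toFinset ∧
      e.value (graft b m j h a.tubes.toList c.tubes.toList) =
        (-1) ^ (c.tubes.card * p + j * h) * a.value a.tubes.toList * c.value c.tubes.toList := by
  obtain rfl : r = m + h := by omega
  have hga := a.nested.good (by omega) a.card_tubes
  have hgc := c.nested.good (by omega) c.card_tubes
  have hpr := a.nested.proper.graft hj hga.bracket hgc.bracket c.nested.proper
  have hG := hga.graft hj hgc
  have hN := hG.nested hpr
  have hlt : ∀ A ∈ c.tubes, ∀ x ∈ A, x < h := fun A hA x => (c.nested.bracket A hA).lt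
  have hlen : (graft b m j h a.tubes.toList c.tubes.toList).length + (p + q) = b.gaps (m + h) := by
    have := hG.length
    omega
  have hcard : (graft b m j h a.tubes.toList c.tubes.toList).toFinset.card + (p + q) =
      b.gaps (m + h) := by rw [List.toFinset_card_of_nodup hpr.1, hlen]
  have hgaps : b.gaps (m + h) = b.gaps m + h := gaps_add h (by omega)
  set f : Fin (p + q) → Fin (b.gaps (m + h)) → ℝ := Fin.append
    (fun i => insertVec (b.gaps (m + h)) j (a.frame i) (0 : Fin h → ℝ))
    (fun i => insertVec (b.gaps (m + h)) j (0 : Fin (b.gaps m) → ℝ) (c.frame i)) with hf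
  have ho : orient (graft b m j h a.tubes.toList c.tubes.toList) f =
      (-1) ^ (c.tubes.toList.length * p + j * h) * orient a.tubes.toList a.frame *
        orient c.tubes.toList c.frame :=
    orient_graft hj hgaps hga.bracket (fun A hA => hlt A (Finset.mem_toList.mp hA))
      (by rw [Finset.length_toList, a.card_tubes])
      (by rw [Finset.length_toList]; exact c.card_tubes) a.frame c.frame
  have hva : a.value a.tubes.toList = orient a.tubes.toList a.frame :=
    value_of a.tubes.nodup_toList (Finset.toList_toFinset _)
  have hvc : c.value c.tubes.toList = orient c.tubes.toList c.frame :=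
    value_of c.tubes.nodup_toList (Finset.toList_toFinset _)
  have hua := isUnit_value (a := a) a.tubes.nodup_toList (Finset.toList_toFinset _)
  have huc := isUnit_value (a := c) c.tubes.nodup_toList (Finset.toList_toFinset _)
  have hne : orient (graft b m j h a.tubes.toList c.tubes.toList) f ≠ 0 := by
    rw [ho, ← hva, ← hvc]
    exact mul_ne_zero (mul_ne_zero (pow_ne_zero _ (by norm_num)) hua.ne_zero) huc.ne_zero
  have hind : LinearIndependent ℝ f := by
    have h1 : listDet ((graft b m j h a.tubes.toList c.tubes.toList).map ind ++ List.ofFn f) ≠ 0 :=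
      fun h1 => hne (by rw [orient, h1, sign_zero]; exact mul_zero _)
    exact ((listDet_ne_zero_iff (by rw [List.length_map, hlen])).mp h1).comp Sum.inr
      Sum.inr_injective
  have hfull : 0 < h → Finset.range h ∈ c.tubes := c.nested.full
  have hmem : ∀ i, f i ∈ tubeSpace _ (graft b m j h a.tubes.toList c.tubes.toList).toFinset := by
    intro i A hA
    rw [hf, hgaps]
    rcases List.mem_append.mp (List.mem_toFinset.mp hA) with hA | hA <;>
      obtain ⟨A, hA', rfl⟩ := List.mem_map.mp hA <;> rw [Finset.mem_toList] at hA' <;>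
      refine Fin.addCases (fun i => ?_) (fun i => ?_) i
    · rw [Fin.append_left, ind_inflate_dotProduct hj
        (fun x => (hga.bracket A (Finset.mem_toList.mpr hA')).lt) (fun _ => dotProduct_zero _)]
      exact a.frame_mem i A hA'
    · rw [Fin.append_right]
      exact (ind_inflate_dotProduct hj (fun x => (hga.bracket A (Finset.mem_toList.mpr hA')).lt)
        (fun hh => c.frame_mem i _ (hfull hh))).trans (dotProduct_zero _)
    · rw [Fin.append_left, ind_shift_dotProduct hj A (hlt A hA'), dotProduct_zero]
    · rw [Fin.append_right]
      exact (ind_shift_dotProduct hj A (hlt A hA') _ _).trans (c.frame_mem i A hA')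
  obtain ⟨e, h1, h2⟩ := exists_cell hN hcard hind hmem
  have h3 : e.tubes = (graft b m j h a.tubes.toList c.tubes.toList).toFinset := by
    rw [OrientedFace.tubes, h1, tubesOf_tubeFace hN]
  refine ⟨e, ⟨?_, h2⟩, h3, ?_⟩
  · rw [h1]
    ext t
    refine and_congr_right fun _ => ⟨fun ht => ⟨?_, fun A hA hAt => ?_, fun A hA hAt => ?_⟩,
      fun ht A hA => ?_⟩
    · change Tight t (Finset.Ico j (j + h))
      rcases Nat.eq_zero_or_pos h with rfl | hh
      · simp [Tight, bound]
      · rw [← shift_range]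
        exact ht _ (List.mem_toFinset.mpr (List.mem_append_right _
          (List.mem_map_of_mem (Finset.mem_toList.mpr (hfull hh)))))
    · exact ht _ (List.mem_toFinset.mpr (List.mem_append_left _
        (List.mem_map_of_mem (Finset.mem_toList.mpr (mem_tubesOf.mpr ⟨hA, hAt⟩)))))
    · exact ht _ (List.mem_toFinset.mpr (List.mem_append_right _
        (List.mem_map_of_mem (Finset.mem_toList.mpr (mem_tubesOf.mpr ⟨hA, hAt⟩)))))
    · rcases List.mem_append.mp (List.mem_toFinset.mp hA) with hA | hA <;>
        obtain ⟨A, hA', rfl⟩ := List.mem_map.mp hA <;>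
        rw [Finset.mem_toList, mem_tubesOf] at hA'
      · exact ht.2.1 A hA'.1 hA'.2
      · exact ht.2.2 A hA'.1 hA'.2
  · rw [value_of hpr.1 h3.symm, h2, ho, hva, hvc, Finset.length_toList]

/-- The comparison map takes composites to composites of cells. -/
theorem exists_toChains_comp {m n r : ℕ} (hr : r + 1 = m + n) (hn : 1 ≤ n) (i : Fin m) (p q : ℕ)
    (σ : Perm (Fin m)) (τ : Perm (Fin n)) (a : Cell b m p) (c : Cell .operad n q) :
    ∃ (x : Ω k b m (p : ℤ)) (y : Ω k .operad n (q : ℤ)) (e : Cell b r (p + q)),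
      (toChains k b m p x).1 = cellChain k b σ a ∧
      (toChains k .operad n q y).1 = cellChain k .operad τ c ∧
      IsComposite (σ i).1 a c e ∧
      (toChains k b r (p + q) (Free.comp hr i (Nat.cast_add p q).symm x y)).1 =
        cellChain k b (permComp hr i σ τ) e := by
  obtain ⟨h, rfl⟩ : ∃ h, n = h + 1 := ⟨n - 1, by omega⟩
  have hm : 1 ≤ m := by have := i.2; omega
  obtain ⟨x, hx, hx'⟩ := exists_toChains_eq (k := k) hm σ a
  obtain ⟨y, hy, hy'⟩ := exists_toChains_eq (k := k) hn τ c
  obtain ⟨e, he, het, hev⟩ := exists_isComposite hr (σ i).2 a c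
  refine ⟨x, y, e, hx', hy', he, ?_⟩
  have hga := a.nested.good hm a.card_tubes
  have hgc := c.nested.good hn c.card_tubes
  have hG := hga.graft (σ i).2 hgc
  have hcard : c.tubes.card + q = h := c.card_tubes
  have hs : graftSign k p q (σ i) h = (-1) ^ (c.tubes.card * p + (σ i).1 * h) := by
    have h1 : (h : ℤ) - q = c.tubes.card := by omega
    rw [graftSign, ← sgnPow_natCast, h1]
    push_cast
    rfl
  obtain rfl : r = m + h := by omega
  rw [← Nat.cast_add] at hG
  rw [toChains, LinearMap.comp_apply, toTubes_comp, hx, hy, map_smul, map_smul (TubeChain.comp _ _ _),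
    LinearMap.smul_apply, TubeChain.comp_cell _ _ _ _ _ hga hgc, map_smul, map_smul, map_smul,
    Submodule.coe_smul, Submodule.coe_smul, Submodule.coe_smul, toCells_cell _ hG,
    cellFun_eq (by omega) _ het.symm, hev, hs, smul_smul, smul_smul, smul_smul]
  have h1 : ((-1 : k) ^ (c.tubes.card * p + (σ i).1 * h)) * (-1) ^ (c.tubes.card * p + (σ i).1 * h) =
      1 := by rw [← mul_pow]; simp
  push_cast
  rcases Int.isUnit_iff.mp (isUnit_value (a := a) a.tubes.nodup_toList
      (Finset.toList_toFinset _)) with h2 | h2 <;>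
    rcases Int.isUnit_iff.mp (isUnit_value (a := c) c.tubes.nodup_toList
      (Finset.toList_toFinset _)) with h3 | h3 <;>
    rw [h2, h3] <;> push_cast <;> simp [h1]

theorem orient_range_one (f : Fin 0 → Fin 1 → ℝ) : orient [Finset.range 1] f = 1 := by
  have h1 : listDet ([Finset.range 1].map ind ++ List.ofFn f) = 1 := by
    rw [listDet_of_length (by simp), Matrix.det_fin_one]
    simp [ind]
  rw [orient, h1]
  simp

theorem top_nested (hn : 1 ≤ n) : Kind.module.Nested n {Finset.range n} := by
  have hg : Kind.module.Good n ((n - 1 : ℕ) : ℤ) [Finset.range n] :=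
    good_corolla (b := .module) hn (by simp only [Kind.excess]; omega)
  exact hg.nested (proper_singleton n)

/-- The top-dimensional cell of the cyclohedron, with the orientation that corresponds to the list
of its single tube. -/
theorem exists_top_cell (hn : 1 ≤ n) : ∃ a : Cell .module n (n - 1),
    a.face = Kind.polytope .module n ∧ a.tubes = {Finset.range n} ∧
      a.value [Finset.range n] = 1 := by
  have hN := top_nested hn
  have hcard : ({Finset.range n} : Finset (Finset ℕ)).card + (n - 1) = Kind.module.gaps n := by
    rw [Finset.card_singleton, Kind.gaps]; omega
  have hface : tubeFace .module n {Finset.range n} = Kind.polytope .module n := by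
    refine Set.Subset.antisymm (fun t ht => ht.1) fun t ht => ⟨ht, fun A hA => ?_⟩
    rw [Finset.mem_singleton.mp hA]
    exact ht.1
  obtain ⟨f, hf, hfB⟩ := exists_frame hN hcard
  have key : ∀ g : Fin (n - 1) → Fin (Kind.module.gaps n) → ℝ, LinearIndependent ℝ g →
      (∀ i, g i ∈ tubeSpace _ {Finset.range n}) → orient [Finset.range n] g = 1 →
      ∃ a : Cell .module n (n - 1), a.face = Kind.polytope .module n ∧
        a.tubes = {Finset.range n} ∧ a.value [Finset.range n] = 1 := fun g hg hgB h1 => by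
    obtain ⟨a, h2, h3⟩ := exists_cell hN hcard hg hgB
    have h4 : a.tubes = {Finset.range n} := by rw [OrientedFace.tubes, h2, tubesOf_tubeFace hN]
    refine ⟨a, h2.trans hface, h4, ?_⟩
    rw [value_of (List.nodup_singleton _) h4.symm, h3, h1]
  have hu : IsUnit (orient [Finset.range n] f) :=
    isUnit_orient (b := .module) (List.nodup_singleton _) hN
      (by rw [List.length_singleton, Kind.gaps]; omega) hf hfB
  rcases Int.isUnit_iff.mp hu with h1 | h1
  · exact key f hf hfB h1
  rcases Nat.lt_or_ge 1 n with hn2 | hn2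
  · -- reversing one vector of the frame reverses the orientation
    let d : Fin (n - 1) → ℝ := fun i => if i.1 = 0 then -1 else 1
    have hd : (Matrix.diagonal d).det = -1 := by
      rw [Matrix.det_diagonal, Finset.prod_eq_single ⟨0, by omega⟩]
      · simp [d]
      · exact fun i _ hi => if_neg fun h => hi (Fin.ext h)
      · exact fun h => absurd (Finset.mem_univ _) h
    have hdf : ∀ i, ∑ j, Matrix.diagonal d i j • f j = d i • f i := fun i => by
      rw [Finset.sum_eq_single i]
      · rw [Matrix.diagonal_apply_eq]
      · exact fun j _ hj => by rw [Matrix.diagonal_apply_ne _ hj.symm, zero_smul]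
      · exact fun h => absurd (Finset.mem_univ _) h
    refine key (fun i => ∑ j, Matrix.diagonal d i j • f j) ?_
      (fun i => Submodule.sum_mem _ fun j _ => Submodule.smul_mem _ _ (hfB j)) ?_
    · simp only [hdf]
      have h5 := hf.units_smul fun i => if i.1 = 0 then (-1 : ℝˣ) else 1
      have h6 : (fun i => d i • f i) =
          (fun i : Fin (n - 1) => if i.1 = 0 then (-1 : ℝˣ) else 1) • f := by
        funext i
        by_cases hi : i.1 = 0 <;> simp [d, hi]
      rw [h6]
      exact h5
    · rw [orient_transition (by rw [List.length_singleton, Kind.gaps]; omega), hd, h1]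
      simp
  · -- the polytope is a point
    obtain rfl : n = 1 := by omega
    exact absurd (h1.symm.trans (orient_range_one f)) (by norm_num)

/-- The generator dual to the identical permutation goes to the top cell. -/
theorem exists_toChains_topGenerator (hn : 1 ≤ n) : ∃ a : Cell .module n (n - 1),
    a.face = Kind.polytope .module n ∧
      (toChains k .module n (n - 1) (topGenerator k n hn)).1 = cellChain k .module 1 a := by
  obtain ⟨a, h1, h2, h3⟩ := exists_top_cell hn
  refine ⟨a, h1, ?_⟩
  have hx : Kind.module.excess n ((n - 1 : ℕ) : ℤ) = 0 := by simp only [Kind.excess]; omega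
  have hg : Kind.module.Good n ((n - 1 : ℕ) : ℤ) [Finset.range n] :=
    good_corolla (b := .module) hn hx
  have h4 : toTubes k .module n ((n - 1 : ℕ) : ℤ) (topGenerator k n hn) =
      cell k .module ((n - 1 : ℕ) : ℤ) 1 [Finset.range n] := toTubes_mu (b := .module) hn hx
  rw [toChains, LinearMap.comp_apply, h4, toCells_cell _ hg, cellFun_eq hn _ (by rw [h2]; rfl), h3,
    Int.cast_one, one_smul]

end

end Cyclo

end

theorem theorem5p3 (k : Type*) [Field k] :
    ∃ D : ∀ (b : Kind) (n : ℕ) {p p' : ℤ} (_ : p' + 1 = p), Ω k b n p →ₗ[k] Ω k b n p',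
      -- the cobar differential exists (it is unique), and the cobar construction is a complex
      IsCobarDifferential (cyclDual k) (assDual k) D ∧
      (∀ (b : Kind) (n : ℕ) {p p' p'' : ℤ} (hp : p' + 1 = p) (hp' : p'' + 1 = p') (x : Ω k b n p),
        D b n hp' (D b n hp x) = 0) ∧
      -- it vanishes in negative degrees
      (∀ (b : Kind) (n : ℕ) (p : ℤ), p < 0 → Subsingleton (Ω k b n p)) ∧
      -- linear maps to the cellular chains of the symmetrized associahedra and cyclohedra
      ∃ φ : ∀ (b : Kind) (n p : ℕ), Ω k b n (p : ℤ) →ₗ[k] chains k b n p,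
        -- they are isomorphisms
        (∀ (b : Kind) (n p : ℕ), 1 ≤ n → Function.Bijective (φ b n p)) ∧
        -- they commute with the differentials
        (∀ (b : Kind) (n p : ℕ) (x : Ω k b n ((p + 1 : ℕ) : ℤ)) (σ : Equiv.Perm (Fin n)),
          (φ b n p (D b n (Nat.cast_succ p).symm x)).1 σ = boundary ((φ b n (p + 1) x).1 σ)) ∧
        -- they are equivariant
        (∀ (b : Kind) (n p : ℕ) (x : Ω k b n (p : ℤ)) (ρ σ : Equiv.Perm (Fin n)),
          (φ b n p (Free.act ρ x)).1 σ = (φ b n p x).1 (σ * ρ⁻¹)) ∧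
        -- they are compatible with the operad structures and the right module structures,
        -- where oriented cells of the polytopes are composed by inserting bracketings
        (∀ (b : Kind) {m n r : ℕ} (h : r + 1 = m + n) (_ : 1 ≤ n) (i : Fin m) (p q : ℕ)
          (σ : Equiv.Perm (Fin m)) (τ : Equiv.Perm (Fin n)) (a : Cell b m p)
          (c : Cell .operad n q),
          ∃ (x : Ω k b m (p : ℤ)) (y : Ω k .operad n (q : ℤ)) (e : Cell b r (p + q)),
            (φ b m p x).1 = cellChain k b σ a ∧
            (φ .operad n q y).1 = cellChain k .operad τ c ∧
            IsComposite (σ i).1 a c e ∧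
            (φ b r (p + q) (Free.comp h i (Nat.cast_add p q).symm x y)).1 =
              cellChain k b (permComp h i σ τ) e) ∧
        -- the generator dual to the identical permutation goes to the top cell of the cyclohedron
        (∀ (n : ℕ) (hn : 1 ≤ n), ∃ a : Cell .module n (n - 1),
          a.face = Kind.polytope .module n ∧
          (φ .module n (n - 1) (topGenerator k n hn)).1 = cellChain k .module 1 a) := by
  exact ⟨cobarDiff k, isCobarDifferential_cobarDiff,
    fun _ _ _ _ _ hp hp' x => cobarDiff_cobarDiff hp hp' x,
    fun _ _ _ hp => cobar_subsingleton hp, toChains k, fun _ _ _ hn => bijective_toChains hn,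
    fun _ _ _ x σ => toChains_cobarDiff x σ, fun _ _ _ x ρ σ => toChains_act x ρ σ,
    fun _ _ _ _ h hn i p q σ τ a c => exists_toChains_comp h hn i p q σ τ a c,
    fun _ hn => exists_toChains_topGenerator hn⟩
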